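/- All functions are real and smooth, on nonempty open domains. Let $\mathcal E'$ be the class of equations $u_t=A u_{xx}+B u_x+C u+D$ for $u=u(t,x)$, where $A,B,C,D$ are arbitrary smooth functions of $(t,x)$ on a common domain with $A\ne0$ everywhere and $A_t=B_t=C_t=0$ (so the homogeneous part has time-independent coefficients, while $D$ may depend on $t$); the arbitrary-element tuple is $\theta=(A,B,C,D)$. Let $\mathcal E'_0$ be the class of homogeneous equations $u_t=A u_{xx}+B u_x+C u$ with $A\ne0$, $A_t=B_t=C_t=0$ and $\theta=(A,B,C)$. For a class $\mathcal L=\{\mathcal L_\theta\}$ of this kind, an \emph{admissible transformation} is a triple $(\theta_1,\Phi,\theta_2)$, where $\mathcal L_{\theta_1},\mathcal L_{\theta_2}$ belong to the class and $\Phi$ is a point transformation (local diffeomorphism of the $(t,x,u)$-space) that maps $\mathcal L_{\theta_1}$ to $\mathcal L_{\theta_2}$, i.e. its second prolongation maps the part of the submanifold $\mathcal L_{\theta_1}$ of the second-order jet space that lies over the domain of $\Phi$ into $\mathcal L_{\theta_2}$. Put $(\theta_1,\Phi,\theta_2)\star(\theta_2,\Phi',\theta_3)=(\theta_1,\Phi'\circ\Phi,\theta_3)$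 and $(\theta_1,\Phi,\theta_2)^{-1}=(\theta_2,\Phi^{-1},\theta_1)$; two admissible transformations are composable if the target $\theta_2$ of the first is the source of the second. The usual equivalence group $G^\sim_{\mathcal L}$ consists of the (local) point transformations of the space of $(t,x,u_{(2)},\theta)$ that are projectable to the spaces of $(t,x,u)$ and of $(t,x,u_{(2)})$, are consistent with the contact structure, and map each equation of the class to an equation of the class (and so do their inverses). Its action groupoid $\mathcal G^{G^\sim_{\mathcal L}}$ consists of the admissible transformations $(\theta,\Phi,\tilde\theta)$ such that $\Phi$ is (on its domain) the projection to the $(t,x,u)$-space of some $\mathscr T\in G^\sim_{\mathcal L}$ that maps $\theta$ to $\tilde\theta$. For $\mathcal L=\mathcal E'_0$, let $\mathcal G^{\rm lin}$ be the set of the admissible transformations $(\theta,\Phi,\theta)$ with $\Phi\colon \tilde t=t,\ \tilde x=x,\ \tilde u=u+f(t,x)$, where $f$ is a solution of $\mathcal L_\theta$ (linear superposition of solutions). Given a set $\mathcal U$ of admissible transformations, two admissible transformations $\mathcal T,\tilde{\mathcal T}$ are $\mathcal U$-equivalent if $\tilde{\mathcal T}=\mathcal T_1\star\mathcal T\star\mathcal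 T_2$ with $\mathcal T_1,\mathcal T_2\in\mathcal U$. A set $\mathcal B$ of admissible transformations is \emph{generating up to the $\mathcal U$-equivalence} if every admissible transformation of the class is, locally near each point of its domain, a composition of finitely many elements of $\mathcal B$, inverses of elements of $\mathcal B$, and elements of $\mathcal U$. It is \emph{self-consistent} with respect to the $\mathcal U$-equivalence if, for all $\mathcal T,\mathcal T'\in\mathcal B\cup\mathcal B^{-1}$, $\mathcal T$ is composable with $\mathcal T'$ whenever some admissible transformation $\mathcal U$-equivalent to $\mathcal T$ is composable with $\mathcal T'$. It is a \emph{minimal self-consistent generating set} if it is minimal with respect to inclusion among the self-consistent generating sets. Identify a potential $C=C(x)$ with the tuple $(A,B,C,D)=(1,0,C,0)$ in $\mathcal E'$ and $(A,B,C)=(1,0,C)$ in $\mathcal E'_0$, i.e. with the equation $u_t=u_{xx}+C(x)u$ on the natural domain of $C$ ($x\ne0$ if $C$ contains a term $\mu/x^2$ with $\mu\ne0$, the whole plane otherwise). For $\mu\in\mathbb R$ let \begin{gather*} \mathcal T_{1\mu}:=\Big(\frac\mu{x^2}+x^2,\ \Phi_1,\ \frac\mu{\tilde x^2}\Big),\quad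 \Phi_1\colon \tilde t=\tfrac12\tan 2t,\ \ \tilde x=\frac x{\cos 2t},\ \ \tilde u=|\cos2t|^{1/2}e^{-\tan(2t)x^2/2}u\quad (|t|<\pi/4),\\ \mathcal T_{2\mu}:=\Big(\frac\mu{x^2}-x^2,\ \Phi_2,\ \frac\mu{\tilde x^2}\Big),\quad \Phi_2\colon \tilde t=\tfrac14e^{4t},\ \ \tilde x=e^{2t}x,\ \ \tilde u=e^{-x^2/2-t}u,\\ \mathcal T_3:=(x,\ \Phi_3,\ 0),\quad \Phi_3\colon \tilde t=t,\ \ \tilde x=x+t^2,\ \ \tilde u=e^{-tx-t^3/3}u, \end{gather*} and $\mathcal B=\{\mathcal T_{1\mu},\mathcal T_{2\mu},\mathcal T_3\mid\mu\in\mathbb R\}$ (where, for $\mu\neq0$, $\Phi_1$ and $\Phi_2$ are restricted to $x\neq0$). Then: (i) $\mathcal B$ is a minimal self-consistent generating set of admissible transformations for the class $\mathcal E'$ up to the $G^\sim_{\mathcal E'}$-equivalence, i.e. with $\mathcal U=\mathcal G^{G^\sim_{\mathcal E'}}$. (ii) $\mathcal B$ is a minimal self-consistent generating set of admissible transformations for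 the class $\mathcal E'_0$ up to the $G^\sim_{\mathcal E'_0}$-equivalence and the linear superposition of solutions, i.e. with $\mathcal U=\mathcal G^{G^\sim_{\mathcal E'_0}}\star\mathcal G^{\rm lin}=\{\mathcal T_0\star\mathcal T_1\mid\mathcal T_0\in\mathcal G^{G^\sim_{\mathcal E'_0}},\ \mathcal T_1\in\mathcal G^{\rm lin}\}$. -/

import Mathlib

open Set Filter Topology
open scoped ContDiff

/-! ### Variables, jets, point transformations -/

/-- The space of the independent variables `(t, x)`. -/
abbrev Base := ℝ × ℝ

/-- The space of the independent and dependent variables `(t, x, u)`. -/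
abbrev Pt := ℝ × ℝ × ℝ

/-- The second-order jet space, `((t, x, u), (u_t, u_x), (u_tt, u_tx, u_xx))`. -/
abbrev Jet := Pt × (ℝ × ℝ) × (ℝ × ℝ × ℝ)

/-- The projection `(t, x, u) ↦ (t, x)`. -/
def base (P : Pt) : Base := (P.1, P.2.1)

/-- The partial derivative with respect to `t`. -/
noncomputable def dt (f : Base → ℝ) (p : Base) : ℝ := fderiv ℝ f p (1, 0)

/-- The partial derivative with respect to `x`. -/
noncomputable def dx (f : Base → ℝ) (p : Base) : ℝ := fderiv ℝ f p (0, 1)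

/-- The point of the graph of `f` over `p`. -/
def graphPt (f : Base → ℝ) (p : Base) : Pt := (p.1, p.2, f p)

/-- The second-order jet of `f` at `p`. -/
noncomputable def jet (f : Base → ℝ) (p : Base) : Jet :=
  (graphPt f p, (dt f p, dx f p), (dt (dt f) p, dx (dt f) p, dx (dx f) p))

/-- `f` is smooth on a neighbourhood of `p`. -/
def SmoothNear (f : Base → ℝ) (p : Base) : Prop := ∀ᶠ q in 𝓝 p, ContDiffAt ℝ ∞ f q

/-- `Φ` is a point transformation, i.e. a diffeomorphism between two nonempty open subsets of the
`(t, x, u)`-space. (The values of `Φ` outside its source carry no information.) -/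
def IsPointTransformation (Φ : OpenPartialHomeomorph Pt Pt) : Prop :=
  Φ.source.Nonempty ∧ ContDiffOn ℝ ∞ Φ Φ.source ∧ ContDiffOn ℝ ∞ Φ.symm Φ.target

/-- `Prolongs Φ z z'` means `(pr⁽²⁾ Φ) z = z'`: there are smooth functions `f` and `g` whose second
jets are `z` and `z'`, and `Φ` maps the graph of `f` near the point under `z` into the graph of `g`
(with the point under `z` going to the point under `z'`). -/
def Prolongs (Φ : OpenPartialHomeomorph Pt Pt) (z z' : Jet) : Prop :=
  ∃ (f g : Base → ℝ) (p q : Base), SmoothNear f p ∧ SmoothNear g q ∧ jet f p = z ∧ jet g q = z' ∧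
    z.1 ∈ Φ.source ∧ Φ z.1 = z'.1 ∧
    ∀ᶠ p' in 𝓝 p, Φ (graphPt f p') = graphPt g (base (Φ (graphPt f p')))

/-! ### Classes of differential equations -/

/-- A tuple of `k` smooth functions of `(t, x)` on a nonempty open domain. The values outside the
domain carry no information; they are normalised to `0`, so that equality of such tuples is equality
of functions. -/
@[ext]
structure ArbitraryElement (k : ℕ) where
  domain : Set Base
  val : Base → Fin k → ℝ
  isOpen_domain : IsOpen domain
  nonempty_domain : domain.Nonempty
  smooth : ContDiffOn ℝ ∞ val domain
  val_off : ∀ p, p ∉ domain → val p = 0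

/-- A class of second-order differential equations `L (t, x, u₍₂₎, θ(t, x)) = 0` for one unknown
function `u` of `(t, x)`, with arbitrary-element tuple `θ` running through the set `S`. -/
structure EquationClass (k : ℕ) where
  S : Set (ArbitraryElement k)
  L : Jet → (Fin k → ℝ) → ℝ

/-- The equation with the arbitrary element `θ`, as a subset of the jet space. -/
def EquationClass.locus {k : ℕ} (𝓛 : EquationClass k) (θ : ArbitraryElement k) : Set Jet :=
  {z | base z.1 ∈ θ.domain ∧ 𝓛.L z (θ.val (base z.1)) = 0}

/-- The class `ℰ'` of the equations `u_t = A u_xx + B u_x + C u + D` with `A ≠ 0` and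
`A_t = B_t = C_t = 0`; the arbitrary-element tuple is `(A, B, C, D)`. -/
noncomputable def classE' : EquationClass 4 where
  S := {θ | ∀ p ∈ θ.domain, θ.val p 0 ≠ 0 ∧
    dt (fun q => θ.val q 0) p = 0 ∧ dt (fun q => θ.val q 1) p = 0 ∧ dt (fun q => θ.val q 2) p = 0}
  L := fun z a => z.2.1.1 - (a 0 * z.2.2.2.2 + a 1 * z.2.1.2 + a 2 * z.1.2.2 + a 3)

/-- The class `ℰ'₀` of the equations `u_t = A u_xx + B u_x + C u` with `A ≠ 0` and
`A_t = B_t = C_t = 0`; the arbitrary-element tuple is `(A, B, C)`. -/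
noncomputable def classE'₀ : EquationClass 3 where
  S := {θ | ∀ p ∈ θ.domain, θ.val p 0 ≠ 0 ∧
    dt (fun q => θ.val q 0) p = 0 ∧ dt (fun q => θ.val q 1) p = 0 ∧ dt (fun q => θ.val q 2) p = 0}
  L := fun z a => z.2.1.1 - (a 0 * z.2.2.2.2 + a 1 * z.2.1.2 + a 2 * z.1.2.2)

/-! ### The equivalence groupoid -/

/-- A triple `(θ₁, Φ, θ₂)`. -/
structure Triple (k : ℕ) where
  src : ArbitraryElement k
  Φ : OpenPartialHomeomorph Pt Pt
  tgt : ArbitraryElement k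

namespace Triple

variable {k : ℕ}

/-- The inverse `(θ₂, Φ⁻¹, θ₁)`. -/
def inv (T : Triple k) : Triple k := ⟨T.tgt, T.Φ.symm, T.src⟩

/-- The composition `T ⋆ T' = (θ₁, Φ' ∘ Φ, θ₂')`, to be used only if `T.tgt = T'.src`. -/
noncomputable def comp (T T' : Triple k) : Triple k := ⟨T.src, T.Φ.trans T'.Φ, T'.tgt⟩

end Triple

namespace EquationClass

variable {k : ℕ} (𝓛 : EquationClass k)

/-- The equivalence groupoid of the class: the set of its admissible transformations, that is, of
the triples `(θ₁, Φ, θ₂)` with `θ₁, θ₂ ∈ S` and a point transformation `Φ` acting between the places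
where the two equations are defined, such that `(pr⁽²⁾ Φ)^* L_{θ₂}` vanishes on `L_{θ₁} = 0`. -/
def groupoid : Set (Triple k) :=
  {T | T.src ∈ 𝓛.S ∧ T.tgt ∈ 𝓛.S ∧ IsPointTransformation T.Φ ∧
    (∀ P ∈ T.Φ.source, base P ∈ T.src.domain ∧ base (T.Φ P) ∈ T.tgt.domain) ∧
    ∀ z z', Prolongs T.Φ z z' → z ∈ 𝓛.locus T.src → z' ∈ 𝓛.locus T.tgt}

end EquationClass

/-! ### The usual equivalence group and its action groupoid -/

/-- A local homeomorphism of the space of `(t, x, u₍₂₎, θ)` together with a local homeomorphism of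
the space of `(t, x, u)` (meant to be its projection). -/
structure ExtendedTransformation (k : ℕ) where
  full : OpenPartialHomeomorph (Jet × (Fin k → ℝ)) (Jet × (Fin k → ℝ))
  Φ : OpenPartialHomeomorph Pt Pt

/-- The inverse transformation. -/
def ExtendedTransformation.symm {k : ℕ} (𝒯 : ExtendedTransformation k) :
    ExtendedTransformation k := ⟨𝒯.full.symm, 𝒯.Φ.symm⟩

namespace EquationClass

variable {k : ℕ} (𝓛 : EquationClass k)

/-- `𝒯` maps `θ` to `θ'`, and its projection maps the equation `L_θ` to the equation `L_{θ'}`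
(over the points where the graph of `θ` meets the domain of `𝒯`). -/
def MapsTo (𝒯 : ExtendedTransformation k) (θ θ' : ArbitraryElement k) : Prop :=
  ∀ w ∈ 𝒯.full.source, base w.1.1 ∈ θ.domain → w.2 = θ.val (base w.1.1) →
    base (𝒯.full w).1.1 ∈ θ'.domain ∧ (𝒯.full w).2 = θ'.val (base (𝒯.full w).1.1) ∧
    ∀ z z', z.1 = w.1.1 → Prolongs 𝒯.Φ z z' → z ∈ 𝓛.locus θ → z' ∈ 𝓛.locus θ'

/-- The usual equivalence group (pseudogroup) of the class: the point transformations `𝒯` of the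
space of `(t, x, u₍₂₎, θ)` that are projectable to the spaces of `(t, x, u)` and `(t, x, u₍₂₎)`, are
consistent with the contact structure (their projection to the jet space is the prolongation of
their projection to the space of `(t, x, u)`) and, together with their inverses, map every equation
of the class to an equation of the class. -/
def equivalenceGroup : Set (ExtendedTransformation k) :=
  {𝒯 | IsPointTransformation 𝒯.Φ ∧
    ContDiffOn ℝ ∞ 𝒯.full 𝒯.full.source ∧ ContDiffOn ℝ ∞ 𝒯.full.symm 𝒯.full.target ∧
    (∀ w ∈ 𝒯.full.source, Prolongs 𝒯.Φ w.1 (𝒯.full w).1) ∧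
    (∀ P ∈ 𝒯.Φ.source, ∃ w ∈ 𝒯.full.source, w.1.1 = P) ∧
    (∀ θ ∈ 𝓛.S, ∃ θ' ∈ 𝓛.S, 𝓛.MapsTo 𝒯 θ θ') ∧
    ∀ θ ∈ 𝓛.S, ∃ θ' ∈ 𝓛.S, 𝓛.MapsTo 𝒯.symm θ θ'}

/-- The action groupoid of the usual equivalence group: the admissible transformations
`(θ₁, Φ, θ₂)` such that, over the source of `Φ`, the map `Φ` is the projection of an equivalence
transformation `𝒯`, and `𝒯` maps `θ₁` to `θ₂`. -/
def actionGroupoid : Set (Triple k) :=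
  {T | T ∈ 𝓛.groupoid ∧ ∃ 𝒯 ∈ 𝓛.equivalenceGroup, ∀ P ∈ T.Φ.source,
    P ∈ 𝒯.Φ.source ∧ T.Φ P = 𝒯.Φ P ∧
    (∃ w ∈ 𝒯.full.source, w.1.1 = P ∧ w.2 = T.src.val (base P)) ∧
    ∀ w ∈ 𝒯.full.source, w.1.1 = P → w.2 = T.src.val (base P) →
      (𝒯.full w).2 = T.tgt.val (base (T.Φ P))}

/-- The admissible transformations `(θ, Φ, θ)` given by the linear superposition of solutions:
`Φ` is `t̃ = t`, `x̃ = x`, `ũ = u + f(t, x)` with a solution `f` of the equation `L_θ`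
(for classes of linear homogeneous equations). -/
def linGroupoid : Set (Triple k) :=
  {T | T ∈ 𝓛.groupoid ∧ T.tgt = T.src ∧ ∃ f : Base → ℝ, ∀ P ∈ T.Φ.source,
    SmoothNear f (base P) ∧ jet f (base P) ∈ 𝓛.locus T.src ∧
    T.Φ P = (P.1, P.2.1, P.2.2 + f (base P))}

/-- The `⋆`-product of the action groupoid of the usual equivalence group and of the groupoid of
linear superposition. -/
def actionLinGroupoid : Set (Triple k) :=
  {T | T ∈ 𝓛.groupoid ∧ ∃ T₀ ∈ 𝓛.actionGroupoid, ∃ T₁ ∈ 𝓛.linGroupoid,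
    T₀.tgt = T₁.src ∧ T = T₀.comp T₁}

/-! ### Generating sets up to the equivalence given by a set `U` of admissible transformations -/

/-- `𝓑` together with the inverses of its elements. -/
def withInverses (𝓑 : Set (Triple k)) : Set (Triple k) := 𝓑 ∪ Triple.inv '' 𝓑

/-- `IsLocalComposition M θ θ' P F`: there are `T₁, …, Tₙ ∈ M`, `n ≥ 1`, each composable with the
next one, such that `θ` is the source of `T₁`, `θ'` is the target of `Tₙ`, the point `P` lies in the
domain of the composition of the transformations, and `F` is this composition. -/
inductive IsLocalComposition (M : Set (Triple k)) :
    ArbitraryElement k → ArbitraryElement k → Pt → (Pt → Pt) → Prop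
  | single (T : Triple k) (hT : T ∈ M) (P : Pt) (hP : P ∈ T.Φ.source) :
      IsLocalComposition M T.src T.tgt P T.Φ
  | cons (T : Triple k) (hT : T ∈ M) (P : Pt) (hP : P ∈ T.Φ.source) (θ : ArbitraryElement k)
      (F : Pt → Pt) (hF : IsLocalComposition M T.tgt θ (T.Φ P) F) :
      IsLocalComposition M T.src θ P (F ∘ T.Φ)

/-- `𝓑` is a generating set of admissible transformations up to the `U`-equivalence: it consists of
admissible transformations, and every admissible transformation is a composition of finitely many
elements of `𝓑`, inverses of elements of `𝓑`, and elements of `U`. Point transformations being local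
diffeomorphisms, the latter equality is understood locally, near each point of the domain. -/
def IsGenerating (U 𝓑 : Set (Triple k)) : Prop :=
  𝓑 ⊆ 𝓛.groupoid ∧ ∀ T ∈ 𝓛.groupoid, ∀ P ∈ T.Φ.source, ∃ F : Pt → Pt,
    IsLocalComposition (withInverses 𝓑 ∪ U) T.src T.tgt P F ∧ F =ᶠ[𝓝 P] T.Φ

/-- `T` and `T'` are `U`-equivalent: `T' = T₁ ⋆ T ⋆ T₂` for some `T₁, T₂ ∈ U`. -/
def UEquivalent (U : Set (Triple k)) (T T' : Triple k) : Prop :=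
  T' ∈ 𝓛.groupoid ∧ ∃ T₁ ∈ U, ∃ T₂ ∈ U, T₁.tgt = T.src ∧ T.tgt = T₂.src ∧
    T' = (T₁.comp T).comp T₂

/-- `T` is composable with `T'` up to the `U`-equivalence. -/
def ComposableUpTo (U : Set (Triple k)) (T T' : Triple k) : Prop :=
  ∃ T'', 𝓛.UEquivalent U T T'' ∧ T''.tgt = T'.src

/-- `𝓑` is self-consistent with respect to the `U`-equivalence. -/
def IsSelfConsistent (U 𝓑 : Set (Triple k)) : Prop :=
  ∀ T ∈ withInverses 𝓑, ∀ T' ∈ withInverses 𝓑, 𝓛.ComposableUpTo U T T' → T.tgt = T'.src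

/-- `𝓑` is a minimal (with respect to inclusion) self-consistent generating set of admissible
transformations of the class up to the `U`-equivalence. -/
def IsMinimalSelfConsistentGenerating (U 𝓑 : Set (Triple k)) : Prop :=
  Minimal (fun 𝓑' => 𝓛.IsGenerating U 𝓑' ∧ 𝓛.IsSelfConsistent U 𝓑') 𝓑

end EquationClass

/-! ### The families of admissible transformations -/

/-- The natural domain of the expression `μ / x² + …` in the variable `x`. -/
def natDom (μ : ℝ) : Set ℝ := {x | μ ≠ 0 → x ≠ 0}

theorem isOpen_natDom (μ : ℝ) : IsOpen (natDom μ) := by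
  by_cases h : μ = 0
  · have : natDom μ = univ := by ext x; simp [natDom, h]
    rw [this]; exact isOpen_univ
  · have : natDom μ = {0}ᶜ := by ext x; simp [natDom, h]
    rw [this]; exact isOpen_compl_singleton

theorem one_mem_natDom (μ : ℝ) : (1 : ℝ) ∈ natDom μ := fun _ => one_ne_zero

theorem mul_mem_natDom {μ x c : ℝ} (hx : x ∈ natDom μ) (hc : c ≠ 0) : x * c ∈ natDom μ :=
  fun h => mul_ne_zero (hx h) hc

open Classical in
/-- The tuple `(A, B, C) = (1, 0, μ / x² + α x² + β x)` for `k = 3`, and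
`(A, B, C, D) = (1, 0, μ / x² + α x² + β x, 0)` for `k = 4`; the domain is given by `x ≠ 0` if
`μ ≠ 0`, and is the whole plane if `μ = 0`. -/
noncomputable def potential (k : ℕ) (μ α β : ℝ) : ArbitraryElement k where
  domain := {p | p.2 ∈ natDom μ}
  val := fun p i => if p.2 ∈ natDom μ then
      (if i.val = 0 then 1 else if i.val = 2 then μ / p.2 ^ 2 + α * p.2 ^ 2 + β * p.2 else 0)
    else 0
  isOpen_domain := (isOpen_natDom μ).preimage continuous_snd
  nonempty_domain := ⟨(0, 1), one_mem_natDom μ⟩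
  smooth := by
    rw [contDiffOn_pi]
    intro i
    have key : ContDiffOn ℝ ∞ (fun p : Base => if i.val = 0 then (1 : ℝ) else
        if i.val = 2 then μ / p.2 ^ 2 + α * p.2 ^ 2 + β * p.2 else 0)
        {p | p.2 ∈ natDom μ} := by
      split_ifs
      · exact contDiffOn_const
      · refine ContDiffOn.add (ContDiffOn.add ?_ (by fun_prop)) (by fun_prop)
        by_cases h : μ = 0
        · simp only [h, zero_div]; exact contDiffOn_const
        · exact contDiffOn_const.div (by fun_prop) (fun p hp => pow_ne_zero 2 (hp h))
      · exact contDiffOn_const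
    refine key.congr (fun p hp => ?_)
    have hp' : p.2 ∈ natDom μ := hp
    simp only [if_pos hp']
  val_off := by
    intro p hp
    have hp' : p.2 ∉ natDom μ := hp
    funext i
    simp only [if_neg hp', Pi.zero_apply]

/-- The point transformation
`t̃ = tan(2t) / 2`, `x̃ = x / cos(2t)`, `ũ = |cos(2t)|^(1/2) exp(-tan(2t) x² / 2) u`
on the strip `|t| < π/4`, `x` being in the natural domain of `μ / x²`. -/
noncomputable def Phi₁ (μ : ℝ) : OpenPartialHomeomorph Pt Pt where
  toFun P := (Real.tan (2 * P.1) / 2, P.2.1 / Real.cos (2 * P.1),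
    Real.sqrt |Real.cos (2 * P.1)| * Real.exp (-(Real.tan (2 * P.1) * P.2.1 ^ 2 / 2)) * P.2.2)
  invFun Q := (Real.arctan (2 * Q.1) / 2, Q.2.1 * Real.cos (Real.arctan (2 * Q.1)),
    Q.2.2 / (Real.sqrt |Real.cos (Real.arctan (2 * Q.1))| *
      Real.exp (-(2 * Q.1 * (Q.2.1 * Real.cos (Real.arctan (2 * Q.1))) ^ 2 / 2))))
  source := {P | |P.1| < Real.pi / 4 ∧ P.2.1 ∈ natDom μ}
  target := {Q | Q.2.1 ∈ natDom μ}
  map_source' := by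
    rintro ⟨t, x, u⟩ ⟨ht, hx⟩
    rw [abs_lt] at ht
    have hc : 0 < Real.cos (2 * t) :=
      Real.cos_pos_of_mem_Ioo ⟨by simp only at ht; linarith, by simp only at ht; linarith⟩
    simp only [mem_ofPred_eq, div_eq_mul_inv] at hx ⊢
    exact mul_mem_natDom hx (inv_ne_zero hc.ne')
  map_target' := by
    rintro ⟨t, x, u⟩ hx
    have hc := Real.cos_arctan_pos (2 * t)
    have h1 := Real.arctan_lt_pi_div_two (2 * t)
    have h2 := Real.neg_pi_div_two_lt_arctan (2 * t)
    refine ⟨?_, mul_mem_natDom hx hc.ne'⟩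
    simp only [abs_lt]
    constructor <;> linarith
  left_inv' := by
    rintro ⟨t, x, u⟩ ⟨ht, hx⟩
    simp only [abs_lt] at ht
    have hc : 0 < Real.cos (2 * t) := Real.cos_pos_of_mem_Ioo ⟨by linarith, by linarith⟩
    have ha : Real.arctan (Real.tan (2 * t)) = 2 * t := Real.arctan_tan (by linarith) (by linarith)
    have e1 : 2 * (Real.tan (2 * t) / 2) = Real.tan (2 * t) := by ring
    simp only [e1, ha]
    have e2 : x / Real.cos (2 * t) * Real.cos (2 * t) = x := div_mul_cancel₀ x hc.ne'
    have hs : 0 < Real.sqrt |Real.cos (2 * t)| := Real.sqrt_pos.2 (abs_pos.2 hc.ne')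
    have he := Real.exp_pos (-(Real.tan (2 * t) * x ^ 2 / 2))
    rw [e2]
    refine Prod.ext (by ring) (Prod.ext rfl ?_)
    exact mul_div_cancel_left₀ u (mul_pos hs he).ne'
  right_inv' := by
    rintro ⟨t, x, u⟩ hx
    have hc := Real.cos_arctan_pos (2 * t)
    have e1 : 2 * (Real.arctan (2 * t) / 2) = Real.arctan (2 * t) := by ring
    simp only [e1, Real.tan_arctan]
    have hs : 0 < Real.sqrt |Real.cos (Real.arctan (2 * t))| :=
      Real.sqrt_pos.2 (abs_pos.2 hc.ne')
    have he := Real.exp_pos (-(2 * t * (x * Real.cos (Real.arctan (2 * t))) ^ 2 / 2))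
    refine Prod.ext (by ring) (Prod.ext (mul_div_cancel_right₀ x hc.ne') ?_)
    exact mul_div_cancel₀ u (mul_pos hs he).ne'
  open_source := by
    have h1 : IsOpen {P : Pt | |P.1| < Real.pi / 4} := isOpen_lt (by fun_prop) continuous_const
    have h2 : IsOpen {P : Pt | P.2.1 ∈ natDom μ} := (isOpen_natDom μ).preimage (by fun_prop)
    exact h1.inter h2
  open_target := (isOpen_natDom μ).preimage (by fun_prop)
  continuousOn_toFun := by
    have hc : ∀ P ∈ {P : Pt | |P.1| < Real.pi / 4 ∧ P.2.1 ∈ natDom μ}, Real.cos (2 * P.1) ≠ 0 := by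
      rintro ⟨t, x, u⟩ ⟨ht, hx⟩
      simp only [abs_lt] at ht
      exact (Real.cos_pos_of_mem_Ioo ⟨by simp only; linarith, by simp only; linarith⟩).ne'
    have htan : ContinuousOn (fun P : Pt => Real.tan (2 * P.1))
        {P : Pt | |P.1| < Real.pi / 4 ∧ P.2.1 ∈ natDom μ} := by
      simp only [Real.tan_eq_sin_div_cos]
      exact ContinuousOn.div (by fun_prop) (by fun_prop) hc
    refine (htan.div_const 2).prodMk ((ContinuousOn.div (by fun_prop) (by fun_prop) hc).prodMk ?_)
    refine ContinuousOn.mul (ContinuousOn.mul (by fun_prop) ?_) (by fun_prop)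
    exact Real.continuous_exp.comp_continuousOn
      (((htan.mul (by fun_prop)).div_const 2).neg)
  continuousOn_invFun := by
    refine Continuous.continuousOn ?_
    refine Continuous.prodMk (by fun_prop) (Continuous.prodMk (by fun_prop) ?_)
    refine Continuous.div (by fun_prop) (by fun_prop) (fun Q => ?_)
    exact (mul_pos (Real.sqrt_pos.2 (abs_pos.2 (Real.cos_arctan_pos _).ne')) (Real.exp_pos _)).ne'

/-- The point transformation `t̃ = exp(4t) / 4`, `x̃ = exp(2t) x`, `ũ = exp(-x² / 2 - t) u`,
`x` being in the natural domain of `μ / x²`. -/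
noncomputable def Phi₂ (μ : ℝ) : OpenPartialHomeomorph Pt Pt where
  toFun P := (Real.exp (4 * P.1) / 4, Real.exp (2 * P.1) * P.2.1,
    Real.exp (-P.2.1 ^ 2 / 2 - P.1) * P.2.2)
  invFun Q := (Real.log (4 * Q.1) / 4, Real.exp (-(Real.log (4 * Q.1) / 2)) * Q.2.1,
    Real.exp ((Real.exp (-(Real.log (4 * Q.1) / 2)) * Q.2.1) ^ 2 / 2 + Real.log (4 * Q.1) / 4) *
      Q.2.2)
  source := {P | P.2.1 ∈ natDom μ}
  target := {Q | 0 < Q.1 ∧ Q.2.1 ∈ natDom μ}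
  map_source' := by
    rintro ⟨t, x, u⟩ hx
    refine ⟨by positivity, ?_⟩
    simp only [mul_comm _ x]
    exact mul_mem_natDom hx (Real.exp_pos _).ne'
  map_target' := by
    rintro ⟨t, x, u⟩ ⟨_, hx⟩
    simp only [mem_ofPred_eq, mul_comm _ x]
    exact mul_mem_natDom hx (Real.exp_pos _).ne'
  left_inv' := by
    rintro ⟨t, x, u⟩ _
    have e1 : Real.log (4 * (Real.exp (4 * t) / 4)) = 4 * t := by
      rw [mul_div_cancel₀ _ (by norm_num), Real.log_exp]
    have e2 : Real.exp (-(4 * t / 2)) * (Real.exp (2 * t) * x) = x := by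
      rw [← mul_assoc, ← Real.exp_add]; ring_nf; simp
    simp only [e1, e2]
    refine Prod.ext (by ring) (Prod.ext rfl ?_)
    simp only [← mul_assoc, ← Real.exp_add]
    ring_nf; simp
  right_inv' := by
    rintro ⟨t, x, u⟩ ⟨ht, _⟩
    have ht' : 0 < 4 * t := by simp only at ht; linarith
    refine Prod.ext ?_ (Prod.ext ?_ ?_)
    · simp only
      rw [show 4 * (Real.log (4 * t) / 4) = Real.log (4 * t) by ring, Real.exp_log ht']; ring
    · simp only
      rw [← mul_assoc, ← Real.exp_add]; ring_nf; simp
    · simp only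
      rw [← mul_assoc, ← Real.exp_add]; ring_nf; simp
  open_source := (isOpen_natDom μ).preimage (by fun_prop)
  open_target := by
    have h1 : IsOpen {Q : Pt | 0 < Q.1} := isOpen_lt continuous_const (by fun_prop)
    have h2 : IsOpen {Q : Pt | Q.2.1 ∈ natDom μ} := (isOpen_natDom μ).preimage (by fun_prop)
    exact h1.inter h2
  continuousOn_toFun := Continuous.continuousOn (by fun_prop)
  continuousOn_invFun := by
    have hlog : ContinuousOn (fun Q : Pt => Real.log (4 * Q.1))
        {Q : Pt | 0 < Q.1 ∧ Q.2.1 ∈ natDom μ} :=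
      ContinuousOn.log (by fun_prop) (fun Q hQ => by have := hQ.1; positivity)
    have hx : ContinuousOn (fun Q : Pt => Real.exp (-(Real.log (4 * Q.1) / 2)) * Q.2.1)
        {Q : Pt | 0 < Q.1 ∧ Q.2.1 ∈ natDom μ} :=
      (Real.continuous_exp.comp_continuousOn (hlog.div_const 2).neg).mul (by fun_prop)
    refine (hlog.div_const 4).prodMk (hx.prodMk ?_)
    exact (Real.continuous_exp.comp_continuousOn
      (((hx.pow 2).div_const 2).add (hlog.div_const 4))).mul (by fun_prop)

/-- The point transformation `t̃ = t`, `x̃ = x + t²`, `ũ = exp(-t x - t³ / 3) u`. -/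
noncomputable def Phi₃ : OpenPartialHomeomorph Pt Pt where
  toFun P := (P.1, P.2.1 + P.1 ^ 2, Real.exp (-P.1 * P.2.1 - P.1 ^ 3 / 3) * P.2.2)
  invFun Q := (Q.1, Q.2.1 - Q.1 ^ 2, Real.exp (Q.1 * (Q.2.1 - Q.1 ^ 2) + Q.1 ^ 3 / 3) * Q.2.2)
  source := univ
  target := univ
  map_source' := fun _ _ => mem_univ _
  map_target' := fun _ _ => mem_univ _
  left_inv' := by
    rintro ⟨t, x, u⟩ _
    refine Prod.ext rfl (Prod.ext (by simp) ?_)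
    simp only [← mul_assoc, ← Real.exp_add]
    ring_nf; simp
  right_inv' := by
    rintro ⟨t, x, u⟩ _
    refine Prod.ext rfl (Prod.ext (by simp) ?_)
    simp only [← mul_assoc, ← Real.exp_add]
    ring_nf; simp
  open_source := isOpen_univ
  open_target := isOpen_univ
  continuousOn_toFun := Continuous.continuousOn (by fun_prop)
  continuousOn_invFun := Continuous.continuousOn (by fun_prop)

/-- `𝒯_{1μ} = (μ / x² + x², Φ₁, μ / x̃²)`. -/
noncomputable def triple₁ (k : ℕ) (μ : ℝ) : Triple k := ⟨potential k μ 1 0, Phi₁ μ, potential k μ 0 0⟩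

/-- `𝒯_{2μ} = (μ / x² - x², Φ₂, μ / x̃²)`. -/
noncomputable def triple₂ (k : ℕ) (μ : ℝ) : Triple k :=
  ⟨potential k μ (-1) 0, Phi₂ μ, potential k μ 0 0⟩

/-- `𝒯₃ = (x, Φ₃, 0)`. -/
noncomputable def triple₃ (k : ℕ) : Triple k := ⟨potential k 0 0 1, Phi₃, potential k 0 0 0⟩

/-- The set `{𝒯_{1μ}, 𝒯_{2μ}, 𝒯₃ | μ ∈ ℝ}`. -/
def generators (k : ℕ) : Set (Triple k) := range (triple₁ k) ∪ range (triple₂ k) ∪ {triple₃ k}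

/-! ### Calculus of smooth functions of two variables -/

/-! Locally, an admissible transformation has the form `t̃ = T(t)`, `x̃ = X(t, x)`, `u = V ũ + W`,
and its coefficients obey four determining equations (`PB.Det`, `hasGerms_of_mem_groupoid`).
Membership in the set `U` of either part of the theorem is visible on germs: it amounts to
`PB.Affine`, that is `T_tt = 0` and `X_t = 0`. Indeed, an equivalence transformation acts on all
arbitrary elements at once, and comparing its action on two exponential coefficients `A` forces
these equations (`affine_of_mem_actionGroupoid`). Conversely, an affine germ between two equations
of the class preserves the whole class, so it comes from the equivalence group, for `k = 3` up to
superposition of solutions (`exists_mem_actionGroupoid`, `exists_mem_actionLinGroupoid`). Both parts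
thus become one statement on germs modulo affine ones,
`isMinimalSelfConsistentGenerating_generators`, for `linClass 4` and `linClass 3`.

Generation. Affine germs bring every equation to the form `u_t = u_xx + C(x) u`
(`exists_adm_normal`). Removing `D` needs a local solution of an inhomogeneous equation with merely
smooth coefficients, which a heat kernel average and a Neumann series provide
(`exists_local_solution`). Between two such equations `X = S(t) x + Y(t)`. With `a = S_t / (2S)` and
`b = Y_t / (2S)`, eliminating the target potential yields `2(ax + b) C' + 4aC = A₂x² + A₁x + A₀`
with coefficients depending on `t` only. For a non-affine germ `a` or `b` is not identically zero,
whence `C = μ/y² + αy² + βy + γ` with `y = x + z` (`Adm.special`). Affine germs remove `z` and `γ`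
and normalise `α` and `β`, and the generators then lead to `μ/x²` (`exists_gen_vertex`); the
parameter `μ` is invariant. It remains to treat germs between inverse square potentials. Conjugating
time shifts of the potentials `μ/x² + x²` and `x` by `Φ₁` and `Φ₃` gives the projective
transformations and, for `μ = 0`, the Galilean boosts. A suitable choice of the shifts makes `X_tx`
and `X_t` vanish at the point, and then the germ is affine (`gen_of_inverse_square`).

Self-consistency and minimality. Affine germs never connect two different potentials among the
sources and targets of the generators, because they only scale and shift `x` (`eq_of_affine`). If a
generator is left out, no remaining non-affine step ends at its source; hence any composition
leading there from `μ/x²` would produce an affine germ between two different potentials of the list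
(`minimal_generators`). -/

namespace SmoothNear

variable {f g a b : Base → ℝ} {p : Base}

theorem contDiffAt (hf : SmoothNear f p) : ContDiffAt ℝ ∞ f p := hf.self_of_nhds

theorem differentiableAt (hf : SmoothNear f p) : DifferentiableAt ℝ f p :=
  hf.contDiffAt.differentiableAt (by simp)

theorem continuousAt (hf : SmoothNear f p) : ContinuousAt f p := hf.contDiffAt.continuousAt

theorem eventually (hf : SmoothNear f p) : ∀ᶠ q in 𝓝 p, SmoothNear f q :=
  eventually_eventually_nhds.2 hf

theorem of_contDiff (hf : ContDiff ℝ ∞ f) : SmoothNear f p :=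
  Eventually.of_forall fun _ => hf.contDiffAt

theorem of_contDiffOn {s : Set Base} (hf : ContDiffOn ℝ ∞ f s) (hs : IsOpen s) (hp : p ∈ s) :
    SmoothNear f p := by
  filter_upwards [hs.mem_nhds hp] with q hq using hf.contDiffAt (hs.mem_nhds hq)

theorem const (c : ℝ) : SmoothNear (fun _ => c) p := of_contDiff contDiff_const

theorem fst : SmoothNear (fun q => q.1) p := of_contDiff contDiff_fst

theorem snd : SmoothNear (fun q => q.2) p := of_contDiff contDiff_snd

theorem add (hf : SmoothNear f p) (hg : SmoothNear g p) : SmoothNear (fun q => f q + g q) p := by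
  filter_upwards [hf, hg] with q h1 h2 using h1.add h2

theorem sub (hf : SmoothNear f p) (hg : SmoothNear g p) : SmoothNear (fun q => f q - g q) p := by
  filter_upwards [hf, hg] with q h1 h2 using h1.sub h2

theorem mul (hf : SmoothNear f p) (hg : SmoothNear g p) : SmoothNear (fun q => f q * g q) p := by
  filter_upwards [hf, hg] with q h1 h2 using h1.mul h2

theorem neg (hf : SmoothNear f p) : SmoothNear (fun q => -f q) p := by
  filter_upwards [hf] with q h1 using h1.neg

theorem pow (hf : SmoothNear f p) (n : ℕ) : SmoothNear (fun q => f q ^ n) p := by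
  filter_upwards [hf] with q h1 using h1.pow n

theorem exp (hf : SmoothNear f p) : SmoothNear (fun q => Real.exp (f q)) p := by
  filter_upwards [hf] with q h1 using h1.exp

theorem div (hf : SmoothNear f p) (hg : SmoothNear g p) (h0 : g p ≠ 0) :
    SmoothNear (fun q => f q / g q) p := by
  filter_upwards [hf, hg, hg.continuousAt.eventually_ne h0] with q h1 h2 h3 using h1.div h2 h3

theorem inv (hg : SmoothNear g p) (h0 : g p ≠ 0) : SmoothNear (fun q => (g q)⁻¹) p := by
  filter_upwards [hg, hg.continuousAt.eventually_ne h0] with q h2 h3 using h2.inv h3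

theorem sqrt (hg : SmoothNear g p) (h0 : g p ≠ 0) : SmoothNear (fun q => Real.sqrt (g q)) p := by
  filter_upwards [hg, hg.continuousAt.eventually_ne h0] with q h2 h3 using h2.sqrt h3

theorem comp₁ {h : ℝ → ℝ} (hh : ∀ᶠ y in 𝓝 (f p), ContDiffAt ℝ ∞ h y) (hf : SmoothNear f p) :
    SmoothNear (fun q => h (f q)) p := by
  filter_upwards [hf, hf.continuousAt.eventually hh] with q h1 h2 using h2.comp q h1

theorem comp (hg : SmoothNear g (a p, b p)) (ha : SmoothNear a p) (hb : SmoothNear b p) :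
    SmoothNear (fun q => g (a q, b q)) p := by
  have hc : ContinuousAt (fun q => (a q, b q)) p := ha.continuousAt.prodMk hb.continuousAt
  filter_upwards [ha, hb, hc.eventually hg] with q h1 h2 h3
  exact ContDiffAt.comp (g := g) (f := fun q => (a q, b q)) q h3 (h1.prodMk h2)

theorem congr (hf : SmoothNear f p) (h : g =ᶠ[𝓝 p] f) : SmoothNear g p := by
  filter_upwards [hf, h.eventuallyEq_nhds] with q h1 h2 using h1.congr_of_eventuallyEq h2

theorem fderiv_apply (hf : SmoothNear f p) (v : Base) :
    SmoothNear (fun q => fderiv ℝ f q v) p := by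
  filter_upwards [hf] with q h1
  exact (h1.fderiv_right (m := ∞) (by simp)).clm_apply contDiffAt_const

theorem dt (hf : SmoothNear f p) : SmoothNear (dt f) p := hf.fderiv_apply (1, 0)

theorem dx (hf : SmoothNear f p) : SmoothNear (dx f) p := hf.fderiv_apply (0, 1)

end SmoothNear

/-! ### Calculus rules for the partial derivatives -/

section Partial

variable {f g a b : Base → ℝ} {p : Base}

theorem dt_congr (h : f =ᶠ[𝓝 p] g) : dt f p = dt g p := by simp only [dt, h.fderiv_eq]

theorem dx_congr (h : f =ᶠ[𝓝 p] g) : dx f p = dx g p := by simp only [dx, h.fderiv_eq]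

theorem dt_congr' (h : f =ᶠ[𝓝 p] g) : dt f =ᶠ[𝓝 p] dt g := by
  filter_upwards [h.eventuallyEq_nhds] with q hq using dt_congr hq

theorem dx_congr' (h : f =ᶠ[𝓝 p] g) : dx f =ᶠ[𝓝 p] dx g := by
  filter_upwards [h.eventuallyEq_nhds] with q hq using dx_congr hq

theorem jet_congr (h : f =ᶠ[𝓝 p] g) : jet f p = jet g p := by
  simp only [jet, graphPt, h.eq_of_nhds, dt_congr h, dx_congr h, dt_congr (dt_congr' h),
    dx_congr (dt_congr' h), dx_congr (dx_congr' h)]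

@[simp] theorem dt_const (c : ℝ) : dt (fun _ => c) p = 0 := by simp [dt]
@[simp] theorem dx_const (c : ℝ) : dx (fun _ => c) p = 0 := by simp [dx]
@[simp] theorem dt_fst : dt (fun q => q.1) p = 1 := by
  have := (hasFDerivAt_fst (𝕜 := ℝ) (p := p)).fderiv
  simp [dt, this]
@[simp] theorem dx_fst : dx (fun q => q.1) p = 0 := by
  have := (hasFDerivAt_fst (𝕜 := ℝ) (p := p)).fderiv
  simp [dx, this]
@[simp] theorem dt_snd : dt (fun q => q.2) p = 0 := by
  have := (hasFDerivAt_snd (𝕜 := ℝ) (p := p)).fderiv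
  simp [dt, this]
@[simp] theorem dx_snd : dx (fun q => q.2) p = 1 := by
  have := (hasFDerivAt_snd (𝕜 := ℝ) (p := p)).fderiv
  simp [dx, this]

theorem dt_add (hf : DifferentiableAt ℝ f p) (hg : DifferentiableAt ℝ g p) :
    dt (fun q => f q + g q) p = dt f p + dt g p := by simp [dt, fderiv_fun_add hf hg]

theorem dx_add (hf : DifferentiableAt ℝ f p) (hg : DifferentiableAt ℝ g p) :
    dx (fun q => f q + g q) p = dx f p + dx g p := by simp [dx, fderiv_fun_add hf hg]

theorem dt_sub (hf : DifferentiableAt ℝ f p) (hg : DifferentiableAt ℝ g p) :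
    dt (fun q => f q - g q) p = dt f p - dt g p := by simp [dt, fderiv_fun_sub hf hg]

theorem dx_sub (hf : DifferentiableAt ℝ f p) (hg : DifferentiableAt ℝ g p) :
    dx (fun q => f q - g q) p = dx f p - dx g p := by simp [dx, fderiv_fun_sub hf hg]

theorem dt_neg : dt (fun q => -f q) p = -dt f p := by simp [dt]

theorem dx_neg : dx (fun q => -f q) p = -dx f p := by simp [dx]

theorem dt_mul (hf : DifferentiableAt ℝ f p) (hg : DifferentiableAt ℝ g p) :
    dt (fun q => f q * g q) p = dt f p * g p + f p * dt g p := by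
  simp [dt, fderiv_fun_mul hf hg]; ring

theorem dx_mul (hf : DifferentiableAt ℝ f p) (hg : DifferentiableAt ℝ g p) :
    dx (fun q => f q * g q) p = dx f p * g p + f p * dx g p := by
  simp [dx, fderiv_fun_mul hf hg]; ring

theorem dt_const_mul (c : ℝ) (hg : DifferentiableAt ℝ g p) :
    dt (fun q => c * g q) p = c * dt g p := by
  simp [dt, fderiv_const_mul hg c]

theorem dx_const_mul (c : ℝ) (hg : DifferentiableAt ℝ g p) :
    dx (fun q => c * g q) p = c * dx g p := by
  simp [dx, fderiv_const_mul hg c]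

theorem fderiv_comp₁ {h : ℝ → ℝ} {h' : ℝ} (hh : HasDerivAt h h' (f p))
    (hf : DifferentiableAt ℝ f p) (v : Base) :
    fderiv ℝ (fun q => h (f q)) p v = h' * fderiv ℝ f p v := by
  have := (hh.comp_hasFDerivAt p hf.hasFDerivAt).fderiv
  simp only [Function.comp_def] at this
  rw [this]; simp

theorem dt_comp₁ {h : ℝ → ℝ} {h' : ℝ} (hh : HasDerivAt h h' (f p)) (hf : DifferentiableAt ℝ f p) :
    dt (fun q => h (f q)) p = h' * dt f p := fderiv_comp₁ hh hf _

theorem dx_comp₁ {h : ℝ → ℝ} {h' : ℝ} (hh : HasDerivAt h h' (f p)) (hf : DifferentiableAt ℝ f p) :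
    dx (fun q => h (f q)) p = h' * dx f p := fderiv_comp₁ hh hf _

theorem dt_inv (hf : DifferentiableAt ℝ f p) (h0 : f p ≠ 0) :
    dt (fun q => (f q)⁻¹) p = -dt f p / f p ^ 2 := by
  rw [dt_comp₁ (hasDerivAt_inv h0) hf]; field_simp

theorem dx_inv (hf : DifferentiableAt ℝ f p) (h0 : f p ≠ 0) :
    dx (fun q => (f q)⁻¹) p = -dx f p / f p ^ 2 := by
  rw [dx_comp₁ (hasDerivAt_inv h0) hf]; field_simp

theorem dt_div (hf : DifferentiableAt ℝ f p) (hg : DifferentiableAt ℝ g p) (h0 : g p ≠ 0) :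
    dt (fun q => f q / g q) p = (dt f p * g p - f p * dt g p) / g p ^ 2 := by
  simp only [div_eq_mul_inv]
  rw [dt_mul hf (hg.fun_inv h0), dt_inv hg h0]; field_simp; ring

theorem dx_div (hf : DifferentiableAt ℝ f p) (hg : DifferentiableAt ℝ g p) (h0 : g p ≠ 0) :
    dx (fun q => f q / g q) p = (dx f p * g p - f p * dx g p) / g p ^ 2 := by
  simp only [div_eq_mul_inv]
  rw [dx_mul hf (hg.fun_inv h0), dx_inv hg h0]; field_simp; ring

theorem dt_pow (hf : DifferentiableAt ℝ f p) (n : ℕ) :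
    dt (fun q => f q ^ n) p = n * f p ^ (n - 1) * dt f p := dt_comp₁ (hasDerivAt_pow n _) hf

theorem dx_pow (hf : DifferentiableAt ℝ f p) (n : ℕ) :
    dx (fun q => f q ^ n) p = n * f p ^ (n - 1) * dx f p := dx_comp₁ (hasDerivAt_pow n _) hf

theorem dt_exp (hf : DifferentiableAt ℝ f p) :
    dt (fun q => Real.exp (f q)) p = Real.exp (f p) * dt f p := dt_comp₁ (Real.hasDerivAt_exp _) hf

theorem dx_exp (hf : DifferentiableAt ℝ f p) :
    dx (fun q => Real.exp (f q)) p = Real.exp (f p) * dx f p := dx_comp₁ (Real.hasDerivAt_exp _) hf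

theorem fderiv_eq_dt_dx (f : Base → ℝ) (p v : Base) :
    fderiv ℝ f p v = v.1 * dt f p + v.2 * dx f p := by
  have : v = v.1 • ((1, 0) : Base) + v.2 • ((0, 1) : Base) := by ext <;> simp
  rw [this, map_add, map_smul, map_smul]; simp [dt, dx]

theorem fderiv_comp₂ (hg : DifferentiableAt ℝ g (a p, b p)) (ha : DifferentiableAt ℝ a p)
    (hb : DifferentiableAt ℝ b p) (v : Base) : fderiv ℝ (fun q => g (a q, b q)) p v =
      dt g (a p, b p) * fderiv ℝ a p v + dx g (a p, b p) * fderiv ℝ b p v := by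
  have h := (HasFDerivAt.comp (g := g) (f := fun q => (a q, b q)) p hg.hasFDerivAt
    (ha.hasFDerivAt.prodMk hb.hasFDerivAt)).fderiv
  simp only [Function.comp_def] at h
  rw [h]
  simp only [ContinuousLinearMap.comp_apply, ContinuousLinearMap.prod_apply, fderiv_eq_dt_dx g]
  ring

theorem dt_comp (hg : DifferentiableAt ℝ g (a p, b p)) (ha : DifferentiableAt ℝ a p)
    (hb : DifferentiableAt ℝ b p) : dt (fun q => g (a q, b q)) p =
      dt g (a p, b p) * dt a p + dx g (a p, b p) * dt b p := fderiv_comp₂ hg ha hb _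

theorem dx_comp (hg : DifferentiableAt ℝ g (a p, b p)) (ha : DifferentiableAt ℝ a p)
    (hb : DifferentiableAt ℝ b p) : dx (fun q => g (a q, b q)) p =
      dt g (a p, b p) * dx a p + dx g (a p, b p) * dx b p := fderiv_comp₂ hg ha hb _

theorem dt_dx_comm (hf : SmoothNear f p) : dt (dx f) p = dx (dt f) p := by
  have h2 : ContDiffAt ℝ 2 f p := hf.contDiffAt.of_le (WithTop.coe_le_coe.2 (le_top : (2 : ℕ∞) ≤ ⊤))
  have hs := h2.isSymmSndFDerivAt (by simp)
  have hd : DifferentiableAt ℝ (fderiv ℝ f) p :=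
    (h2.fderiv_right (m := 1) (by norm_num)).differentiableAt (by simp)
  have e : ∀ v w : Base, fderiv ℝ (fun q => fderiv ℝ f q v) p w = fderiv ℝ (fderiv ℝ f) p w v := by
    intro v w
    rw [fderiv_clm_apply hd (differentiableAt_const v)]; simp
  change fderiv ℝ (fun q => fderiv ℝ f q (0, 1)) p (1, 0)
    = fderiv ℝ (fun q => fderiv ℝ f q (1, 0)) p (0, 1)
  rw [e, e]; exact hs.eq _ _

theorem dt_eq_zero (h : ∀ᶠ q in 𝓝 p, f q = 0) : dt f p = 0 := by
  rw [dt_congr (g := fun _ => 0) h]; simp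

theorem dx_eq_zero (h : ∀ᶠ q in 𝓝 p, f q = 0) : dx f p = 0 := by
  rw [dx_congr (g := fun _ => 0) h]; simp

end Partial

theorem continuous_base : Continuous base := by unfold base; fun_prop

theorem continuousAt_graphPt {f : Base → ℝ} {p : Base} (hf : ContinuousAt f p) :
    ContinuousAt (graphPt f) p := by
  unfold graphPt; fun_prop

/-! ### Linear classes with a padded tuple of arbitrary elements -/

/-- The `i`-th entry of a tuple, `0` if there is none. -/
def co {k : ℕ} (a : Fin k → ℝ) (i : ℕ) : ℝ := if h : i < k then a ⟨i, h⟩ else 0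

/-- The difference of the two sides of the equation `f_t = a₀ f_xx + a₁ f_x + a₂ f + a₃`. -/
noncomputable def res (a : ℕ → ℝ) (f : Base → ℝ) (q : Base) : ℝ :=
  dt f q - (a 0 * dx (dx f) q + a 1 * dx f q + a 2 * f q + a 3)

/-- The class of the equations `u_t = A u_xx + B u_x + C u + D` with time-independent homogeneous
part, the tuple of the first `k` of `A, B, C, D` being the arbitrary element and the others `0`. -/
noncomputable def linClass (k : ℕ) : EquationClass k where
  S := {θ | ∀ p ∈ θ.domain, co (θ.val p) 0 ≠ 0 ∧ dt (fun q => co (θ.val q) 0) p = 0 ∧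
    dt (fun q => co (θ.val q) 1) p = 0 ∧ dt (fun q => co (θ.val q) 2) p = 0}
  L := fun z a => z.2.1.1 - (co a 0 * z.2.2.2.2 + co a 1 * z.2.1.2 + co a 2 * z.1.2.2 + co a 3)

theorem classE'_eq : classE' = linClass 4 := by
  simp [classE', linClass, co]

theorem classE'₀_eq : classE'₀ = linClass 3 := by
  simp [classE'₀, linClass, co]

theorem jet_mem_locus {k : ℕ} {θ : ArbitraryElement k} {f : Base → ℝ} {q : Base} :
    jet f q ∈ (linClass k).locus θ ↔ q ∈ θ.domain ∧ res (co (θ.val q)) f q = 0 := Iff.rfl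

theorem smoothNear_co {k : ℕ} (θ : ArbitraryElement k) (i : ℕ) {p : Base} (hp : p ∈ θ.domain) :
    SmoothNear (fun q => co (θ.val q) i) p := by
  by_cases h : i < k
  · simp only [co, h, dif_pos]
    exact SmoothNear.of_contDiffOn (contDiffOn_pi.1 θ.smooth ⟨i, h⟩) θ.isOpen_domain hp
  · simp only [co, h, dif_neg, not_false_iff]
    exact SmoothNear.const 0

theorem co_injective {k : ℕ} {a b : Fin k → ℝ} (h : ∀ i < k, co a i = co b i) : a = b := by
  funext i
  simpa [co] using h i i.2

theorem res_congr {a : ℕ → ℝ} {f g : Base → ℝ} {q : Base} (h : f =ᶠ[𝓝 q] g) :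
    res a f q = res a g q := by
  simp only [res, dt_congr h, dx_congr h, dx_congr (dx_congr' h), h.eq_of_nhds]

/-! ### Quadratic functions with a given jet -/

/-- The quadratic function with the second-order jet `z`. -/
noncomputable def quad (z : Jet) (q : Base) : ℝ :=
  z.1.2.2 + z.2.1.1 * (q.1 - z.1.1) + z.2.1.2 * (q.2 - z.1.2.1)
  + z.2.2.1 / 2 * (q.1 - z.1.1) ^ 2 + z.2.2.2.1 * ((q.1 - z.1.1) * (q.2 - z.1.2.1))
  + z.2.2.2.2 / 2 * (q.2 - z.1.2.1) ^ 2

theorem contDiff_quad (z : Jet) : ContDiff ℝ ∞ (quad z) := by unfold quad; fun_prop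

theorem smoothNear_quad (z : Jet) {p : Base} : SmoothNear (quad z) p :=
  SmoothNear.of_contDiff (contDiff_quad z)

theorem hasFDerivAt_affine (a t0 x0 b c : ℝ) (q : Base) :
    HasFDerivAt (fun q : Base => a + b * (q.1 - t0) + c * (q.2 - x0))
      (b • ContinuousLinearMap.fst ℝ ℝ ℝ + c • ContinuousLinearMap.snd ℝ ℝ ℝ) q :=
  ((((hasFDerivAt_fst (𝕜 := ℝ) (p := q)).sub_const t0).const_mul b).const_add a).add
    (((hasFDerivAt_snd (𝕜 := ℝ) (p := q)).sub_const x0).const_mul c)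

theorem dt_affine (a t0 x0 b c : ℝ) (q : Base) :
    dt (fun q : Base => a + b * (q.1 - t0) + c * (q.2 - x0)) q = b := by
  simp [dt, (hasFDerivAt_affine a t0 x0 b c q).fderiv]

theorem dx_affine (a t0 x0 b c : ℝ) (q : Base) :
    dx (fun q : Base => a + b * (q.1 - t0) + c * (q.2 - x0)) q = c := by
  simp [dx, (hasFDerivAt_affine a t0 x0 b c q).fderiv]

theorem dt_quad (z : Jet) : dt (quad z) = fun q => z.2.1.1 + z.2.2.1 * (q.1 - z.1.1)
    + z.2.2.2.1 * (q.2 - z.1.2.1) := by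
  funext q
  have h1 := (hasFDerivAt_fst (𝕜 := ℝ) (p := q)).sub_const z.1.1
  have h2 := (hasFDerivAt_snd (𝕜 := ℝ) (p := q)).sub_const z.1.2.1
  have := (((((h1.const_mul z.2.1.1).const_add z.1.2.2).add (h2.const_mul z.2.1.2)).add
    ((h1.pow 2).const_mul (z.2.2.1 / 2))).add ((h1.mul h2).const_mul z.2.2.2.1)).add
    ((h2.pow 2).const_mul (z.2.2.2.2 / 2))
  have e := this.fderiv
  change fderiv ℝ (quad z) q = _ at e
  simp only [dt, e]
  simp
  ring

theorem dx_quad (z : Jet) : dx (quad z) = fun q => z.2.1.2 + z.2.2.2.1 * (q.1 - z.1.1)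
    + z.2.2.2.2 * (q.2 - z.1.2.1) := by
  funext q
  have h1 := (hasFDerivAt_fst (𝕜 := ℝ) (p := q)).sub_const z.1.1
  have h2 := (hasFDerivAt_snd (𝕜 := ℝ) (p := q)).sub_const z.1.2.1
  have := (((((h1.const_mul z.2.1.1).const_add z.1.2.2).add (h2.const_mul z.2.1.2)).add
    ((h1.pow 2).const_mul (z.2.2.1 / 2))).add ((h1.mul h2).const_mul z.2.2.2.1)).add
    ((h2.pow 2).const_mul (z.2.2.2.2 / 2))
  have e := this.fderiv
  change fderiv ℝ (quad z) q = _ at e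
  simp only [dx, e]
  simp
  ring

theorem jet_quad (z : Jet) : jet (quad z) (base z.1) = z := by
  simp only [jet, dt_quad, dx_quad, dt_affine, dx_affine, graphPt, base]
  simp [quad]

theorem res_quad (a : ℕ → ℝ) (z : Jet) : res a (quad z) (base z.1) =
    z.2.1.1 - (a 0 * z.2.2.2.2 + a 1 * z.2.1.2 + a 2 * z.1.2.2 + a 3) := by
  simp only [res, dt_quad, dx_quad, dx_affine, base]
  simp [quad]

/-! ### Pullbacks of functions by fibre-preserving affine point transformations -/

/-- The data of the point transformation `t̃ = T`, `x̃ = X`, `u = V ũ + W`. -/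
structure PB where
  T : Base → ℝ
  X : Base → ℝ
  V : Base → ℝ
  W : Base → ℝ

namespace PB

variable (G : PB) {g : Base → ℝ} {q : Base}

/-- The transformation of the independent variables. -/
def ψ (q : Base) : Base := (G.T q, G.X q)

/-- The point transformation. -/
noncomputable def map (P : Pt) : Pt :=
  (G.T (base P), G.X (base P), (P.2.2 - G.W (base P)) / G.V (base P))

/-- The function whose graph is mapped to the graph of `g`. -/
def pull (g : Base → ℝ) (q : Base) : ℝ := G.V q * g (G.ψ q) + G.W q

/-- Regularity at a point. -/
structure Rg (q : Base) : Prop where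
  sT : SmoothNear G.T q
  sX : SmoothNear G.X q
  sV : SmoothNear G.V q
  sW : SmoothNear G.W q
  hTx : ∀ᶠ q' in 𝓝 q, dx G.T q' = 0
  hT : dt G.T q ≠ 0
  hX : dx G.X q ≠ 0
  hV : G.V q ≠ 0

variable {G}

theorem Rg.eventually (h : G.Rg q) : ∀ᶠ q' in 𝓝 q, G.Rg q' := by
  filter_upwards [h.sT.eventually, h.sX.eventually, h.sV.eventually, h.sW.eventually,
    eventually_eventually_nhds.2 h.hTx, h.sT.dt.continuousAt.eventually_ne h.hT,
    h.sX.dx.continuousAt.eventually_ne h.hX, h.sV.continuousAt.eventually_ne h.hV]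
    with q' h1 h2 h3 h4 h5 h6 h7 h8 using ⟨h1, h2, h3, h4, h5, h6, h7, h8⟩

theorem Rg.continuousAt_ψ (h : G.Rg q) : ContinuousAt G.ψ q :=
  h.sT.continuousAt.prodMk h.sX.continuousAt

theorem Rg.sc (h : G.Rg q) (hg : SmoothNear g (G.ψ q)) : SmoothNear (fun q => g (G.ψ q)) q :=
  SmoothNear.comp hg h.sT h.sX

theorem Rg.s_pull (h : G.Rg q) (hg : SmoothNear g (G.ψ q)) : SmoothNear (G.pull g) q :=
  (h.sV.mul (h.sc hg)).add h.sW

theorem Rg.dt_c (h : G.Rg q) (hg : SmoothNear g (G.ψ q)) :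
    dt (fun q => g (G.ψ q)) q = dt g (G.ψ q) * dt G.T q + dx g (G.ψ q) * dt G.X q :=
  dt_comp hg.differentiableAt h.sT.differentiableAt h.sX.differentiableAt

theorem Rg.dx_c (h : G.Rg q) (hg : SmoothNear g (G.ψ q)) :
    dx (fun q => g (G.ψ q)) q = dx g (G.ψ q) * dx G.X q := by
  refine (dx_comp hg.differentiableAt h.sT.differentiableAt h.sX.differentiableAt).trans ?_
  rw [h.hTx.self_of_nhds]; simp [ψ]

theorem Rg.dxdtT (h : G.Rg q) : dx (dt G.T) q = 0 := by
  rw [← dt_dx_comm h.sT]; exact dt_eq_zero h.hTx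

theorem Rg.dt_pull (h : G.Rg q) (hg : SmoothNear g (G.ψ q)) : dt (G.pull g) q =
    dt G.V q * g (G.ψ q) + G.V q * (dt g (G.ψ q) * dt G.T q + dx g (G.ψ q) * dt G.X q) +
      dt G.W q := by
  unfold pull
  rw [dt_add (h.sV.mul (h.sc hg)).differentiableAt h.sW.differentiableAt,
    dt_mul h.sV.differentiableAt (h.sc hg).differentiableAt, h.dt_c hg]

theorem Rg.dx_pull (h : G.Rg q) (hg : SmoothNear g (G.ψ q)) : dx (G.pull g) q =
    dx G.V q * g (G.ψ q) + G.V q * (dx g (G.ψ q) * dx G.X q) + dx G.W q := by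
  unfold pull
  rw [dx_add (h.sV.mul (h.sc hg)).differentiableAt h.sW.differentiableAt,
    dx_mul h.sV.differentiableAt (h.sc hg).differentiableAt, h.dx_c hg]

theorem Rg.eventually_smooth (h : G.Rg q) (hg : SmoothNear g (G.ψ q)) :
    ∀ᶠ q' in 𝓝 q, G.Rg q' ∧ SmoothNear g (G.ψ q') :=
  h.eventually.and (h.continuousAt_ψ.eventually hg.eventually)

theorem Rg.dtdt_pull (h : G.Rg q) (hg : SmoothNear g (G.ψ q)) : dt (dt (G.pull g)) q =
    dt (dt G.V) q * g (G.ψ q)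
    + 2 * dt G.V q * (dt g (G.ψ q) * dt G.T q + dx g (G.ψ q) * dt G.X q)
    + G.V q * (dt (dt g) (G.ψ q) * dt G.T q ^ 2 + 2 * dx (dt g) (G.ψ q) * dt G.T q * dt G.X q
      + dx (dx g) (G.ψ q) * dt G.X q ^ 2 + dt g (G.ψ q) * dt (dt G.T) q
      + dx g (G.ψ q) * dt (dt G.X) q) + dt (dt G.W) q := by
  have e : dt (G.pull g) =ᶠ[𝓝 q] fun q => dt G.V q * g (G.ψ q) +
      G.V q * (dt g (G.ψ q) * dt G.T q + dx g (G.ψ q) * dt G.X q) + dt G.W q := by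
    filter_upwards [h.eventually_smooth hg] with q' h' using h'.1.dt_pull h'.2
  have s1 := h.sc hg
  have s2 := h.sc hg.dt
  have s3 := h.sc hg.dx
  have s4 := (s2.mul h.sT.dt)
  have s5 := (s3.mul h.sX.dt)
  rw [dt_congr e, dt_add ((h.sV.dt.mul s1).add (h.sV.mul (s4.add s5))).differentiableAt
    h.sW.dt.differentiableAt, dt_add (h.sV.dt.mul s1).differentiableAt
    (h.sV.mul (s4.add s5)).differentiableAt, dt_mul h.sV.dt.differentiableAt s1.differentiableAt,
    dt_mul h.sV.differentiableAt (s4.add s5).differentiableAt, dt_add s4.differentiableAt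
    s5.differentiableAt, dt_mul s2.differentiableAt h.sT.dt.differentiableAt,
    dt_mul s3.differentiableAt h.sX.dt.differentiableAt, h.dt_c hg, h.dt_c hg.dt, h.dt_c hg.dx,
    dt_dx_comm hg]
  ring

theorem Rg.dxdt_pull (h : G.Rg q) (hg : SmoothNear g (G.ψ q)) : dx (dt (G.pull g)) q =
    dx (dt G.V) q * g (G.ψ q) + dt G.V q * (dx g (G.ψ q) * dx G.X q)
    + dx G.V q * (dt g (G.ψ q) * dt G.T q + dx g (G.ψ q) * dt G.X q)
    + G.V q * (dx (dt g) (G.ψ q) * dx G.X q * dt G.T q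
      + dx (dx g) (G.ψ q) * dx G.X q * dt G.X q
      + dx g (G.ψ q) * dx (dt G.X) q) + dx (dt G.W) q := by
  have e : dt (G.pull g) =ᶠ[𝓝 q] fun q => dt G.V q * g (G.ψ q) +
      G.V q * (dt g (G.ψ q) * dt G.T q + dx g (G.ψ q) * dt G.X q) + dt G.W q := by
    filter_upwards [h.eventually_smooth hg] with q' h' using h'.1.dt_pull h'.2
  have s1 := h.sc hg
  have s2 := h.sc hg.dt
  have s3 := h.sc hg.dx
  have s4 := (s2.mul h.sT.dt)
  have s5 := (s3.mul h.sX.dt)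
  rw [dx_congr e, dx_add ((h.sV.dt.mul s1).add (h.sV.mul (s4.add s5))).differentiableAt
    h.sW.dt.differentiableAt, dx_add (h.sV.dt.mul s1).differentiableAt
    (h.sV.mul (s4.add s5)).differentiableAt, dx_mul h.sV.dt.differentiableAt s1.differentiableAt,
    dx_mul h.sV.differentiableAt (s4.add s5).differentiableAt, dx_add s4.differentiableAt
    s5.differentiableAt, dx_mul s2.differentiableAt h.sT.dt.differentiableAt,
    dx_mul s3.differentiableAt h.sX.dt.differentiableAt, h.dx_c hg, h.dx_c hg.dt, h.dx_c hg.dx,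
    h.dxdtT]
  ring

theorem Rg.dxdx_pull (h : G.Rg q) (hg : SmoothNear g (G.ψ q)) : dx (dx (G.pull g)) q =
    dx (dx G.V) q * g (G.ψ q) + 2 * dx G.V q * (dx g (G.ψ q) * dx G.X q)
    + G.V q * (dx (dx g) (G.ψ q) * dx G.X q ^ 2 + dx g (G.ψ q) * dx (dx G.X) q)
    + dx (dx G.W) q := by
  have e : dx (G.pull g) =ᶠ[𝓝 q] fun q => dx G.V q * g (G.ψ q) +
      G.V q * (dx g (G.ψ q) * dx G.X q) + dx G.W q := by
    filter_upwards [h.eventually_smooth hg] with q' h' using h'.1.dx_pull h'.2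
  have s1 := h.sc hg
  have s3 := h.sc hg.dx
  have s5 := (s3.mul h.sX.dx)
  rw [dx_congr e, dx_add ((h.sV.dx.mul s1).add (h.sV.mul s5)).differentiableAt
    h.sW.dx.differentiableAt, dx_add (h.sV.dx.mul s1).differentiableAt
    (h.sV.mul s5).differentiableAt, dx_mul h.sV.dx.differentiableAt s1.differentiableAt,
    dx_mul h.sV.differentiableAt s5.differentiableAt,
    dx_mul s3.differentiableAt h.sX.dx.differentiableAt, h.dx_c hg, h.dx_c hg.dx]
  ring

variable (G)

/-- The action of the pullback on second-order jets. -/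
noncomputable def pullJet (q : Base) (z : Jet) : Jet :=
  ((q.1, q.2, G.V q * z.1.2.2 + G.W q),
   (dt G.V q * z.1.2.2 + G.V q * (z.2.1.1 * dt G.T q + z.2.1.2 * dt G.X q) + dt G.W q,
    dx G.V q * z.1.2.2 + G.V q * (z.2.1.2 * dx G.X q) + dx G.W q),
   (dt (dt G.V) q * z.1.2.2 + 2 * dt G.V q * (z.2.1.1 * dt G.T q + z.2.1.2 * dt G.X q)
      + G.V q * (z.2.2.1 * dt G.T q ^ 2 + 2 * z.2.2.2.1 * dt G.T q * dt G.X q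
        + z.2.2.2.2 * dt G.X q ^ 2 + z.2.1.1 * dt (dt G.T) q
        + z.2.1.2 * dt (dt G.X) q) + dt (dt G.W) q,
    dx (dt G.V) q * z.1.2.2 + dt G.V q * (z.2.1.2 * dx G.X q)
      + dx G.V q * (z.2.1.1 * dt G.T q + z.2.1.2 * dt G.X q)
      + G.V q * (z.2.2.2.1 * dx G.X q * dt G.T q + z.2.2.2.2 * dx G.X q * dt G.X q
        + z.2.1.2 * dx (dt G.X) q) + dx (dt G.W) q,
    dx (dx G.V) q * z.1.2.2 + 2 * dx G.V q * (z.2.1.2 * dx G.X q)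
      + G.V q * (z.2.2.2.2 * dx G.X q ^ 2 + z.2.1.2 * dx (dx G.X) q) + dx (dx G.W) q))

variable {G}

theorem Rg.jet_pull (h : G.Rg q) (hg : SmoothNear g (G.ψ q)) :
    jet (G.pull g) q = G.pullJet q (jet g (G.ψ q)) := by
  simp only [jet, h.dt_pull hg, h.dx_pull hg, h.dtdt_pull hg, h.dxdt_pull hg, h.dxdx_pull hg,
    pullJet, graphPt, pull]

variable (G)

/-- The coefficient `A` of the equation mapped to the equation with given coefficients. -/
noncomputable def pullA (q : Base) (a : ℕ → ℝ) : ℝ := dt G.T q * a 0 / dx G.X q ^ 2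

/-- The coefficient `B` of the equation mapped to the equation with given coefficients. -/
noncomputable def pullB (q : Base) (a : ℕ → ℝ) : ℝ :=
  (dt G.T q * a 1 + dt G.X q - G.pullA q a * dx (dx G.X) q) / dx G.X q
    - 2 * G.pullA q a * (dx G.V q / G.V q)

/-- The coefficient `C` of the equation mapped to the equation with given coefficients. -/
noncomputable def pullC (q : Base) (a : ℕ → ℝ) : ℝ :=
  dt G.T q * a 2 + dt G.V q / G.V q - G.pullA q a * (dx (dx G.V) q / G.V q)
    - G.pullB q a * (dx G.V q / G.V q)

/-- The coefficients `A, B, C, D` of the equation that is mapped to the equation with given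
coefficients. -/
noncomputable def pullCoef (q : Base) (a : ℕ → ℝ) : ℕ → ℝ
  | 0 => G.pullA q a
  | 1 => G.pullB q a
  | 2 => G.pullC q a
  | 3 => G.V q * dt G.T q * a 3 + dt G.W q - G.pullA q a * dx (dx G.W) q
      - G.pullB q a * dx G.W q - G.pullC q a * G.W q
  | _ + 4 => 0

variable {G}

/-- The equations relating the coefficients `b` with `pullCoef G q a`. -/
structure Det (G : PB) (q : Base) (b a : ℕ → ℝ) : Prop where
  h0 : dt G.T q * a 0 = b 0 * dx G.X q ^ 2
  h1 : G.V q * dt G.T q * a 1 = G.V q * (b 0 * dx (dx G.X) q + b 1 * dx G.X q - dt G.X q)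
    + 2 * b 0 * dx G.X q * dx G.V q
  h2 : G.V q * dt G.T q * a 2 = -dt G.V q + b 0 * dx (dx G.V) q + b 1 * dx G.V q + b 2 * G.V q
  h3 : G.V q * dt G.T q * a 3 = -dt G.W q + b 0 * dx (dx G.W) q + b 1 * dx G.W q + b 2 * G.W q
    + b 3

/-- For a given target tuple the system is triangular: since `X_x` and `V` do not vanish, the
equations successively yield `b 0`, `b 1`, `b 2` and `b 3`. -/
theorem Rg.det_iff (h : G.Rg q) {b a : ℕ → ℝ} :
    Det G q b a ↔ ∀ i < 4, b i = G.pullCoef q a i := by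
  have hX := h.hX
  have hV := h.hV
  constructor
  · rintro ⟨h0, h1, h2, h3⟩
    have e0 : b 0 = G.pullA q a := by unfold pullA; field_simp; linarith
    have e1 : b 1 = G.pullB q a := by unfold pullB; rw [← e0]; field_simp; linarith
    have e2 : b 2 = G.pullC q a := by unfold pullC; rw [← e1, ← e0]; field_simp; linarith
    intro i hi
    interval_cases i
    · exact e0
    · exact e1
    · exact e2
    · simp only [pullCoef]; rw [← e2, ← e1, ← e0]; linarith
  · intro hb
    have e0 : b 0 = G.pullA q a := hb 0 (by norm_num)
    have e1 : b 1 = G.pullB q a := hb 1 (by norm_num)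
    have e2 : b 2 = G.pullC q a := hb 2 (by norm_num)
    have e3 := hb 3 (by norm_num)
    simp only [pullCoef] at e3
    rw [← e0, ← e1, ← e2] at e3
    unfold pullC at e2
    rw [← e0, ← e1] at e2
    unfold pullB at e1
    rw [← e0] at e1
    unfold pullA at e0
    refine ⟨?_, ?_, ?_, ?_⟩
    · rw [e0]; field_simp
    · rw [e1]; field_simp; ring
    · rw [e2]; field_simp; ring
    · rw [e3]; ring

/-- The determining equations compare the coefficients of `g_xx`, `g_x`, `g` and `1` in this
identity. The factor `V T_t` is nonzero, so solution jets correspond to solution jets. -/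
theorem Rg.res_pull (h : G.Rg q) {b a : ℕ → ℝ} (hd : Det G q b a) (hg : SmoothNear g (G.ψ q)) :
    res b (G.pull g) q = G.V q * dt G.T q * res a g (G.ψ q) := by
  obtain ⟨h0, h1, h2, h3⟩ := hd
  simp only [res, h.dt_pull hg, h.dx_pull hg, h.dxdx_pull hg, pull]
  linear_combination (G.V q * dx (dx g) (G.ψ q)) * h0 + dx g (G.ψ q) * h1 + g (G.ψ q) * h2 + h3

/-- The determining equations follow from the inclusion of the solution jets over two values of
the dependent variable. -/
theorem Rg.det_of_forall (h : G.Rg q) {b a : ℕ → ℝ} {I : Set ℝ} {u₁ u₂ : ℝ} (hu₁ : u₁ ∈ I)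
    (hu₂ : u₂ ∈ I) (hne : u₁ ≠ u₂) (hd : ∀ g, ContDiff ℝ ∞ g → g (G.ψ q) ∈ I →
      res b (G.pull g) q = 0 → res a g (G.ψ q) = 0) : Det G q b a := by
  -- The tuple `a'` is the one for which the determining equations with the given `b` hold.
  -- Pullbacks then vanish on `b` exactly when the residual for `a'` vanishes, and it remains to
  -- compare `a'` with `a`.
  set a' : ℕ → ℝ := fun i => match i with
    | 0 => b 0 * dx G.X q ^ 2 / dt G.T q
    | 1 => (G.V q * (b 0 * dx (dx G.X) q + b 1 * dx G.X q - dt G.X q)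
      + 2 * b 0 * dx G.X q * dx G.V q) / (G.V q * dt G.T q)
    | 2 => (-dt G.V q + b 0 * dx (dx G.V) q + b 1 * dx G.V q + b 2 * G.V q) / (G.V q * dt G.T q)
    | 3 => (-dt G.W q + b 0 * dx (dx G.W) q + b 1 * dx G.W q + b 2 * G.W q + b 3)
      / (G.V q * dt G.T q)
    | _ => 0 with ha'
  have hT := h.hT
  have hV := h.hV
  have hd' : Det G q b a' := by
    refine ⟨?_, ?_, ?_, ?_⟩ <;> simp only [ha'] <;> field_simp
  have key : ∀ i < 4, a' i = a i := by
    have key2 : ∀ u ∈ I, ∀ ux uxx : ℝ, a 0 * uxx + a 1 * ux + a 2 * u + a 3 =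
        a' 0 * uxx + a' 1 * ux + a' 2 * u + a' 3 := by
      intro u hu ux uxx
      set z : Jet := ((G.T q, G.X q, u), (a' 0 * uxx + a' 1 * ux + a' 2 * u + a' 3, ux),
        (0, 0, uxx))
      have hz : base z.1 = G.ψ q := rfl
      have h1 := hd _ (contDiff_quad z) (by rw [← hz]; simpa [quad, base, z] using hu) (by
        rw [h.res_pull hd' (smoothNear_quad z), ← hz, res_quad]; simp [z])
      rw [← hz, res_quad] at h1
      simp only [z] at h1
      linarith
    -- Two values of `u` separate the coefficient of `u` from the free term; changing `ux` and `uxx`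
    -- separates the other two.
    have k0 := key2 u₁ hu₁ 0 0
    have k1 := key2 u₂ hu₂ 0 0
    have k2 := key2 u₁ hu₁ 1 0
    have k3 := key2 u₁ hu₁ 0 1
    have e2 : a' 2 = a 2 := by
      apply mul_right_cancel₀ (sub_ne_zero.2 hne); linear_combination k1 - k0
    rw [e2] at k0 k2 k3
    intro i hi
    interval_cases i <;> linarith
  obtain ⟨h0, h1, h2, h3⟩ := hd'
  rw [key _ (by norm_num)] at h0 h1 h2 h3
  exact ⟨h0, h1, h2, h3⟩

/-- Turns a relation between coefficients into one between residuals. Composition and inversion of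
the determining equations follow from it without expanding any chain rule. -/
theorem Rg.det_of_res (h : G.Rg q) {b a : ℕ → ℝ}
    (hd : ∀ g, ContDiff ℝ ∞ g → res b (G.pull g) q = G.V q * dt G.T q * res a g (G.ψ q)) :
    Det G q b a := by
  refine h.det_of_forall (mem_univ 0) (mem_univ 1) zero_ne_one fun g hg _ h0 => ?_
  rw [hd g hg] at h0
  simpa [h.hV, h.hT] using h0

end PB

/-! ### Local inverses -/

/-- The inverse function theorem, with the source shrunk so that the Jacobian is nonzero on all of
it; the inverse is therefore smooth on the whole target and not only at one point. -/
theorem exists_chart {a b : Base → ℝ} {p : Base} (ha : SmoothNear a p) (hb : SmoothNear b p)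
    (hJ : dt a p * dx b p - dx a p * dt b p ≠ 0) {N : Set Base} (hN : N ∈ 𝓝 p) :
    ∃ χ : OpenPartialHomeomorph Base Base, p ∈ χ.source ∧ χ.source ⊆ N ∧
      (∀ q, χ q = (a q, b q)) ∧
      ∀ y ∈ χ.target, SmoothNear (fun y => (χ.symm y).1) y ∧ SmoothNear (fun y => (χ.symm y).2) y := by
  have key : ∀ q, SmoothNear a q → SmoothNear b q → dt a q * dx b q - dx a q * dt b q ≠ 0 →
      ContDiffAt ℝ ∞ (fun q => (a q, b q)) q ∧
      ∃ L : Base ≃L[ℝ] Base, HasFDerivAt (fun q => (a q, b q)) (L : Base →L[ℝ] Base) q := by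
    intro q hqa hqb hq
    refine ⟨hqa.contDiffAt.prodMk hqb.contDiffAt, ?_⟩
    set L : Base →L[ℝ] Base := (fderiv ℝ a q).prod (fderiv ℝ b q) with hL
    have hinj : Function.Injective (L : Base →ₗ[ℝ] Base) := by
      rw [← LinearMap.ker_eq_bot, LinearMap.ker_eq_bot']
      intro v hv
      have h1 : fderiv ℝ a q v = 0 := congrArg Prod.fst hv
      have h2 : fderiv ℝ b q v = 0 := congrArg Prod.snd hv
      rw [fderiv_eq_dt_dx] at h1 h2
      have e1 : v.1 = 0 := by
        apply mul_left_cancel₀ hq; linear_combination dx b q * h1 - dx a q * h2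
      have e2 : v.2 = 0 := by
        apply mul_left_cancel₀ hq; linear_combination dt a q * h2 - dt b q * h1
      exact Prod.ext e1 e2
    refine ⟨(LinearEquiv.ofInjectiveEndo (L : Base →ₗ[ℝ] Base) hinj).toContinuousLinearEquiv, ?_⟩
    have : ((LinearEquiv.ofInjectiveEndo (L : Base →ₗ[ℝ] Base) hinj).toContinuousLinearEquiv
        : Base →L[ℝ] Base) = L := by
      ext <;> rfl
    rw [this]
    exact hqa.differentiableAt.hasFDerivAt.prodMk hqb.differentiableAt.hasFDerivAt
  obtain ⟨hp, L, hL⟩ := key p ha hb hJ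
  set χ₀ := hp.toOpenPartialHomeomorph (fun q => (a q, b q)) hL (by simp)
  have hcoe : ∀ q, χ₀ q = (a q, b q) := fun q => rfl
  have hev : ∀ᶠ q in 𝓝 p, q ∈ N ∧ SmoothNear a q ∧ SmoothNear b q ∧
      dt a q * dx b q - dx a q * dt b q ≠ 0 := by
    filter_upwards [hN, ha.eventually, hb.eventually, (((ha.dt.mul hb.dx).sub
      (ha.dx.mul hb.dt)).continuousAt.eventually_ne hJ)] with q h1 h2 h3 h4 using ⟨h1, h2, h3, h4⟩
  obtain ⟨M, hM, hMo, hpM⟩ := mem_nhds_iff.1 hev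
  refine ⟨χ₀.restrOpen M hMo, ?_, ?_, fun q => hcoe q, ?_⟩
  · exact ⟨hp.mem_toOpenPartialHomeomorph_source hL (by simp), hpM⟩
  · intro q hq
    exact (hM hq.2).1
  · intro y hy
    set χ := χ₀.restrOpen M hMo
    have hs : ∀ y ∈ χ.target, ContDiffAt ℝ ∞ χ.symm y := by
      intro y hy
      have hq := χ.map_target hy
      obtain ⟨_, h2, h3, h4⟩ := hM hq.2
      obtain ⟨h5, L', hL'⟩ := key _ h2 h3 h4
      exact χ.contDiffAt_symm hy hL' h5
    constructor
    · filter_upwards [χ.open_target.mem_nhds hy] with y hy using (hs y hy).fst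
    · filter_upwards [χ.open_target.mem_nhds hy] with y hy using (hs y hy).snd

namespace PB

/-! ### Composition -/

/-- The pullback data of the composition: first `G`, then `H`. -/
def comp (G H : PB) : PB where
  T q := H.T (G.ψ q)
  X q := H.X (G.ψ q)
  V q := G.V q * H.V (G.ψ q)
  W q := G.V q * H.W (G.ψ q) + G.W q

variable {G H : PB} {q : Base}

theorem comp_ψ : (G.comp H).ψ q = H.ψ (G.ψ q) := rfl

theorem comp_pull (g : Base → ℝ) : (G.comp H).pull g = G.pull (H.pull g) := by
  funext q; simp only [comp, pull, ψ]; ring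

theorem base_map (P : Pt) : base (G.map P) = G.ψ (base P) := rfl

theorem comp_map {P : Pt} (hG : G.V (base P) ≠ 0) (hH : H.V (G.ψ (base P)) ≠ 0) :
    (G.comp H).map P = H.map (G.map P) := by
  have e : base (G.map P) = G.ψ (base P) := rfl
  simp only [map, comp]
  refine Prod.ext rfl (Prod.ext rfl ?_)
  have e2 : base (G.T (base P), G.X (base P), (P.2.2 - G.W (base P)) / G.V (base P)) =
    G.ψ (base P) := rfl
  simp only [e2]
  field_simp
  ring

theorem Rg.comp (hG : G.Rg q) (hH : H.Rg (G.ψ q)) : (G.comp H).Rg q where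
  sT := hG.sc hH.sT
  sX := hG.sc hH.sX
  sV := hG.sV.mul (hG.sc hH.sV)
  sW := (hG.sV.mul (hG.sc hH.sW)).add hG.sW
  hTx := by
    filter_upwards [hG.eventually, hG.continuousAt_ψ.eventually hH.eventually] with q' h1 h2
    exact (h1.dx_c h2.sT).trans (by rw [h2.hTx.self_of_nhds, zero_mul])
  hT := by
    have := hG.dt_c hH.sT
    rw [hH.hTx.self_of_nhds, zero_mul, add_zero] at this
    exact this.trans_ne (mul_ne_zero hH.hT hG.hT)
  hX := (hG.dx_c hH.sX).trans_ne (mul_ne_zero hH.hX hG.hX)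
  hV := mul_ne_zero hG.hV hH.hV

theorem Rg.dt_comp_T (hG : G.Rg q) (hH : H.Rg (G.ψ q)) :
    dt (G.comp H).T q = dt H.T (G.ψ q) * dt G.T q := by
  have := hG.dt_c hH.sT
  rw [hH.hTx.self_of_nhds, zero_mul, add_zero] at this
  exact this

theorem Det.comp {a b c : ℕ → ℝ} (hG : G.Rg q) (hH : H.Rg (G.ψ q)) (h1 : Det G q c b)
    (h2 : Det H (G.ψ q) b a) : Det (G.comp H) q c a := by
  refine (hG.comp hH).det_of_res fun g hg => ?_
  rw [comp_pull, hG.res_pull h1 (hH.s_pull (SmoothNear.of_contDiff hg)),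
    hH.res_pull h2 (SmoothNear.of_contDiff hg), hG.dt_comp_T hH]
  simp only [PB.comp, ψ]; ring

end PB

/-! ### Local isomorphisms -/

/-- Mutually inverse pullback data on two open sets. -/
structure GIso where
  G : PB
  G' : PB
  O : Set Base
  O' : Set Base
  isOpen : IsOpen O
  isOpen' : IsOpen O'
  rg : ∀ q ∈ O, G.Rg q
  rg' : ∀ q ∈ O', G'.Rg q
  maps : ∀ q ∈ O, G.ψ q ∈ O'
  maps' : ∀ q ∈ O', G'.ψ q ∈ O
  left : ∀ q ∈ O, G'.ψ (G.ψ q) = q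
  right : ∀ q ∈ O', G.ψ (G'.ψ q) = q
  hV : ∀ q ∈ O, G.V q * G'.V (G.ψ q) = 1
  hV' : ∀ q ∈ O', G'.V q * G.V (G'.ψ q) = 1
  hW : ∀ q ∈ O, G.V q * G'.W (G.ψ q) + G.W q = 0
  hW' : ∀ q ∈ O', G'.V q * G.W (G'.ψ q) + G'.W q = 0

namespace GIso

/-- The inverse. -/
def symm (e : GIso) : GIso where
  G := e.G'
  G' := e.G
  O := e.O'
  O' := e.O
  isOpen := e.isOpen'
  isOpen' := e.isOpen
  rg := e.rg'
  rg' := e.rg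
  maps := e.maps'
  maps' := e.maps
  left := e.right
  right := e.left
  hV := e.hV'
  hV' := e.hV
  hW := e.hW'
  hW' := e.hW

variable (e : GIso) {q : Base}

theorem dt_T (hq : q ∈ e.O) : dt e.G'.T (e.G.ψ q) * dt e.G.T q = 1 := by
  have h := e.rg q hq
  have h' := e.rg' _ (e.maps q hq)
  have h1 := h.dt_c h'.sT
  rw [h'.hTx.self_of_nhds, zero_mul, add_zero] at h1
  rw [← h1, dt_congr (g := fun q => q.1), dt_fst]
  filter_upwards [e.isOpen.mem_nhds hq] with q' hq'
  exact congrArg Prod.fst (e.left q' hq')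

theorem pull_pull {f : Base → ℝ} (hq : q ∈ e.O) : e.G.pull (e.G'.pull f) q = f q := by
  have h1 := e.hV q hq
  have h2 := e.hW q hq
  simp only [PB.pull, e.left q hq]
  linear_combination f q * h1 + h2

theorem pull_pull_eventuallyEq {f : Base → ℝ} (hq : q ∈ e.O) :
    e.G.pull (e.G'.pull f) =ᶠ[𝓝 q] f := by
  filter_upwards [e.isOpen.mem_nhds hq] with q' hq' using e.pull_pull hq'

/-- Apply the residual identity of `e.G` to `e.G'.pull f`, whose pullback by `e.G` is `f`; the
factors `V T_t` of the two directions are reciprocal. -/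
theorem det_symm {a b : ℕ → ℝ} (hq : q ∈ e.O) (h : e.G.Det q b a) :
    e.G'.Det (e.G.ψ q) a b := by
  have hr := e.rg q hq
  have hr' := e.rg' _ (e.maps q hq)
  refine hr'.det_of_res fun f hf => ?_
  have h1 := hr.res_pull h (hr'.s_pull (SmoothNear.of_contDiff hf))
  rw [res_congr (e.pull_pull_eventuallyEq hq)] at h1
  rw [e.left q hq, h1]
  linear_combination (-res a (e.G'.pull f) (e.G.ψ q)) * e.hV q hq
    - (res a (e.G'.pull f) (e.G.ψ q)) * e.G.V q * e.G'.V (e.G.ψ q) * e.dt_T hq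

theorem map_map {P : Pt} (hP : base P ∈ e.O) : e.G'.map (e.G.map P) = P := by
  have h1 := e.hV _ hP
  have h2 := e.hW _ hP
  have hV := (e.rg _ hP).hV
  have hV' := (e.rg' _ (e.maps _ hP)).hV
  rw [← PB.comp_map hV hV']
  have h3 := e.left _ hP
  have h4 : (e.G'.ψ (e.G.ψ (base P))).1 = P.1 := by rw [h3]; rfl
  have h5 : (e.G'.ψ (e.G.ψ (base P))).2 = P.2.1 := by rw [h3]; rfl
  refine Prod.ext h4 (Prod.ext h5 ?_)
  simp only [PB.map, PB.comp, h1, h2]; simp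

end GIso

theorem PB.Rg.exists_gIso {G : PB} {p : Base} (hp : G.Rg p) {N : Set Base} (hN : N ∈ 𝓝 p) :
    ∃ e : GIso, e.G = G ∧ p ∈ e.O ∧ e.O ⊆ N := by
  obtain ⟨χ, h1, h2, h3, h4⟩ := exists_chart hp.sT hp.sX (p := p)
    (by rw [hp.hTx.self_of_nhds]; simpa using ⟨hp.hT, hp.hX⟩) (inter_mem hN hp.eventually)
  have hψ : ∀ q, G.ψ q = χ q := fun q => (h3 q).symm
  have hrg : ∀ q ∈ χ.source, G.Rg q := fun q hq => (h2 hq).2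
  have hs : ∀ y ∈ χ.target, ContinuousAt χ.symm y := fun y hy => χ.continuousAt_symm hy
  have sm : ∀ {f : Base → ℝ} {y}, y ∈ χ.target → SmoothNear f (χ.symm y) →
      SmoothNear (fun y => f (χ.symm y)) y := fun hy hf =>
    SmoothNear.comp (g := _) (a := fun y => (χ.symm y).1) (b := fun y => (χ.symm y).2) hf
      (h4 _ hy).1 (h4 _ hy).2
  refine ⟨{
    G := G
    G' := ⟨fun y => (χ.symm y).1, fun y => (χ.symm y).2, fun y => (G.V (χ.symm y))⁻¹,
      fun y => -(G.W (χ.symm y) / G.V (χ.symm y))⟩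
    O := χ.source
    O' := χ.target
    isOpen := χ.open_source
    isOpen' := χ.open_target
    rg := hrg
    rg' := ?_
    maps := fun q hq => by rw [hψ]; exact χ.map_source hq
    maps' := fun y hy => χ.map_target hy
    left := fun q hq => by rw [hψ]; exact χ.left_inv hq
    right := fun y hy => by rw [hψ]; exact χ.right_inv hy
    hV := fun q hq => by
      simp only [hψ, χ.left_inv hq]
      exact mul_inv_cancel₀ (hrg q hq).hV
    hV' := fun y hy => inv_mul_cancel₀ (hrg _ (χ.map_target hy)).hV
    hW := fun q hq => by
      have := (hrg q hq).hV
      simp only [hψ, χ.left_inv hq]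
      field_simp; simp
    hW' := fun y hy => by
      change (G.V (χ.symm y))⁻¹ * G.W (χ.symm y) + -(G.W (χ.symm y) / G.V (χ.symm y)) = 0
      rw [div_eq_inv_mul]; ring }, rfl, h1, fun q hq => (h2 hq).1⟩
  -- Differentiating in `x` the identity that the inverse undoes `T` leaves the required derivative
  -- times `X_x`, because `T_x = 0`.
  have hTx : ∀ y ∈ χ.target, dx (fun y => (χ.symm y).1) y = 0 := by
    intro y hy
    have hr := hrg _ (χ.map_target hy)
    have e1 := hr.dx_c (g := fun y => (χ.symm y).1)
      (by rw [hψ, χ.right_inv hy]; exact (h4 y hy).1)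
    rw [dx_congr (g := fun q => q.1), dx_fst, hψ, χ.right_inv hy] at e1
    · exact (mul_eq_zero.1 e1.symm).resolve_right hr.hX
    · filter_upwards [χ.open_source.mem_nhds (χ.map_target hy)] with q hq
      rw [hψ, χ.left_inv hq]
  intro y hy
  have hr := hrg _ (χ.map_target hy)
  refine ⟨(h4 y hy).1, (h4 y hy).2, (sm hy hr.sV).inv hr.hV, ((sm hy hr.sW).div (sm hy hr.sV)
    hr.hV).neg, ?_, ?_, ?_, inv_ne_zero hr.hV⟩
  · filter_upwards [χ.open_target.mem_nhds hy] with y hy using hTx y hy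
  · intro h0
    have e1 := hr.dt_c (g := fun y => (χ.symm y).1)
      (by rw [hψ, χ.right_inv hy]; exact (h4 y hy).1)
    rw [dt_congr (g := fun q => q.1), dt_fst, hψ, χ.right_inv hy, hTx y hy, h0] at e1
    · simp at e1
    · filter_upwards [χ.open_source.mem_nhds (χ.map_target hy)] with q hq
      rw [hψ, χ.left_inv hq]
  · intro h0
    have e1 := hr.dx_c (g := fun y => (χ.symm y).2)
      (by rw [hψ, χ.right_inv hy]; exact (h4 y hy).2)
    rw [dx_congr (g := fun q => q.2), dx_snd, hψ, χ.right_inv hy, h0] at e1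
    · simp at e1
    · filter_upwards [χ.open_source.mem_nhds (χ.map_target hy)] with q hq
      rw [hψ, χ.left_inv hq]

/-! ### Admissible germs -/

/-- `G` maps, near `p`, the equation with the arbitrary element `θ` to the one with `θ'`. -/
def Adm {k : ℕ} (θ θ' : ArbitraryElement k) (p : Base) (G : PB) : Prop :=
  ∀ᶠ q in 𝓝 p, G.Rg q ∧ q ∈ θ.domain ∧ G.ψ q ∈ θ'.domain ∧
    G.Det q (co (θ.val q)) (co (θ'.val (G.ψ q)))

namespace Adm

variable {k : ℕ} {θ θ' θ'' : ArbitraryElement k} {p : Base} {G H : PB}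

theorem rg (h : Adm θ θ' p G) : G.Rg p := h.self_of_nhds.1

theorem mem (h : Adm θ θ' p G) : p ∈ θ.domain := h.self_of_nhds.2.1

theorem mem' (h : Adm θ θ' p G) : G.ψ p ∈ θ'.domain := h.self_of_nhds.2.2.1

theorem eventually (h : Adm θ θ' p G) : ∀ᶠ q in 𝓝 p, Adm θ θ' q G := eventually_eventually_nhds.2 h

theorem comp (h : Adm θ θ' p G) (h' : Adm θ' θ'' (G.ψ p) H) : Adm θ θ'' p (G.comp H) := by
  filter_upwards [h, h.rg.continuousAt_ψ.eventually h'] with q h1 h2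
  exact ⟨h1.1.comp h2.1, h1.2.1, h2.2.2.1, PB.Det.comp h1.1 h2.1 h1.2.2.2 h2.2.2.2⟩

theorem symm {e : GIso} (hp : p ∈ e.O) (h : Adm θ θ' p e.G) : Adm θ' θ (e.G.ψ p) e.G' := by
  have hc : Tendsto e.G'.ψ (𝓝 (e.G.ψ p)) (𝓝 p) := by
    have := (e.rg' _ (e.maps p hp)).continuousAt_ψ
    rwa [ContinuousAt, e.left p hp] at this
  filter_upwards [hc.eventually h, e.isOpen'.mem_nhds (e.maps p hp)] with y h1 h2
  obtain ⟨_, h4, h5, h6⟩ := h1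
  have h7 := e.det_symm (e.maps' y h2) h6
  rw [e.right y h2] at h5 h7
  exact ⟨e.rg' y h2, h5, h4, h7⟩

end Adm

/-! ### Sufficiency: germs of pullback data give admissible transformations -/

theorem PB.Rg.contDiffAt_map {G : PB} {P : Pt} (h : G.Rg (base P)) : ContDiffAt ℝ ∞ G.map P := by
  have hb : ContDiffAt ℝ ∞ base P := by unfold base; fun_prop
  exact (h.sT.contDiffAt.comp P hb).prodMk ((h.sX.contDiffAt.comp P hb).prodMk
    (((contDiffAt_snd.comp P contDiffAt_snd).sub (h.sW.contDiffAt.comp P hb)).div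
      (h.sV.contDiffAt.comp P hb) h.hV))

/-- The graph condition says that near the point `f` is the pullback of `g`, so the residuals of `f`
and `g` differ by a nonzero factor. -/
theorem mem_locus_of_prolongs {k : ℕ} {θ θ' : ArbitraryElement k} {P : Pt} {G : PB}
    {Φ : OpenPartialHomeomorph Pt Pt} (hG : Adm θ θ' (base P) G) (hΦ : Φ =ᶠ[𝓝 P] G.map)
    {z z' : Jet} (hz : z.1 = P) (hp : Prolongs Φ z z') (h : z ∈ (linClass k).locus θ) :
    z' ∈ (linClass k).locus θ' := by
  obtain ⟨f, g, p, q, hf, hg, rfl, rfl, h1, h2, h3⟩ := hp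
  have hbp : base P = p := by rw [← hz]; rfl
  have hP : graphPt f p = P := hz
  rw [hbp] at hG
  have hq : q = G.ψ p := by
    have : base (Φ (graphPt f p)) = q := by
      have := congrArg base h2; exact this
    rw [← this, hP, hΦ.eq_of_nhds, PB.base_map, hbp]
  subst hq
  have hc : Tendsto (graphPt f) (𝓝 p) (𝓝 P) := by
    have := continuousAt_graphPt hf.continuousAt
    rwa [ContinuousAt, hP] at this
  have e : f =ᶠ[𝓝 p] G.pull g := by
    filter_upwards [h3, hc.eventually hΦ, hG.rg.eventually] with p' h4 h5 h6
    rw [h5, PB.base_map] at h4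
    have h7 : (f p' - G.W p') / G.V p' = g (G.ψ p') := congrArg (fun P : Pt => P.2.2) h4
    have hV := h6.hV
    simp only [PB.pull, ← h7]; field_simp; ring
  rw [jet_mem_locus] at h ⊢
  refine ⟨hG.mem', ?_⟩
  have h4 := h.2
  rw [res_congr e, hG.rg.res_pull hG.self_of_nhds.2.2.2 hg] at h4
  simpa [hG.rg.hV, hG.rg.hT] using h4

theorem symm_eventuallyEq {Φ : OpenPartialHomeomorph Pt Pt} {P : Pt} (hP : P ∈ Φ.source)
    {e : GIso} (he : base P ∈ e.O) (hΦ : Φ =ᶠ[𝓝 P] e.G.map) :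
    Φ.symm =ᶠ[𝓝 (Φ P)] e.G'.map := by
  have hc : Tendsto Φ.symm (𝓝 (Φ P)) (𝓝 P) := by
    have := Φ.continuousAt_symm (Φ.map_source hP)
    rwa [ContinuousAt, Φ.left_inv hP] at this
  filter_upwards [hc.eventually hΦ, Φ.open_target.mem_nhds (Φ.map_source hP),
    hc.eventually (continuous_base.continuousAt.eventually (e.isOpen.mem_nhds he))] with Q h1 h2 h3
  rw [Φ.right_inv h2] at h1
  conv_rhs => rw [h1]
  exact (e.map_map h3).symm

/-- Every germ of the transformation is given by admissible pullback data. -/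
def HasGerms {k : ℕ} (T : Triple k) : Prop :=
  ∀ P ∈ T.Φ.source, ∃ G, Adm T.src T.tgt (base P) G ∧ T.Φ =ᶠ[𝓝 P] G.map

theorem HasGerms.inv {k : ℕ} {T : Triple k} (h : HasGerms T) : HasGerms T.inv := by
  intro Q hQ
  have hP := T.Φ.map_target hQ
  obtain ⟨G, h1, h2⟩ := h _ hP
  obtain ⟨e, rfl, h3, -⟩ := h1.rg.exists_gIso univ_mem
  have h4 := symm_eventuallyEq hP h3 h2
  rw [T.Φ.right_inv hQ] at h4
  refine ⟨e.G', ?_, h4⟩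
  have h5 := h1.symm h3
  rwa [← PB.base_map, ← h2.eq_of_nhds, T.Φ.right_inv hQ] at h5

theorem HasGerms.contDiffOn {k : ℕ} {T : Triple k} (h : HasGerms T) :
    ContDiffOn ℝ ∞ T.Φ T.Φ.source := by
  intro P hP
  obtain ⟨G, h1, h2⟩ := h P hP
  exact (h1.rg.contDiffAt_map.congr_of_eventuallyEq h2).contDiffWithinAt

/-- Smoothness of both directions, the domains and the inclusion of the loci are all local, so they
can be tested on germs. The converse is `hasGerms_of_mem_groupoid`. -/
theorem mem_groupoid_of_hasGerms {k : ℕ} {T : Triple k} (hs : T.src ∈ (linClass k).S)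
    (ht : T.tgt ∈ (linClass k).S) (hn : T.Φ.source.Nonempty) (h : HasGerms T) :
    T ∈ (linClass k).groupoid := by
  refine ⟨hs, ht, ⟨hn, h.contDiffOn, h.inv.contDiffOn⟩, ?_, ?_⟩
  · intro P hP
    obtain ⟨G, h1, h2⟩ := h P hP
    exact ⟨h1.mem, by rw [h2.eq_of_nhds, PB.base_map]; exact h1.mem'⟩
  · intro z z' hz hl
    have hP : z.1 ∈ T.Φ.source := by
      obtain ⟨f, g, p, q, hf, hg, rfl, rfl, h1, h2, h3⟩ := hz
      exact h1
    obtain ⟨G, h1, h2⟩ := h _ hP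
    exact mem_locus_of_prolongs h1 h2 rfl hz hl

/-! ### Derivatives along graphs -/

/-- `H` is smooth near `P`. -/
def Smooth₃ (H : Pt → ℝ) (P : Pt) : Prop := ∀ᶠ Q in 𝓝 P, ContDiffAt ℝ ∞ H Q

/-- The partial derivative with respect to `t` in the `(t, x, u)`-space. -/
noncomputable def pt (H : Pt → ℝ) (P : Pt) : ℝ := fderiv ℝ H P (1, 0, 0)

/-- The partial derivative with respect to `x` in the `(t, x, u)`-space. -/
noncomputable def px (H : Pt → ℝ) (P : Pt) : ℝ := fderiv ℝ H P (0, 1, 0)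

/-- The partial derivative with respect to `u` in the `(t, x, u)`-space. -/
noncomputable def pu (H : Pt → ℝ) (P : Pt) : ℝ := fderiv ℝ H P (0, 0, 1)

namespace Smooth₃

variable {H : Pt → ℝ} {P : Pt}

theorem fderiv_apply (hf : Smooth₃ H P) (v : Pt) : Smooth₃ (fun Q => fderiv ℝ H Q v) P := by
  filter_upwards [hf] with q h1
  exact (h1.fderiv_right (m := ∞) (by simp)).clm_apply contDiffAt_const

theorem dpt (h : Smooth₃ H P) : Smooth₃ (pt H) P := h.fderiv_apply _

theorem dpx (h : Smooth₃ H P) : Smooth₃ (px H) P := h.fderiv_apply _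

theorem dpu (h : Smooth₃ H P) : Smooth₃ (pu H) P := h.fderiv_apply _

theorem eventually (h : Smooth₃ H P) : ∀ᶠ Q in 𝓝 P, Smooth₃ H Q := eventually_eventually_nhds.2 h

theorem differentiableAt (h : Smooth₃ H P) : DifferentiableAt ℝ H P :=
  h.self_of_nhds.differentiableAt (by simp)

theorem px_pu_comm (hf : Smooth₃ H P) : px (pu H) P = pu (px H) P := by
  have h2 : ContDiffAt ℝ 2 H P :=
    hf.self_of_nhds.of_le (WithTop.coe_le_coe.2 (le_top : (2 : ℕ∞) ≤ ⊤))
  have hs := h2.isSymmSndFDerivAt (by simp)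
  have hd : DifferentiableAt ℝ (fderiv ℝ H) P :=
    (h2.fderiv_right (m := 1) (by norm_num)).differentiableAt (by simp)
  have e : ∀ v w : Pt, fderiv ℝ (fun q => fderiv ℝ H q v) P w = fderiv ℝ (fderiv ℝ H) P w v := by
    intro v w
    rw [fderiv_clm_apply hd (differentiableAt_const v)]; simp
  change fderiv ℝ (fun q => fderiv ℝ H q (0, 0, 1)) P (0, 1, 0)
    = fderiv ℝ (fun q => fderiv ℝ H q (0, 1, 0)) P (0, 0, 1)
  rw [e, e]; exact hs.eq _ _

variable {f : Base → ℝ} {p : Base}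

theorem comp_graph (hH : Smooth₃ H (graphPt f p)) (hf : SmoothNear f p) :
    SmoothNear (fun q => H (graphPt f q)) p := by
  filter_upwards [hf, (continuousAt_graphPt hf.continuousAt).eventually hH] with q h1 h2
  exact ContDiffAt.comp (g := H) (f := graphPt f) q h2
    (contDiffAt_fst.prodMk (contDiffAt_snd.prodMk h1))

theorem fderiv_graph (hH : Smooth₃ H (graphPt f p)) (hf : SmoothNear f p) (v : Base) :
    fderiv ℝ (fun q => H (graphPt f q)) p v = v.1 * pt H (graphPt f p)
      + v.2 * px H (graphPt f p) + pu H (graphPt f p) * fderiv ℝ f p v := by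
  have h := (HasFDerivAt.comp (g := H) (f := graphPt f) p hH.differentiableAt.hasFDerivAt
    (hasFDerivAt_fst.prodMk (hasFDerivAt_snd.prodMk hf.differentiableAt.hasFDerivAt))).fderiv
  simp only [Function.comp_def] at h
  rw [h]
  set r := fderiv ℝ f p v
  have e : ((v.1, v.2, r) : Pt) = v.1 • ((1, 0, 0) : Pt) + v.2 • ((0, 1, 0) : Pt)
    + r • ((0, 0, 1) : Pt) := by simp
  change fderiv ℝ H (graphPt f p) (v.1, v.2, r) = _
  rw [e, map_add, map_add, map_smul, map_smul, map_smul]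
  simp only [pt, px, pu, smul_eq_mul]; ring

theorem dt_graph (hH : Smooth₃ H (graphPt f p)) (hf : SmoothNear f p) :
    dt (fun q => H (graphPt f q)) p =
      pt H (graphPt f p) + pu H (graphPt f p) * dt f p := by
  have := hH.fderiv_graph hf (1, 0)
  simpa [dt] using this

theorem dx_graph (hH : Smooth₃ H (graphPt f p)) (hf : SmoothNear f p) :
    dx (fun q => H (graphPt f q)) p =
      px H (graphPt f p) + pu H (graphPt f p) * dx f p := by
  have := hH.fderiv_graph hf (0, 1)
  simpa [dx] using this

end Smooth₃

section SecondOrder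

variable {H : Pt → ℝ} {f : Base → ℝ} {p : Base}

/-- The part of the second total derivative with respect to `t` without second derivatives of `f`. -/
noncomputable def Ktt (H : Pt → ℝ) (P : Pt) (a : ℝ) : ℝ :=
  pt (pt H) P + pu (pt H) P * a + (pt (pu H) P + pu (pu H) P * a) * a

/-- The part of the mixed total derivative without second derivatives of `f`. -/
noncomputable def Ktx (H : Pt → ℝ) (P : Pt) (a b : ℝ) : ℝ :=
  px (pt H) P + pu (pt H) P * b + (px (pu H) P + pu (pu H) P * b) * a

/-- The part of the second total derivative with respect to `x` without second derivatives of `f`. -/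
noncomputable def Kxx (H : Pt → ℝ) (P : Pt) (b : ℝ) : ℝ :=
  px (px H) P + pu (px H) P * b + (px (pu H) P + pu (pu H) P * b) * b

theorem Smooth₃.eventually_graph (hH : Smooth₃ H (graphPt f p)) (hf : SmoothNear f p) :
    ∀ᶠ q in 𝓝 p, Smooth₃ H (graphPt f q) ∧ SmoothNear f q :=
  ((continuousAt_graphPt hf.continuousAt).eventually hH.eventually).and hf.eventually

theorem Smooth₃.dtdt_graph (hH : Smooth₃ H (graphPt f p)) (hf : SmoothNear f p) :
    dt (dt (fun q => H (graphPt f q))) p =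
      Ktt H (graphPt f p) (dt f p) + pu H (graphPt f p) * dt (dt f) p := by
  have e : dt (fun q => H (graphPt f q)) =ᶠ[𝓝 p]
      fun q => pt H (graphPt f q) + pu H (graphPt f q) * dt f q := by
    filter_upwards [hH.eventually_graph hf] with q h using h.1.dt_graph h.2
  have s1 := hH.dpt.comp_graph hf
  have s2 := hH.dpu.comp_graph hf
  rw [dt_congr e, dt_add s1.differentiableAt (s2.mul hf.dt).differentiableAt,
    dt_mul s2.differentiableAt hf.dt.differentiableAt, hH.dpt.dt_graph hf, hH.dpu.dt_graph hf, Ktt]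
  ring

theorem Smooth₃.dxdt_graph (hH : Smooth₃ H (graphPt f p)) (hf : SmoothNear f p) :
    dx (dt (fun q => H (graphPt f q))) p =
      Ktx H (graphPt f p) (dt f p) (dx f p) + pu H (graphPt f p) * dx (dt f) p := by
  have e : dt (fun q => H (graphPt f q)) =ᶠ[𝓝 p]
      fun q => pt H (graphPt f q) + pu H (graphPt f q) * dt f q := by
    filter_upwards [hH.eventually_graph hf] with q h using h.1.dt_graph h.2
  have s1 := hH.dpt.comp_graph hf
  have s2 := hH.dpu.comp_graph hf
  rw [dx_congr e, dx_add s1.differentiableAt (s2.mul hf.dt).differentiableAt,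
    dx_mul s2.differentiableAt hf.dt.differentiableAt, hH.dpt.dx_graph hf, hH.dpu.dx_graph hf, Ktx]
  ring

theorem Smooth₃.dxdx_graph (hH : Smooth₃ H (graphPt f p)) (hf : SmoothNear f p) :
    dx (dx (fun q => H (graphPt f q))) p =
      Kxx H (graphPt f p) (dx f p) + pu H (graphPt f p) * dx (dx f) p := by
  have e : dx (fun q => H (graphPt f q)) =ᶠ[𝓝 p]
      fun q => px H (graphPt f q) + pu H (graphPt f q) * dx f q := by
    filter_upwards [hH.eventually_graph hf] with q h using h.1.dx_graph h.2
  have s1 := hH.dpx.comp_graph hf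
  have s2 := hH.dpu.comp_graph hf
  rw [dx_congr e, dx_add s1.differentiableAt (s2.mul hf.dx).differentiableAt,
    dx_mul s2.differentiableAt hf.dx.differentiableAt, hH.dpx.dx_graph hf, hH.dpu.dx_graph hf, Kxx]
  ring

variable {g a b : Base → ℝ}

theorem dtdt_comp (hg : SmoothNear g (a p, b p)) (ha : SmoothNear a p) (hb : SmoothNear b p) :
    dt (dt (fun q => g (a q, b q))) p = dt (dt g) (a p, b p) * dt a p ^ 2
      + 2 * dx (dt g) (a p, b p) * dt a p * dt b p + dx (dx g) (a p, b p) * dt b p ^ 2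
      + dt g (a p, b p) * dt (dt a) p + dx g (a p, b p) * dt (dt b) p := by
  have hc : ContinuousAt (fun q => (a q, b q)) p := ha.continuousAt.prodMk hb.continuousAt
  have e : dt (fun q => g (a q, b q)) =ᶠ[𝓝 p]
      fun q => dt g (a q, b q) * dt a q + dx g (a q, b q) * dt b q := by
    filter_upwards [hc.eventually hg.eventually, ha.eventually, hb.eventually] with q h1 h2 h3
    exact dt_comp h1.differentiableAt h2.differentiableAt h3.differentiableAt
  have s1 := SmoothNear.comp hg.dt ha hb
  have s2 := SmoothNear.comp hg.dx ha hb
  rw [dt_congr e, dt_add (s1.mul ha.dt).differentiableAt (s2.mul hb.dt).differentiableAt,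
    dt_mul s1.differentiableAt ha.dt.differentiableAt,
    dt_mul s2.differentiableAt hb.dt.differentiableAt,
    dt_comp hg.dt.differentiableAt ha.differentiableAt hb.differentiableAt,
    dt_comp hg.dx.differentiableAt ha.differentiableAt hb.differentiableAt, dt_dx_comm hg]
  ring

theorem dxdt_comp (hg : SmoothNear g (a p, b p)) (ha : SmoothNear a p) (hb : SmoothNear b p) :
    dx (dt (fun q => g (a q, b q))) p = dt (dt g) (a p, b p) * dt a p * dx a p
      + dx (dt g) (a p, b p) * (dt a p * dx b p + dx a p * dt b p)
      + dx (dx g) (a p, b p) * dt b p * dx b p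
      + dt g (a p, b p) * dx (dt a) p + dx g (a p, b p) * dx (dt b) p := by
  have hc : ContinuousAt (fun q => (a q, b q)) p := ha.continuousAt.prodMk hb.continuousAt
  have e : dt (fun q => g (a q, b q)) =ᶠ[𝓝 p]
      fun q => dt g (a q, b q) * dt a q + dx g (a q, b q) * dt b q := by
    filter_upwards [hc.eventually hg.eventually, ha.eventually, hb.eventually] with q h1 h2 h3
    exact dt_comp h1.differentiableAt h2.differentiableAt h3.differentiableAt
  have s1 := SmoothNear.comp hg.dt ha hb
  have s2 := SmoothNear.comp hg.dx ha hb
  rw [dx_congr e, dx_add (s1.mul ha.dt).differentiableAt (s2.mul hb.dt).differentiableAt,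
    dx_mul s1.differentiableAt ha.dt.differentiableAt,
    dx_mul s2.differentiableAt hb.dt.differentiableAt,
    dx_comp hg.dt.differentiableAt ha.differentiableAt hb.differentiableAt,
    dx_comp hg.dx.differentiableAt ha.differentiableAt hb.differentiableAt, dt_dx_comm hg]
  ring

theorem dxdx_comp (hg : SmoothNear g (a p, b p)) (ha : SmoothNear a p) (hb : SmoothNear b p) :
    dx (dx (fun q => g (a q, b q))) p = dt (dt g) (a p, b p) * dx a p ^ 2
      + 2 * dx (dt g) (a p, b p) * dx a p * dx b p + dx (dx g) (a p, b p) * dx b p ^ 2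
      + dt g (a p, b p) * dx (dx a) p + dx g (a p, b p) * dx (dx b) p := by
  have hc : ContinuousAt (fun q => (a q, b q)) p := ha.continuousAt.prodMk hb.continuousAt
  have e : dx (fun q => g (a q, b q)) =ᶠ[𝓝 p]
      fun q => dt g (a q, b q) * dx a q + dx g (a q, b q) * dx b q := by
    filter_upwards [hc.eventually hg.eventually, ha.eventually, hb.eventually] with q h1 h2 h3
    exact dx_comp h1.differentiableAt h2.differentiableAt h3.differentiableAt
  have s1 := SmoothNear.comp hg.dt ha hb
  have s2 := SmoothNear.comp hg.dx ha hb
  rw [dx_congr e, dx_add (s1.mul ha.dx).differentiableAt (s2.mul hb.dx).differentiableAt,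
    dx_mul s1.differentiableAt ha.dx.differentiableAt,
    dx_mul s2.differentiableAt hb.dx.differentiableAt,
    dx_comp hg.dt.differentiableAt ha.differentiableAt hb.differentiableAt,
    dx_comp hg.dx.differentiableAt ha.differentiableAt hb.differentiableAt, dt_dx_comm hg]
  ring

end SecondOrder

/-! ### Necessity: the form of admissible transformations -/

section Components

variable (Φ : OpenPartialHomeomorph Pt Pt)

/-- The `t`-component of a transformation. -/
def cT (P : Pt) : ℝ := (Φ P).1

/-- The `x`-component of a transformation. -/
def cX (P : Pt) : ℝ := (Φ P).2.1

/-- The `u`-component of a transformation. -/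
def cU (P : Pt) : ℝ := (Φ P).2.2

variable {Φ} {P : Pt}

theorem contDiffAt_of_mem (hs : ContDiffOn ℝ ∞ Φ Φ.source) (hP : P ∈ Φ.source) :
    ∀ᶠ Q in 𝓝 P, ContDiffAt ℝ ∞ Φ Q := by
  filter_upwards [Φ.open_source.mem_nhds hP] with Q hQ
    using hs.contDiffAt (Φ.open_source.mem_nhds hQ)

theorem smooth_cT (hs : ContDiffOn ℝ ∞ Φ Φ.source) (hP : P ∈ Φ.source) : Smooth₃ (cT Φ) P := by
  filter_upwards [contDiffAt_of_mem hs hP] with Q hQ using hQ.fst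

theorem smooth_cX (hs : ContDiffOn ℝ ∞ Φ Φ.source) (hP : P ∈ Φ.source) : Smooth₃ (cX Φ) P := by
  filter_upwards [contDiffAt_of_mem hs hP] with Q hQ using hQ.snd.fst

theorem smooth_cU (hs : ContDiffOn ℝ ∞ Φ Φ.source) (hP : P ∈ Φ.source) : Smooth₃ (cU Φ) P := by
  filter_upwards [contDiffAt_of_mem hs hP] with Q hQ using hQ.snd.snd

theorem fderiv_eq_pt_px_pu (H : Pt → ℝ) (P v : Pt) :
    fderiv ℝ H P v = v.1 * pt H P + v.2.1 * px H P + v.2.2 * pu H P := by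
  have : v = v.1 • ((1, 0, 0) : Pt) + v.2.1 • ((0, 1, 0) : Pt) + v.2.2 • ((0, 0, 1) : Pt) := by
    simp
  rw [this, map_add, map_add, map_smul, map_smul, map_smul]; simp [pt, px, pu]

/-- The differential of a point transformation is surjective. -/
theorem surjective_differential (h : IsPointTransformation Φ) (hP : P ∈ Φ.source) (w : Pt) :
    ∃ v : Pt, v.1 * pt (cT Φ) P + v.2.1 * px (cT Φ) P + v.2.2 * pu (cT Φ) P = w.1 ∧
      v.1 * pt (cX Φ) P + v.2.1 * px (cX Φ) P + v.2.2 * pu (cX Φ) P = w.2.1 ∧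
      v.1 * pt (cU Φ) P + v.2.1 * px (cU Φ) P + v.2.2 * pu (cU Φ) P = w.2.2 := by
  have hQ := Φ.map_source hP
  have d1 : DifferentiableAt ℝ Φ P := (contDiffAt_of_mem h.2.1 hP).self_of_nhds.differentiableAt
    (by simp)
  have d2 : DifferentiableAt ℝ Φ.symm (Φ P) := ((h.2.2.contDiffAt
    (Φ.open_target.mem_nhds hQ))).differentiableAt (by simp)
  have d1' : HasFDerivAt Φ (fderiv ℝ Φ P) (Φ.symm (Φ P)) := by
    rw [Φ.left_inv hP]; exact d1.hasFDerivAt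
  have e1 := (d1'.comp (Φ P) d2.hasFDerivAt)
  have e2 : HasFDerivAt (Φ ∘ Φ.symm) (ContinuousLinearMap.id ℝ Pt) (Φ P) := by
    refine (hasFDerivAt_id _).congr_of_eventuallyEq ?_
    filter_upwards [Φ.open_target.mem_nhds hQ] with Q hQ using Φ.right_inv hQ
  have e3 := e1.unique e2
  refine ⟨fderiv ℝ Φ.symm (Φ P) w, ?_⟩
  have e4 : fderiv ℝ Φ P (fderiv ℝ Φ.symm (Φ P) w) = w := by
    have := congrArg (fun L : Pt →L[ℝ] Pt => L w) e3
    simpa using this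
  set v := fderiv ℝ Φ.symm (Φ P) w
  rw [← fderiv_eq_pt_px_pu, ← fderiv_eq_pt_px_pu, ← fderiv_eq_pt_px_pu]
  have f1 : fderiv ℝ (cT Φ) P = (ContinuousLinearMap.fst ℝ ℝ (ℝ × ℝ)).comp (fderiv ℝ Φ P) :=
    d1.hasFDerivAt.fst.fderiv
  have f2 : fderiv ℝ (cX Φ) P = (ContinuousLinearMap.fst ℝ ℝ ℝ).comp
      ((ContinuousLinearMap.snd ℝ ℝ (ℝ × ℝ)).comp (fderiv ℝ Φ P)) :=
    d1.hasFDerivAt.snd.fst.fderiv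
  have f3 : fderiv ℝ (cU Φ) P = (ContinuousLinearMap.snd ℝ ℝ ℝ).comp
      ((ContinuousLinearMap.snd ℝ ℝ (ℝ × ℝ)).comp (fderiv ℝ Φ P)) :=
    d1.hasFDerivAt.snd.snd.fderiv
  rw [f1, f2, f3]
  simp [e4]

/-- Where the total Jacobian of the `t`- and `x`-components along the graph of `f` is nonzero, these
components can be inverted and the image of the graph is again a graph. -/
theorem exists_image {f : Base → ℝ} {p : Base} (hs : ContDiffOn ℝ ∞ Φ Φ.source)
    (hP : graphPt f p ∈ Φ.source) (hf : SmoothNear f p)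
    (hJ : dt (fun q => cT Φ (graphPt f q)) p * dx (fun q => cX Φ (graphPt f q)) p
      - dx (fun q => cT Φ (graphPt f q)) p * dt (fun q => cX Φ (graphPt f q)) p ≠ 0) :
    ∃ g, SmoothNear g (base (Φ (graphPt f p))) ∧
      (fun q => g (cT Φ (graphPt f q), cX Φ (graphPt f q))) =ᶠ[𝓝 p]
        (fun q => cU Φ (graphPt f q)) ∧
      Prolongs Φ (jet f p) (jet g (base (Φ (graphPt f p)))) := by
  have sa := (smooth_cT hs hP).comp_graph hf
  have sb := (smooth_cX hs hP).comp_graph hf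
  have sc := (smooth_cU hs hP).comp_graph hf
  obtain ⟨χ, h1, -, h3, h4⟩ := exists_chart sa sb hJ univ_mem
  have hpt : base (Φ (graphPt f p)) = χ p := (h3 p).symm
  have hty : χ p ∈ χ.target := χ.map_source h1
  have hg : SmoothNear (fun y => cU Φ (graphPt f (χ.symm y))) (χ p) := by
    refine SmoothNear.comp (g := fun q => cU Φ (graphPt f q)) (a := fun y => (χ.symm y).1)
      (b := fun y => (χ.symm y).2) ?_ (h4 _ hty).1 (h4 _ hty).2
    rw [χ.left_inv h1]; exact sc
  have he : (fun q => cU Φ (graphPt f (χ.symm (cT Φ (graphPt f q), cX Φ (graphPt f q))))) =ᶠ[𝓝 p]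
      (fun q => cU Φ (graphPt f q)) := by
    filter_upwards [χ.open_source.mem_nhds h1] with q hq
    rw [← h3, χ.left_inv hq]
  refine ⟨_, by rw [hpt]; exact hg, he, f, _, p, _, hf, by rw [hpt]; exact hg, rfl, rfl, hP, ?_, ?_⟩
  · exact Prod.ext rfl (Prod.ext rfl he.eq_of_nhds.symm)
  · filter_upwards [he] with q hq
    exact Prod.ext rfl (Prod.ext rfl hq.symm)

end Components

/-- The relations between the jets of a function and of its image. -/
theorem image_relations {k : ℕ} {T : Triple k} (hT : T ∈ (linClass k).groupoid) {P : Pt}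
    (hP : P ∈ T.Φ.source) {a a' : ℕ → ℝ} (ha : a = co (T.src.val (base P)))
    (ha' : a' = co (T.tgt.val (base (T.Φ P)))) (ft fx ftt ftx fxx : ℝ)
    (hl : ft = a 0 * fxx + a 1 * fx + a 2 * P.2.2 + a 3)
    (hJ : (pt (cT T.Φ) P + pu (cT T.Φ) P * ft) * (px (cX T.Φ) P + pu (cX T.Φ) P * fx)
      - (px (cT T.Φ) P + pu (cT T.Φ) P * fx) * (pt (cX T.Φ) P + pu (cX T.Φ) P * ft) ≠ 0) :
    ∃ gt gx gtt gtx gxx : ℝ, gt = a' 0 * gxx + a' 1 * gx + a' 2 * cU T.Φ P + a' 3 ∧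
      gt * (pt (cT T.Φ) P + pu (cT T.Φ) P * ft) + gx * (pt (cX T.Φ) P + pu (cX T.Φ) P * ft)
        = pt (cU T.Φ) P + pu (cU T.Φ) P * ft ∧
      gt * (px (cT T.Φ) P + pu (cT T.Φ) P * fx) + gx * (px (cX T.Φ) P + pu (cX T.Φ) P * fx)
        = px (cU T.Φ) P + pu (cU T.Φ) P * fx ∧
      gtt * (pt (cT T.Φ) P + pu (cT T.Φ) P * ft) ^ 2 + 2 * gtx * (pt (cT T.Φ) P + pu (cT T.Φ) P * ft)
          * (pt (cX T.Φ) P + pu (cX T.Φ) P * ft) + gxx * (pt (cX T.Φ) P + pu (cX T.Φ) P * ft) ^ 2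
        + gt * (Ktt (cT T.Φ) P ft + pu (cT T.Φ) P * ftt)
        + gx * (Ktt (cX T.Φ) P ft + pu (cX T.Φ) P * ftt)
        = Ktt (cU T.Φ) P ft + pu (cU T.Φ) P * ftt ∧
      gtt * (pt (cT T.Φ) P + pu (cT T.Φ) P * ft) * (px (cT T.Φ) P + pu (cT T.Φ) P * fx)
        + gtx * ((pt (cT T.Φ) P + pu (cT T.Φ) P * ft) * (px (cX T.Φ) P + pu (cX T.Φ) P * fx)
          + (px (cT T.Φ) P + pu (cT T.Φ) P * fx) * (pt (cX T.Φ) P + pu (cX T.Φ) P * ft))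
        + gxx * (pt (cX T.Φ) P + pu (cX T.Φ) P * ft) * (px (cX T.Φ) P + pu (cX T.Φ) P * fx)
        + gt * (Ktx (cT T.Φ) P ft fx + pu (cT T.Φ) P * ftx)
        + gx * (Ktx (cX T.Φ) P ft fx + pu (cX T.Φ) P * ftx)
        = Ktx (cU T.Φ) P ft fx + pu (cU T.Φ) P * ftx ∧
      gtt * (px (cT T.Φ) P + pu (cT T.Φ) P * fx) ^ 2 + 2 * gtx * (px (cT T.Φ) P + pu (cT T.Φ) P * fx)
          * (px (cX T.Φ) P + pu (cX T.Φ) P * fx) + gxx * (px (cX T.Φ) P + pu (cX T.Φ) P * fx) ^ 2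
        + gt * (Kxx (cT T.Φ) P fx + pu (cT T.Φ) P * fxx)
        + gx * (Kxx (cX T.Φ) P fx + pu (cX T.Φ) P * fxx)
        = Kxx (cU T.Φ) P fx + pu (cU T.Φ) P * fxx := by
  obtain ⟨hs, ht, hΦ, hd, hl'⟩ := hT
  set z : Jet := (P, (ft, fx), (ftt, ftx, fxx)) with hz
  have hj : jet (quad z) (base P) = z := jet_quad z
  have hgr : graphPt (quad z) (base P) = P := congrArg Prod.fst hj
  have j1 : dt (quad z) (base P) = ft := congrArg (fun z : Jet => z.2.1.1) hj
  have j2 : dx (quad z) (base P) = fx := congrArg (fun z : Jet => z.2.1.2) hj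
  have j3 : dt (dt (quad z)) (base P) = ftt := congrArg (fun z : Jet => z.2.2.1) hj
  have j4 : dx (dt (quad z)) (base P) = ftx := congrArg (fun z : Jet => z.2.2.2.1) hj
  have j5 : dx (dx (quad z)) (base P) = fxx := congrArg (fun z : Jet => z.2.2.2.2) hj
  have hf : SmoothNear (quad z) (base P) := smoothNear_quad z
  have sT := smooth_cT hΦ.2.1 hP
  have sX := smooth_cX hΦ.2.1 hP
  have sU := smooth_cU hΦ.2.1 hP
  rw [← hgr] at sT sX sU
  have rT := sT.comp_graph hf
  have rX := sX.comp_graph hf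
  obtain ⟨g, g1, g2, g3⟩ := exists_image hΦ.2.1 (p := base P) (by rw [hgr]; exact hP) hf (by
    rw [sT.dt_graph hf, sT.dx_graph hf, sX.dt_graph hf, sX.dx_graph hf, hgr, j1, j2]
    exact hJ)
  have h1 := hl' _ _ g3 (by
    rw [jet_mem_locus]
    refine ⟨(hd P hP).1, ?_⟩
    rw [← ha]
    have := res_quad a z
    change res a (quad z) (base P) = _ at this
    rw [this, hz]; simp only; linarith)
  rw [jet_mem_locus, hgr, ← ha'] at h1
  rw [hgr] at g1
  have g1' : SmoothNear g (cT T.Φ (graphPt (quad z) (base P)), cX T.Φ (graphPt (quad z) (base P))) := by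
    rw [hgr]; exact g1
  have hyp : (cT T.Φ P, cX T.Φ P) = base (T.Φ P) := rfl
  refine ⟨dt g (base (T.Φ P)), dx g (base (T.Φ P)), dt (dt g) (base (T.Φ P)),
    dx (dt g) (base (T.Φ P)), dx (dx g) (base (T.Φ P)), ?_, ?_, ?_, ?_, ?_, ?_⟩
  · have h2 := h1.2
    have h3 := g2.eq_of_nhds
    simp only [hgr, hyp] at h3
    unfold res at h2
    rw [h3] at h2
    linarith
  · have e := dt_congr g2
    rw [dt_comp g1'.differentiableAt rT.differentiableAt rX.differentiableAt, sT.dt_graph hf,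
      sX.dt_graph hf, sU.dt_graph hf, hgr, j1, hyp] at e
    exact e
  · have e := dx_congr g2
    rw [dx_comp g1'.differentiableAt rT.differentiableAt rX.differentiableAt, sT.dx_graph hf,
      sX.dx_graph hf, sU.dx_graph hf, hgr, j2, hyp] at e
    exact e
  · have e := dt_congr (dt_congr' g2)
    rw [dtdt_comp g1' rT rX, sT.dt_graph hf, sX.dt_graph hf, sT.dtdt_graph hf, sX.dtdt_graph hf,
      sU.dtdt_graph hf, hgr, j1, j3, hyp] at e
    exact e
  · have e := dx_congr (dt_congr' g2)
    rw [dxdt_comp g1' rT rX, sT.dt_graph hf, sX.dt_graph hf, sT.dx_graph hf, sX.dx_graph hf,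
      sT.dxdt_graph hf, sX.dxdt_graph hf, sU.dxdt_graph hf, hgr, j1, j2, j4, hyp] at e
    exact e
  · have e := dx_congr (dx_congr' g2)
    rw [dxdx_comp g1' rT rX, sT.dx_graph hf, sX.dx_graph hf,
      sT.dxdx_graph hf, sX.dxdx_graph hf, sU.dxdx_graph hf, hgr, j2, j5, hyp] at e
    exact e

/-! ### Derivatives that vanish because some jet coordinates are free -/

section Form

variable {k : ℕ} {T : Triple k} {P : Pt}

/-- Otherwise the values at `(0, 0)`, `(1, 0)` and `(0, 1)` show that all `2 × 2` minors of the
differentials of the `t`- and `x`-components vanish, contrary to surjectivity. -/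
theorem exists_jacobian_ne_zero (h : IsPointTransformation T.Φ) (hP : P ∈ T.Φ.source) :
    ∃ ft fx : ℝ, (pt (cT T.Φ) P + pu (cT T.Φ) P * ft) * (px (cX T.Φ) P + pu (cX T.Φ) P * fx)
      - (px (cT T.Φ) P + pu (cT T.Φ) P * fx) * (pt (cX T.Φ) P + pu (cX T.Φ) P * ft) ≠ 0 := by
  by_contra! hc
  obtain ⟨v, v1, v2, -⟩ := surjective_differential h hP (1, 0, 0)
  obtain ⟨w, w1, w2, -⟩ := surjective_differential h hP (0, 1, 0)
  simp only at v1 v2 w1 w2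
  have c0 := hc 0 0
  have c1 := hc 1 0
  have c2 := hc 0 1
  simp only [mul_zero, mul_one, add_zero] at c0 c1 c2
  have : (1 : ℝ) = 0 := by
    linear_combination (-1 : ℝ) * v1 + (v.1 * pt (cT T.Φ) P + v.2.1 * px (cT T.Φ) P
      + v.2.2 * pu (cT T.Φ) P) * (-1 : ℝ) * w2 + (w.1 * pt (cT T.Φ) P + w.2.1 * px (cT T.Φ) P
      + w.2.2 * pu (cT T.Φ) P) * v2
      + (v.1 * w.2.1 - v.2.1 * w.1) * c0 + (v.1 * w.2.2 - v.2.2 * w.1) * (c2 - c0)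
      - (v.2.1 * w.2.2 - v.2.2 * w.2.1) * (c1 - c0)
  exact one_ne_zero this

/-- If this number vanished, the differential of the `u`-component would be the combination of those
of the `t`- and `x`-components with coefficients `gt` and `gx`. The number is the factor with which
second derivatives of `f` enter the second-order relations. -/
theorem kappa_ne_zero (h : IsPointTransformation T.Φ) (hP : P ∈ T.Φ.source) {gt gx ft fx : ℝ}
    (r2 : gt * (pt (cT T.Φ) P + pu (cT T.Φ) P * ft) + gx * (pt (cX T.Φ) P + pu (cX T.Φ) P * ft)
        = pt (cU T.Φ) P + pu (cU T.Φ) P * ft)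
    (r3 : gt * (px (cT T.Φ) P + pu (cT T.Φ) P * fx) + gx * (px (cX T.Φ) P + pu (cX T.Φ) P * fx)
        = px (cU T.Φ) P + pu (cU T.Φ) P * fx) :
    pu (cU T.Φ) P - gt * pu (cT T.Φ) P - gx * pu (cX T.Φ) P ≠ 0 := by
  intro h0
  obtain ⟨v, v1, v2, v3⟩ := surjective_differential h hP (0, 0, 1)
  simp only at v1 v2 v3
  have : (1 : ℝ) = 0 := by
    linear_combination (-1 : ℝ) * v3 + gt * v1 + gx * v2 - v.1 * r2 - v.2.1 * r3
      + (v.2.2 - ft * v.1 - fx * v.2.1) * h0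
  exact one_ne_zero this

theorem coef_ne_zero {θ : ArbitraryElement k} (h : θ ∈ (linClass k).S) {p : Base}
    (hp : p ∈ θ.domain) : co (θ.val p) 0 ≠ 0 := (h p hp).1

/-- The source equation does not restrict `f_tt`. Changing it from `0` to `1` leaves `g_t` and `g_x`
unchanged, hence also `g_xx` by the target equation, while the second-order relations change by a
nonzero multiple of the square of the total derivative `D_x T`. Since `A ≠ 0`, the values of `f_t`
and `f_x` are arbitrary, `f_xx` being solved for. -/
theorem px_cT_add (hT : T ∈ (linClass k).groupoid) (hP : P ∈ T.Φ.source) {ft fx : ℝ}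
    (hJ : (pt (cT T.Φ) P + pu (cT T.Φ) P * ft) * (px (cX T.Φ) P + pu (cX T.Φ) P * fx)
      - (px (cT T.Φ) P + pu (cT T.Φ) P * fx) * (pt (cX T.Φ) P + pu (cX T.Φ) P * ft) ≠ 0) :
    px (cT T.Φ) P + pu (cT T.Φ) P * fx = 0 := by
  have hA := coef_ne_zero hT.1 (hT.2.2.2.1 P hP).1
  have hA' := coef_ne_zero hT.2.1 (hT.2.2.2.1 P hP).2
  set a := co (T.src.val (base P)) with ha
  set a' := co (T.tgt.val (base (T.Φ P))) with ha'
  have hl : ft = a 0 * ((ft - (a 1 * fx + a 2 * P.2.2 + a 3)) / a 0) + a 1 * fx + a 2 * P.2.2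
      + a 3 := by field_simp; ring
  obtain ⟨gt, gx, gtt, gtx, gxx, r1, r2, r3, r4, r5, r6⟩ :=
    image_relations hT hP ha ha' ft fx 0 0 _ hl hJ
  obtain ⟨gt', gx', gtt', gtx', gxx', s1, s2, s3, s4, s5, s6⟩ :=
    image_relations hT hP ha ha' ft fx 1 0 _ hl hJ
  have hk := kappa_ne_zero hT.2.2.1 hP r2 r3
  have e1 : gt' = gt := by
    apply mul_right_cancel₀ hJ
    linear_combination (px (cX T.Φ) P + pu (cX T.Φ) P * fx) * (s2 - r2)
      - (pt (cX T.Φ) P + pu (cX T.Φ) P * ft) * (s3 - r3)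
  have e2 : gx' = gx := by
    apply mul_right_cancel₀ hJ
    linear_combination (pt (cT T.Φ) P + pu (cT T.Φ) P * ft) * (s3 - r3)
      - (px (cT T.Φ) P + pu (cT T.Φ) P * fx) * (s2 - r2)
  subst e1 e2
  have e3 : gxx' = gxx := by
    apply mul_left_cancel₀ hA'; linear_combination r1 - s1
  subst e3
  -- This combination of the three second-order relations eliminates `g_tt` and `g_tx`.
  have : (pu (cU T.Φ) P - gt' * pu (cT T.Φ) P - gx' * pu (cX T.Φ) P)
      * (px (cT T.Φ) P + pu (cT T.Φ) P * fx) ^ 2 = 0 := by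
    linear_combination -(px (cT T.Φ) P + pu (cT T.Φ) P * fx) ^ 2 * (s4 - r4)
      + 2 * (px (cT T.Φ) P + pu (cT T.Φ) P * fx) * (pt (cT T.Φ) P + pu (cT T.Φ) P * ft) * (s5 - r5)
      - (pt (cT T.Φ) P + pu (cT T.Φ) P * ft) ^ 2 * (s6 - r6)
  simpa [hk] using this

/-- If `T_u ≠ 0`, then `T_x + T_u f_x` vanishes for a single `f_x`, so the Jacobian is zero for all
other values of `f_x`. As it is affine in `f_x`, it is zero there too. -/
theorem pu_cT (hT : T ∈ (linClass k).groupoid) (hP : P ∈ T.Φ.source) : pu (cT T.Φ) P = 0 := by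
  by_contra hu
  obtain ⟨ft, fx, hJ⟩ := exists_jacobian_ne_zero hT.2.2.1 hP
  have key : ∀ ft fx : ℝ, px (cT T.Φ) P + pu (cT T.Φ) P * fx ≠ 0 →
    (pt (cT T.Φ) P + pu (cT T.Φ) P * ft) * (px (cX T.Φ) P + pu (cX T.Φ) P * fx)
      - (px (cT T.Φ) P + pu (cT T.Φ) P * fx) * (pt (cX T.Φ) P + pu (cX T.Φ) P * ft) = 0 := by
    intro ft fx h
    by_contra hJ
    exact h (px_cT_add hT hP hJ)
  have e0 := px_cT_add hT hP hJ
  have k1 := key ft (fx + 1) (by intro h; apply hu; linear_combination h - e0)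
  have k2 := key ft (fx + 2) (by intro h; apply hu; linear_combination (1 / 2 : ℝ) * (h - e0))
  exact hJ (by linear_combination 2 * k1 - k2)

theorem px_cT (hT : T ∈ (linClass k).groupoid) (hP : P ∈ T.Φ.source) : px (cT T.Φ) P = 0 := by
  obtain ⟨ft, fx, hJ⟩ := exists_jacobian_ne_zero hT.2.2.1 hP
  have := px_cT_add hT hP hJ
  rwa [pu_cT hT hP, zero_mul, add_zero] at this

theorem Kxx_cT (hT : T ∈ (linClass k).groupoid) (hP : P ∈ T.Φ.source) (b : ℝ) :
    Kxx (cT T.Φ) P b = 0 := by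
  have h1 : px (cT T.Φ) =ᶠ[𝓝 P] fun _ => 0 := by
    filter_upwards [T.Φ.open_source.mem_nhds hP] with Q hQ using px_cT hT hQ
  have h2 : pu (cT T.Φ) =ᶠ[𝓝 P] fun _ => 0 := by
    filter_upwards [T.Φ.open_source.mem_nhds hP] with Q hQ using pu_cT hT hQ
  have e : ∀ v, fderiv ℝ (px (cT T.Φ)) P v = 0 ∧ fderiv ℝ (pu (cT T.Φ)) P v = 0 := by
    intro v; rw [h1.fderiv_eq, h2.fderiv_eq]; simp
  simp only [Kxx, px, pu] at e ⊢
  simp only [fun v => (e v).1, fun v => (e v).2]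
  simp

/-- Comparing `f_xx = 0` with `f_xx = 1` gives `A (X_x + X_u b)² = A' T_t` for every `b = f_x` with
a nonzero bracket. If `X_u ≠ 0`, the bracket takes both values `1` and `2`, so `A = 0`. -/
theorem pu_cX (hT : T ∈ (linClass k).groupoid) (hP : P ∈ T.Φ.source) : pu (cX T.Φ) P = 0 := by
  have hA := coef_ne_zero hT.1 (hT.2.2.2.1 P hP).1
  have hA' := coef_ne_zero hT.2.1 (hT.2.2.2.1 P hP).2
  set a := co (T.src.val (base P)) with ha
  set a' := co (T.tgt.val (base (T.Φ P))) with ha'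
  obtain ⟨ft₀, fx₀, hJ₀⟩ := exists_jacobian_ne_zero hT.2.2.1 hP
  have hTu := pu_cT hT hP
  have hTx := px_cT hT hP
  have ht : pt (cT T.Φ) P ≠ 0 := by
    intro h0; apply hJ₀; rw [h0, hTu, hTx]; ring
  have key : ∀ b, px (cX T.Φ) P + pu (cX T.Φ) P * b ≠ 0 →
      a 0 * (px (cX T.Φ) P + pu (cX T.Φ) P * b) ^ 2 = a' 0 * pt (cT T.Φ) P := by
    intro b hb
    have hJ : ∀ ft, (pt (cT T.Φ) P + pu (cT T.Φ) P * ft) * (px (cX T.Φ) P + pu (cX T.Φ) P * b)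
      - (px (cT T.Φ) P + pu (cT T.Φ) P * b) * (pt (cX T.Φ) P + pu (cX T.Φ) P * ft) ≠ 0 := by
      intro ft
      rw [hTu, hTx]
      simpa using ⟨ht, hb⟩
    obtain ⟨gt, gx, gtt, gtx, gxx, r1, r2, r3, r4, r5, r6⟩ :=
      image_relations hT hP ha ha' _ b 0 0 0 rfl (hJ _)
    obtain ⟨gt', gx', gtt', gtx', gxx', s1, s2, s3, s4, s5, s6⟩ :=
      image_relations hT hP ha ha' _ b 0 0 1 rfl (hJ _)
    have hk := kappa_ne_zero hT.2.2.1 hP r2 r3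
    rw [hTu, Kxx_cT hT hP, hTx] at r6 s6
    rw [hTu, hTx] at r3 s3
    rw [hTu] at r2 s2 hk
    have e2 : gx' = gx := by
      apply mul_right_cancel₀ hb; linear_combination s3 - r3
    subst e2
    apply mul_left_cancel₀ hk
    linear_combination a' 0 * pt (cT T.Φ) P * (s6 - r6) - (px (cX T.Φ) P + pu (cX T.Φ) P * b) ^ 2
      * (s2 - r2) + pt (cT T.Φ) P * (px (cX T.Φ) P + pu (cX T.Φ) P * b) ^ 2 * (s1 - r1)
  by_contra hu
  have e1 : px (cX T.Φ) P + pu (cX T.Φ) P * ((1 - px (cX T.Φ) P) / pu (cX T.Φ) P) = 1 := by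
    field_simp; ring
  have e2 : px (cX T.Φ) P + pu (cX T.Φ) P * ((2 - px (cX T.Φ) P) / pu (cX T.Φ) P) = 2 := by
    field_simp; ring
  have k1 := key _ (by rw [e1]; norm_num)
  have k2 := key _ (by rw [e2]; norm_num)
  rw [e1] at k1
  rw [e2] at k2
  exact hA (by linear_combination (1 / 3 : ℝ) * (k2 - k1))

theorem Kxx_cX (hT : T ∈ (linClass k).groupoid) (hP : P ∈ T.Φ.source) (b : ℝ) :
    Kxx (cX T.Φ) P b = px (px (cX T.Φ)) P := by
  have h2 : pu (cX T.Φ) =ᶠ[𝓝 P] fun _ => 0 := by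
    filter_upwards [T.Φ.open_source.mem_nhds hP] with Q hQ using pu_cX hT hQ
  have e : ∀ v, fderiv ℝ (pu (cX T.Φ)) P v = 0 := by
    intro v; rw [h2.fderiv_eq]; simp
  have e1 : px (pu (cX T.Φ)) P = 0 := e _
  have e2 : pu (pu (cX T.Φ)) P = 0 := e _
  have e3 := (smooth_cX hT.2.2.1.2.1 hP).px_pu_comm
  rw [Kxx, ← e3, e1, e2]; ring

theorem pt_cT_ne_zero (hT : T ∈ (linClass k).groupoid) (hP : P ∈ T.Φ.source) :
    pt (cT T.Φ) P ≠ 0 ∧ px (cX T.Φ) P ≠ 0 := by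
  obtain ⟨ft₀, fx₀, hJ₀⟩ := exists_jacobian_ne_zero hT.2.2.1 hP
  rw [pu_cT hT hP, px_cT hT hP, pu_cX hT hP] at hJ₀
  simpa using hJ₀

/-- With `f_xx = 0` and `f_x = b` all relations are affine in `b` and in the unknown derivatives of
`g`, apart from the term `U_uu b²`. The second difference over `b = -1, 0, 1` isolates it. -/
theorem pu_pu_cU (hT : T ∈ (linClass k).groupoid) (hP : P ∈ T.Φ.source) :
    pu (pu (cU T.Φ)) P = 0 := by
  have hA' := coef_ne_zero hT.2.1 (hT.2.2.2.1 P hP).2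
  obtain ⟨ht, hx⟩ := pt_cT_ne_zero hT hP
  obtain ⟨a, ha⟩ : ∃ a, a = co (T.src.val (base P)) := ⟨_, rfl⟩
  obtain ⟨a', ha'⟩ : ∃ a, a = co (T.tgt.val (base (T.Φ P))) := ⟨_, rfl⟩
  rw [← ha'] at hA'
  have hTu := pu_cT hT hP
  have hTx := px_cT hT hP
  have hXu := pu_cX hT hP
  have key : ∀ b, ∃ gt gx gxx : ℝ, gt = a' 0 * gxx + a' 1 * gx + a' 2 * cU T.Φ P + a' 3 ∧
      gt * pt (cT T.Φ) P + gx * pt (cX T.Φ) P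
        = pt (cU T.Φ) P + pu (cU T.Φ) P * (a 1 * b + a 2 * P.2.2 + a 3) ∧
      gx * px (cX T.Φ) P = px (cU T.Φ) P + pu (cU T.Φ) P * b ∧
      gxx * px (cX T.Φ) P ^ 2 + gx * px (px (cX T.Φ)) P = Kxx (cU T.Φ) P b := by
    intro b
    obtain ⟨gt, gx, gtt, gtx, gxx, r1, r2, r3, r4, r5, r6⟩ :=
      image_relations hT hP ha ha' _ b 0 0 0 rfl (by
        rw [hTu, hTx, hXu]; simpa using ⟨ht, hx⟩)
    rw [hTu, Kxx_cT hT hP, hTx, Kxx_cX hT hP, hXu] at r6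
    rw [hTu, hTx, hXu] at r3
    rw [hTu, hXu] at r2
    exact ⟨gt, gx, gxx, r1, by linear_combination r2, by linear_combination r3,
      by linear_combination r6⟩
  obtain ⟨gt, gx, gxx, r1, r2, r3, r4⟩ := key 0
  obtain ⟨gt', gx', gxx', s1, s2, s3, s4⟩ := key 1
  obtain ⟨gt'', gx'', gxx'', t1, t2, t3, t4⟩ := key (-1)
  unfold Kxx at r4 s4 t4
  have ex : gx' + gx'' - 2 * gx = 0 := by
    apply mul_right_cancel₀ hx; linear_combination s3 + t3 - 2 * r3
  have et : gt' + gt'' - 2 * gt = 0 := by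
    apply mul_right_cancel₀ ht; linear_combination s2 + t2 - 2 * r2 - pt (cX T.Φ) P * ex
  have exx : gxx' + gxx'' - 2 * gxx = 0 := by
    apply mul_left_cancel₀ hA'; linear_combination et - (s1 + t1 - 2 * r1) - a' 1 * ex
  linear_combination (px (cX T.Φ) P ^ 2 / 2) * exx + (px (px (cX T.Φ)) P / 2) * ex
    - (s4 + t4 - 2 * r4) / 2

end Form

/-! ### Integration along the fibres and the resulting germs -/

theorem hasDerivAt_u {H : Pt → ℝ} {t x s : ℝ} (h : DifferentiableAt ℝ H (t, x, s)) :
    HasDerivAt (fun s => H (t, x, s)) (pu H (t, x, s)) s := by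
  have h1 : HasDerivAt (fun s : ℝ => ((t, x, s) : Pt)) (0, 0, 1) s :=
    (hasDerivAt_const s t).prodMk ((hasDerivAt_const s x).prodMk (hasDerivAt_id s))
  exact HasFDerivAt.comp_hasDerivAt (f := fun s : ℝ => ((t, x, s) : Pt)) s h.hasFDerivAt h1

theorem mem_ball_pt {P : Pt} {r t x u : ℝ} :
    ((t, x, u) : Pt) ∈ Metric.ball P r ↔ (t, x) ∈ Metric.ball (base P) r ∧
      u ∈ Metric.ball P.2.2 r := by
  simp [base, Prod.dist_eq, and_assoc]

theorem eq_of_pu_eq_zero {H : Pt → ℝ} {P : Pt} {r : ℝ}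
    (hH : ∀ Q ∈ Metric.ball P r, DifferentiableAt ℝ H Q ∧ pu H Q = 0) {t x u u' : ℝ}
    (h : ((t, x, u) : Pt) ∈ Metric.ball P r) (h' : ((t, x, u') : Pt) ∈ Metric.ball P r) :
    H (t, x, u) = H (t, x, u') := by
  rw [mem_ball_pt] at h h'
  have hd : ∀ s ∈ Metric.ball P.2.2 r, HasDerivAt (fun s => H (t, x, s)) 0 s := by
    intro s hs
    obtain ⟨h1, h2⟩ := hH (t, x, s) (mem_ball_pt.2 ⟨h.1, hs⟩)
    rw [← h2]; exact hasDerivAt_u h1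
  exact Metric.isOpen_ball.is_const_of_deriv_eq_zero (convex_ball _ _).isPreconnected
    (fun s hs => (hd s hs).differentiableAt.differentiableWithinAt) (fun s hs => (hd s hs).deriv)
    h.2 h'.2

theorem pu_cU_ne_zero {k : ℕ} {T : Triple k} (hT : T ∈ (linClass k).groupoid) {P : Pt}
    (hP : P ∈ T.Φ.source) : pu (cU T.Φ) P ≠ 0 := by
  obtain ⟨ht, hx⟩ := pt_cT_ne_zero hT hP
  obtain ⟨v, v1, v2, v3⟩ := surjective_differential hT.2.2.1 hP (0, 0, 1)
  intro h0
  rw [px_cT hT hP, pu_cT hT hP] at v1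
  have e1 : v.1 = 0 := by simpa [ht] using v1
  rw [pu_cX hT hP, e1] at v2
  have e2 : v.2.1 = 0 := by simpa [hx] using v2
  rw [e1, e2, h0] at v3
  simp at v3

/-- Admissible transformations are locally fibre-preserving, affine in `u`, and their components
satisfy the determining equations. -/
theorem hasGerms_of_mem_groupoid {k : ℕ} {T : Triple k} (hT : T ∈ (linClass k).groupoid) :
    HasGerms T := by
  intro P hP
  obtain ⟨r, hr, hball⟩ := Metric.isOpen_iff.1 T.Φ.open_source P hP
  have hs := hT.2.2.1.2.1
  set u₀ := P.2.2 with hu₀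
  have hu₀r : u₀ ∈ Metric.ball u₀ r := Metric.mem_ball_self hr
  -- Everything is read off on the slice `u = u₀`: `ũ = U + (u - u₀) U_u` is solved for `u`, which
  -- gives `V = 1 / U_u` and `W = u₀ - U / U_u`.
  set G : PB := ⟨fun q => cT T.Φ (graphPt (fun _ => u₀) q), fun q => cX T.Φ (graphPt (fun _ => u₀) q),
    fun q => (pu (cU T.Φ) (graphPt (fun _ => u₀) q))⁻¹,
    fun q => u₀ - cU T.Φ (graphPt (fun _ => u₀) q) * (pu (cU T.Φ) (graphPt (fun _ => u₀) q))⁻¹⟩ with hG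
  have hsrc : ∀ q ∈ Metric.ball (base P) r, graphPt (fun _ => u₀) q ∈ T.Φ.source := fun q hq =>
    hball (mem_ball_pt.2 ⟨hq, hu₀r⟩)
  have hmap : ∀ Q ∈ Metric.ball P r, T.Φ Q = G.map Q := by
    rintro ⟨t, x, u⟩ hQ
    have hQ' := mem_ball_pt.1 hQ
    have hQ₀ : ((t, x, u₀) : Pt) ∈ Metric.ball P r := mem_ball_pt.2 ⟨hQ'.1, hu₀r⟩
    have e1 : cT T.Φ (t, x, u) = cT T.Φ (t, x, u₀) := eq_of_pu_eq_zero (fun Q hQ =>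
      ⟨(smooth_cT hs (hball hQ)).differentiableAt, pu_cT hT (hball hQ)⟩) hQ hQ₀
    have e2 : cX T.Φ (t, x, u) = cX T.Φ (t, x, u₀) := eq_of_pu_eq_zero (fun Q hQ =>
      ⟨(smooth_cX hs (hball hQ)).differentiableAt, pu_cX hT (hball hQ)⟩) hQ hQ₀
    have e3 : ∀ s ∈ Metric.ball u₀ r, pu (cU T.Φ) (t, x, s) = pu (cU T.Φ) (t, x, u₀) :=
      fun s hs' => eq_of_pu_eq_zero (fun Q hQ =>
      ⟨(smooth_cU hs (hball hQ)).dpu.differentiableAt, pu_pu_cU hT (hball hQ)⟩)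
      (mem_ball_pt.2 ⟨hQ'.1, hs'⟩) hQ₀
    have hd : ∀ s ∈ Metric.ball u₀ r, HasDerivAt
        (fun s => cU T.Φ (t, x, s) - s * pu (cU T.Φ) (t, x, u₀)) 0 s := by
      intro s hs'
      have := (hasDerivAt_u (smooth_cU hs (hball (mem_ball_pt.2 ⟨hQ'.1, hs'⟩))).differentiableAt).sub
        ((hasDerivAt_id s).mul_const (pu (cU T.Φ) (t, x, u₀)))
      rw [e3 s hs', one_mul, sub_self] at this
      exact this
    have e4 := Metric.isOpen_ball.is_const_of_deriv_eq_zero (convex_ball _ _).isPreconnected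
      (fun s hs => (hd s hs).differentiableAt.differentiableWithinAt) (fun s hs => (hd s hs).deriv)
      hQ'.2 hu₀r
    have hne := pu_cU_ne_zero hT (hball hQ₀)
    refine Prod.ext e1 (Prod.ext e2 ?_)
    change cU T.Φ (t, x, u) = (u - (u₀ - cU T.Φ (t, x, u₀) * (pu (cU T.Φ) (t, x, u₀))⁻¹)) /
      (pu (cU T.Φ) (t, x, u₀))⁻¹
    field_simp
    linear_combination e4
  have hrg : ∀ q ∈ Metric.ball (base P) r, G.Rg q := by
    intro q hq
    have hq' := hsrc q hq
    have sc : SmoothNear (fun _ => u₀) q := SmoothNear.const u₀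
    have hne := pu_cU_ne_zero hT hq'
    have s1 := (smooth_cU hs hq').dpu.comp_graph sc
    refine ⟨(smooth_cT hs hq').comp_graph sc, (smooth_cX hs hq').comp_graph sc, s1.inv hne,
      (SmoothNear.const u₀).sub (((smooth_cU hs hq').comp_graph sc).mul (s1.inv hne)), ?_, ?_, ?_,
      inv_ne_zero hne⟩
    · filter_upwards [Metric.isOpen_ball.mem_nhds hq] with q hq
      have hq' := hsrc q hq
      refine ((smooth_cT hs hq').dx_graph (SmoothNear.const u₀)).trans ?_
      rw [px_cT hT hq', pu_cT hT hq']; simp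
    · refine ((smooth_cT hs hq').dt_graph sc).trans_ne ?_
      rw [pu_cT hT hq']; simpa using (pt_cT_ne_zero hT hq').1
    · refine ((smooth_cX hs hq').dx_graph sc).trans_ne ?_
      rw [pu_cX hT hq']; simpa using (pt_cT_ne_zero hT hq').2
  refine ⟨G, ?_, by filter_upwards [Metric.ball_mem_nhds P hr] with Q hQ using hmap Q hQ⟩
  filter_upwards [Metric.ball_mem_nhds (base P) hr] with q hq
  have hR := hrg q hq
  have hq' := hsrc q hq
  obtain ⟨d1, d2⟩ := hT.2.2.2.1 _ hq'
  rw [hmap (graphPt (fun _ => u₀) q) (mem_ball_pt.2 ⟨hq, hu₀r⟩), PB.base_map] at d2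
  refine ⟨hR, d1, d2, ?_⟩
  set V := G.V q
  set W := G.W q
  have hV : V ≠ 0 := hR.hV
  -- Only those values of `ũ` are available whose preimages stay in the ball where `Φ` is known; the
  -- two values chosen correspond to `u = u₀` and `u = u₀ + r / 2`.
  refine hR.det_of_forall (I := {v | V * v + W ∈ Metric.ball u₀ r}) (u₁ := (u₀ - W) / V)
    (u₂ := (u₀ + r / 2 - W) / V) ?_ ?_ ?_ ?_
  · rw [mem_ofPred_eq, mul_div_cancel₀ _ hV, sub_add_cancel]; exact hu₀r
  · rw [mem_ofPred_eq, mul_div_cancel₀ _ hV, sub_add_cancel, Metric.mem_ball, Real.dist_eq]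
    rw [add_sub_cancel_left, abs_of_pos (by linarith)]; linarith
  · intro h
    rw [div_left_inj' hV] at h
    linarith
  · intro g hg hgI h0
    have sg : SmoothNear g (G.ψ q) := SmoothNear.of_contDiff hg
    have sf : SmoothNear (G.pull g) q := hR.s_pull sg
    have hmem : ∀ q', q' ∈ Metric.ball (base P) r → G.pull g q' ∈ Metric.ball u₀ r →
        T.Φ (graphPt (G.pull g) q') = graphPt g (G.ψ q') := by
      intro q' h1 h2
      have hV := (hrg q' h1).hV
      rw [hmap (graphPt (G.pull g) q') (mem_ball_pt.2 ⟨h1, h2⟩)]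
      refine Prod.ext rfl (Prod.ext rfl ?_)
      change (G.V q' * g (G.ψ q') + G.W q' - G.W q') / G.V q' = g (G.ψ q')
      field_simp; ring
    have hp : Prolongs T.Φ (jet (G.pull g) q) (jet g (G.ψ q)) := by
      refine ⟨_, _, _, _, sf, sg, rfl, rfl, hball (mem_ball_pt.2 ⟨hq, hgI⟩), hmem q hq hgI, ?_⟩
      filter_upwards [Metric.isOpen_ball.mem_nhds hq, sf.continuousAt.eventually
        (Metric.isOpen_ball.mem_nhds hgI)] with q' h1 h2
      rw [hmem q' h1 h2]; rfl
    exact (jet_mem_locus.1 (hT.2.2.2.2 _ _ hp (jet_mem_locus.2 ⟨d1, h0⟩))).2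

/-! ### Affine germs and the equivalence group -/

/-- `T` is affine in `t` and `X` does not depend on `t`, near `p`. -/
def PB.Affine (G : PB) (p : Base) : Prop := ∀ᶠ q in 𝓝 p, dt (dt G.T) q = 0 ∧ dt G.X q = 0

theorem tendsto_fiber (P : Pt) : Tendsto (fun q : Base => ((q.1, q.2, P.2.2) : Pt)) (𝓝 (base P))
    (𝓝 P) := by
  have : Continuous (fun q : Base => ((q.1, q.2, P.2.2) : Pt)) := by fun_prop
  exact this.tendsto (base P)

theorem PB.eventuallyEq_of_map {G H : PB} {P : Pt} (h : G.map =ᶠ[𝓝 P] H.map) :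
    G.T =ᶠ[𝓝 (base P)] H.T ∧ G.X =ᶠ[𝓝 (base P)] H.X := by
  constructor
  · filter_upwards [(tendsto_fiber P).eventually h] with q hq using congrArg (fun P : Pt => P.1) hq
  · filter_upwards [(tendsto_fiber P).eventually h] with q hq using congrArg (fun P : Pt => P.2.1) hq

theorem PB.Affine.congr {G H : PB} {p : Base} (h : G.Affine p) (hT : H.T =ᶠ[𝓝 p] G.T)
    (hX : H.X =ᶠ[𝓝 p] G.X) : H.Affine p := by
  filter_upwards [h, dt_congr' (dt_congr' hT), dt_congr' hX] with q h1 h2 h3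
  rw [h2, h3]; exact h1

theorem PB.Affine.eventually {G : PB} {p : Base} (h : G.Affine p) : ∀ᶠ q in 𝓝 p, G.Affine q :=
  eventually_eventually_nhds.2 h

theorem isPointTransformation_restrOpen {Φ : OpenPartialHomeomorph Pt Pt}
    (h : IsPointTransformation Φ) {N : Set Pt} (hN : IsOpen N) (hne : (Φ.source ∩ N).Nonempty) :
    IsPointTransformation (Φ.restrOpen N hN) := by
  refine ⟨by simpa using hne, h.2.1.mono fun Q hQ => hQ.1, h.2.2.mono fun Q hQ => ?_⟩
  exact hQ.1

theorem Prolongs.of_restrOpen {Φ : OpenPartialHomeomorph Pt Pt} {N : Set Pt} (hN : IsOpen N)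
    {z z' : Jet} (h : Prolongs (Φ.restrOpen N hN) z z') : Prolongs Φ z z' ∧ z.1 ∈ N := by
  obtain ⟨f, g, p, q, hf, hg, h1, h2, h3, h4, h5⟩ := h
  exact ⟨⟨f, g, p, q, hf, hg, h1, h2, h3.1, h4, h5⟩, h3.2⟩

section Action

variable {k : ℕ}

/-- An element of the equivalence group gives admissible germs for all arbitrary elements. -/
theorem exists_germ_of_mem_equivalenceGroup {𝒯 : ExtendedTransformation k}
    (h𝒯 : 𝒯 ∈ (linClass k).equivalenceGroup) {w : Jet × (Fin k → ℝ)} (hw : w ∈ 𝒯.full.source)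
    {θ : ArbitraryElement k} (hθ : θ ∈ (linClass k).S) (hd : base w.1.1 ∈ θ.domain)
    (hv : θ.val (base w.1.1) = w.2) : ∃ θ' ∈ (linClass k).S, ∃ G, Adm θ θ' (base w.1.1) G ∧
      𝒯.Φ =ᶠ[𝓝 w.1.1] G.map := by
  obtain ⟨hΦ, -, -, hpr, -, hmap, -⟩ := h𝒯
  obtain ⟨θ', hθ', hm⟩ := hmap θ hθ
  refine ⟨θ', hθ', ?_⟩
  set P := w.1.1 with hP
  have hsrc : ∀ w' ∈ 𝒯.full.source, w'.1.1 ∈ 𝒯.Φ.source ∧ 𝒯.Φ w'.1.1 = (𝒯.full w').1.1 := by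
    intro w' hw'
    obtain ⟨f, g, p, q, hf, hg, h1, h2, h3, h4, h5⟩ := hpr w' hw'
    exact ⟨h3, h4⟩
  -- Moving the base point along the graph of `θ` with the derivatives frozen keeps `w` in the open
  -- source of `𝒯`. On the neighbourhood obtained, the projection of `𝒯` is an admissible
  -- transformation from `θ`.
  have hc : Tendsto (fun P' : Pt => (((P', w.1.2), θ.val (base P')) : Jet × (Fin k → ℝ)))
      (𝓝 P) (𝓝 w) := by
    have h1 : ContinuousAt θ.val (base P) := θ.smooth.continuousOn.continuousAt
      (θ.isOpen_domain.mem_nhds hd)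
    have h2 : ContinuousAt (fun P' : Pt => (((P', w.1.2), θ.val (base P')) : Jet × (Fin k → ℝ))) P :=
      (continuousAt_id.prodMk continuousAt_const).prodMk
        (ContinuousAt.comp (g := θ.val) h1 continuous_base.continuousAt)
    rw [ContinuousAt, hv] at h2
    exact h2
  have hev : ∀ᶠ P' in 𝓝 P, base P' ∈ θ.domain ∧
      (((P', w.1.2), θ.val (base P')) : Jet × (Fin k → ℝ)) ∈ 𝒯.full.source :=
    (continuous_base.continuousAt.eventually (θ.isOpen_domain.mem_nhds hd)).and
      (hc.eventually (𝒯.full.open_source.mem_nhds hw))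
  obtain ⟨N, hN, hNo, hPN⟩ := mem_nhds_iff.1 hev
  have hPs := (hsrc w hw).1
  have hT : (⟨θ, 𝒯.Φ.restrOpen N hNo, θ'⟩ : Triple k) ∈ (linClass k).groupoid := by
    refine ⟨hθ, hθ', isPointTransformation_restrOpen hΦ hNo ⟨P, hPs, hPN⟩, ?_, ?_⟩
    · intro P' hP'
      obtain ⟨h1, h2⟩ := hN hP'.2
      obtain ⟨h3, -, -⟩ := hm _ h2 h1 rfl
      rw [← (hsrc _ h2).2] at h3
      exact ⟨h1, h3⟩
    · intro z z' hz hl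
      obtain ⟨h3, h4⟩ := Prolongs.of_restrOpen hNo hz
      obtain ⟨h1, h2⟩ := hN h4
      obtain ⟨-, -, h5⟩ := hm _ h2 h1 rfl
      exact h5 z z' rfl h3 hl
  obtain ⟨G, hG, hG'⟩ := hasGerms_of_mem_groupoid hT P ⟨hPs, hPN⟩
  exact ⟨G, hG, hG'⟩

/-- The arbitrary element `(a₀ exp (c (x - x₀)), a₁, …)`. -/
noncomputable def expElement (a : Fin k → ℝ) (c x₀ : ℝ) : ArbitraryElement k where
  domain := univ
  val q i := if i.val = 0 then a i * Real.exp (c * (q.2 - x₀)) else a i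
  isOpen_domain := isOpen_univ
  nonempty_domain := univ_nonempty
  smooth := by
    rw [contDiffOn_pi]
    intro i
    split_ifs
    · exact ContDiff.contDiffOn (by fun_prop)
    · exact contDiffOn_const
  val_off p hp := absurd (mem_univ p) hp

theorem co_expElement_zero (a : Fin k → ℝ) (c x₀ : ℝ) (q : Base) :
    co ((expElement a c x₀).val q) 0 = co a 0 * Real.exp (c * (q.2 - x₀)) := by
  unfold co expElement
  split_ifs <;> simp_all

theorem co_expElement_succ (a : Fin k → ℝ) (c x₀ : ℝ) (q : Base) (i : ℕ) :
    co ((expElement a c x₀).val q) (i + 1) = co a (i + 1) := by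
  simp [co, expElement]

theorem expElement_mem {a : Fin k → ℝ} (ha : co a 0 ≠ 0) (c x₀ : ℝ) :
    expElement a c x₀ ∈ (linClass k).S := by
  intro p _
  refine ⟨?_, ?_, ?_, ?_⟩
  · rw [co_expElement_zero]; exact mul_ne_zero ha (Real.exp_pos _).ne'
  · simp only [co_expElement_zero]
    rw [dt_const_mul _ (by fun_prop), dt_exp (by fun_prop), dt_const_mul _ (by fun_prop),
      dt_sub (by fun_prop) (by fun_prop)]
    simp
  · simp only [co_expElement_succ]; simp
  · simp only [co_expElement_succ]; simp

theorem expElement_val_base (a : Fin k → ℝ) (c : ℝ) (p : Base) :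
    (expElement a c p.2).val p = a := by
  funext i; simp [expElement]

/-- The germs of the elements of the action groupoid are affine. -/
theorem affine_of_mem_actionGroupoid {T : Triple k} (hT : T ∈ (linClass k).actionGroupoid)
    {P : Pt} (hP : P ∈ T.Φ.source) {G : PB} (hG : G.Rg (base P)) (hm : T.Φ =ᶠ[𝓝 P] G.map) :
    G.Affine (base P) := by
  obtain ⟨hTg, 𝒯, h𝒯, hU⟩ := hT
  -- the relations at a single point
  have key : ∀ P ∈ T.Φ.source, G.Rg (base P) → T.Φ =ᶠ[𝓝 P] G.map →
      dt G.X (base P) = 0 ∧ ∃ (a₀ : ℝ) (α : Base → ℝ), SmoothNear α (G.ψ (base P)) ∧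
        α (G.ψ (base P)) ≠ 0 ∧ dt α (G.ψ (base P)) = 0 ∧
        ∀ᶠ q in 𝓝 (base P), dt G.T q * α (G.ψ q) = a₀ * dx G.X q ^ 2 := by
    intro P hP hG hm
    obtain ⟨-, -, ⟨w, hw, hwP, hwv⟩, -⟩ := hU P hP
    have hΦ : 𝒯.Φ =ᶠ[𝓝 P] G.map := by
      filter_upwards [hm, T.Φ.open_source.mem_nhds hP] with Q h1 h2
      rw [← h1, (hU Q h2).2.1]
    have ha : co w.2 0 ≠ 0 := by
      rw [hwv]; exact coef_ne_zero hTg.1 (hTg.2.2.2.1 P hP).1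
    subst hwP
    set P := w.1.1
    -- One and the same `Φ` must map all equations with `A = a₀ exp (c (x - x₀))` to equations of
    -- the class; these elements all take the value `w.2` at the base point, so `𝒯` is defined
    -- there.
    have rel : ∀ c : ℝ, ∃ α : Base → ℝ, SmoothNear α (G.ψ (base P)) ∧
        α (G.ψ (base P)) ≠ 0 ∧ dt α (G.ψ (base P)) = 0 ∧
        ∀ᶠ q in 𝓝 (base P), dt G.T q * α (G.ψ q) =
          co w.2 0 * Real.exp (c * (q.2 - (base P).2)) * dx G.X q ^ 2 := by
      intro c
      obtain ⟨θ', hθ', H, hH, hH'⟩ := exists_germ_of_mem_equivalenceGroup h𝒯 hw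
        (expElement_mem ha c (base P).2) (mem_univ _) (expElement_val_base _ _ _)
      obtain ⟨eT, eX⟩ := PB.eventuallyEq_of_map (hH'.symm.trans hΦ)
      have eψ : H.ψ (base P) = G.ψ (base P) := Prod.ext eT.eq_of_nhds eX.eq_of_nhds
      have hd := hH.mem'
      rw [eψ] at hd
      refine ⟨fun q => co (θ'.val q) 0, smoothNear_co θ' 0 hd, coef_ne_zero hθ' hd,
        (hθ' _ hd).2.1, ?_⟩
      filter_upwards [hH, dt_congr' eT, dx_congr' eX, eT, eX] with q h1 h2 h3 h4 h5
      have h6 := h1.2.2.2.h0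
      have h7 : H.ψ q = G.ψ q := Prod.ext h4 h5
      rw [h2, h3, h7, co_expElement_zero] at h6
      exact h6
    obtain ⟨α, s0, n0, d0, e0⟩ := rel 0
    obtain ⟨β, s1, n1, d1, e1⟩ := rel 1
    refine ⟨?_, co w.2 0, α, s0, n0, d0, ?_⟩
    · set p := base P
      -- Dividing the relations for `c = 1` and `c = 0` removes `T` and `X_x`. Since `α` and `β` are
      -- time-independent in the target variables, the `t`- and `x`-derivatives of this identity
      -- give `X_t α = 0`.
      have ee : (fun q => β (G.ψ q)) =ᶠ[𝓝 p] fun q => Real.exp (1 * (q.2 - p.2)) * α (G.ψ q) := by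
        filter_upwards [e0, e1, hG.eventually] with q h1 h2 h3
        apply mul_left_cancel₀ h3.hT
        simp only [zero_mul, Real.exp_zero, mul_one] at h1
        linear_combination h2 - Real.exp (1 * (q.2 - p.2)) * h1
      have f1 := dt_congr ee
      have f2 := dx_congr ee
      have hs : DifferentiableAt ℝ (fun q : Base => Real.exp (1 * (q.2 - p.2))) p := by fun_prop
      have hs' : DifferentiableAt ℝ (fun q : Base => 1 * (q.2 - p.2)) p := by fun_prop
      have hs2 : DifferentiableAt ℝ (fun q : Base => q.2 - p.2) p := by fun_prop
      rw [hG.dt_c s1, dt_mul hs (hG.sc s0).differentiableAt, hG.dt_c s0, d0, d1, dt_exp hs',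
        dt_const_mul _ hs2, dt_sub (by fun_prop) (by fun_prop)] at f1
      rw [hG.dx_c s1, dx_mul hs (hG.sc s0).differentiableAt, hG.dx_c s0, dx_exp hs',
        dx_const_mul _ hs2, dx_sub (by fun_prop) (by fun_prop)] at f2
      simp [-mul_eq_mul_right_iff] at f1 f2
      have : dt G.X p * α (G.ψ p) = 0 := by linear_combination dx G.X p * f1 - dt G.X p * f2
      simpa [n0] using this
    · filter_upwards [e0] with q hq
      simpa using hq
  have hX : ∀ᶠ q in 𝓝 (base P), dt G.X q = 0 := by
    filter_upwards [(tendsto_fiber P).eventually (T.Φ.open_source.mem_nhds hP), hG.eventually,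
      (tendsto_fiber P).eventually hm.eventuallyEq_nhds] with q h1 h2 h3
    exact (key _ h1 h2 h3).1
  filter_upwards [(tendsto_fiber P).eventually (T.Φ.open_source.mem_nhds hP), hG.eventually,
      (tendsto_fiber P).eventually hm.eventuallyEq_nhds, eventually_eventually_nhds.2 hX]
      with q h1 h2 h3 h4
  refine ⟨?_, h4.self_of_nhds⟩
  obtain ⟨-, a₀, α, s, n, d, e⟩ := key _ h1 h2 h3
  change ∀ᶠ q' in 𝓝 q, dt G.T q' * α (G.ψ q') = a₀ * dx G.X q' ^ 2 at e
  change SmoothNear α (G.ψ q) at s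
  change α (G.ψ q) ≠ 0 at n
  change dt α (G.ψ q) = 0 at d
  -- As `X_t = 0`, both `α ∘ ψ` and `X_x` have zero `t`-derivative, and only `T_tt α = 0` remains.
  have f := dt_congr e
  rw [dt_mul h2.sT.dt.differentiableAt (h2.sc s).differentiableAt, h2.dt_c s, d,
    h4.self_of_nhds, dt_const_mul _ (h2.sX.dx.pow 2).differentiableAt,
    dt_pow h2.sX.dx.differentiableAt, dt_dx_comm h2.sX, dx_eq_zero h4] at f
  simpa [n] using f

end Action

/-! ### Functions of one variable -/

section OneVariable

variable {f : Base → ℝ} {p : Base}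

theorem hasDerivAt_fst {t x : ℝ} (h : DifferentiableAt ℝ f (t, x)) :
    HasDerivAt (fun t => f (t, x)) (dt f (t, x)) t := by
  have h1 : HasDerivAt (fun t : ℝ => ((t, x) : Base)) (1, 0) t :=
    (hasDerivAt_id t).prodMk (hasDerivAt_const t x)
  exact HasFDerivAt.comp_hasDerivAt (f := fun t : ℝ => ((t, x) : Base)) t h.hasFDerivAt h1

theorem hasDerivAt_snd {t x : ℝ} (h : DifferentiableAt ℝ f (t, x)) :
    HasDerivAt (fun x => f (t, x)) (dx f (t, x)) x := by
  have h1 : HasDerivAt (fun x : ℝ => ((t, x) : Base)) (0, 1) x :=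
    (hasDerivAt_const x t).prodMk (hasDerivAt_id x)
  exact HasFDerivAt.comp_hasDerivAt (f := fun x : ℝ => ((t, x) : Base)) x h.hasFDerivAt h1

theorem exists_ball_iff {Q : Base → Prop} (h : ∀ᶠ q in 𝓝 p, Q q) :
    ∃ r > 0, ∀ t ∈ Metric.ball p.1 r, ∀ x ∈ Metric.ball p.2 r, Q (t, x) := by
  obtain ⟨r, hr, h⟩ := Metric.eventually_nhds_iff_ball.1 h
  refine ⟨r, hr, fun t ht x hx => h _ ?_⟩
  rw [← ball_prod_same]
  exact ⟨ht, hx⟩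

theorem eventually_of_ball {Q : Base → Prop} {r : ℝ} (hr : 0 < r)
    (h : ∀ t ∈ Metric.ball p.1 r, ∀ x ∈ Metric.ball p.2 r, Q (t, x)) : ∀ᶠ q in 𝓝 p, Q q := by
  filter_upwards [Metric.ball_mem_nhds p hr] with q hq
  have hq' : (q.1, q.2) ∈ Metric.ball (p.1, p.2) r := hq
  rw [← ball_prod_same] at hq'
  exact h _ hq'.1 _ hq'.2

theorem eq_of_dx_eq_zero_on {a b r : ℝ} (h : ∀ t ∈ Metric.ball a r, ∀ x ∈ Metric.ball b r,
    DifferentiableAt ℝ f (t, x) ∧ dx f (t, x) = 0) {t x y : ℝ} (ht : t ∈ Metric.ball a r)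
    (hx : x ∈ Metric.ball b r) (hy : y ∈ Metric.ball b r) : f (t, x) = f (t, y) := by
  have hd : ∀ s ∈ Metric.ball b r, HasDerivAt (fun s => f (t, s)) 0 s := by
    intro s hs
    have := hasDerivAt_snd (h t ht s hs).1
    rwa [(h t ht s hs).2] at this
  exact Metric.isOpen_ball.is_const_of_deriv_eq_zero (convex_ball _ _).isPreconnected
    (fun s hs => (hd s hs).differentiableAt.differentiableWithinAt) (fun s hs => (hd s hs).deriv)
    hx hy

theorem eq_of_dt_eq_zero_on {a b r : ℝ} (h : ∀ t ∈ Metric.ball a r, ∀ x ∈ Metric.ball b r,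
    DifferentiableAt ℝ f (t, x) ∧ dt f (t, x) = 0) {t s x : ℝ} (ht : t ∈ Metric.ball a r)
    (hs : s ∈ Metric.ball a r) (hx : x ∈ Metric.ball b r) : f (t, x) = f (s, x) := by
  have hd : ∀ s ∈ Metric.ball a r, HasDerivAt (fun s => f (s, x)) 0 s := by
    intro s hs
    have := hasDerivAt_fst (h s hs x hx).1
    rwa [(h s hs x hx).2] at this
  exact Metric.isOpen_ball.is_const_of_deriv_eq_zero (convex_ball _ _).isPreconnected
    (fun s hs => (hd s hs).differentiableAt.differentiableWithinAt) (fun s hs => (hd s hs).deriv)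
    ht hs

theorem eventually_eq_of_dx (hf : SmoothNear f p) (h : ∀ᶠ q in 𝓝 p, dx f q = 0) :
    ∀ᶠ q in 𝓝 p, f q = f (q.1, p.2) := by
  obtain ⟨r, hr, h1⟩ := exists_ball_iff (hf.eventually.and h)
  exact eventually_of_ball hr fun t ht x hx => eq_of_dx_eq_zero_on
    (fun t ht x hx => ⟨(h1 t ht x hx).1.differentiableAt, (h1 t ht x hx).2⟩) ht hx
    (Metric.mem_ball_self hr)

theorem eventually_eq_of_dt (hf : SmoothNear f p) (h : ∀ᶠ q in 𝓝 p, dt f q = 0) :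
    ∀ᶠ q in 𝓝 p, f q = f (p.1, q.2) := by
  obtain ⟨r, hr, h1⟩ := exists_ball_iff (hf.eventually.and h)
  exact eventually_of_ball hr fun t ht x hx => eq_of_dt_eq_zero_on
    (fun t ht x hx => ⟨(h1 t ht x hx).1.differentiableAt, (h1 t ht x hx).2⟩) ht
    (Metric.mem_ball_self hr) hx

theorem tendsto_line (p : Base) : Tendsto (fun t : ℝ => ((t, p.2) : Base)) (𝓝 p.1) (𝓝 p) := by
  have : Continuous (fun t : ℝ => ((t, p.2) : Base)) := by fun_prop
  exact this.tendsto p.1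

theorem tendsto_line' (p : Base) : Tendsto (fun x : ℝ => ((p.1, x) : Base)) (𝓝 p.2) (𝓝 p) := by
  have : Continuous (fun x : ℝ => ((p.1, x) : Base)) := by fun_prop
  exact this.tendsto p.2

theorem eventually_const (hf : SmoothNear f p) (h : ∀ᶠ q in 𝓝 p, dt f q = 0 ∧ dx f q = 0) :
    ∀ᶠ q in 𝓝 p, f q = f p := by
  have h1 := eventually_eq_of_dt hf (h.mono fun q hq => hq.1)
  have h2 := eventually_eq_of_dx hf (h.mono fun q hq => hq.2)
  have h3 := (tendsto_line' p).eventually h2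
  filter_upwards [h1, continuous_snd.continuousAt.eventually h3] with q h4 h5
  rw [h4]; exact h5

end OneVariable

/-! ### Polynomial identities for inverse square potentials -/

theorem coeff_eq_zero_of_eventually {n : ℕ} {a : ℕ → ℝ} {x₀ : ℝ}
    (h : ∀ᶠ x in 𝓝 x₀, ∑ i ∈ Finset.range n, a i * x ^ i = 0) : ∀ i < n, a i = 0 := by
  set P : Polynomial ℝ := ∑ i ∈ Finset.range n, Polynomial.C (a i) * Polynomial.X ^ i with hP
  have h0 : P = 0 := by
    refine Polynomial.eq_zero_of_infinite_isRoot P ((infinite_of_mem_nhds x₀ h).mono fun x hx => ?_)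
    simp only [mem_ofPred_eq, Polynomial.IsRoot.def, hP, Polynomial.eval_finsetSum]
    simpa using hx
  intro i hi
  have := congrArg (fun P => Polynomial.coeff P i) h0
  simpa [hP, Polynomial.finsetSum_coeff, Polynomial.coeff_C_mul, Polynomial.coeff_X_pow, hi]
    using this

/-- The point `x = 0` belongs to `natDom μ` only for `μ = 0`, where both sides are zero. -/
theorem div_sq_mul_sq {μ x : ℝ} (h : x ∈ natDom μ) : μ / x ^ 2 * x ^ 2 = μ := by
  by_cases hμ : μ = 0
  · simp [hμ]
  · have := h hμ; field_simp

/-- Multiplication by `x² (s x + κ)²` gives a polynomial identity of degree six. The coefficients of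
degrees six, five and four yield `q₂ = q₁ = q₀ = 0` in turn, degree two yields `μ' = μ`, and the
constant term yields `μ κ² = 0`. -/
theorem inverse_square_identity {μ μ' s κ q₂ q₁ q₀ x₀ : ℝ} (hs : s ≠ 0)
    (h : ∀ᶠ x in 𝓝 x₀, x ∈ natDom μ ∧ s * x + κ ∈ natDom μ' ∧
      s ^ 2 * (μ' / (s * x + κ) ^ 2) = μ / x ^ 2 + q₂ * x ^ 2 + q₁ * x + q₀) :
    q₂ = 0 ∧ q₁ = 0 ∧ q₀ = 0 ∧ μ' = μ ∧ μ * κ = 0 := by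
  set a : ℕ → ℝ := fun i => match i with
    | 0 => μ * κ ^ 2
    | 1 => 2 * μ * s * κ
    | 2 => μ * s ^ 2 - s ^ 2 * μ' + κ ^ 2 * q₀
    | 3 => 2 * s * κ * q₀ + κ ^ 2 * q₁
    | 4 => s ^ 2 * q₀ + 2 * s * κ * q₁ + κ ^ 2 * q₂
    | 5 => s ^ 2 * q₁ + 2 * s * κ * q₂
    | 6 => s ^ 2 * q₂
    | _ => 0
  have ha : ∀ i < 7, a i = 0 := by
    refine coeff_eq_zero_of_eventually (x₀ := x₀) ?_
    filter_upwards [h] with x hx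
    have h1 := div_sq_mul_sq hx.1
    have h2 := div_sq_mul_sq hx.2.1
    simp only [Finset.sum_range_succ, Finset.sum_range_zero, a]
    linear_combination (-x ^ 2 * (s * x + κ) ^ 2) * hx.2.2 - (s * x + κ) ^ 2 * h1 + s ^ 2 * x ^ 2 * h2
  have e6 : q₂ = 0 := by
    have := ha 6 (by norm_num); simpa [a, hs] using this
  have e5 : q₁ = 0 := by
    have := ha 5 (by norm_num); simpa [a, hs, e6] using this
  have e4 : q₀ = 0 := by
    have := ha 4 (by norm_num); simpa [a, hs, e6, e5] using this
  refine ⟨e6, e5, e4, ?_, ?_⟩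
  · have := ha 2 (by norm_num)
    simp only [a, e4] at this
    apply mul_left_cancel₀ (pow_ne_zero 2 hs); linear_combination -this
  · have := ha 0 (by norm_num)
    simp only [a] at this
    rcases mul_eq_zero.1 this with h | h
    · rw [h, zero_mul]
    · rw [pow_eq_zero_iff (by norm_num)] at h; rw [h, mul_zero]

/-! ### Normal forms and potentials -/

/-- Near `p`, the equation is `u_t = u_xx + C(x) u`. -/
def Nrm {k : ℕ} (θ : ArbitraryElement k) (C : ℝ → ℝ) (p : Base) : Prop :=
  ∀ᶠ q in 𝓝 p, q ∈ θ.domain ∧ co (θ.val q) 0 = 1 ∧ co (θ.val q) 1 = 0 ∧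
    co (θ.val q) 2 = C q.2 ∧ co (θ.val q) 3 = 0

theorem co_potential {k : ℕ} (hk : 3 ≤ k) (μ α β : ℝ) {q : Base} (hq : q.2 ∈ natDom μ) :
    co ((potential k μ α β).val q) 0 = 1 ∧ co ((potential k μ α β).val q) 1 = 0 ∧
    co ((potential k μ α β).val q) 2 = μ / q.2 ^ 2 + α * q.2 ^ 2 + β * q.2 ∧
    co ((potential k μ α β).val q) 3 = 0 := by
  have h0 : 0 < k := by omega
  have h1 : 1 < k := by omega
  have h2 : 2 < k := by omega
  refine ⟨?_, ?_, ?_, ?_⟩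
  · simp [co, potential, hq, h0]
  · simp [co, potential, hq, h1]
  · simp [co, potential, hq, h2]
  · simp [co, potential, hq]

theorem eventually_natDom {μ : ℝ} {p : Base} (hp : p.2 ∈ natDom μ) :
    ∀ᶠ q : Base in 𝓝 p, q.2 ∈ natDom μ :=
  continuous_snd.continuousAt.eventually ((isOpen_natDom μ).mem_nhds hp)

theorem nrm_potential {k : ℕ} (hk : 3 ≤ k) (μ α β : ℝ) {p : Base}
    (hp : p ∈ (potential k μ α β).domain) :
    Nrm (potential k μ α β) (fun x => μ / x ^ 2 + α * x ^ 2 + β * x) p := by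
  filter_upwards [eventually_natDom hp] with q hq using ⟨hq, co_potential hk μ α β hq⟩

theorem dt_fun_snd (h : ℝ → ℝ) (p : Base) : dt (fun q => h q.2) p = 0 := by
  by_cases hd : DifferentiableAt ℝ (fun q : Base => h q.2) p
  · have := hasDerivAt_fst (f := fun q : Base => h q.2) (t := p.1) (x := p.2) hd
    exact this.unique (hasDerivAt_const p.1 (h p.2))
  · simp [dt, fderiv_zero_of_not_differentiableAt hd]

theorem potential_mem {k : ℕ} (hk : 3 ≤ k) (μ α β : ℝ) : potential k μ α β ∈ (linClass k).S := by
  intro p hp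
  have h := eventually_natDom (show p.2 ∈ natDom μ from hp)
  refine ⟨by rw [(co_potential hk μ α β hp).1]; exact one_ne_zero, ?_, ?_, ?_⟩
  · rw [dt_congr (g := fun _ => 1), dt_const]
    filter_upwards [h] with q hq using (co_potential hk μ α β hq).1
  · rw [dt_congr (g := fun _ => 0), dt_const]
    filter_upwards [h] with q hq using (co_potential hk μ α β hq).2.1
  · rw [dt_congr (g := fun q => (fun x => μ / x ^ 2 + α * x ^ 2 + β * x) q.2)]
    · exact dt_fun_snd (fun x => μ / x ^ 2 + α * x ^ 2 + β * x) p
    · filter_upwards [h] with q hq using (co_potential hk μ α β hq).2.2.1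

/-- Equal leading coefficients `1` give `T_t = X_x²`. As `T` does not depend on `x`, neither does
`X_x`; the remaining two equations are the determining equations simplified accordingly. -/
theorem Adm.normal_eqs {k : ℕ} {θ θ' : ArbitraryElement k} {p : Base} {G : PB} {C C' : ℝ → ℝ}
    (h : Adm θ θ' p G) (hn : Nrm θ C p) (hn' : Nrm θ' C' (G.ψ p)) :
    ∀ᶠ q in 𝓝 p, dt G.T q = dx G.X q ^ 2 ∧ dx (dx G.X) q = 0 ∧
      2 * dx G.X q * dx G.V q = G.V q * dt G.X q ∧
      G.V q * dt G.T q * C' (G.X q) = -dt G.V q + dx (dx G.V) q + C q.2 * G.V q := by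
  have h1 : ∀ᶠ q in 𝓝 p, dt G.T q = dx G.X q ^ 2 := by
    filter_upwards [h, hn, h.rg.continuousAt_ψ.eventually hn'] with q h1 h2 h3
    have := h1.2.2.2.h0
    rw [h3.2.1, h2.2.1] at this
    linarith
  filter_upwards [h, hn, h.rg.continuousAt_ψ.eventually hn', eventually_eventually_nhds.2 h1]
    with q h1 h2 h3 h4
  have e0 := h4.self_of_nhds
  have e1 : dx (dx G.X) q = 0 := by
    have e := dx_congr h4
    rw [h1.1.dxdtT, dx_pow h1.1.sX.dx.differentiableAt] at e
    simpa [h1.1.hX] using e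
  have d1 := h1.2.2.2.h1
  have d2 := h1.2.2.2.h2
  rw [h2.2.1, h2.2.2.1, h3.2.2.1, e1] at d1
  rw [h2.2.1, h2.2.2.1, h2.2.2.2.1, h3.2.2.2.1] at d2
  exact ⟨e0, e1, by linear_combination -d1, by simp only [PB.ψ] at d2; linear_combination d2⟩

/-- An affine germ between two equations in normal form is a scaling and shift of `x`. -/
theorem Adm.normal_affine {k : ℕ} {θ θ' : ArbitraryElement k} {p : Base} {G : PB} {C C' : ℝ → ℝ}
    (h : Adm θ θ' p G) (ha : G.Affine p) (hn : Nrm θ C p) (hn' : Nrm θ' C' (G.ψ p)) :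
    ∃ s κ c : ℝ, s ≠ 0 ∧ G.X p = s * p.2 + κ ∧
      ∀ᶠ x in 𝓝 p.2, s ^ 2 * C' (s * x + κ) = C x + c := by
  have hr := h.rg
  have he := h.normal_eqs hn hn'
  have hXt : ∀ᶠ q in 𝓝 p, dt G.X q = 0 := ha.mono fun q hq => hq.2
  have hXx : ∀ᶠ q in 𝓝 p, dx G.X q = dx G.X p := by
    refine eventually_const hr.sX.dx ?_
    filter_upwards [eventually_eventually_nhds.2 hXt, he, hr.sX.eventually] with q h1 h2 h3
    exact ⟨by rw [dt_dx_comm h3]; exact dx_eq_zero h1, h2.2.1⟩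
  set s := dx G.X p with hs
  have hX : ∀ᶠ q in 𝓝 p, G.X q = s * q.2 + (G.X p - s * p.2) := by
    have := eventually_const (f := fun q => G.X q - s * q.2)
      (hr.sX.sub ((SmoothNear.const s).mul SmoothNear.snd)) (by
        filter_upwards [hXt, hXx, hr.sX.eventually] with q h1 h2 h3
        rw [dt_sub h3.differentiableAt (by fun_prop), dx_sub h3.differentiableAt (by fun_prop),
          dt_const_mul _ (by fun_prop), dx_const_mul _ (by fun_prop), h1, h2]
        simp)
    filter_upwards [this] with q hq
    linear_combination hq
  have hVx : ∀ᶠ q in 𝓝 p, dx G.V q = 0 := by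
    filter_upwards [he, hXt, hr.eventually] with q h1 h2 h3
    have := h1.2.2.1
    rw [h2, mul_zero] at this
    simpa [h3.hX] using this
  -- Since `V_x = 0`, the quotient `V_t / V` depends on `t` only. Along the line through `p` it is a
  -- constant, which becomes `-c`.
  have hm := eventually_eq_of_dx (f := fun q => dt G.V q / G.V q) (hr.sV.dt.div hr.sV hr.hV) (by
    filter_upwards [eventually_eventually_nhds.2 hVx, hr.eventually] with q h1 h2
    rw [dx_div h2.sV.dt.differentiableAt h2.sV.differentiableAt h2.hV, ← dt_dx_comm h2.sV,
      dt_eq_zero h1, h1.self_of_nhds]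
    simp)
  refine ⟨s, G.X p - s * p.2, -(dt G.V p / G.V p), hr.hX, by ring, ?_⟩
  filter_upwards [(tendsto_line' p).eventually (he.and (hX.and (hm.and (hXx.and
    (hr.eventually.and (eventually_eventually_nhds.2 hVx))))))] with x hx
  obtain ⟨h1, h2, h3, h4, h5, h6⟩ := hx
  have e := h1.2.2.2
  rw [h1.1, h4, h2, dx_eq_zero h6] at e
  have hV := h5.hV
  change dt G.V (p.1, x) / G.V (p.1, x) = dt G.V p / G.V p at h3
  rw [← h3]
  field_simp
  linear_combination e

/-- The parameters of the sources and targets of the generators. -/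
def Listed (μ α β : ℝ) : Prop := ((α = 1 ∨ α = -1 ∨ α = 0) ∧ β = 0) ∨ (μ = 0 ∧ α = 0 ∧ β = 1)

/-- An affine germ acts as `x ↦ s x + κ`, so `μ` is invariant and `α = s⁴ α'`. The sign of `α` is
preserved, and the list contains one value for each sign; for `α = 0` the number `β = s³ β'` stays
zero or nonzero. Both self-consistency and minimality rest on this rigidity. -/
theorem eq_of_affine {k : ℕ} (hk : 3 ≤ k) {μ α β μ' α' β' : ℝ} (hl : Listed μ α β)
    (hl' : Listed μ' α' β') {p : Base} {G : PB}
    (h : Adm (potential k μ α β) (potential k μ' α' β') p G) (ha : G.Affine p) :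
    μ = μ' ∧ α = α' ∧ β = β' := by
  have hp : p.2 ∈ natDom μ := h.mem
  have hp' : (G.ψ p).2 ∈ natDom μ' := h.mem'
  obtain ⟨s, κ, c, hs, hX, he⟩ := h.normal_affine ha (nrm_potential hk μ α β hp)
    (nrm_potential hk μ' α' β' hp')
  have hc : Tendsto (fun x => s * x + κ) (𝓝 p.2) (𝓝 (G.ψ p).2) := by
    have : Continuous (fun x => s * x + κ) := by fun_prop
    have h2 := this.tendsto p.2
    rwa [← hX] at h2
  obtain ⟨e2, e1, e0, eμ, -⟩ := inverse_square_identity (μ := μ) (μ' := μ') (κ := κ) (x₀ := p.2)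
    (q₂ := α - s ^ 4 * α') (q₁ := β - 2 * s ^ 3 * κ * α' - s ^ 3 * β')
    (q₀ := c - s ^ 2 * (α' * κ ^ 2 + β' * κ)) hs (by
      filter_upwards [he, (isOpen_natDom μ).mem_nhds hp,
        hc.eventually ((isOpen_natDom μ').mem_nhds hp')] with x h1 h2 h3
      exact ⟨h2, h3, by linear_combination h1⟩)
  have hs4 : 0 < s ^ 4 := by positivity
  have hs3 : s ^ 3 ≠ 0 := pow_ne_zero 3 hs
  have hα : α = α' := by
    rcases hl with ⟨h1 | h1 | h1, -⟩ | ⟨-, h1, -⟩ <;>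
    rcases hl' with ⟨h2 | h2 | h2, -⟩ | ⟨-, h2, -⟩ <;> rw [h1, h2] at e2 ⊢ <;> exfalso <;> linarith
  refine ⟨eμ.symm, hα, ?_⟩
  rcases hl with ⟨h1, h1'⟩ | ⟨-, h1, h1'⟩ <;>
  rcases hl' with ⟨h2, h2'⟩ | ⟨-, h2, h2'⟩
  · rw [h1', h2']
  · rw [h1', h2', h2] at e1; simp [hs] at e1
  · rw [h1', h2', ← hα, h1] at e1; simp at e1
  · rw [h1', h2']

/-! ### The generators are admissible transformations -/

theorem dt_eq_of_hasDerivAt {f : Base → ℝ} {q : Base} {d : ℝ} (hf : DifferentiableAt ℝ f q)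
    (h : HasDerivAt (fun t => f (t, q.2)) d q.1) : dt f q = d :=
  (hasDerivAt_fst (t := q.1) (x := q.2) hf).unique h

theorem dx_eq_of_hasDerivAt {f : Base → ℝ} {q : Base} {d : ℝ} (hf : DifferentiableAt ℝ f q)
    (h : HasDerivAt (fun x => f (q.1, x)) d q.2) : dx f q = d :=
  (hasDerivAt_snd (t := q.1) (x := q.2) hf).unique h

/-- The pullback data with `V = exp φ` and `W = 0`. -/
noncomputable def PB.ofExp (T X φ : Base → ℝ) : PB := ⟨T, X, fun q => Real.exp (φ q), fun _ => 0⟩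

/-- With `V = exp φ` the factor `V` cancels from the determining equations, and checking a concrete
transformation reduces to explicit derivatives of `T`, `X` and `φ`. -/
theorem adm_ofExp {k : ℕ} {θ θ' : ArbitraryElement k} {C C' : ℝ → ℝ} {p : Base} {T X φ : Base → ℝ}
    (hT : SmoothNear T p) (hX : SmoothNear X p) (hφ : SmoothNear φ p) (hn : Nrm θ C p)
    (hn' : Nrm θ' C' (T p, X p)) (h : ∀ᶠ q in 𝓝 p, dx T q = 0 ∧ dt T q = dx X q ^ 2 ∧ dx X q ≠ 0 ∧
      dx (dx X) q = 0 ∧ 2 * dx X q * dx φ q = dt X q ∧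
      dt T q * C' (X q) = C q.2 - dt φ q + dx (dx φ) q + dx φ q ^ 2) :
    Adm θ θ' p (PB.ofExp T X φ) := by
  have hψ : ContinuousAt (fun q => (T q, X q)) p := hT.continuousAt.prodMk hX.continuousAt
  filter_upwards [eventually_eventually_nhds.2 h, hT.eventually, hX.eventually, hφ.eventually, hn,
    hψ.eventually hn'] with q h1 h2 h3 h4 h5 h6
  obtain ⟨e1, e2, e3, e4, e5, e6⟩ := h1.self_of_nhds
  have hE : dx (fun q => Real.exp (φ q)) =ᶠ[𝓝 q] fun q => Real.exp (φ q) * dx φ q := by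
    filter_upwards [h4.eventually] with q' h using dx_exp h.differentiableAt
  have hxx : dx (dx (fun q => Real.exp (φ q))) q = Real.exp (φ q) * (dx (dx φ) q + dx φ q ^ 2) := by
    rw [dx_congr hE, dx_mul h4.exp.differentiableAt h4.dx.differentiableAt,
      dx_exp h4.differentiableAt]; ring
  refine ⟨⟨h2, h3, h4.exp, SmoothNear.const 0, h1.mono fun q h => h.1, ?_, e3,
    (Real.exp_pos _).ne'⟩, h5.1, h6.1, ?_, ?_, ?_, ?_⟩
  · change dt T q ≠ 0
    rw [e2]; exact pow_ne_zero 2 e3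
  · change dt T q * co (θ'.val (T q, X q)) 0 = _ * dx X q ^ 2
    rw [h5.2.1, h6.2.1, e2]; ring
  · change Real.exp (φ q) * dt T q * co (θ'.val (T q, X q)) 1 = Real.exp (φ q) *
      (co (θ.val q) 0 * dx (dx X) q + co (θ.val q) 1 * dx X q - dt X q)
      + 2 * co (θ.val q) 0 * dx X q * dx (fun q => Real.exp (φ q)) q
    rw [h5.2.1, h5.2.2.1, h6.2.2.1, e4, hE.eq_of_nhds]
    linear_combination (-Real.exp (φ q)) * e5
  · change Real.exp (φ q) * dt T q * co (θ'.val (T q, X q)) 2 = -dt (fun q => Real.exp (φ q)) q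
      + co (θ.val q) 0 * dx (dx (fun q => Real.exp (φ q))) q
      + co (θ.val q) 1 * dx (fun q => Real.exp (φ q)) q + co (θ.val q) 2 * Real.exp (φ q)
    rw [h5.2.1, h5.2.2.1, h5.2.2.2.1, h6.2.2.2.1, hxx, dt_exp h4.differentiableAt]
    linear_combination Real.exp (φ q) * e6
  · change Real.exp (φ q) * dt T q * co (θ'.val (T q, X q)) 3 = -dt (fun _ => 0) q
      + co (θ.val q) 0 * dx (dx (fun _ => 0)) q
      + co (θ.val q) 1 * dx (fun _ => 0) q + co (θ.val q) 2 * 0 + co (θ.val q) 3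
    have : dx (dx (fun _ : Base => (0 : ℝ))) q = 0 :=
      dx_eq_zero (Eventually.of_forall fun _ => dx_const 0)
    rw [h5.2.2.2.2, h6.2.2.2.2, this]; simp

theorem PB.ofExp_map (T X φ : Base → ℝ) (P : Pt) : (PB.ofExp T X φ).map P =
    (T (base P), X (base P), Real.exp (-φ (base P)) * P.2.2) := by
  simp only [PB.map, PB.ofExp, sub_zero, Real.exp_neg]
  rw [div_eq_inv_mul]

section Generators

variable {k : ℕ}

/-- The pullback data of `Φ₁`. -/
noncomputable def gen₁ : PB := PB.ofExp (fun q => Real.sin (2 * q.1) / (2 * Real.cos (2 * q.1)))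
  (fun q => q.2 / Real.cos (2 * q.1))
  (fun q => Real.sin (2 * q.1) * q.2 ^ 2 / (2 * Real.cos (2 * q.1))
    - Real.log (Real.cos (2 * q.1)) / 2)

/-- The pullback data of `Φ₂`. -/
noncomputable def gen₂ : PB := PB.ofExp (fun q => Real.exp (4 * q.1) / 4)
  (fun q => Real.exp (2 * q.1) * q.2) (fun q => q.2 ^ 2 / 2 + q.1)

/-- The pullback data of `Φ₃`. -/
noncomputable def gen₃ : PB := PB.ofExp (fun q => q.1) (fun q => q.2 + q.1 ^ 2)
  (fun q => q.1 * q.2 + q.1 ^ 3 / 3)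

theorem cos_pos_of_abs_lt {t : ℝ} (ht : |t| < Real.pi / 4) : 0 < Real.cos (2 * t) := by
  rw [abs_lt] at ht
  exact Real.cos_pos_of_mem_Ioo ⟨by linarith, by linarith⟩

theorem adm_gen₁ (hk : 3 ≤ k) {μ : ℝ} {p : Base} (ht : |p.1| < Real.pi / 4) (hx : p.2 ∈ natDom μ) :
    Adm (potential k μ 1 0) (potential k μ 0 0) p gen₁ := by
  have hc := cos_pos_of_abs_lt ht
  have hev : ∀ᶠ q : Base in 𝓝 p, 0 < Real.cos (2 * q.1) ∧ q.2 ∈ natDom μ := by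
    have : ContinuousAt (fun q : Base => Real.cos (2 * q.1)) p := by fun_prop
    exact (this.eventually (isOpen_Ioi.mem_nhds hc)).and (eventually_natDom hx)
  have sc : ∀ q : Base, SmoothNear (fun q => Real.cos (2 * q.1)) q := fun q =>
    SmoothNear.of_contDiff (by fun_prop)
  have ss : ∀ q : Base, SmoothNear (fun q => Real.sin (2 * q.1)) q := fun q =>
    SmoothNear.of_contDiff (by fun_prop)
  have sT : ∀ q : Base, 0 < Real.cos (2 * q.1) →
      SmoothNear (fun q : Base => Real.sin (2 * q.1) / (2 * Real.cos (2 * q.1))) q := fun q hq =>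
    (ss q).div ((SmoothNear.const 2).mul (sc q)) (by positivity)
  have sX : ∀ q : Base, 0 < Real.cos (2 * q.1) →
      SmoothNear (fun q : Base => q.2 / Real.cos (2 * q.1)) q := fun q hq =>
    SmoothNear.snd.div (sc q) hq.ne'
  have sφ : ∀ q : Base, 0 < Real.cos (2 * q.1) →
      SmoothNear (fun q : Base => Real.sin (2 * q.1) * q.2 ^ 2 / (2 * Real.cos (2 * q.1))
        - Real.log (Real.cos (2 * q.1)) / 2) q := fun q hq =>
    (((ss q).mul (SmoothNear.snd.pow 2)).div ((SmoothNear.const 2).mul (sc q)) (by positivity)).sub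
      ((SmoothNear.comp₁ (h := Real.log) (by
        filter_upwards [isOpen_Ioi.mem_nhds hq] with y hy
        exact Real.contDiffAt_log.2 (ne_of_gt hy)) (sc q)).div (SmoothNear.const 2) two_ne_zero)
  have dcos : ∀ t : ℝ, HasDerivAt (fun t => Real.cos (2 * t)) (-Real.sin (2 * t) * 2) t := fun t => by
    have := ((hasDerivAt_id' t).const_mul (2 : ℝ)).cos; simpa using this
  have dsin : ∀ t : ℝ, HasDerivAt (fun t => Real.sin (2 * t)) (Real.cos (2 * t) * 2) t := fun t => by
    have := ((hasDerivAt_id' t).const_mul (2 : ℝ)).sin; simpa using this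
  refine adm_ofExp (sT p hc) (sX p hc) (sφ p hc) (nrm_potential hk μ 1 0 hx)
    (nrm_potential hk μ 0 0 ?_) ?_
  · change p.2 / Real.cos (2 * p.1) ∈ natDom μ
    rw [div_eq_mul_inv]; exact mul_mem_natDom hx (inv_ne_zero hc.ne')
  filter_upwards [eventually_eventually_nhds.2 hev] with q hq
  obtain ⟨h0, h0'⟩ := hq.self_of_nhds
  have hne := h0.ne'
  have f1 : dx (fun q : Base => Real.sin (2 * q.1) / (2 * Real.cos (2 * q.1))) q = 0 :=
    dx_eq_of_hasDerivAt (sT q h0).differentiableAt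
      (hasDerivAt_const q.2 (Real.sin (2 * q.1) / (2 * Real.cos (2 * q.1))))
  have f2 : dt (fun q : Base => Real.sin (2 * q.1) / (2 * Real.cos (2 * q.1))) q =
      1 / Real.cos (2 * q.1) ^ 2 := by
    refine dt_eq_of_hasDerivAt (sT q h0).differentiableAt ?_
    refine HasDerivAt.congr_deriv ((dsin q.1).div ((dcos q.1).const_mul 2) (mul_ne_zero two_ne_zero hne)) ?_
    field_simp
    linear_combination Real.sin_sq_add_cos_sq (2 * q.1)
  have f3 : ∀ q : Base, 0 < Real.cos (2 * q.1) →
      dx (fun q : Base => q.2 / Real.cos (2 * q.1)) q = 1 / Real.cos (2 * q.1) := fun q h0 =>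
    dx_eq_of_hasDerivAt (sX q h0).differentiableAt ((hasDerivAt_id' q.2).div_const (Real.cos (2 * q.1)))
  have f4 : dt (fun q : Base => q.2 / Real.cos (2 * q.1)) q =
      2 * q.2 * Real.sin (2 * q.1) / Real.cos (2 * q.1) ^ 2 := by
    refine dt_eq_of_hasDerivAt (sX q h0).differentiableAt ?_
    refine HasDerivAt.congr_deriv ((hasDerivAt_const q.1 q.2).div (dcos q.1) hne) ?_
    ring
  have f5 : ∀ q : Base, 0 < Real.cos (2 * q.1) → dx (fun q : Base => Real.sin (2 * q.1) * q.2 ^ 2 /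
      (2 * Real.cos (2 * q.1)) - Real.log (Real.cos (2 * q.1)) / 2) q =
      Real.sin (2 * q.1) * q.2 / Real.cos (2 * q.1) := fun q h0 => by
    refine dx_eq_of_hasDerivAt (sφ q h0).differentiableAt ?_
    refine HasDerivAt.congr_deriv (((((hasDerivAt_id' q.2).pow 2).const_mul (Real.sin (2 * q.1))).div_const
      (2 * Real.cos (2 * q.1))).sub_const (Real.log (Real.cos (2 * q.1)) / 2)) ?_
    simp; field_simp
  have f6 : dt (fun q : Base => Real.sin (2 * q.1) * q.2 ^ 2 /
      (2 * Real.cos (2 * q.1)) - Real.log (Real.cos (2 * q.1)) / 2) q =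
      q.2 ^ 2 / Real.cos (2 * q.1) ^ 2 + Real.sin (2 * q.1) / Real.cos (2 * q.1) := by
    refine dt_eq_of_hasDerivAt (sφ q h0).differentiableAt ?_
    refine HasDerivAt.congr_deriv ((((dsin q.1).mul_const (q.2 ^ 2)).div ((dcos q.1).const_mul 2)
      (mul_ne_zero two_ne_zero hne)).sub (((dcos q.1).log hne).div_const 2)) ?_
    field_simp
    linear_combination q.2 ^ 2 * Real.sin_sq_add_cos_sq (2 * q.1)
  have f7 : dx (dx (fun q : Base => q.2 / Real.cos (2 * q.1))) q = 0 := by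
    rw [dx_congr (g := fun q => 1 / Real.cos (2 * q.1)) (hq.mono fun q h => f3 q h.1)]
    exact dx_eq_of_hasDerivAt ((SmoothNear.const 1).div (sc q) hne).differentiableAt
      (hasDerivAt_const q.2 (1 / Real.cos (2 * q.1)))
  have f8 : dx (dx (fun q : Base => Real.sin (2 * q.1) * q.2 ^ 2 /
      (2 * Real.cos (2 * q.1)) - Real.log (Real.cos (2 * q.1)) / 2)) q =
      Real.sin (2 * q.1) / Real.cos (2 * q.1) := by
    rw [dx_congr (g := fun q => Real.sin (2 * q.1) * q.2 / Real.cos (2 * q.1))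
      (hq.mono fun q h => f5 q h.1)]
    refine dx_eq_of_hasDerivAt (((ss q).mul SmoothNear.snd).div (sc q) hne).differentiableAt ?_
    refine HasDerivAt.congr_deriv (((hasDerivAt_id' q.2).const_mul (Real.sin (2 * q.1))).div_const (Real.cos (2 * q.1))) ?_
    simp
  rw [f1, f2, f3 q h0, f4, f5 q h0, f6, f7, f8]
  refine ⟨rfl, by field_simp, by positivity, rfl, by field_simp, ?_⟩
  -- For `μ = 0` the point `x = 0` is allowed, so `μ / x²` is kept as an opaque quantity instead of
  -- clearing its denominator.
  have e : μ / (q.2 / Real.cos (2 * q.1)) ^ 2 = Real.cos (2 * q.1) ^ 2 * (μ / q.2 ^ 2) := by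
    rw [div_pow, div_div_eq_mul_div]; ring
  simp only [e]
  generalize μ / q.2 ^ 2 = m
  field_simp
  linear_combination (-Real.cos (2 * q.1) ^ 2 * q.2 ^ 2) * Real.sin_sq_add_cos_sq (2 * q.1)

theorem adm_gen₂ (hk : 3 ≤ k) {μ : ℝ} {p : Base} (hx : p.2 ∈ natDom μ) :
    Adm (potential k μ (-1) 0) (potential k μ 0 0) p gen₂ := by
  have sT : ∀ q : Base, SmoothNear (fun q : Base => Real.exp (4 * q.1) / 4) q := fun q =>
    SmoothNear.of_contDiff (by fun_prop)
  have sX : ∀ q : Base, SmoothNear (fun q : Base => Real.exp (2 * q.1) * q.2) q := fun q =>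
    SmoothNear.of_contDiff (by fun_prop)
  have sφ : ∀ q : Base, SmoothNear (fun q : Base => q.2 ^ 2 / 2 + q.1) q := fun q =>
    SmoothNear.of_contDiff (by fun_prop)
  have dexp : ∀ c t : ℝ, HasDerivAt (fun t => Real.exp (c * t)) (Real.exp (c * t) * c) t :=
    fun c t => by have := ((hasDerivAt_id' t).const_mul c).exp; simpa using this
  refine adm_ofExp (sT p) (sX p) (sφ p) (nrm_potential hk μ (-1) 0 hx)
    (nrm_potential hk μ 0 0 ?_) ?_
  · change Real.exp (2 * p.1) * p.2 ∈ natDom μ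
    rw [mul_comm]; exact mul_mem_natDom hx (Real.exp_pos _).ne'
  refine Eventually.of_forall fun q => ?_
  have f1 : dx (fun q : Base => Real.exp (4 * q.1) / 4) q = 0 :=
    dx_eq_of_hasDerivAt (sT q).differentiableAt (hasDerivAt_const q.2 (Real.exp (4 * q.1) / 4))
  have f2 : dt (fun q : Base => Real.exp (4 * q.1) / 4) q = Real.exp (4 * q.1) := by
    refine dt_eq_of_hasDerivAt (sT q).differentiableAt ?_
    refine HasDerivAt.congr_deriv ((dexp 4 q.1).div_const 4) ?_
    ring
  have f3 : dx (fun q : Base => Real.exp (2 * q.1) * q.2) = fun q => Real.exp (2 * q.1) := by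
    funext q
    refine dx_eq_of_hasDerivAt (sX q).differentiableAt ?_
    refine HasDerivAt.congr_deriv ((hasDerivAt_id' q.2).const_mul (Real.exp (2 * q.1))) ?_
    ring
  have f4 : dt (fun q : Base => Real.exp (2 * q.1) * q.2) q = 2 * Real.exp (2 * q.1) * q.2 := by
    refine dt_eq_of_hasDerivAt (sX q).differentiableAt ?_
    refine HasDerivAt.congr_deriv ((dexp 2 q.1).mul_const q.2) ?_
    ring
  have f5 : dx (fun q : Base => q.2 ^ 2 / 2 + q.1) = fun q => q.2 := by
    funext q
    refine dx_eq_of_hasDerivAt (sφ q).differentiableAt ?_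
    refine HasDerivAt.congr_deriv ((((hasDerivAt_id' q.2).pow 2).div_const 2).add_const q.1) ?_
    simp
  have f6 : dt (fun q : Base => q.2 ^ 2 / 2 + q.1) q = 1 := by
    refine dt_eq_of_hasDerivAt (sφ q).differentiableAt ?_
    exact (hasDerivAt_id' q.1).const_add (q.2 ^ 2 / 2)
  have f7 : dx (fun q : Base => Real.exp (2 * q.1)) q = 0 :=
    dx_eq_of_hasDerivAt (by fun_prop) (hasDerivAt_const q.2 (Real.exp (2 * q.1)))
  have e4 : Real.exp (4 * q.1) = Real.exp (2 * q.1) ^ 2 := by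
    rw [← Real.exp_nat_mul]; ring_nf
  rw [f1, f2, f3, f4, f5, f6, f7]
  refine ⟨rfl, e4, (Real.exp_pos _).ne', rfl, by ring, ?_⟩
  have hE := (Real.exp_pos (2 * q.1)).ne'
  have e : μ / (Real.exp (2 * q.1) * q.2) ^ 2 = (μ / q.2 ^ 2) / Real.exp (2 * q.1) ^ 2 := by
    rw [mul_pow, div_div]; ring
  rw [e4, dx_snd]
  simp only [e]
  generalize μ / q.2 ^ 2 = m
  field_simp
  ring

theorem adm_gen₃ (hk : 3 ≤ k) (p : Base) : Adm (potential k 0 0 1) (potential k 0 0 0) p gen₃ := by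
  have sT : ∀ q : Base, SmoothNear (fun q : Base => q.1) q := fun q => SmoothNear.fst
  have sX : ∀ q : Base, SmoothNear (fun q : Base => q.2 + q.1 ^ 2) q := fun q =>
    SmoothNear.of_contDiff (by fun_prop)
  have sφ : ∀ q : Base, SmoothNear (fun q : Base => q.1 * q.2 + q.1 ^ 3 / 3) q := fun q =>
    SmoothNear.of_contDiff (by fun_prop)
  refine adm_ofExp (sT p) (sX p) (sφ p) (nrm_potential hk 0 0 1 fun h => absurd rfl h)
    (nrm_potential hk 0 0 0 fun h => absurd rfl h) ?_
  refine Eventually.of_forall fun q => ?_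
  have f3 : dx (fun q : Base => q.2 + q.1 ^ 2) = fun _ => 1 := by
    funext q
    exact dx_eq_of_hasDerivAt (sX q).differentiableAt ((hasDerivAt_id' q.2).add_const (q.1 ^ 2))
  have f4 : dt (fun q : Base => q.2 + q.1 ^ 2) q = 2 * q.1 := by
    refine dt_eq_of_hasDerivAt (sX q).differentiableAt ?_
    refine HasDerivAt.congr_deriv (((hasDerivAt_id' q.1).pow 2).const_add q.2) ?_
    norm_num
  have f5 : dx (fun q : Base => q.1 * q.2 + q.1 ^ 3 / 3) = fun q => q.1 := by
    funext q
    refine dx_eq_of_hasDerivAt (sφ q).differentiableAt ?_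
    refine HasDerivAt.congr_deriv (((hasDerivAt_id' q.2).const_mul q.1).add_const (q.1 ^ 3 / 3)) ?_
    norm_num
  have f6 : dt (fun q : Base => q.1 * q.2 + q.1 ^ 3 / 3) q = q.2 + q.1 ^ 2 := by
    refine dt_eq_of_hasDerivAt (sφ q).differentiableAt ?_
    refine HasDerivAt.congr_deriv (((hasDerivAt_id' q.1).mul_const q.2).add (((hasDerivAt_id' q.1).pow 3).div_const 3)) ?_
    norm_num
  rw [f3, f4, f5, f6]
  simp

theorem Phi₁_eventuallyEq {μ : ℝ} {P : Pt} (hP : P ∈ (Phi₁ μ).source) : Phi₁ μ =ᶠ[𝓝 P] gen₁.map := by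
  filter_upwards [(Phi₁ μ).open_source.mem_nhds hP] with Q hQ
  have hc := cos_pos_of_abs_lt hQ.1
  rw [gen₁, PB.ofExp_map]
  refine Prod.ext ?_ (Prod.ext rfl ?_)
  · change Real.tan (2 * Q.1) / 2 = Real.sin (2 * Q.1) / (2 * Real.cos (2 * Q.1))
    rw [Real.tan_eq_sin_div_cos]; field_simp
  · change Real.sqrt |Real.cos (2 * Q.1)| * Real.exp (-(Real.tan (2 * Q.1) * Q.2.1 ^ 2 / 2)) * Q.2.2
      = Real.exp (-(Real.sin (2 * Q.1) * Q.2.1 ^ 2 / (2 * Real.cos (2 * Q.1))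
        - Real.log (Real.cos (2 * Q.1)) / 2)) * Q.2.2
    congr 1
    rw [abs_of_pos hc, neg_sub, sub_eq_add_neg, Real.exp_add, Real.tan_eq_sin_div_cos]
    congr 1
    · rw [Real.sqrt_eq_rpow, Real.rpow_def_of_pos hc]; congr 1; ring
    · congr 1; field_simp

theorem Phi₂_eq_map (μ : ℝ) (P : Pt) : Phi₂ μ P = gen₂.map P := by
  rw [gen₂, PB.ofExp_map]
  refine Prod.ext rfl (Prod.ext rfl ?_)
  change Real.exp (-P.2.1 ^ 2 / 2 - P.1) * P.2.2 = Real.exp (-(P.2.1 ^ 2 / 2 + P.1)) * P.2.2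
  congr 2; ring

theorem Phi₃_eq_map (P : Pt) : Phi₃ P = gen₃.map P := by
  rw [gen₃, PB.ofExp_map]
  refine Prod.ext rfl (Prod.ext rfl ?_)
  change Real.exp (-P.1 * P.2.1 - P.1 ^ 3 / 3) * P.2.2
    = Real.exp (-(P.1 * P.2.1 + P.1 ^ 3 / 3)) * P.2.2
  congr 2; ring

theorem hasGerms_triple₁ (hk : 3 ≤ k) (μ : ℝ) : HasGerms (triple₁ k μ) := fun _ hP =>
  ⟨gen₁, adm_gen₁ hk hP.1 hP.2, Phi₁_eventuallyEq hP⟩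

theorem hasGerms_triple₂ (hk : 3 ≤ k) (μ : ℝ) : HasGerms (triple₂ k μ) := fun _ hP =>
  ⟨gen₂, adm_gen₂ hk hP, Eventually.of_forall (Phi₂_eq_map μ)⟩

theorem hasGerms_triple₃ (hk : 3 ≤ k) : HasGerms (triple₃ k) := fun _ _ =>
  ⟨gen₃, adm_gen₃ hk _, Eventually.of_forall Phi₃_eq_map⟩

/-- Every generator is an admissible transformation from an equation with a listed potential,
which determines the generator, to an equation with the potential `μ / x²`. -/
theorem generators_cases {T : Triple k} (hT : T ∈ generators k) :
    ∃ μ α β, Listed μ α β ∧ T.src = potential k μ α β ∧ T.tgt = potential k μ 0 0 ∧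
      ((α = 1 ∧ β = 0 ∧ T = triple₁ k μ) ∨ (α = -1 ∧ β = 0 ∧ T = triple₂ k μ) ∨
        (μ = 0 ∧ α = 0 ∧ β = 1 ∧ T = triple₃ k)) := by
  rcases hT with (⟨μ, rfl⟩ | ⟨μ, rfl⟩) | rfl
  · exact ⟨μ, 1, 0, Or.inl ⟨Or.inl rfl, rfl⟩, rfl, rfl, Or.inl ⟨rfl, rfl, rfl⟩⟩
  · exact ⟨μ, -1, 0, Or.inl ⟨Or.inr (Or.inl rfl), rfl⟩, rfl, rfl, Or.inr (Or.inl ⟨rfl, rfl, rfl⟩)⟩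
  · exact ⟨0, 0, 1, Or.inr ⟨rfl, rfl, rfl⟩, rfl, rfl, Or.inr (Or.inr ⟨rfl, rfl, rfl, rfl⟩)⟩

theorem hasGerms_generators (hk : 3 ≤ k) {T : Triple k} (hT : T ∈ generators k) : HasGerms T := by
  rcases hT with (⟨μ, rfl⟩ | ⟨μ, rfl⟩) | rfl
  · exact hasGerms_triple₁ hk μ
  · exact hasGerms_triple₂ hk μ
  · exact hasGerms_triple₃ hk

theorem generators_nonempty {T : Triple k} (hT : T ∈ generators k) : T.Φ.source.Nonempty := by
  rcases hT with (⟨μ, rfl⟩ | ⟨μ, rfl⟩) | rfl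
  · exact ⟨(0, 1, 0), by simpa using Real.pi_pos, one_mem_natDom μ⟩
  · exact ⟨(0, 1, 0), one_mem_natDom μ⟩
  · exact ⟨(0, 1, 0), mem_univ _⟩

theorem generators_subset (hk : 3 ≤ k) : generators k ⊆ (linClass k).groupoid := by
  intro T hT
  obtain ⟨μ, α, β, -, h1, h2, -⟩ := generators_cases hT
  exact mem_groupoid_of_hasGerms (h1 ▸ potential_mem hk _ _ _) (h2 ▸ potential_mem hk _ _ _)
    (generators_nonempty hT) (hasGerms_generators hk hT)

theorem inv_mem_groupoid {T : Triple k} (hT : T ∈ (linClass k).groupoid) :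
    T.inv ∈ (linClass k).groupoid := by
  refine mem_groupoid_of_hasGerms hT.2.1 hT.1 ?_ (hasGerms_of_mem_groupoid hT).inv
  obtain ⟨P, hP⟩ := hT.2.2.1.1
  exact ⟨T.Φ P, T.Φ.map_source hP⟩

end Generators

open EquationClass

/-! ### Self-consistency and minimality -/

theorem PB.Affine.comp {G H : PB} {p : Base} (hG : G.Rg p) (hH : H.Rg (G.ψ p)) (ha : G.Affine p)
    (hb : H.Affine (G.ψ p)) : (G.comp H).Affine p := by
  have key : ∀ᶠ q in 𝓝 p, dt (G.comp H).T q = dt H.T (G.ψ q) * dt G.T q := by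
    filter_upwards [hG.eventually, hG.continuousAt_ψ.eventually hH.eventually] with q h1 h2
    exact h1.dt_comp_T h2
  filter_upwards [hG.eventually, hG.continuousAt_ψ.eventually hH.eventually, ha,
    hG.continuousAt_ψ.eventually hb, eventually_eventually_nhds.2 key] with q h1 h2 h3 h4 h5
  constructor
  · rw [dt_congr h5, dt_mul (h1.sc h2.sT.dt).differentiableAt h1.sT.dt.differentiableAt,
      h1.dt_c h2.sT.dt, h2.dxdtT, h3.1, h4.1]
    ring
  · change dt (fun q => H.X (G.ψ q)) q = 0
    rw [h1.dt_c h2.sX, h4.2, h3.2]; ring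

/-- The pullback data of the superposition with a function. -/
def PB.shift (f : Base → ℝ) : PB := ⟨fun q => q.1, fun q => q.2, fun _ => 1, f⟩

theorem PB.rg_shift {f : Base → ℝ} {p : Base} (hf : SmoothNear f p) : (PB.shift f).Rg p where
  sT := SmoothNear.fst
  sX := SmoothNear.snd
  sV := SmoothNear.const 1
  sW := hf
  hTx := Eventually.of_forall fun _ => dx_fst
  hT := dt_fst.trans_ne one_ne_zero
  hX := dx_snd.trans_ne one_ne_zero
  hV := one_ne_zero

theorem PB.affine_shift (f : Base → ℝ) (p : Base) : (PB.shift f).Affine p := by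
  refine Eventually.of_forall fun q => ⟨?_, dt_snd⟩
  have : dt (PB.shift f).T = fun _ => 1 := funext fun q => dt_fst
  rw [this, dt_const]

theorem adm_shift {k : ℕ} {θ θ' : ArbitraryElement k} {f : Base → ℝ} {p : Base}
    (hf : SmoothNear f p)
    (h : ∀ᶠ q in 𝓝 p, q ∈ θ.domain ∧ q ∈ θ'.domain ∧ (∀ i < 3, co (θ'.val q) i = co (θ.val q) i) ∧
      co (θ'.val q) 3 = -res (co (θ.val q)) f q) :
    Adm θ θ' p (PB.shift f) := by
  filter_upwards [h, hf.eventually] with q h1 h2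
  obtain ⟨h3, h4, h5, h6⟩ := h1
  have c1 : dx (fun q : Base => q.2) = fun _ => 1 := funext fun q => dx_snd
  have c2 : dx (fun _ : Base => (1 : ℝ)) = fun _ => 0 := funext fun q => dx_const 1
  refine ⟨PB.rg_shift h2, h3, h4, ?_, ?_, ?_, ?_⟩ <;> simp only [PB.shift, PB.ψ, c1, c2, dt_fst,
    dt_snd, dt_const, dx_const]
  · rw [h5 0 (by norm_num)]; ring
  · rw [h5 1 (by norm_num)]; ring
  · rw [h5 2 (by norm_num)]; ring
  · rw [h6, res]; ring

theorem adm_refl {k : ℕ} {θ : ArbitraryElement k} {p : Base} (hp : p ∈ θ.domain) :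
    Adm θ θ p (PB.shift fun _ => 0) := by
  refine adm_shift (SmoothNear.const 0) ?_
  have c : dx (fun _ : Base => (0 : ℝ)) = fun _ => 0 := funext fun q => dx_const 0
  filter_upwards [θ.isOpen_domain.mem_nhds hp] with q hq
  exact ⟨hq, hq, fun _ _ => rfl, by simp [res, c]⟩

/-- Locally, the transformation is given by affine pullback data. -/
def HasAffineGerms {k : ℕ} (T : Triple k) : Prop :=
  ∀ P ∈ T.Φ.source, ∃ G, Adm T.src T.tgt (base P) G ∧ T.Φ =ᶠ[𝓝 P] G.map ∧ G.Affine (base P)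

theorem HasAffineGerms.comp {k : ℕ} {T T' : Triple k} (h : HasAffineGerms T)
    (h' : HasAffineGerms T') (he : T.tgt = T'.src) : HasAffineGerms (T.comp T') := by
  intro P hP
  simp only [Triple.comp, OpenPartialHomeomorph.trans_source] at hP
  obtain ⟨G, h1, h2, h3⟩ := h P hP.1
  obtain ⟨H, k1, k2, k3⟩ := h' _ hP.2
  have e : base (T.Φ P) = G.ψ (base P) := by rw [h2.eq_of_nhds, PB.base_map]
  rw [e] at k1 k3
  rw [← he] at k1
  refine ⟨G.comp H, h1.comp k1, ?_, h3.comp h1.rg k1.rg k3⟩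
  have hc : Tendsto base (𝓝 P) (𝓝 (base P)) := continuous_base.continuousAt
  filter_upwards [h2, (T.Φ.continuousAt hP.1).eventually k2, hc.eventually h1.rg.eventually,
    hc.eventually (h1.rg.continuousAt_ψ.eventually k1.rg.eventually)] with Q e1 e2 e3 e4
  rw [PB.comp_map e3.hV e4.hV, ← e1]
  exact e2

theorem hasAffineGerms_of_mem_actionGroupoid {k : ℕ} {T : Triple k}
    (hT : T ∈ (linClass k).actionGroupoid) : HasAffineGerms T := by
  intro P hP
  obtain ⟨G, h1, h2⟩ := hasGerms_of_mem_groupoid hT.1 P hP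
  exact ⟨G, h1, h2, affine_of_mem_actionGroupoid hT hP h1.rg h2⟩

theorem hasAffineGerms_of_mem_linGroupoid {k : ℕ} {T : Triple k}
    (hT : T ∈ (linClass k).linGroupoid) : HasAffineGerms T := by
  intro P hP
  obtain ⟨h0, -, f, hf⟩ := hT
  obtain ⟨G, h1, h2⟩ := hasGerms_of_mem_groupoid h0 P hP
  refine ⟨G, h1, h2, ?_⟩
  have e : G.map =ᶠ[𝓝 P] (PB.shift fun q => -f q).map := by
    filter_upwards [h2, T.Φ.open_source.mem_nhds hP] with Q e1 e2
    rw [← e1, (hf Q e2).2.2]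
    simp [PB.map, PB.shift, base]
  obtain ⟨e1, e2⟩ := PB.eventuallyEq_of_map e
  exact (PB.affine_shift _ _).congr e1 e2

theorem hasAffineGerms_of_mem_actionLinGroupoid {k : ℕ} {T : Triple k}
    (hT : T ∈ (linClass k).actionLinGroupoid) : HasAffineGerms T := by
  obtain ⟨-, T₀, h0, T₁, h1, he, rfl⟩ := hT
  exact (hasAffineGerms_of_mem_actionGroupoid h0).comp (hasAffineGerms_of_mem_linGroupoid h1) he

theorem withInverses_cases {k : ℕ} {𝓑 : Set (Triple k)} (h𝓑 : 𝓑 ⊆ generators k) {T : Triple k}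
    (hT : T ∈ withInverses 𝓑) :
    (∃ μ α β, Listed μ α β ∧ T.src = potential k μ α β) ∧
    ∃ μ α β, Listed μ α β ∧ T.tgt = potential k μ α β := by
  have key : ∀ T ∈ 𝓑, (∃ μ α β, Listed μ α β ∧ T.src = potential k μ α β) ∧
      ∃ μ α β, Listed μ α β ∧ T.tgt = potential k μ α β := by
    intro T hT
    obtain ⟨μ, α, β, hl, h1, h2, -⟩ := generators_cases (h𝓑 hT)
    exact ⟨⟨μ, α, β, hl, h1⟩, μ, 0, 0, Or.inl ⟨Or.inr (Or.inr rfl), rfl⟩, h2⟩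
  rcases hT with hT | ⟨T, hT, rfl⟩
  · exact key T hT
  · exact ⟨(key T hT).2, (key T hT).1⟩

/-- If `T₁ ⋆ T ⋆ T₂` is composable with `T'`, then `T₂` goes from the target of `T` to the source of
`T'`. Both are listed and `T₂` has affine germs, so they coincide by `eq_of_affine`. -/
theorem isSelfConsistent_generators {k : ℕ} (hk : 3 ≤ k) {U : Set (Triple k)}
    (hU : ∀ T ∈ U, T.Φ.source.Nonempty ∧ HasAffineGerms T) :
    (linClass k).IsSelfConsistent U (generators k) := by
  rintro T hT T' hT' ⟨T'', ⟨-, T₁, -, T₂, h2, -, h4, rfl⟩, h6⟩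
  obtain ⟨-, μ, α, β, hl, e⟩ := withInverses_cases Subset.rfl hT
  obtain ⟨⟨μ', α', β', hl', e'⟩, -⟩ := withInverses_cases Subset.rfl hT'
  obtain ⟨⟨P, hP⟩, h7⟩ := hU T₂ h2
  obtain ⟨G, h8, -, h9⟩ := h7 P hP
  have h6' : T₂.tgt = T'.src := h6
  rw [← h4, h6', e, e'] at h8
  obtain ⟨rfl, rfl, rfl⟩ := eq_of_affine hk hl hl' h8 h9
  rw [e, e']

/-- If the non-affine steps of a composition do not end at a given listed equation, then the
composition cannot be distinguished from an affine one. -/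
theorem exists_affine_of_isLocalComposition {k : ℕ} (hk : 3 ≤ k) {M : Set (Triple k)} {μ α β : ℝ}
    (hl : Listed μ α β)
    (hM : ∀ T ∈ M, HasAffineGerms T ∨ ∃ μ' α' β', Listed μ' α' β' ∧ T.tgt = potential k μ' α' β' ∧
      ¬(μ' = μ ∧ α' = α ∧ β' = β))
    {θ θ' : ArbitraryElement k} {P : Pt} {F : Pt → Pt} (hc : IsLocalComposition M θ θ' P F)
    (hθ' : θ' = potential k μ α β) (hd : base (F P) ∈ (potential k μ α β).domain) :
    ∃ G, Adm θ θ' (base P) G ∧ G.Affine (base P) := by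
  induction hc with
  | single T hT P hP =>
    rcases hM T hT with h | ⟨μ', α', β', hl', e, hne⟩
    · obtain ⟨G, h1, -, h3⟩ := h P hP
      exact ⟨G, h1, h3⟩
    -- The target of the step is the tuple `θ'` itself, so the identity is an affine germ between
    -- two listed potentials with different parameters. The assumption that the endpoint lies in the
    -- domain supplies a point for this germ.
    · exfalso
      rw [← hθ', e] at hd
      have h1 := adm_refl hd
      rw [← e] at h1
      nth_rewrite 2 [hθ'] at h1
      rw [e] at h1
      exact hne (eq_of_affine hk hl' hl h1 (PB.affine_shift _ _))
  | cons T hT P hP θ F hF ih =>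
    obtain ⟨H, k1, k2⟩ := ih hθ' hd
    rcases hM T hT with h | ⟨μ', α', β', hl', e, hne⟩
    · obtain ⟨G, h1, h2, h3⟩ := h P hP
      have e : base (T.Φ P) = G.ψ (base P) := by rw [h2.eq_of_nhds, PB.base_map]
      rw [e] at k1 k2
      exact ⟨G.comp H, h1.comp k1, h3.comp h1.rg k1.rg k2⟩
    · rw [e, hθ'] at k1
      exact absurd (eq_of_affine hk hl' hl k1 k2) hne

/-- A generator is determined by its source, whose `(α, β)` is nonzero, whereas generators end at
`(α, β) = (0, 0)`. Without `b`, no element of `𝓑` or of its inverses ends at the source of `b`. A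
composition representing the inverse of `b` would then entail an affine germ from `μ / x²` to that
source. -/
theorem minimal_generators {k : ℕ} (hk : 3 ≤ k) {U 𝓑 : Set (Triple k)}
    (hU : ∀ T ∈ U, T.Φ.source.Nonempty ∧ HasAffineGerms T) (h𝓑 : 𝓑 ⊆ generators k)
    (hg : (linClass k).IsGenerating U 𝓑) : generators k ⊆ 𝓑 := by
  intro b hb
  by_contra hn
  obtain ⟨μ, α, β, hl, h1, h2, h3⟩ := generators_cases hb
  obtain ⟨P, hP⟩ := generators_nonempty hb
  have hαβ : ¬(α = 0 ∧ β = 0) := by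
    rcases h3 with ⟨rfl, -, -⟩ | ⟨rfl, -, -⟩ | ⟨-, -, rfl, -⟩ <;> norm_num
  have hQ : b.Φ P ∈ b.inv.Φ.source := b.Φ.map_source hP
  obtain ⟨F, hF, hFe⟩ := hg.2 b.inv (inv_mem_groupoid (generators_subset hk hb)) _ hQ
  have h0 : Listed μ 0 0 := Or.inl ⟨Or.inr (Or.inr rfl), rfl⟩
  have hM : ∀ T ∈ withInverses 𝓑 ∪ U, HasAffineGerms T ∨ ∃ μ' α' β', Listed μ' α' β' ∧
      T.tgt = potential k μ' α' β' ∧ ¬(μ' = μ ∧ α' = α ∧ β' = β) := by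
    rintro T ((hT | ⟨T, hT, rfl⟩) | hT)
    · obtain ⟨μ', α', β', -, -, h4, -⟩ := generators_cases (h𝓑 hT)
      exact Or.inr ⟨μ', 0, 0, Or.inl ⟨Or.inr (Or.inr rfl), rfl⟩, h4,
        fun h => hαβ ⟨h.2.1.symm, h.2.2.symm⟩⟩
    · obtain ⟨μ', α', β', hl', h4, -, h5⟩ := generators_cases (h𝓑 hT)
      refine Or.inr ⟨μ', α', β', hl', h4, ?_⟩
      rintro ⟨rfl, rfl, rfl⟩
      refine hn ?_
      have : b = T := by
        rcases h3 with ⟨e1, e2, e3⟩ | ⟨e1, e2, e3⟩ | ⟨e1, e2, e3, e4⟩ <;>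
        rcases h5 with ⟨f1, f2, f3⟩ | ⟨f1, f2, f3⟩ | ⟨f1, f2, f3, f4⟩ <;>
        first | (exfalso; linarith) | (rw [e3, f3]) | (rw [e4, f4])
      rwa [this]
    · exact Or.inl (hU T hT).2
  obtain ⟨G, hG, hGa⟩ := exists_affine_of_isLocalComposition hk hl hM hF h1 (by
    rw [hFe.eq_of_nhds]
    change base (b.Φ.symm (b.Φ P)) ∈ _
    rw [b.Φ.left_inv hP, ← h1]
    exact ((generators_subset hk hb).2.2.2.1 P hP).1)
  change Adm b.tgt b.src _ _ at hG
  rw [h1, h2] at hG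
  obtain ⟨-, h4, h5⟩ := eq_of_affine hk h0 hl hG hGa
  exact hαβ ⟨h4.symm, h5.symm⟩

/-! ### Stationary functions -/

/-- `f` is smooth and does not depend on `t` near `q`. -/
def Stationary (f : Base → ℝ) (q : Base) : Prop := ∀ᶠ q' in 𝓝 q, SmoothNear f q' ∧ dt f q' = 0

namespace Stationary

variable {f g : Base → ℝ} {q : Base}

theorem smooth (h : Stationary f q) : SmoothNear f q := h.self_of_nhds.1

theorem eq_zero (h : Stationary f q) : dt f q = 0 := h.self_of_nhds.2

theorem const (c : ℝ) : Stationary (fun _ => c) q :=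
  Eventually.of_forall fun _ => ⟨SmoothNear.const c, dt_const c⟩

theorem congr (hf : Stationary f q) (h : f =ᶠ[𝓝 q] g) : Stationary g q := by
  filter_upwards [hf, eventually_eventually_nhds.2 h] with q h1 h2
  exact ⟨h1.1.congr (EventuallyEq.symm h2), by rw [← dt_congr h2]; exact h1.2⟩

theorem dx (hf : Stationary f q) : Stationary (dx f) q := by
  filter_upwards [eventually_eventually_nhds.2 hf] with q h
  exact ⟨h.self_of_nhds.1.dx,
    (dt_dx_comm h.self_of_nhds.1).trans (dx_eq_zero (h.mono fun _ h => h.2))⟩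

theorem add (hf : Stationary f q) (hg : Stationary g q) : Stationary (fun q => f q + g q) q := by
  filter_upwards [hf, hg] with q h1 h2
  exact ⟨h1.1.add h2.1, by rw [dt_add h1.1.differentiableAt h2.1.differentiableAt, h1.2, h2.2]; simp⟩

theorem sub (hf : Stationary f q) (hg : Stationary g q) : Stationary (fun q => f q - g q) q := by
  filter_upwards [hf, hg] with q h1 h2
  exact ⟨h1.1.sub h2.1, by rw [dt_sub h1.1.differentiableAt h2.1.differentiableAt, h1.2, h2.2]; simp⟩

theorem mul (hf : Stationary f q) (hg : Stationary g q) : Stationary (fun q => f q * g q) q := by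
  filter_upwards [hf, hg] with q h1 h2
  exact ⟨h1.1.mul h2.1, by rw [dt_mul h1.1.differentiableAt h2.1.differentiableAt, h1.2, h2.2]; simp⟩

theorem inv (hf : Stationary f q) (h0 : f q ≠ 0) : Stationary (fun q => (f q)⁻¹) q := by
  filter_upwards [hf, hf.smooth.continuousAt.eventually_ne h0] with q h1 h2
  exact ⟨h1.1.inv h2, by rw [dt_inv h1.1.differentiableAt h2, h1.2]; simp⟩

theorem div (hf : Stationary f q) (hg : Stationary g q) (h0 : g q ≠ 0) :
    Stationary (fun q => f q / g q) q := by
  simpa only [div_eq_mul_inv] using hf.mul (hg.inv h0)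

theorem pow (hf : Stationary f q) (n : ℕ) : Stationary (fun q => f q ^ n) q := by
  induction n with
  | zero => simpa using const (1 : ℝ)
  | succ n ih => simpa only [pow_succ] using ih.mul hf

theorem comp {G : PB} (hG : G.Rg q) (hX : ∀ᶠ q' in 𝓝 q, dt G.X q' = 0)
    (hf : Stationary f (G.ψ q)) : Stationary (fun q => f (G.ψ q)) q := by
  filter_upwards [hG.eventually, hX, hG.continuousAt_ψ.eventually hf] with q h1 h2 h3
  exact ⟨h1.sc h3.1, by rw [h1.dt_c h3.1, h2, h3.2]; ring⟩

end Stationary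

/-- The transformation maps all equations with time-independent homogeneous part to such ones. -/
structure PB.Stat (G : PB) (q : Base) : Prop where
  T : Stationary (dt G.T) q
  X : ∀ᶠ q' in 𝓝 q, dt G.X q' = 0
  Vx : Stationary (fun q => dx G.V q / G.V q) q
  Vt : Stationary (fun q => dt G.V q / G.V q) q

theorem PB.Stat.stationary_X {G : PB} {q : Base} (h : G.Stat q) (hr : G.Rg q) :
    Stationary G.X q := by
  filter_upwards [h.X, hr.eventually] with q h1 h2 using ⟨h2.sX, h1⟩

theorem PB.Stat.stationary_Vxx {G : PB} {q : Base} (h : G.Stat q) (hr : G.Rg q) :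
    Stationary (fun q => dx (dx G.V) q / G.V q) q := by
  refine (h.Vx.dx.add (h.Vx.mul h.Vx)).congr ?_
  filter_upwards [hr.eventually] with q h
  have := h.hV
  rw [dx_div h.sV.dx.differentiableAt h.sV.differentiableAt h.hV]
  field_simp
  ring

/-- The push-forward of a tuple of coefficients has a time-independent homogeneous part. -/
theorem PB.Stat.pullCoef {G : PB} {q : Base} (h : G.Stat q) (hr : G.Rg q) {a : Base → ℕ → ℝ}
    (ha : ∀ i < 3, Stationary (fun q => a q i) (G.ψ q)) :
    ∀ i < 3, Stationary (fun q => G.pullCoef q (a (G.ψ q)) i) q := by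
  have sX := h.stationary_X hr
  have c : ∀ i < 3, Stationary (fun q => a (G.ψ q) i) q := fun i hi =>
    Stationary.comp (f := fun q => a q i) hr h.X (ha i hi)
  have sXt : Stationary (dt G.X) q := by
    filter_upwards [eventually_eventually_nhds.2 h.X, hr.eventually] with q h1 h2
    exact ⟨h2.sX.dt, dt_eq_zero h1⟩
  have sA : Stationary (fun q => G.pullA q (a (G.ψ q))) q :=
    (h.T.mul (c 0 (by norm_num))).div (sX.dx.pow 2) (pow_ne_zero 2 hr.hX)
  have sB : Stationary (fun q => G.pullB q (a (G.ψ q))) q :=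
    ((((h.T.mul (c 1 (by norm_num))).add sXt).sub (sA.mul sX.dx.dx)).div sX.dx hr.hX).sub
      (((Stationary.const 2).mul sA).mul h.Vx)
  have sC : Stationary (fun q => G.pullC q (a (G.ψ q))) q :=
    (((h.T.mul (c 2 (by norm_num))).add h.Vt).sub (sA.mul (h.stationary_Vxx hr))).sub
      (sB.mul h.Vx)
  intro i hi
  interval_cases i
  exacts [sA, sB, sC]

theorem stationary_co {k : ℕ} {θ : ArbitraryElement k} (hθ : θ ∈ (linClass k).S) {p : Base}
    (hp : p ∈ θ.domain) : ∀ i < 3, Stationary (fun q => co (θ.val q) i) p := by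
  intro i hi
  filter_upwards [θ.isOpen_domain.mem_nhds hp] with q hq
  refine ⟨smoothNear_co θ i hq, ?_⟩
  obtain ⟨-, h0, h1, h2⟩ := hθ q hq
  interval_cases i
  exacts [h0, h1, h2]

/-- Affine germs between equations of the class preserve the class. -/
theorem Adm.stat {k : ℕ} {θ θ' : ArbitraryElement k} (hθ : θ ∈ (linClass k).S)
    (hθ' : θ' ∈ (linClass k).S) {p : Base} {G : PB} (h : Adm θ θ' p G) (ha : G.Affine p) :
    G.Stat p := by
  have hr := h.rg
  have hX : ∀ᶠ q in 𝓝 p, dt G.X q = 0 := ha.mono fun q hq => hq.2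
  have sT : Stationary (dt G.T) p := by
    filter_upwards [hr.eventually, ha] with q h1 h2 using ⟨h1.sT.dt, h2.1⟩
  have sX : Stationary G.X p := by
    filter_upwards [hr.eventually, hX] with q h1 h2 using ⟨h1.sX, h2⟩
  have sXt : Stationary (dt G.X) p := by
    filter_upwards [eventually_eventually_nhds.2 hX, hr.eventually] with q h1 h2
    exact ⟨h2.sX.dt, dt_eq_zero h1⟩
  have b := stationary_co hθ h.mem
  have a : ∀ i < 3, Stationary (fun q => co (θ'.val (G.ψ q)) i) p := fun i hi =>
    Stationary.comp (f := fun q => co (θ'.val q) i) hr hX (stationary_co hθ' h.mem' i hi)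
  have b0 := b 0 (by norm_num)
  have hb0 : co (θ.val p) 0 ≠ 0 := (hθ p h.mem).1
  have hb0' : ∀ᶠ q in 𝓝 p, co (θ.val q) 0 ≠ 0 := b0.smooth.continuousAt.eventually_ne hb0
  -- The second determining equation is solved for `V_x / V`, and below the third one for `V_t / V`;
  -- every other quantity in them is already stationary.
  have sVx : Stationary (fun q => dx G.V q / G.V q) p := by
    refine Stationary.congr (((sT.mul (a 1 (by norm_num))).sub (((b0.mul sX.dx.dx).add
      ((b 1 (by norm_num)).mul sX.dx)).sub sXt)).div (((Stationary.const 2).mul b0).mul sX.dx)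
        (mul_ne_zero (mul_ne_zero two_ne_zero hb0) hr.hX)) ?_
    filter_upwards [h, hb0'] with q h1 h2
    obtain ⟨h3, -, -, h4⟩ := h1
    have := h3.hV
    have := h3.hX
    rw [div_eq_div_iff (by positivity) (by positivity)]
    linear_combination h4.h1
  have sVxx : Stationary (fun q => dx (dx G.V) q / G.V q) p := by
    refine (sVx.dx.add (sVx.mul sVx)).congr ?_
    filter_upwards [hr.eventually] with q h
    have := h.hV
    rw [dx_div h.sV.dx.differentiableAt h.sV.differentiableAt h.hV]
    field_simp
    ring
  refine ⟨sT, hX, sVx, ?_⟩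
  refine Stationary.congr ((((b0.mul sVxx).add ((b 1 (by norm_num)).mul sVx)).add
    (b 2 (by norm_num))).sub (sT.mul (a 2 (by norm_num)))) ?_
  filter_upwards [h] with q h1
  have hV := h1.1.hV
  have h2 := h1.2.2.2.h2
  field_simp
  linear_combination -h2

namespace GIso

variable (e : GIso) {q : Base}

/-- The inverse has `T'_t = 1 / T_t` and `V' = 1 / V` at corresponding points, and `X'_t = 0`
follows by differentiating `X ∘ ψ' = x`. Composition with a map satisfying `X'_t = 0` preserves
stationarity. -/
theorem stat_symm (h : ∀ q ∈ e.O, e.G.Stat q) : ∀ q ∈ e.O', e.G'.Stat q := by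
  intro q hq
  have hr' := e.rg' q hq
  have nb := e.isOpen'.mem_nhds hq
  have hX : ∀ᶠ q in 𝓝 q, dt e.G'.X q = 0 := by
    filter_upwards [nb] with q hq
    have hr' := e.rg' q hq
    have hr := e.rg _ (e.maps' q hq)
    have h1 := hr'.dt_c hr.sX
    have h2 : dt (fun q => e.G.X (e.G'.ψ q)) q = 0 := by
      rw [dt_congr (g := fun q => q.2), dt_snd]
      filter_upwards [e.isOpen'.mem_nhds hq] with y hy
      exact congrArg Prod.snd (e.right y hy)
    rw [h2, (h _ (e.maps' q hq)).X.self_of_nhds, zero_mul, zero_add] at h1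
    exact (mul_eq_zero.1 h1.symm).resolve_left hr.hX
  have hs := h _ (e.maps' q hq)
  have hr := e.rg _ (e.maps' q hq)
  have sT : Stationary (dt e.G'.T) q := by
    refine ((Stationary.comp hr' hX hs.T).inv hr.hT).congr ?_
    filter_upwards [nb] with q hq
    have := e.dt_T (e.maps' q hq)
    rw [e.right q hq] at this
    exact (eq_inv_of_mul_eq_one_left this).symm
  have sX' : Stationary e.G'.X q := by
    filter_upwards [hX, hr'.eventually] with q h1 h2 using ⟨h2.sX, h1⟩
  have hVe : ∀ᶠ q in 𝓝 q, e.G'.V =ᶠ[𝓝 q] fun q => (e.G.V (e.G'.ψ q))⁻¹ := by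
    refine eventually_eventually_nhds.2 ?_
    filter_upwards [nb] with q hq
    exact eq_inv_of_mul_eq_one_left (e.hV' q hq)
  refine ⟨sT, hX, ?_, ?_⟩
  · refine Stationary.congr ((Stationary.const (-1)).mul ((Stationary.comp hr' hX hs.Vx).mul
      sX'.dx)) ?_
    filter_upwards [hVe, nb] with q h1 hq
    have hr := e.rg _ (e.maps' q hq)
    have hr' := e.rg' q hq
    have := hr.hV
    rw [dx_congr h1, dx_inv (hr'.sc hr.sV).differentiableAt hr.hV, hr'.dx_c hr.sV, h1.eq_of_nhds]
    field_simp
  · refine Stationary.congr ((Stationary.const (-1)).mul ((Stationary.comp hr' hX hs.Vt).mul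
      sT)) ?_
    filter_upwards [hVe, nb, hX] with q h1 hq hX
    have hr := e.rg _ (e.maps' q hq)
    have hr' := e.rg' q hq
    have := hr.hV
    rw [dt_congr h1, dt_inv (hr'.sc hr.sV).differentiableAt hr.hV, hr'.dt_c hr.sV, h1.eq_of_nhds,
      hX]
    field_simp
    ring

end GIso

/-! ### Equivalence transformations -/

namespace GIso

variable (e : GIso)

/-- The point transformation given by mutually inverse pullback data. -/
noncomputable def Φ : OpenPartialHomeomorph Pt Pt where
  toFun := e.G.map
  invFun := e.G'.map
  source := {P | base P ∈ e.O}
  target := {P | base P ∈ e.O'}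
  map_source' _ hP := e.maps _ hP
  map_target' _ hP := e.maps' _ hP
  left_inv' _ hP := e.map_map hP
  right_inv' _ hP := e.symm.map_map hP
  open_source := e.isOpen.preimage continuous_base
  open_target := e.isOpen'.preimage continuous_base
  continuousOn_toFun _ hP := (e.rg _ hP).contDiffAt_map.continuousAt.continuousWithinAt
  continuousOn_invFun _ hP := (e.rg' _ hP).contDiffAt_map.continuousAt.continuousWithinAt

theorem isPointTransformation (hne : e.O.Nonempty) : IsPointTransformation e.Φ := by
  obtain ⟨q, hq⟩ := hne
  exact ⟨⟨(q.1, q.2, 0), hq⟩, fun P hP => (e.rg _ hP).contDiffAt_map.contDiffWithinAt,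
    fun P hP => (e.rg' _ hP).contDiffAt_map.contDiffWithinAt⟩

/-- The action on the second-order jets and the arbitrary elements. -/
noncomputable def ext (k : ℕ) (w : Jet × (Fin k → ℝ)) : Jet × (Fin k → ℝ) :=
  (e.G'.pullJet (e.G.ψ (base w.1.1)) w.1,
    fun i => e.G'.pullCoef (e.G.ψ (base w.1.1)) (co w.2) i)

/-- The transformation acts on the tuples of arbitrary elements of length `k`. -/
def Acts (k : ℕ) : Prop := k = 4 ∨ k = 3 ∧ (∀ q, e.G.W q = 0) ∧ ∀ q, e.G'.W q = 0

variable {e} {k : ℕ}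

theorem Acts.symm (h : e.Acts k) : e.symm.Acts k := h.imp_right fun h => ⟨h.1, h.2.2, h.2.1⟩

/-- For `k = 3` the truncated tuple loses its fourth entry, so this entry must be zero; it is,
because `W = 0` and the free term of `a` is zero. -/
theorem Acts.co_pullCoef (h : e.Acts k) {q : Base} (a : Fin k → ℝ) :
    ∀ i < 4, co (fun j : Fin k => e.G'.pullCoef q (co a) j) i = e.G'.pullCoef q (co a) i := by
  intro i hi
  rcases h with rfl | ⟨rfl, h1, h2⟩
  · simp [co, hi]
  · by_cases h3 : i < 3
    · simp [co, h3]
    · obtain rfl : i = 3 := by omega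
      have e1 : e.G'.W = fun _ => 0 := funext h2
      have e2 : dx (fun _ : Base => (0 : ℝ)) = fun _ => 0 := funext fun q => dx_const 0
      simp [co, PB.pullCoef, e1, e2]

theorem pullCoef_pullCoef (h : e.Acts k) {q : Base} (hq : q ∈ e.O) (a : Fin k → ℝ) :
    e.G.Det q (co a) (co fun j : Fin k => e.G'.pullCoef (e.G.ψ q) (co a) j) := by
  have h1 : e.G'.Det (e.G.ψ q) (co fun j : Fin k => e.G'.pullCoef (e.G.ψ q) (co a) j) (co a) :=
    (e.rg' _ (e.maps q hq)).det_iff.2 (h.co_pullCoef a)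
  have h2 := e.symm.det_symm (e.maps q hq) h1
  change e.G.Det (e.G'.ψ (e.G.ψ q)) _ _ at h2
  rwa [e.left q hq] at h2

/-- On jets, choose a quadratic representative and use that the two pullbacks cancel on functions.
On coefficients, use that the determining equations can be inverted and have a unique solution. -/
theorem ext_ext (h : e.Acts k) (w : Jet × (Fin k → ℝ)) (hw : base w.1.1 ∈ e.O) :
    e.symm.ext k (e.ext k w) = w := by
  set q := base w.1.1 with hq
  have hb : base (e.ext k w).1.1 = e.G.ψ q := rfl
  have hr := e.rg q hw
  have hr' := e.rg' _ (e.maps q hw)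
  refine Prod.ext ?_ (co_injective fun i hi => ?_)
  · change e.G.pullJet (e.G'.ψ (e.G.ψ q)) (e.G'.pullJet (e.G.ψ q) w.1) = w.1
    have s : SmoothNear (quad w.1) (e.G'.ψ (e.G.ψ q)) := smoothNear_quad w.1
    have h1 := hr'.jet_pull s
    rw [e.left q hw, hq, jet_quad] at h1
    rw [e.left q hw, ← h1, ← hr.jet_pull (hr'.s_pull s),
      jet_congr (e.pull_pull_eventuallyEq hw), hq, jet_quad]
  · have hi4 : i < 4 := by rcases h with rfl | ⟨rfl, -⟩ <;> omega
    change co (fun j : Fin k => e.G.pullCoef (e.G'.ψ (e.G.ψ q))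
      (co fun j : Fin k => e.G'.pullCoef (e.G.ψ q) (co w.2) j) j) i = _
    have h1 := h.symm.co_pullCoef (q := e.G'.ψ (e.G.ψ q))
      (fun j : Fin k => e.G'.pullCoef (e.G.ψ q) (co w.2) j) i hi4
    change co (fun j : Fin k => e.G.pullCoef _ _ j) i = e.G.pullCoef _ _ i at h1
    rw [h1, e.left q hw]
    exact (hr.det_iff.1 (pullCoef_pullCoef h hw w.2) i hi4).symm

theorem contDiffAt_ext {w : Jet × (Fin k → ℝ)} (hw : base w.1.1 ∈ e.O) :
    ContDiffAt ℝ ∞ (e.ext k) w := by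
  have hr := e.rg _ hw
  have hr' := e.rg' _ (e.maps _ hw)
  have hb : ContDiffAt ℝ ∞ (fun w : Jet × (Fin k → ℝ) => base w.1.1) w := by unfold base; fun_prop
  have key : ∀ {f : Base → ℝ}, SmoothNear f (e.G.ψ (base w.1.1)) →
      ContDiffAt ℝ ∞ (fun w : Jet × (Fin k → ℝ) => f (e.G.ψ (base w.1.1))) w := fun {f} hf =>
    ContDiffAt.comp (g := fun q => f (e.G.ψ q)) w (hr.sc hf).contDiffAt hb
  have kT := key hr'.sT.dt
  have kTt := key hr'.sT.dt.dt
  have kXt := key hr'.sX.dt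
  have kXx := key hr'.sX.dx
  have kXtt := key hr'.sX.dt.dt
  have kXtx := key hr'.sX.dt.dx
  have kXxx := key hr'.sX.dx.dx
  have kV := key hr'.sV
  have kVt := key hr'.sV.dt
  have kVx := key hr'.sV.dx
  have kVtt := key hr'.sV.dt.dt
  have kVtx := key hr'.sV.dt.dx
  have kVxx := key hr'.sV.dx.dx
  have kW := key hr'.sW
  have kWt := key hr'.sW.dt
  have kWx := key hr'.sW.dx
  have kWtt := key hr'.sW.dt.dt
  have kWtx := key hr'.sW.dt.dx
  have kWxx := key hr'.sW.dx.dx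
  have k1 : ContDiffAt ℝ ∞ (fun w : Jet × (Fin k → ℝ) => (e.G.ψ (base w.1.1)).1) w :=
    key SmoothNear.fst
  have k2 : ContDiffAt ℝ ∞ (fun w : Jet × (Fin k → ℝ) => (e.G.ψ (base w.1.1)).2) w :=
    key SmoothNear.snd
  have kc : ∀ i, ContDiffAt ℝ ∞ (fun w : Jet × (Fin k → ℝ) => co w.2 i) w := by
    intro i
    by_cases h : i < k
    · simp only [co, h, dif_pos]; fun_prop
    · simp only [co, h, dif_neg, not_false_iff]; exact contDiffAt_const
  have sVx := kVx.div kV hr'.hV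
  have sVt := kVt.div kV hr'.hV
  have sVxx := kVxx.div kV hr'.hV
  have sA : ContDiffAt ℝ ∞ (fun w : Jet × (Fin k → ℝ) =>
      e.G'.pullA (e.G.ψ (base w.1.1)) (co w.2)) w :=
    (kT.mul (kc 0)).div (kXx.pow 2) (pow_ne_zero 2 hr'.hX)
  have sB : ContDiffAt ℝ ∞ (fun w : Jet × (Fin k → ℝ) =>
      e.G'.pullB (e.G.ψ (base w.1.1)) (co w.2)) w :=
    ((((kT.mul (kc 1)).add kXt).sub (sA.mul kXxx)).div kXx hr'.hX).sub
      ((contDiffAt_const.mul sA).mul sVx)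
  have sC : ContDiffAt ℝ ∞ (fun w : Jet × (Fin k → ℝ) =>
      e.G'.pullC (e.G.ψ (base w.1.1)) (co w.2)) w :=
    (((kT.mul (kc 2)).add sVt).sub (sA.mul sVxx)).sub (sB.mul sVx)
  refine ContDiffAt.prodMk ?_ (contDiffAt_pi.2 fun i => ?_)
  · unfold PB.pullJet
    fun_prop
  · obtain ⟨i, hi⟩ := i
    match i with
    | 0 => exact sA
    | 1 => exact sB
    | 2 => exact sC
    | 3 => exact ((((kV.mul kT).mul (kc 3)).add kWt).sub (sA.mul kWxx)).sub (sB.mul kWx) |>.sub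
            (sC.mul kW)
    | _ + 4 => exact contDiffAt_const

/-- The extension of the transformation to the jets and the arbitrary elements. -/
noncomputable def extended (h : e.Acts k) : ExtendedTransformation k where
  full :=
    { toFun := e.ext k
      invFun := e.symm.ext k
      source := {w | base w.1.1 ∈ e.O}
      target := {w | base w.1.1 ∈ e.O'}
      map_source' := fun w hw => e.maps _ hw
      map_target' := fun w hw => e.maps' _ hw
      left_inv' := fun w hw => ext_ext h w hw
      right_inv' := fun w hw => ext_ext h.symm w hw
      open_source := e.isOpen.preimage (continuous_base.comp (by fun_prop))
      open_target := e.isOpen'.preimage (continuous_base.comp (by fun_prop))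
      continuousOn_toFun := fun w hw => (contDiffAt_ext hw).continuousAt.continuousWithinAt
      continuousOn_invFun := fun w hw =>
        (contDiffAt_ext (e := e.symm) hw).continuousAt.continuousWithinAt }
  Φ := e.Φ

theorem extended_symm (h : e.Acts k) : (extended h).symm = extended h.symm := rfl

theorem graph_pull {f : Base → ℝ} {q : Base} (hq : q ∈ e.O) :
    e.Φ (graphPt f q) = graphPt (e.G'.pull f) (e.G.ψ q) := by
  have h1 := e.hV q hq
  have h2 := e.hW q hq
  have h3 := (e.rg q hq).hV
  refine Prod.ext rfl (Prod.ext rfl ?_)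
  change (f q - e.G.W q) / e.G.V q = e.G'.V (e.G.ψ q) * f (e.G'.ψ (e.G.ψ q)) + e.G'.W (e.G.ψ q)
  rw [e.left q hq]
  field_simp
  linear_combination (-f q) * h1 - h2

theorem prolongs_extended (h : e.Acts k) {w : Jet × (Fin k → ℝ)} (hw : base w.1.1 ∈ e.O) :
    Prolongs e.Φ w.1 ((extended h).full w).1 := by
  have hr' := e.rg' _ (e.maps _ hw)
  have s : SmoothNear (quad w.1) (e.G'.ψ (e.G.ψ (base w.1.1))) := smoothNear_quad w.1
  have h1 := hr'.jet_pull s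
  rw [e.left _ hw, jet_quad] at h1
  have h2 : graphPt (quad w.1) (base w.1.1) = w.1.1 := by
    have := congrArg Prod.fst (jet_quad w.1); exact this
  refine ⟨quad w.1, e.G'.pull (quad w.1), base w.1.1, e.G.ψ (base w.1.1), smoothNear_quad _,
    hr'.s_pull s, jet_quad _, h1, hw, ?_, ?_⟩
  · have h3 := e.graph_pull (f := quad w.1) hw
    rw [h2] at h3
    rw [h3]
    exact congrArg Prod.fst h1
  · filter_upwards [e.isOpen.mem_nhds hw] with q hq
    exact e.graph_pull hq

open Classical in
/-- The push-forward of an arbitrary element. -/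
noncomputable def push (e : GIso) (θ : ArbitraryElement k)
    (hne : (e.O ∩ θ.domain).Nonempty) : ArbitraryElement k where
  domain := e.O' ∩ e.G'.ψ ⁻¹' θ.domain
  val q := if q ∈ e.O' ∩ e.G'.ψ ⁻¹' θ.domain then
    fun j => e.G'.pullCoef q (co (θ.val (e.G'.ψ q))) j else 0
  isOpen_domain := by
    have : ContinuousOn e.G'.ψ e.O' := fun q hq =>
      (e.rg' q hq).continuousAt_ψ.continuousWithinAt
    exact this.isOpen_inter_preimage e.isOpen' θ.isOpen_domain
  nonempty_domain := by
    obtain ⟨q, h1, h2⟩ := hne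
    refine ⟨e.G.ψ q, e.maps q h1, ?_⟩
    rw [mem_preimage, e.left q h1]; exact h2
  smooth := by
    intro q hq
    have hr := e.rg' q hq.1
    have h1 : ContDiffAt ℝ ∞ e.G'.ψ q := hr.sT.contDiffAt.prodMk hr.sX.contDiffAt
    have h2 : ContDiffAt ℝ ∞ (fun q => θ.val (e.G'.ψ q)) q :=
      (θ.smooth.contDiffAt (θ.isOpen_domain.mem_nhds hq.2)).comp q h1
    -- The zero jet is an arbitrary filler: only the coefficient component of `ext` is used.
    have h3 := (contDiffAt_ext (k := k) (e := e)
      (w := ((((e.G'.ψ q).1, (e.G'.ψ q).2, 0), (0, 0), (0, 0, 0)), θ.val (e.G'.ψ q)))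
      (e.maps' q hq.1)).comp q (((h1.fst.prodMk (h1.snd.prodMk contDiffAt_const)).prodMk
        (contDiffAt_const.prodMk contDiffAt_const)).prodMk h2)
    refine h3.snd.contDiffWithinAt.congr (fun y hy => ?_) ?_
    · rw [if_pos hy]
      change _ = fun j : Fin k => e.G'.pullCoef (e.G.ψ (e.G'.ψ y)) _ j
      rw [e.right y hy.1]
    · rw [if_pos hq]
      change _ = fun j : Fin k => e.G'.pullCoef (e.G.ψ (e.G'.ψ q)) _ j
      rw [e.right q hq.1]
  val_off _ hp := if_neg hp

theorem push_val {θ : ArbitraryElement k} {hne : (e.O ∩ θ.domain).Nonempty} {q : Base}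
    (hq : q ∈ (e.push θ hne).domain) :
    (e.push θ hne).val q = fun j : Fin k => e.G'.pullCoef q (co (θ.val (e.G'.ψ q))) j :=
  if_pos hq

theorem push_mem (h : e.Acts k) (hst : ∀ q ∈ e.O', e.G'.Stat q) {θ : ArbitraryElement k}
    (hθ : θ ∈ (linClass k).S) (hne : (e.O ∩ θ.domain).Nonempty) :
    e.push θ hne ∈ (linClass k).S := by
  intro q hq
  have hr := e.rg' q hq.1
  have st := (hst q hq.1).pullCoef hr (a := fun q => co (θ.val q)) (stationary_co hθ hq.2)
  have key : ∀ i < 4, (fun q => co ((e.push θ hne).val q) i) =ᶠ[𝓝 q]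
      fun q => e.G'.pullCoef q (co (θ.val (e.G'.ψ q))) i := by
    intro i hi
    filter_upwards [(e.push θ hne).isOpen_domain.mem_nhds hq] with y hy
    rw [push_val hy, h.co_pullCoef _ i hi]
  refine ⟨?_, ?_, ?_, ?_⟩
  · rw [(key 0 (by norm_num)).eq_of_nhds]
    exact div_ne_zero (mul_ne_zero hr.hT (hθ _ hq.2).1) (pow_ne_zero 2 hr.hX)
  · rw [dt_congr (key 0 (by norm_num))]; exact (st 0 (by norm_num)).eq_zero
  · rw [dt_congr (key 1 (by norm_num))]; exact (st 1 (by norm_num)).eq_zero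
  · rw [dt_congr (key 2 (by norm_num))]; exact (st 2 (by norm_num)).eq_zero

theorem adm_push (h : e.Acts k) {θ : ArbitraryElement k} {hne : (e.O ∩ θ.domain).Nonempty}
    {p : Base} (hp : p ∈ e.O) (hd : p ∈ θ.domain) : Adm θ (e.push θ hne) p e.G := by
  filter_upwards [e.isOpen.mem_nhds hp, θ.isOpen_domain.mem_nhds hd] with q h1 h2
  have h3 : e.G.ψ q ∈ (e.push θ hne).domain :=
    ⟨e.maps q h1, by rw [mem_preimage, e.left q h1]; exact h2⟩
  refine ⟨e.rg q h1, h2, h3, ?_⟩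
  rw [push_val h3, e.left q h1]
  exact pullCoef_pullCoef h h1 _

theorem exists_mapsTo (h : e.Acts k) (hst : ∀ q ∈ e.O', e.G'.Stat q) {θ : ArbitraryElement k}
    (hθ : θ ∈ (linClass k).S) :
    ∃ θ' ∈ (linClass k).S, (linClass k).MapsTo (extended h) θ θ' := by
  by_cases hne : (e.O ∩ θ.domain).Nonempty
  · refine ⟨e.push θ hne, push_mem h hst hθ hne, fun w hw hd hv => ?_⟩
    have hw' : base w.1.1 ∈ e.O := hw
    have ha := adm_push (hne := hne) h hw' hd
    refine ⟨ha.mem', ?_, fun z z' hz hp hl => ?_⟩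
    · change (fun j : Fin k => e.G'.pullCoef (e.G.ψ (base w.1.1)) (co w.2) j) =
        (e.push θ hne).val (e.G.ψ (base w.1.1))
      rw [push_val ha.mem', e.left _ hw', ← hv]
    · exact mem_locus_of_prolongs (Φ := e.Φ) ha EventuallyEq.rfl hz hp hl
  -- When the domain of `θ` misses `e.O` the condition is empty, and any member of the class serves
  -- as the image.
  · exact ⟨θ, hθ, fun w hw hd => absurd ⟨_, hw, hd⟩ hne⟩

theorem extended_mem (h : e.Acts k) (hne : e.O.Nonempty) (hst : ∀ q ∈ e.O, e.G.Stat q) :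
    extended h ∈ (linClass k).equivalenceGroup := by
  refine ⟨e.isPointTransformation hne, fun w hw => (contDiffAt_ext hw).contDiffWithinAt,
    fun w hw => (contDiffAt_ext (e := e.symm) hw).contDiffWithinAt,
    fun w hw => prolongs_extended h hw, fun P hP => ⟨((P, (0, 0), (0, 0, 0)), 0), hP, rfl⟩,
    fun θ hθ => exists_mapsTo h (e.stat_symm hst) hθ, fun θ hθ => ?_⟩
  rw [extended_symm]
  exact exists_mapsTo h.symm hst hθ

theorem hasGerms {θ θ' : ArbitraryElement k} (h : ∀ q ∈ e.O, Adm θ θ' q e.G) :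
    HasGerms (⟨θ, e.Φ, θ'⟩ : Triple k) := fun _ hP => ⟨e.G, h _ hP, EventuallyEq.rfl⟩

theorem mem_groupoid {θ θ' : ArbitraryElement k} (hθ : θ ∈ (linClass k).S)
    (hθ' : θ' ∈ (linClass k).S) (hne : e.O.Nonempty) (h : ∀ q ∈ e.O, Adm θ θ' q e.G) :
    (⟨θ, e.Φ, θ'⟩ : Triple k) ∈ (linClass k).groupoid :=
  mem_groupoid_of_hasGerms hθ hθ' (e.isPointTransformation hne).1 (hasGerms h)

theorem mem_actionGroupoid (ha : e.Acts k) (hst : ∀ q ∈ e.O, e.G.Stat q)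
    {θ θ' : ArbitraryElement k} (hθ : θ ∈ (linClass k).S) (hθ' : θ' ∈ (linClass k).S)
    (hne : e.O.Nonempty) (h : ∀ q ∈ e.O, Adm θ θ' q e.G) :
    (⟨θ, e.Φ, θ'⟩ : Triple k) ∈ (linClass k).actionGroupoid := by
  refine ⟨mem_groupoid hθ hθ' hne h, extended ha, extended_mem ha hne hst, fun P hP =>
    ⟨hP, rfl, ⟨((P, (0, 0), (0, 0, 0)), θ.val (base P)), hP, rfl, rfl⟩, fun w hw hw1 hw2 => ?_⟩⟩
  have hP' : base P ∈ e.O := hP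
  change w.2 = θ.val (base P) at hw2
  change (fun j : Fin k => e.G'.pullCoef (e.G.ψ (base w.1.1)) (co w.2) j) = θ'.val (e.G.ψ (base P))
  rw [hw1, hw2]
  have h1 := e.det_symm hP' (h _ hP').self_of_nhds.2.2.2
  refine co_injective fun i hi => ?_
  have hi4 : i < 4 := by rcases ha with rfl | ⟨rfl, -⟩ <;> omega
  rw [ha.co_pullCoef _ i hi4]
  exact ((e.rg' _ (e.maps _ hP')).det_iff.1 h1 i hi4).symm

end GIso

/-! ### Affine germs come from the equivalence group and the superposition of solutions -/

section Germs

variable {k : ℕ}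

theorem Adm.exists_gIso {θ θ' : ArbitraryElement k} {p : Base} {G : PB} (h : Adm θ θ' p G)
    {N : Set Base} (hN : N ∈ 𝓝 p) :
    ∃ e : GIso, e.G = G ∧ p ∈ e.O ∧ e.O ⊆ N ∧ ∀ q ∈ e.O, Adm θ θ' q e.G := by
  obtain ⟨e, rfl, h1, h2⟩ := h.rg.exists_gIso (inter_mem hN h.eventually)
  exact ⟨e, rfl, h1, fun q hq => (h2 hq).1, fun q hq => (h2 hq).2⟩

/-- By `Adm.stat` an affine germ between two equations of the class keeps the whole class. For `k =
4` the shift `W` is harmless, since it affects only `D`, which may be any function of `(t, x)`. -/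
theorem exists_mem_actionGroupoid {θ θ' : ArbitraryElement 4} (hθ : θ ∈ (linClass 4).S)
    (hθ' : θ' ∈ (linClass 4).S) {p : Base} {G : PB} (h : Adm θ θ' p G) (ha : G.Affine p) {P : Pt}
    (hP : base P = p) : ∃ T ∈ (linClass 4).actionGroupoid, T.src = θ ∧ T.tgt = θ' ∧
      P ∈ T.Φ.source ∧ T.Φ =ᶠ[𝓝 P] G.map := by
  obtain ⟨e, rfl, h1, h2, h3⟩ := h.exists_gIso ha.eventually
  subst hP
  exact ⟨⟨θ, e.Φ, θ'⟩, e.mem_actionGroupoid (Or.inl rfl) (fun q hq => (h3 q hq).stat hθ hθ' (h2 hq))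
    hθ hθ' ⟨_, h1⟩ h3, rfl, rfl, h1, EventuallyEq.rfl⟩

/-- The same transformation of the independent variables and the same scaling of `u`, without shift
of `u`. -/
def GIso.homog (e : GIso) : GIso where
  G := { e.G with W := fun _ => 0 }
  G' := { e.G' with W := fun _ => 0 }
  O := e.O
  O' := e.O'
  isOpen := e.isOpen
  isOpen' := e.isOpen'
  rg q hq := { e.rg q hq with sW := SmoothNear.const 0 }
  rg' q hq := { e.rg' q hq with sW := SmoothNear.const 0 }
  maps := e.maps
  maps' := e.maps'
  left := e.left
  right := e.right
  hV := e.hV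
  hV' := e.hV'
  hW q _ := by simp
  hW' q _ := by simp

/-- The shift of `u` by a function which is smooth on an open set. -/
def GIso.shift (f : Base → ℝ) (O : Set Base) (hO : IsOpen O) (hf : ∀ q ∈ O, SmoothNear f q) :
    GIso where
  G := PB.shift fun q => -f q
  G' := PB.shift f
  O := O
  O' := O
  isOpen := hO
  isOpen' := hO
  rg q hq := PB.rg_shift (hf q hq).neg
  rg' q hq := PB.rg_shift (hf q hq)
  maps _ hq := hq
  maps' _ hq := hq
  left _ _ := rfl
  right _ _ := rfl
  hV _ _ := one_mul 1
  hV' _ _ := one_mul 1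
  hW q _ := by simp [PB.shift, PB.ψ]
  hW' q _ := by simp [PB.shift, PB.ψ]

theorem HasGerms.comp {T T' : Triple k} (h : HasGerms T) (h' : HasGerms T')
    (he : T.tgt = T'.src) : HasGerms (T.comp T') := by
  intro P hP
  simp only [Triple.comp, OpenPartialHomeomorph.trans_source] at hP
  obtain ⟨G, h1, h2⟩ := h P hP.1
  obtain ⟨H, k1, k2⟩ := h' _ hP.2
  have e : base (T.Φ P) = G.ψ (base P) := by rw [h2.eq_of_nhds, PB.base_map]
  rw [e, ← he] at k1
  refine ⟨G.comp H, h1.comp k1, ?_⟩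
  have hc : Tendsto base (𝓝 P) (𝓝 (base P)) := continuous_base.continuousAt
  filter_upwards [h2, (T.Φ.continuousAt hP.1).eventually k2, hc.eventually h1.rg.eventually,
    hc.eventually (h1.rg.continuousAt_ψ.eventually k1.rg.eventually)] with Q e1 e2 e3 e4
  rw [PB.comp_map e3.hV e4.hV, ← e1]
  exact e2

/-- The first three determining equations do not involve `W`, so the same germ with `W = 0` is
admissible and comes from the equivalence group. What remains is adding `e.G'.W` to the new unknown
function. The fourth determining equation of the inverse germ says that this function solves the
target equation, so the second factor is a superposition of solutions. -/
theorem exists_mem_actionLinGroupoid {θ θ' : ArbitraryElement 3} (hθ : θ ∈ (linClass 3).S)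
    (hθ' : θ' ∈ (linClass 3).S) {p : Base} {G : PB} (h : Adm θ θ' p G) (ha : G.Affine p) {P : Pt}
    (hP : base P = p) : ∃ T ∈ (linClass 3).actionLinGroupoid, T.src = θ ∧ T.tgt = θ' ∧
      P ∈ T.Φ.source ∧ T.Φ =ᶠ[𝓝 P] G.map := by
  obtain ⟨e, rfl, h1, h2, h3⟩ := h.exists_gIso ha.eventually
  subst hP
  have c0 : dx (fun _ : Base => (0 : ℝ)) = fun _ => 0 := funext fun q => dx_const 0
  have c3 : ∀ a : Fin 3 → ℝ, co a 3 = 0 := fun a => by simp [co]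
  have h4 : ∀ q ∈ e.homog.O, Adm θ θ' q e.homog.G := by
    intro q hq
    filter_upwards [h3 q hq, e.isOpen.mem_nhds hq] with q' h5 h6
    refine ⟨e.homog.rg q' h6, h5.2.1, h5.2.2.1, h5.2.2.2.h0, h5.2.2.2.h1, h5.2.2.2.h2, ?_⟩
    simp [c3, GIso.homog, c0]
  have h5 := e.homog.mem_actionGroupoid (k := 3) (Or.inr ⟨rfl, fun _ => rfl, fun _ => rfl⟩)
    (fun q hq => (h4 q hq).stat hθ hθ' (h2 hq)) hθ hθ' ⟨_, h1⟩ h4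
  have s : ∀ q ∈ e.O', SmoothNear e.G'.W q := fun q hq => (e.rg' q hq).sW
  set e' := GIso.shift e.G'.W e.O' e.isOpen' s with he'
  have hres : ∀ q ∈ e.O', q ∈ θ'.domain ∧ res (co (θ'.val q)) e.G'.W q = 0 := by
    intro q hq
    have h6 := (h3 _ (e.maps' q hq)).symm (e.maps' q hq)
    rw [e.right q hq] at h6
    refine ⟨h6.mem, ?_⟩
    have := h6.self_of_nhds.2.2.2.h3
    rw [c3, c3] at this
    rw [res, c3]
    linarith
  have h6 : ∀ q ∈ e'.O, Adm θ' θ' q e'.G := by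
    intro q hq
    refine adm_shift (s q hq).neg ?_
    filter_upwards [e.isOpen'.mem_nhds hq] with y hy
    refine ⟨(hres y hy).1, (hres y hy).1, fun _ _ => rfl, ?_⟩
    have n1 : dx (fun q => -e.G'.W q) =ᶠ[𝓝 y] fun q => -dx e.G'.W q :=
      Eventually.of_forall fun q => dx_neg
    have := (hres y hy).2
    rw [c3]
    simp only [res, dt_neg, dx_neg, dx_congr n1, c3] at this ⊢
    linarith
  have h7 : (⟨θ', e'.Φ, θ'⟩ : Triple 3) ∈ (linClass 3).linGroupoid := by
    refine ⟨e'.mem_groupoid hθ' hθ' ⟨_, e.maps _ h1⟩ h6, rfl, e.G'.W, fun Q hQ => ⟨s _ hQ,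
      jet_mem_locus.2 (hres _ hQ), ?_⟩⟩
    change PB.map _ Q = _
    simp [PB.map, he', GIso.shift, PB.shift, base]
  refine ⟨Triple.comp ⟨θ, e.homog.Φ, θ'⟩ ⟨θ', e'.Φ, θ'⟩, ⟨?_, _, h5, _, h7, rfl, rfl⟩, rfl, rfl, ?_, ?_⟩
  · refine mem_groupoid_of_hasGerms hθ hθ' ⟨P, ?_⟩ ((e.homog.hasGerms h4).comp (e'.hasGerms h6) rfl)
    exact ⟨h1, e.maps _ h1⟩
  · exact ⟨h1, e.maps _ h1⟩
  · filter_upwards [continuous_base.continuousAt.eventually (e.isOpen.mem_nhds h1)] with Q hQ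
    change e'.G.map (e.homog.G.map Q) = e.G.map Q
    have h8 := e.hW _ hQ
    have h9 := (e.rg _ hQ).hV
    simp only [PB.map, he', GIso.shift, PB.shift, GIso.homog, base, PB.ψ] at h8 h9 ⊢
    refine Prod.ext rfl (Prod.ext rfl ?_)
    field_simp
    linear_combination h8

/-! ### Compositions of generators and affine transformations -/

/-- The generators, their inverses, and the transformations with affine germs. -/
def pieces (k : ℕ) : Set (Triple k) :=
  withInverses (generators k) ∪ {T | T ∈ (linClass k).groupoid ∧ HasAffineGerms T}

theorem Triple.inv_inv (T : Triple k) : T.inv.inv = T := by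
  rfl

theorem PB.Affine.symm {e : GIso} {p : Base} (hp : p ∈ e.O) (h : e.G.Affine p) :
    e.G'.Affine (e.G.ψ p) := by
  have hc : Tendsto e.G'.ψ (𝓝 (e.G.ψ p)) (𝓝 p) := by
    have := (e.rg' _ (e.maps p hp)).continuousAt_ψ
    rwa [ContinuousAt, e.left p hp] at this
  filter_upwards [hc.eventually h.eventually, e.isOpen'.mem_nhds (e.maps p hp)] with y h1 hy
  have hX : ∀ y ∈ e.O', dt e.G.X (e.G'.ψ y) = 0 → dt e.G'.X y = 0 := by
    intro q hq h0
    have hr' := e.rg' q hq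
    have hr := e.rg _ (e.maps' q hq)
    have h1 := hr'.dt_c hr.sX
    have h2 : dt (fun q => e.G.X (e.G'.ψ q)) q = 0 := by
      rw [dt_congr (g := fun q => q.2), dt_snd]
      filter_upwards [e.isOpen'.mem_nhds hq] with y hy
      exact congrArg Prod.snd (e.right y hy)
    rw [h2, h0, zero_mul, zero_add] at h1
    exact (mul_eq_zero.1 h1.symm).resolve_left hr.hX
  have hr' := e.rg' y hy
  have hr := e.rg _ (e.maps' y hy)
  refine ⟨?_, hX y hy h1.self_of_nhds.2⟩
  rw [dt_congr (g := fun q => (dt e.G.T (e.G'.ψ q))⁻¹), dt_inv (hr'.sc hr.sT.dt).differentiableAt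
    hr.hT, hr'.dt_c hr.sT.dt, h1.self_of_nhds.1, hr.dxdtT]
  · simp
  · filter_upwards [e.isOpen'.mem_nhds hy] with q hq
    have := e.dt_T (e.maps' q hq)
    rw [e.right q hq] at this
    exact eq_inv_of_mul_eq_one_left this

theorem HasAffineGerms.inv {T : Triple k} (h : HasAffineGerms T) : HasAffineGerms T.inv := by
  intro Q hQ
  have hP := T.Φ.map_target hQ
  obtain ⟨G, h1, h2, ha⟩ := h _ hP
  obtain ⟨e, rfl, h3, -⟩ := h1.rg.exists_gIso univ_mem
  have h4 := symm_eventuallyEq hP h3 h2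
  rw [T.Φ.right_inv hQ] at h4
  have h5 := h1.symm h3
  have h6 := ha.symm h3
  rw [← PB.base_map, ← h2.eq_of_nhds, T.Φ.right_inv hQ] at h5 h6
  exact ⟨e.G', h5, h4, h6⟩

theorem inv_mem_pieces {T : Triple k} (hT : T ∈ pieces k) : T.inv ∈ pieces k := by
  rcases hT with (hT | ⟨T, hT, rfl⟩) | hT
  · exact Or.inl (Or.inr ⟨T, hT, rfl⟩)
  · exact Or.inl (Or.inl (by rwa [Triple.inv_inv]))
  · exact Or.inr ⟨inv_mem_groupoid hT.1, hT.2.inv⟩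

theorem EquationClass.IsLocalComposition.append {M : Set (Triple k)} {θ θ' θ'' : ArbitraryElement k} {P : Pt}
    {F F' : Pt → Pt} (h : IsLocalComposition M θ θ' P F)
    (h' : IsLocalComposition M θ' θ'' (F P) F') : IsLocalComposition M θ θ'' P (F' ∘ F) := by
  induction h with
  | single T hT P hP => exact .cons T hT P hP _ _ h'
  | cons T hT P hP θ F hF ih => exact .cons T hT P hP _ _ (ih h')

theorem EquationClass.IsLocalComposition.continuousAt {M : Set (Triple k)} {θ θ' : ArbitraryElement k} {P : Pt}
    {F : Pt → Pt} (h : IsLocalComposition M θ θ' P F) : ContinuousAt F P := by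
  induction h with
  | single T hT P hP => exact T.Φ.continuousAt hP
  | cons T hT P hP θ F hF ih => exact ContinuousAt.comp ih (T.Φ.continuousAt hP)

/-- The set `pieces k` is closed under inversion, so a chain can be run backwards. -/
theorem EquationClass.IsLocalComposition.exists_inverse {θ θ' : ArbitraryElement k} {P : Pt} {F : Pt → Pt}
    (h : IsLocalComposition (pieces k) θ θ' P F) :
    ∃ F', IsLocalComposition (pieces k) θ' θ (F P) F' ∧ ∀ᶠ Q in 𝓝 P, F' (F Q) = Q := by
  induction h with
  | single T hT P hP =>
    refine ⟨T.Φ.symm, .single T.inv (inv_mem_pieces hT) _ (T.Φ.map_source hP), ?_⟩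
    filter_upwards [T.Φ.open_source.mem_nhds hP] with Q hQ using T.Φ.left_inv hQ
  | cons T hT P hP θ F hF ih =>
    obtain ⟨F', h1, h2⟩ := ih
    refine ⟨T.Φ.symm ∘ F', h1.append ?_, ?_⟩
    · rw [h2.self_of_nhds]
      exact .single T.inv (inv_mem_pieces hT) _ (T.Φ.map_source hP)
    · filter_upwards [T.Φ.open_source.mem_nhds hP, (T.Φ.continuousAt hP).eventually h2] with Q h3 h4
      simp only [Function.comp_apply, h4, T.Φ.left_inv h3]

/-- The germ of `G` at `p` is an admissible transformation from `θ` to `θ'` which is a composition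
of generators, their inverses and affine transformations. -/
def Gen (θ θ' : ArbitraryElement k) (p : Base) (G : PB) : Prop :=
  Adm θ θ' p G ∧ ∀ P, base P = p → ∃ F, IsLocalComposition (pieces k) θ θ' P F ∧ F =ᶠ[𝓝 P] G.map

namespace Gen

variable {θ θ' θ'' : ArbitraryElement k} {p : Base} {G H : PB}

theorem of_affine (hθ : θ ∈ (linClass k).S) (hθ' : θ' ∈ (linClass k).S) (h : Adm θ θ' p G)
    (ha : G.Affine p) : Gen θ θ' p G := by
  refine ⟨h, fun P hP => ?_⟩
  obtain ⟨e, rfl, h1, h2, h3⟩ := h.exists_gIso ha.eventually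
  subst hP
  refine ⟨e.Φ, .single ⟨θ, e.Φ, θ'⟩ (Or.inr ⟨e.mem_groupoid hθ hθ' ⟨_, h1⟩ h3, fun Q hQ => ?_⟩) P h1,
    EventuallyEq.rfl⟩
  exact ⟨e.G, h3 _ hQ, EventuallyEq.rfl, h2 hQ⟩

theorem comp (h : Gen θ θ' p G) (h' : Gen θ' θ'' (G.ψ p) H) : Gen θ θ'' p (G.comp H) := by
  refine ⟨h.1.comp h'.1, fun P hP => ?_⟩
  obtain ⟨F, h1, h2⟩ := h.2 P hP
  obtain ⟨F', h3, h4⟩ := h'.2 (F P) (by rw [h2.eq_of_nhds, PB.base_map, hP])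
  refine ⟨F' ∘ F, h1.append h3, ?_⟩
  subst hP
  have hc : Tendsto base (𝓝 P) (𝓝 (base P)) := continuous_base.continuousAt
  filter_upwards [h2, h1.continuousAt.eventually h4, hc.eventually h.1.rg.eventually,
    hc.eventually (h.1.rg.continuousAt_ψ.eventually h'.1.rg.eventually)] with Q e1 e2 e3 e4
  rw [PB.comp_map e3.hV e4.hV, ← e1]
  exact e2

theorem symm {e : GIso} (hp : p ∈ e.O) (h : Gen θ θ' p e.G) : Gen θ' θ (e.G.ψ p) e.G' := by
  refine ⟨h.1.symm hp, fun Q hQ => ?_⟩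
  have hQ' : base Q ∈ e.O' := by rw [hQ]; exact e.maps p hp
  have hb : base (e.G'.map Q) = p := by rw [PB.base_map, hQ, e.left p hp]
  obtain ⟨F, h1, h2⟩ := h.2 _ hb
  obtain ⟨F', h3, h4⟩ := h1.exists_inverse
  have e1 : e.G.map (e.G'.map Q) = Q := e.symm.map_map hQ'
  rw [h2.eq_of_nhds, e1] at h3
  refine ⟨F', h3, ?_⟩
  have hc : Tendsto e.G'.map (𝓝 Q) (𝓝 (e.G'.map Q)) :=
    (e.rg' _ hQ').contDiffAt_map.continuousAt
  filter_upwards [hc.eventually h4, hc.eventually h2,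
    continuous_base.continuousAt.eventually (e.isOpen'.mem_nhds hQ')] with Q' h5 h6 h7
  have e2 : e.G.map (e.G'.map Q') = Q' := e.symm.map_map h7
  rwa [h6, e2] at h5

/-- Near the point `G` is `e.G` followed by `e.G'.comp G`, so it suffices to generate both factors.
-/
theorem cancel_left {e : GIso} (hp : p ∈ e.O) (h : Gen θ θ' p e.G) (hG : Adm θ θ'' p G)
    (h' : Gen θ' θ'' (e.G.ψ p) (e.G'.comp G)) : Gen θ θ'' p G := by
  refine ⟨hG, fun P hP => ?_⟩
  obtain ⟨F, h1, h2⟩ := (h.comp h').2 P hP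
  refine ⟨F, h1, h2.trans ?_⟩
  subst hP
  have hc : Tendsto base (𝓝 P) (𝓝 (base P)) := continuous_base.continuousAt
  filter_upwards [hc.eventually (e.isOpen.mem_nhds hp), hc.eventually hG.rg.eventually] with Q h3 h4
  have e1 := (e.rg _ h3).hV
  have e2 := (e.rg' _ (e.maps _ h3)).hV
  have e4 : e.G'.ψ (e.G.ψ (base Q)) = base Q := e.left _ h3
  have e3 : G.V (e.G'.ψ (e.G.ψ (base Q))) ≠ 0 := by rw [e4]; exact h4.hV
  rw [PB.comp_map e1 (mul_ne_zero e2 e3), PB.comp_map (by rwa [PB.base_map])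
    (by rwa [PB.base_map]), e.map_map h3]

theorem cancel_right {e : GIso} (hG : Adm θ θ' p G) (hp : G.ψ p ∈ e.O)
    (h : Gen θ' θ'' (G.ψ p) e.G) (h' : Gen θ θ'' p (G.comp e.G)) : Gen θ θ' p G := by
  refine ⟨hG, fun P hP => ?_⟩
  obtain ⟨F, h1, h2⟩ := (h'.comp (h.symm hp)).2 P hP
  refine ⟨F, h1, h2.trans ?_⟩
  subst hP
  have hc : Tendsto base (𝓝 P) (𝓝 (base P)) := continuous_base.continuousAt
  filter_upwards [hc.eventually (hG.rg.continuousAt_ψ.eventually (e.isOpen.mem_nhds hp)),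
    hc.eventually hG.rg.eventually] with Q h3 h4
  have e1 := (e.rg _ h3).hV
  have e2 := (e.rg' _ (e.maps _ h3)).hV
  rw [PB.comp_map (mul_ne_zero h4.hV e1) e2, PB.comp_map h4.hV e1]
  exact e.map_map h3

end Gen

/-- If affine germs are compositions of elements of `U`, then so is every composition, up to
generators. -/
theorem EquationClass.IsLocalComposition.of_pieces {U : Set (Triple k)}
    (hU : ∀ {θ θ' : ArbitraryElement k}, θ ∈ (linClass k).S → θ' ∈ (linClass k).S →
      ∀ {p : Base} {G : PB}, Adm θ θ' p G → G.Affine p → ∀ {P : Pt}, base P = p →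
        ∃ T ∈ U, T.src = θ ∧ T.tgt = θ' ∧ P ∈ T.Φ.source ∧ T.Φ =ᶠ[𝓝 P] G.map)
    {θ θ' : ArbitraryElement k} {P : Pt} {F : Pt → Pt}
    (h : IsLocalComposition (pieces k) θ θ' P F) :
    ∃ F', IsLocalComposition (withInverses (generators k) ∪ U) θ θ' P F' ∧ F' =ᶠ[𝓝 P] F := by
  have key : ∀ T ∈ pieces k, ∀ P ∈ T.Φ.source, ∃ T' ∈ withInverses (generators k) ∪ U,
      T'.src = T.src ∧ T'.tgt = T.tgt ∧ P ∈ T'.Φ.source ∧ T'.Φ =ᶠ[𝓝 P] T.Φ := by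
    rintro T (hT | hT) P hP
    · exact ⟨T, Or.inl hT, rfl, rfl, hP, EventuallyEq.rfl⟩
    · obtain ⟨G, h1, h2, h3⟩ := hT.2 P hP
      obtain ⟨T', h4, h5, h6, h7, h8⟩ := hU hT.1.1 hT.1.2.1 h1 h3 rfl
      exact ⟨T', Or.inr h4, h5, h6, h7, h8.trans h2.symm⟩
  induction h with
  | single T hT P hP =>
    obtain ⟨T', h1, h2, h3, h4, h5⟩ := key T hT P hP
    rw [← h2, ← h3]
    exact ⟨T'.Φ, .single T' h1 P h4, h5⟩
  | cons T hT P hP θ F hF ih =>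
    obtain ⟨T', h1, h2, h3, h4, h5⟩ := key T hT P hP
    obtain ⟨F', h6, h7⟩ := ih
    rw [← h3, ← h5.eq_of_nhds] at h6
    rw [← h2]
    refine ⟨F' ∘ T'.Φ, .cons T' h1 P h4 _ _ h6, ?_⟩
    filter_upwards [h5, (T.Φ.continuousAt hP).eventually h7] with Q h8 h9
    simp only [Function.comp_apply, h8, h9]

end Germs

open MeasureTheory ProbabilityTheory

/-! ### The inverse of the heat operator with absorption -/

namespace Heat

/-- The measure `exp (-l s) ds` on the positive half-line. -/
noncomputable def σ (l : ℝ) : Measure ℝ :=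
  (volume.restrict (Ioi 0)).withDensity fun s => ENNReal.ofReal (Real.exp (-l * s))

theorem integral_σ (l : ℝ) (g : ℝ → ℝ) :
    ∫ s, g s ∂σ l = ∫ s in Ioi 0, Real.exp (-l * s) * g s := by
  rw [σ, integral_withDensity_eq_integral_toReal_smul (by fun_prop)
    (Eventually.of_forall fun _ => ENNReal.ofReal_lt_top)]
  simp only [ENNReal.toReal_ofReal (Real.exp_pos _).le, smul_eq_mul]

theorem σ_univ {l : ℝ} (hl : 0 < l) : σ l univ = ENNReal.ofReal l⁻¹ := by
  rw [σ, withDensity_apply _ MeasurableSet.univ, Measure.restrict_univ,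
    ← ofReal_integral_eq_lintegral_ofReal (exp_neg_integrableOn_Ioi 0 hl)
      (Eventually.of_forall fun _ => (Real.exp_pos _).le), integral_exp_mul_Ioi (neg_lt_zero.2 hl)]
  simp

/-- The weight of the mean over the backward heat flow. -/
noncomputable def ν (l : ℝ) : Measure (ℝ × ℝ) := (σ l).prod (gaussianReal 0 2)

theorem isFinite_σ {l : ℝ} (hl : 0 < l) : IsFiniteMeasure (σ l) :=
  ⟨by rw [σ_univ hl]; exact ENNReal.ofReal_lt_top⟩

theorem isFinite_ν {l : ℝ} (hl : 0 < l) : IsFiniteMeasure (ν l) := by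
  have := isFinite_σ hl
  unfold ν; infer_instance

theorem ν_univ {l : ℝ} (hl : 0 < l) : (ν l).real univ = l⁻¹ := by
  have := isFinite_σ hl
  rw [ν, Measure.real, ← univ_prod_univ, Measure.prod_prod, σ_univ hl, measure_univ, mul_one,
    ENNReal.toReal_ofReal (inv_pos.2 hl).le]

/-- The mean of `f` over the backward heat flow starting at `p`. -/
noncomputable def mean {E : Type*} [NormedAddCommGroup E] [NormedSpace ℝ E] (l : ℝ) (f : Base → E)
    (p : Base) : E := ∫ w, f (p - (w.1, √w.1 * w.2)) ∂ν l

section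

variable {E : Type*} [NormedAddCommGroup E] [NormedSpace ℝ E] {l : ℝ} {f : Base → E}

theorem integrable {E : Type*} [NormedAddCommGroup E] {l : ℝ} {f : Base → E} (hl : 0 < l) (hf : Continuous f) {B : ℝ} (hB : ∀ p, ‖f p‖ ≤ B) (p : Base) :
    Integrable (fun w : ℝ × ℝ => f (p - (w.1, √w.1 * w.2))) (ν l) := by
  have := isFinite_ν hl
  have hc : Continuous fun w : ℝ × ℝ => f (p - (w.1, √w.1 * w.2)) := by fun_prop
  exact Integrable.of_bound hc.aestronglyMeasurable B (Eventually.of_forall fun _ => hB _)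

theorem norm_mean_le (hl : 0 < l) {B : ℝ} (hB : ∀ p, ‖f p‖ ≤ B) (p : Base) :
    ‖mean l f p‖ ≤ l⁻¹ * B := by
  have := isFinite_ν hl
  refine (norm_integral_le_of_norm_le_const (Eventually.of_forall fun _ => hB _)).trans ?_
  rw [ν_univ hl, mul_comm]

theorem hasFDerivAt_mean (hl : 0 < l) {f' : Base → Base →L[ℝ] E} (h : ∀ p, HasFDerivAt f (f' p) p)
    (hc : Continuous f') {B B' : ℝ} (hB : ∀ p, ‖f p‖ ≤ B) (hB' : ∀ p, ‖f' p‖ ≤ B') (p : Base) :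
    HasFDerivAt (mean l f) (mean l f' p) p := by
  have := isFinite_ν hl
  have hf : Continuous f := continuous_iff_continuousAt.2 fun p => (h p).continuousAt
  refine hasFDerivAt_integral_of_dominated_of_fderiv_le (bound := fun _ => B')
    (F' := fun q w => f' (q - (w.1, √w.1 * w.2))) univ_mem
    (Eventually.of_forall fun q => (integrable hl hf hB q).aestronglyMeasurable)
    (integrable hl hf hB p) (integrable hl hc hB' p).aestronglyMeasurable
    (Eventually.of_forall fun w q _ => hB' _) (integrable_const _)
    (Eventually.of_forall fun w q _ => ?_)
  have := (h (q - (w.1, √w.1 * w.2))).comp q ((hasFDerivAt_id q).sub_const (w.1, √w.1 * w.2))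
  simpa [Function.comp_def] using this

theorem mean_comp {F : Type*} [NormedAddCommGroup F] [NormedSpace ℝ F] [CompleteSpace E]
    [CompleteSpace F] (hl : 0 < l) (L : E ≃ₗᵢ[ℝ] F) (hf : Continuous f) {B : ℝ}
    (hB : ∀ p, ‖f p‖ ≤ B) (p : Base) : mean l (fun p => L (f p)) p = L (mean l f p) :=
  L.toContinuousLinearEquiv.toContinuousLinearMap.integral_comp_comm (integrable hl hf hB p)

end

/-- Smooth functions with bounded derivatives of all orders. -/
structure BddSmooth (f : Base → ℝ) : Prop where
  smooth : ContDiff ℝ ∞ f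
  bdd : ∀ n, ∃ B, ∀ p, ‖iteratedFDeriv ℝ n f p‖ ≤ B

theorem bddSmooth_of_hasCompactSupport {f : Base → ℝ} (hf : ContDiff ℝ ∞ f)
    (hc : HasCompactSupport f) : BddSmooth f :=
  ⟨hf, fun n => (hf.continuous_iteratedFDeriv (m := n) (mod_cast le_top)).bounded_above_of_compact_support
    (hc.iteratedFDeriv n)⟩

namespace BddSmooth

variable {f g : Base → ℝ} {l : ℝ}

theorem bdd_zero (hf : BddSmooth f) : ∃ B, ∀ p, |f p| ≤ B := by
  obtain ⟨B, hB⟩ := hf.bdd 0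
  exact ⟨B, fun p => by simpa using hB p⟩

/-- Averaging over translates commutes with differentiation, so the averaged derivatives of `f` form
a Taylor series of the average. Their bounds acquire only the factor `l⁻¹`, the total mass of `ν l`.
-/
theorem hasFTaylorSeriesUpTo_mean (hl : 0 < l) (hf : BddSmooth f) :
    HasFTaylorSeriesUpTo ∞ (mean l f) (fun p n => mean l (iteratedFDeriv ℝ n f) p) := by
  have hc : ∀ n : ℕ, Continuous (iteratedFDeriv ℝ n f) := fun n =>
    hf.smooth.continuous_iteratedFDeriv (m := n) (mod_cast le_top)
  have key : ∀ (n : ℕ) (p : Base), HasFDerivAt (mean l (iteratedFDeriv ℝ n f))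
      (mean l (iteratedFDeriv ℝ (n + 1) f) p).curryLeft p := by
    intro n p
    obtain ⟨B, hB⟩ := hf.bdd n
    obtain ⟨B', hB'⟩ := hf.bdd (n + 1)
    let L : (Base [×n + 1]→L[ℝ] ℝ) ≃ₗᵢ[ℝ] (Base →L[ℝ] (Base [×n]→L[ℝ] ℝ)) :=
      continuousMultilinearCurryLeftEquiv ℝ (fun _ : Fin (n + 1) => Base) ℝ
    have h1 : ∀ p, HasFDerivAt (iteratedFDeriv ℝ n f) (L (iteratedFDeriv ℝ (n + 1) f p)) p := by
      intro p
      have := (hf.smooth.differentiable_iteratedFDeriv (m := n)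
        (mod_cast ENat.natCast_lt_top n) p).hasFDerivAt
      rw [iteratedFDeriv_succ_eq_comp_left]
      simpa [L] using this
    have h2 := hasFDerivAt_mean hl h1 (L.continuous.comp (hc (n + 1))) hB
      (fun p => by rw [L.norm_map]; exact hB' p) p
    have h3 : mean l (fun p => L (iteratedFDeriv ℝ (n + 1) f p)) p =
        L (mean l (iteratedFDeriv ℝ (n + 1) f) p) := by
      have := mean_comp (E := Base [×n + 1]→L[ℝ] ℝ) (F := Base →L[ℝ] (Base [×n]→L[ℝ] ℝ)) hl L (hc (n + 1)) hB' p
      exact this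
    rw [h3] at h2
    exact h2
  refine ⟨fun p => ?_, fun n _ p => key n p, fun n _ => continuous_iff_continuousAt.2 fun p =>
    (key n p).continuousAt⟩
  obtain ⟨B, hB⟩ := hf.bdd 0
  let L := continuousMultilinearCurryFin0 ℝ Base ℝ
  have h3 : mean l (fun p => L (iteratedFDeriv ℝ 0 f p)) p = L (mean l (iteratedFDeriv ℝ 0 f) p) :=
    mean_comp hl L (hc 0) hB p
  exact h3.symm

theorem iteratedFDeriv_mean (hl : 0 < l) (hf : BddSmooth f) (n : ℕ) (p : Base) :
    iteratedFDeriv ℝ n (mean l f) p = mean l (iteratedFDeriv ℝ n f) p :=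
  ((hasFTaylorSeriesUpTo_mean hl hf).eq_iteratedFDeriv (mod_cast le_top) p).symm

theorem contDiff_mean (hl : 0 < l) (hf : BddSmooth f) : ContDiff ℝ ∞ (mean l f) :=
  (hasFTaylorSeriesUpTo_mean hl hf).contDiff

theorem norm_iteratedFDeriv_mean_le (hl : 0 < l) (hf : BddSmooth f) {n : ℕ} {B : ℝ}
    (hB : ∀ p, ‖iteratedFDeriv ℝ n f p‖ ≤ B) (p : Base) :
    ‖iteratedFDeriv ℝ n (mean l f) p‖ ≤ l⁻¹ * B := by
  rw [iteratedFDeriv_mean hl hf]; exact norm_mean_le hl hB p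

theorem mean' (hl : 0 < l) (hf : BddSmooth f) : BddSmooth (mean l f) :=
  ⟨contDiff_mean hl hf, fun n => (hf.bdd n).imp' (fun B => l⁻¹ * B) fun _ hB =>
    norm_iteratedFDeriv_mean_le hl hf hB⟩

theorem mul (hf : BddSmooth f) (hg : BddSmooth g) : BddSmooth fun p => f p * g p := by
  refine ⟨hf.smooth.mul hg.smooth, fun n => ?_⟩
  choose B hB using hf.bdd
  choose B' hB' using hg.bdd
  refine ⟨_, fun p => (norm_iteratedFDeriv_mul_le hf.smooth hg.smooth p (mod_cast le_top)).trans
    (Finset.sum_le_sum (f := _) (g := fun i => (n.choose i : ℝ) * B i * B' (n - i)) fun i _ => ?_)⟩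
  have h0 := (norm_nonneg _).trans (hB i p)
  gcongr
  exacts [hB i p, hB' _ p]

theorem fderiv_apply (hf : BddSmooth f) (v : Base) : BddSmooth fun p => fderiv ℝ f p v := by
  have hd : ContDiff ℝ ∞ (fderiv ℝ f) := hf.smooth.fderiv_right (mod_cast le_top)
  refine ⟨hd.clm_apply contDiff_const, fun n => ?_⟩
  obtain ⟨B, hB⟩ := hf.bdd (n + 1)
  refine ⟨‖v‖ * B, fun p => ?_⟩
  have h1 := (ContinuousLinearMap.apply ℝ ℝ v).norm_iteratedFDeriv_comp_left (f := fderiv ℝ f)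
    (x := p) (N := ∞) (n := n) hd.contDiffAt (mod_cast le_top)
  refine h1.trans ?_
  rw [norm_iteratedFDeriv_fderiv]
  gcongr
  · refine ContinuousLinearMap.opNorm_le_bound _ (norm_nonneg _) fun L => ?_
    simpa [mul_comm] using L.le_opNorm v
  · exact hB p

theorem dt (hf : BddSmooth f) : BddSmooth (dt f) := hf.fderiv_apply (1, 0)

theorem dx (hf : BddSmooth f) : BddSmooth (dx f) := hf.fderiv_apply (0, 1)

theorem fderiv_mean_apply (hl : 0 < l) (hf : BddSmooth f) (v p : Base) :
    fderiv ℝ (mean l f) p v = mean l (fun q => fderiv ℝ f q v) p := by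
  have hd : Continuous (fderiv ℝ f) := (hf.smooth.fderiv_right (m := ∞) (mod_cast le_top)).continuous
  obtain ⟨B, hB⟩ := hf.bdd_zero
  obtain ⟨B', hB'⟩ := hf.bdd 1
  have hB'' : ∀ p, ‖fderiv ℝ f p‖ ≤ B' := fun p => by
    rw [← norm_iteratedFDeriv_one]; exact hB' p
  rw [(hasFDerivAt_mean hl (fun p => (hf.smooth.differentiable (by simp) p).hasFDerivAt) hd hB hB''
    p).fderiv]
  exact (ContinuousLinearMap.apply ℝ ℝ v).integral_comp_comm (integrable hl hd hB'' p) |>.symm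

theorem dt_mean (hl : 0 < l) (hf : BddSmooth f) : _root_.dt (mean l f) = mean l (_root_.dt f) :=
  funext fun p => fderiv_mean_apply hl hf _ p

theorem dx_mean (hl : 0 < l) (hf : BddSmooth f) : _root_.dx (mean l f) = mean l (_root_.dx f) :=
  funext fun p => fderiv_mean_apply hl hf _ p

end BddSmooth

end Heat

/-! ### Gaussian means and the resolvent identity -/

namespace Heat

/-- Integration by parts with respect to the Gaussian measure of variance `2`. -/
theorem integral_mul_gaussian {g g' : ℝ → ℝ} (h : ∀ z, HasDerivAt g (g' z) z) (hc : Continuous g')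
    {B B' : ℝ} (hB : ∀ z, |g z| ≤ B) (hB' : ∀ z, |g' z| ≤ B') :
    ∫ z, z * g z ∂gaussianReal 0 2 = 2 * ∫ z, g' z ∂gaussianReal 0 2 := by
  have h2 : (2 : NNReal) ≠ 0 := two_ne_zero
  have hgc : Continuous g := continuous_iff_continuousAt.2 fun z => (h z).continuousAt
  have hid : Integrable (fun z : ℝ => z) (gaussianReal 0 2) :=
    (memLp_id_gaussianReal 1).integrable (by simp)
  have i1 : Integrable (fun z => z * g z) (gaussianReal 0 2) :=
    hid.mul_bdd hgc.aestronglyMeasurable (Eventually.of_forall hB)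
  have i2 : Integrable g' (gaussianReal 0 2) :=
    Integrable.of_bound hc.aestronglyMeasurable B' (Eventually.of_forall hB')
  have i3 : Integrable g (gaussianReal 0 2) :=
    Integrable.of_bound hgc.aestronglyMeasurable B (Eventually.of_forall hB)
  have key : ∀ {k : ℝ → ℝ}, Integrable k (gaussianReal 0 2) →
      Integrable (fun z => gaussianPDFReal 0 2 z * k z) := by
    intro k hk
    rw [gaussianReal_of_var_ne_zero 0 h2, gaussianPDF_def,
      integrable_withDensity_iff_integrable_smul' (by fun_prop)
        (Eventually.of_forall fun _ => ENNReal.ofReal_lt_top)] at hk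
    simpa only [ENNReal.toReal_ofReal (gaussianPDFReal_nonneg 0 2 _), smul_eq_mul] using hk
  have hd : ∀ z, HasDerivAt (gaussianPDFReal 0 2) (-(z / 2) * gaussianPDFReal 0 2 z) z := by
    intro z
    rw [gaussianPDFReal_def]
    have h1 : HasDerivAt (fun x : ℝ => -(x - 0) ^ 2 / (2 * ((2 : NNReal) : ℝ))) (-(z / 2)) z := by
      refine HasDerivAt.congr_deriv ((((hasDerivAt_id' z).sub_const 0).pow 2).neg.div_const _) ?_
      push_cast; ring
    refine HasDerivAt.congr_deriv (h1.exp.const_mul _) ?_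
    ring
  rw [integral_gaussianReal_eq_integral_smul h2, integral_gaussianReal_eq_integral_smul h2]
  simp only [smul_eq_mul]
  have e := integral_mul_deriv_eq_deriv_mul_of_integrable (u := g) (v := gaussianPDFReal 0 2)
    (u' := g') (v' := fun z => -(z / 2) * gaussianPDFReal 0 2 z) (fun z _ => h z) (fun z _ => hd z)
    ?_ ?_ ?_
  · have e1 : ∫ z, gaussianPDFReal 0 2 z * (z * g z) =
        (-2) * ∫ z, g z * (-(z / 2) * gaussianPDFReal 0 2 z) := by
      rw [← integral_const_mul]; congr 1; funext z; ring
    rw [e1, e]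
    have e2 : ∫ z, g' z * gaussianPDFReal 0 2 z = ∫ z, gaussianPDFReal 0 2 z * g' z := by
      congr 1; funext z; ring
    rw [e2]; ring
  · refine ((key i1).const_mul (-(1 / 2))).congr (Eventually.of_forall fun z => ?_)
    simp only [Pi.mul_apply]; ring
  · refine (key i2).congr (Eventually.of_forall fun z => ?_)
    simp only [Pi.mul_apply]; ring
  · refine (key i3).congr (Eventually.of_forall fun z => ?_)
    simp only [Pi.mul_apply]; ring

/-- The Gaussian mean at time `s`. -/
noncomputable def gmean (f : Base → ℝ) (p : Base) (s : ℝ) : ℝ :=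
  ∫ z, f (p - (s, √s * z)) ∂gaussianReal 0 2

variable {f : Base → ℝ} {l : ℝ}

theorem mean_eq (hl : 0 < l) (hf : Continuous f) {B : ℝ} (hB : ∀ p, |f p| ≤ B) (p : Base) :
    mean l f p = ∫ s in Ioi 0, Real.exp (-l * s) * gmean f p s := by
  have := isFinite_σ hl
  rw [mean, ν, integral_prod _ (integrable hl hf hB p), integral_σ]
  rfl

theorem continuous_gmean (hf : Continuous f) {B : ℝ} (hB : ∀ p, |f p| ≤ B) (p : Base) :
    Continuous (gmean f p) := by
  refine continuous_of_dominated (bound := fun _ => B) (fun s => ?_) (fun s => Eventually.of_forall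
    fun z => hB _) (integrable_const B) (Eventually.of_forall fun z => by fun_prop)
  exact Continuous.aestronglyMeasurable (by fun_prop)

theorem abs_gmean_le {B : ℝ} (hB : ∀ p, |f p| ≤ B) (p : Base) (s : ℝ) : |gmean f p s| ≤ B := by
  have := norm_integral_le_of_norm_le_const (μ := gaussianReal 0 2)
    (f := fun z => f (p - (s, √s * z))) (C := B) (Eventually.of_forall fun z => hB _)
  simpa [gmean] using this

theorem gmean_integrable (hf : BddSmooth f) (p : Base) (s : ℝ) :
    Integrable (fun z => f (p - (s, √s * z))) (gaussianReal 0 2) := by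
  obtain ⟨B, hB⟩ := hf.bdd_zero
  have := hf.smooth.continuous
  exact Integrable.of_bound (Continuous.aestronglyMeasurable (by fun_prop)) B
    (Eventually.of_forall fun z => hB _)

/-- The Gaussian mean solves the backward heat equation. -/
theorem hasDerivAt_gmean (hf : BddSmooth f) (p : Base) {s : ℝ} (hs : 0 < s) :
    HasDerivAt (gmean f p) (gmean (dx (dx f)) p s - gmean (dt f) p s) s := by
  obtain ⟨Bt, hBt⟩ := hf.dt.bdd_zero
  obtain ⟨Bx, hBx⟩ := hf.dx.bdd_zero
  obtain ⟨Bxx, hBxx⟩ := hf.dx.dx.bdd_zero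
  have ct := hf.dt.smooth.continuous
  have cx := hf.dx.smooth.continuous
  have cxx := hf.dx.dx.smooth.continuous
  have hBx0 : 0 ≤ Bx := (abs_nonneg _).trans (hBx 0)
  have hid : Integrable (fun z : ℝ => z) (gaussianReal 0 2) :=
    (memLp_id_gaussianReal 1).integrable (by simp)
  have hd : ∀ s > 0, ∀ z, HasDerivAt (fun s => f (p - (s, √s * z)))
      (-dt f (p - (s, √s * z)) - z / (2 * √s) * dx f (p - (s, √s * z))) s := by
    intro s hs z
    have h1 : HasDerivAt (fun s => p - (s, √s * z)) (-(1, 1 / (2 * √s) * z)) s :=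
      ((hasDerivAt_id' s).prodMk ((Real.hasDerivAt_sqrt hs.ne').mul_const z)).const_sub p
    have h2 := ((hf.smooth.differentiable (by simp) (p - (s, √s * z))).hasFDerivAt).comp_hasDerivAt s h1
    refine h2.congr_deriv ?_
    rw [map_neg, fderiv_eq_dt_dx]
    ring
  -- Staying above `s / 2` keeps the singular factor `1 / √s` bounded, so that `|z|` times a
  -- constant dominates.
  have hs2 : 0 < s / 2 := by linarith
  have key := (hasDerivAt_integral_of_dominated_loc_of_deriv_le (μ := gaussianReal 0 2) (𝕜 := ℝ)
    (F := fun s z => f (p - (s, √s * z)))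
    (F' := fun s z => -dt f (p - (s, √s * z)) - z / (2 * √s) * dx f (p - (s, √s * z)))
    (bound := fun z => Bt + |z| / (2 * √(s / 2)) * Bx) (x₀ := s) (s := Ioi (s / 2))
    (Ioi_mem_nhds (by linarith))
    (Eventually.of_forall fun s => (gmean_integrable hf p s).aestronglyMeasurable)
    (gmean_integrable hf p s) (Continuous.aestronglyMeasurable (by fun_prop))
    (Eventually.of_forall fun z s' hs' => ?_)
    ((integrable_const _).add ((hid.abs.div_const _).mul_const _))
    (Eventually.of_forall fun z s' hs' => hd s' (hs2.trans hs') z)).2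
  · refine key.congr_deriv ?_
    -- Gaussian integration by parts trades the weight `z / (2√s)` on `f_x` for the second
    -- derivative `f_xx`.
    have ibp := integral_mul_gaussian (g := fun z => dx f (p - (s, √s * z)))
      (g' := fun z => -√s * dx (dx f) (p - (s, √s * z))) (fun z => ?_) (by fun_prop)
      (fun z => hBx _) (B' := √s * Bxx) (fun z => ?_)
    · have h0 : √s ≠ 0 := (Real.sqrt_pos.2 hs).ne'
      have i1 : Integrable (fun z => z / (2 * √s) * dx f (p - (s, √s * z))) (gaussianReal 0 2) :=
        (hid.div_const _).mul_bdd (Continuous.aestronglyMeasurable (by fun_prop))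
          (Eventually.of_forall fun z => hBx _)
      have i2 : Integrable (fun z => -dt f (p - (s, √s * z))) (gaussianReal 0 2) :=
        (gmean_integrable hf.dt p s).neg
      rw [integral_sub i2 i1, integral_neg]
      have e : ∫ z, z / (2 * √s) * dx f (p - (s, √s * z)) ∂gaussianReal 0 2 =
          (1 / (2 * √s)) * ∫ z, z * dx f (p - (s, √s * z)) ∂gaussianReal 0 2 := by
        rw [← integral_const_mul]; congr 1; funext z; ring
      rw [e, ibp, integral_const_mul]
      simp only [gmean]
      field_simp
      ring
    · have h1 : HasDerivAt (fun z : ℝ => p - (s, √s * z)) (-(0, √s * 1)) z :=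
        ((hasDerivAt_const z s).prodMk ((hasDerivAt_id' z).const_mul (√s))).const_sub p
      have h2 := ((hf.dx.smooth.differentiable (by simp) (p - (s, √s * z))).hasFDerivAt).comp_hasDerivAt
        z h1
      refine h2.congr_deriv ?_
      rw [map_neg, fderiv_eq_dt_dx]
      ring
    · rw [neg_mul, abs_neg, abs_mul, abs_of_nonneg (Real.sqrt_nonneg s)]
      gcongr
      exact hBxx _
  · refine (norm_sub_le _ _).trans (add_le_add ?_ ?_)
    · rw [norm_neg]; exact hBt _
    · rw [norm_mul, norm_div, Real.norm_eq_abs z, Real.norm_eq_abs (2 * √s'),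
        abs_of_nonneg (show 0 ≤ 2 * √s' by positivity)]
      have : √(s / 2) ≤ √s' := Real.sqrt_le_sqrt (le_of_lt hs')
      have h0 : 0 < √(s / 2) := Real.sqrt_pos.2 hs2
      gcongr
      exact hBx _

/-- The displacement `√s z` has variance `2s`, that of the heat kernel of `u_t = u_xx`, so `gmean`
is the heat semigroup along backward time. Integrating the derivative of `exp (-l s) gmean f p s`
over `(0, ∞)`, with limit `0` at infinity and value `f p` at `s = 0`, shows that `mean l` inverts
the operator `∂_t - ∂_xx + l`. -/
theorem mean_heat (hl : 0 < l) (hf : BddSmooth f) (p : Base) :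
    mean l (dt f) p - mean l (dx (dx f)) p + l * mean l f p = f p := by
  obtain ⟨B, hB⟩ := hf.bdd_zero
  obtain ⟨Bt, hBt⟩ := hf.dt.bdd_zero
  obtain ⟨Bxx, hBxx⟩ := hf.dx.dx.bdd_zero
  have c := continuous_gmean hf.smooth.continuous hB p
  have ct := continuous_gmean hf.dt.smooth.continuous hBt p
  have cxx := continuous_gmean hf.dx.dx.smooth.continuous hBxx p
  have hE : ∀ s, HasDerivAt (fun s => Real.exp (-l * s)) (Real.exp (-l * s) * (-l * 1)) s := fun s =>
    ((hasDerivAt_id' s).const_mul (-l)).exp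
  have hi : ∀ {k : ℝ → ℝ} {K : ℝ}, Continuous k → (∀ s, |k s| ≤ K) →
      IntegrableOn (fun s => Real.exp (-l * s) * k s) (Ioi 0) := fun {k K} hk hK =>
    (exp_neg_integrableOn_Ioi 0 hl).mul_bdd hk.aestronglyMeasurable (Eventually.of_forall hK)
  have i0 := hi c (abs_gmean_le hB p)
  have it := hi ct (abs_gmean_le hBt p)
  have ixx := hi cxx (abs_gmean_le hBxx p)
  have key := integral_Ioi_of_hasDerivAt_of_tendsto (f := fun s => Real.exp (-l * s) * gmean f p s)
    (f' := fun s => Real.exp (-l * s) * gmean (dx (dx f)) p s - Real.exp (-l * s) * gmean (dt f) p s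
      - l * (Real.exp (-l * s) * gmean f p s)) (a := 0) (m := 0)
    (Continuous.continuousWithinAt (by fun_prop)) (fun s hs => ?_) ((ixx.sub it).sub (i0.const_mul l)) ?_
  · have i1 : IntegrableOn (fun s => Real.exp (-l * s) * gmean (dx (dx f)) p s
        - Real.exp (-l * s) * gmean (dt f) p s) (Ioi 0) := ixx.sub it
    rw [integral_sub i1 (i0.const_mul l), integral_sub ixx it, integral_const_mul,
      ← mean_eq hl hf.smooth.continuous hB, ← mean_eq hl hf.dt.smooth.continuous hBt,
      ← mean_eq hl hf.dx.dx.smooth.continuous hBxx] at key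
    have e0 : p - ((0 : ℝ), (0 : ℝ)) = p := sub_zero p
    have h0 : gmean f p 0 = f p := by simp [gmean, e0]
    rw [h0] at key
    simp only [mul_zero, Real.exp_zero, one_mul, zero_sub] at key
    linarith
  · refine ((hE s).mul (hasDerivAt_gmean hf p hs)).congr_deriv ?_
    ring
  · have h1 : Tendsto (fun s => Real.exp (-l * s)) atTop (𝓝 0) :=
      Real.tendsto_exp_atBot.comp (tendsto_id.const_mul_atTop_of_neg (neg_lt_zero.2 hl))
    exact h1.zero_mul_isBoundedUnder_le (isBoundedUnder_of ⟨B, fun s => abs_gmean_le hB p s⟩)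

end Heat

/-! ### Neumann series for a bounded zeroth-order term -/

namespace Heat

/-- Summing the recursion bounds a partial sum by `a 0 + ∑ b` plus half of the preceding one, so all
of them are at most `2 (a 0 + ∑ b)`. -/
theorem summable_of_le_half {a b : ℕ → ℝ} (ha : ∀ n, 0 ≤ a n) (hb0 : ∀ n, 0 ≤ b n)
    (hb : Summable b) (h : ∀ n, a (n + 1) ≤ a n / 2 + b n) : Summable a := by
  refine summable_of_sum_range_le (c := 2 * (a 0 + ∑' n, b n)) ha fun n => ?_
  have hB : 0 ≤ ∑' n, b n := tsum_nonneg hb0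
  induction n with
  | zero => simp only [Finset.range_zero, Finset.sum_empty]; linarith [ha 0]
  | succ n ih =>
    rw [Finset.sum_range_succ']
    have h1 : ∑ i ∈ Finset.range n, a (i + 1) ≤
        (∑ i ∈ Finset.range n, a i) / 2 + ∑ i ∈ Finset.range n, b i := by
      rw [Finset.sum_div, ← Finset.sum_add_distrib]
      exact Finset.sum_le_sum fun i _ => h i
    have h2 := hb.sum_le_tsum (Finset.range n) fun i _ => hb0 i
    linarith

/-- The terms of the Neumann series. -/
noncomputable def term (l : ℝ) (c d : Base → ℝ) : ℕ → Base → ℝ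
  | 0 => d
  | n + 1 => fun p => c p * mean l (term l c d n) p

/-- Bounds for the derivatives of the terms of the Neumann series. -/
noncomputable def bound (l : ℝ) (C D : ℕ → ℝ) : ℕ → ℕ → ℝ
  | 0 => D
  | n + 1 => fun i => ∑ j ∈ Finset.range (i + 1), (i.choose j : ℝ) * C j * (l⁻¹ * bound l C D n (i - j))

variable {l : ℝ} {c d : Base → ℝ} {C D : ℕ → ℝ}

theorem bound_nonneg (hl : 0 < l) (hC : ∀ i, 0 ≤ C i) (hD : ∀ i, 0 ≤ D i) (n i : ℕ) :
    0 ≤ bound l C D n i := by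
  induction n generalizing i with
  | zero => exact hD i
  | succ n ih =>
    refine Finset.sum_nonneg fun j _ => ?_
    have := hC j
    have := ih (i - j)
    positivity

/-- In the Leibniz sum the term with no derivative on `c` contracts by `C 0 / l = 1 / 2`. The other
terms involve bounds for derivatives of lower order, summable by induction on the order. No
smallness of the derivatives of `c` is required. -/
theorem summable_bound (hl : 0 < l) (hC : ∀ i, 0 ≤ C i) (hD : ∀ i, 0 ≤ D i) (h0 : C 0 = l / 2)
    (i : ℕ) : Summable fun n => bound l C D n i := by
  induction i using Nat.strong_induction_on with
  | _ i ih =>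
    refine summable_of_le_half (b := fun n => ∑ j ∈ Finset.range i, (i.choose (j + 1) : ℝ) * C (j + 1)
      * (l⁻¹ * bound l C D n (i - (j + 1)))) (fun n => bound_nonneg hl hC hD n i) (fun n => ?_) ?_
      fun n => ?_
    · refine Finset.sum_nonneg fun j _ => ?_
      have := hC (j + 1)
      have := bound_nonneg hl hC hD n (i - (j + 1))
      positivity
    · refine summable_sum fun j hj => ((ih _ ?_).mul_left _).mul_left _
      have := Finset.mem_range.1 hj
      omega
    · simp only [bound, Finset.sum_range_succ', h0,Nat.choose_zero_right, Nat.cast_one, one_mul, Nat.sub_zero]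
      have : l / 2 * (l⁻¹ * bound l C D n i) = bound l C D n i / 2 := by field_simp
      rw [this, add_comm]

theorem bddSmooth_term (hl : 0 < l) (hc : BddSmooth c) (hd : BddSmooth d) (n : ℕ) :
    BddSmooth (term l c d n) := by
  induction n with
  | zero => exact hd
  | succ n ih => exact hc.mul (ih.mean' hl)

theorem norm_iteratedFDeriv_term_le (hl : 0 < l) (hc : BddSmooth c) (hd : BddSmooth d)
    (hC : ∀ i p, ‖iteratedFDeriv ℝ i c p‖ ≤ C i) (hD : ∀ i p, ‖iteratedFDeriv ℝ i d p‖ ≤ D i)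
    (n i : ℕ) (p : Base) : ‖iteratedFDeriv ℝ i (term l c d n) p‖ ≤ bound l C D n i := by
  induction n generalizing i p with
  | zero => exact hD i p
  | succ n ih =>
    have hn := bddSmooth_term hl hc hd n
    refine (norm_iteratedFDeriv_mul_le hc.smooth (hn.contDiff_mean hl) p (mod_cast le_top)).trans
      (Finset.sum_le_sum fun j _ => ?_)
    have h0 := (norm_nonneg _).trans (hC j p)
    gcongr
    · exact hC j p
    · exact hn.norm_iteratedFDeriv_mean_le hl (ih (i - j)) p

/-- The equation `v_t = v_xx + (c - l) v + d` has a global smooth solution for large `l`. -/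
theorem exists_solution (hl : 0 < l) (hc : BddSmooth c) (hd : BddSmooth d)
    (hcl : ∀ p, |c p| ≤ l / 2) :
    ∃ v : Base → ℝ, ContDiff ℝ ∞ v ∧ ∀ p, dt v p = dx (dx v) p - l * v p + c p * v p + d p := by
  -- The bound of order zero is set to exactly `l / 2`, which produces the contraction factor `1 /
  -- 2`.
  obtain ⟨C, hC, hC0⟩ : ∃ C : ℕ → ℝ, (∀ i p, ‖iteratedFDeriv ℝ i c p‖ ≤ C i) ∧ C 0 = l / 2 := by
    choose C hC using hc.bdd
    refine ⟨fun i => if i = 0 then l / 2 else C i, fun i p => ?_, if_pos rfl⟩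
    by_cases hi : i = 0
    · subst hi; simpa using hcl p
    · simpa [hi] using hC i p
  choose D hD using hd.bdd
  have hC' : ∀ i, 0 ≤ C i := fun i => (norm_nonneg _).trans (hC i 0)
  have hD' : ∀ i, 0 ≤ D i := fun i => (norm_nonneg _).trans (hD i 0)
  have hs := summable_bound hl hC' hD' hC0
  have hw := bddSmooth_term hl hc hd
  have hb := norm_iteratedFDeriv_term_le hl hc hd hC hD
  set w : Base → ℝ := fun p => ∑' n, term l c d n p with hwdef
  have hb0 : ∀ n p, ‖term l c d n p‖ ≤ bound l C D n 0 := fun n p => by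
    simpa using hb n 0 p
  have hwB : BddSmooth w := by
    refine ⟨contDiff_tsum (N := ⊤) (fun n => (hw n).smooth) (v := fun i n => bound l C D n i)
      (fun i _ => hs i) fun i n p _ => hb n i p, fun i => ⟨∑' n, bound l C D n i, fun p => ?_⟩⟩
    rw [hwdef, iteratedFDeriv_tsum (N := ⊤) (v := fun i n => bound l C D n i)
      (fun n => (hw n).smooth) (fun i _ => hs i) (fun i n p _ => hb n i p) (mod_cast le_top)]
    exact tsum_of_norm_bounded (hs i).hasSum fun n => hb n i p
  have hsum : ∀ p, HasSum (fun n => mean l (term l c d n) p) (mean l w p) := by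
    intro p
    refine hasSum_integral_of_summable_integral_norm
      (F := fun n (ω' : ℝ × ℝ) => term l c d n (p - (ω'.1, √ω'.1 * ω'.2)))
      (fun n => integrable hl (hw n).smooth.continuous (hb0 n) p) ?_
    refine Summable.of_nonneg_of_le (fun n => integral_nonneg fun _ => norm_nonneg _) (fun n => ?_)
      ((hs 0).mul_left l⁻¹)
    exact (Real.le_norm_self _).trans
      (norm_mean_le (f := fun p => ‖term l c d n p‖) hl (fun p => by simpa using hb0 n p) p)
  -- Since `mean l` inverts `∂_t - ∂_xx + l`, this fixed-point equation says that `v = mean l w`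
  -- solves the required equation.
  have hfix : ∀ p, w p = d p + c p * mean l w p := by
    intro p
    have h1 : Summable fun n => term l c d n p :=
      Summable.of_norm_bounded (hs 0) fun n => hb0 n p
    rw [hwdef]
    simp only
    rw [h1.tsum_eq_zero_add, ← (hsum p).tsum_eq, ← tsum_mul_left]
    rfl
  refine ⟨mean l w, hwB.contDiff_mean hl, fun p => ?_⟩
  have h1 := mean_heat hl hwB p
  rw [hwB.dt_mean hl, hwB.dx_mean hl, hwB.dx.dx_mean hl]
  linarith [hfix p]

end Heat

/-- Local solvability of inhomogeneous equations with the heat operator. -/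
theorem exists_local_solution {C D : Base → ℝ} {p : Base} (hC : SmoothNear C p)
    (hD : SmoothNear D p) : ∃ W : Base → ℝ, ContDiff ℝ ∞ W ∧
      ∀ᶠ q in 𝓝 p, dt W q = dx (dx W) q + C q * W q + D q := by
  obtain ⟨r, hr, hball⟩ := Metric.eventually_nhds_iff_ball.1 (hC.and hD)
  have hr2 : 0 < r / 2 := half_pos hr
  -- Cutting off near `p` makes the coefficients globally smooth with bounded derivatives; the
  -- equation is unchanged where `χ = 1`.
  let χ : ContDiffBump p := ⟨r / 4, r / 2, by positivity, by linarith⟩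
  have key : ∀ F : Base → ℝ, (∀ q ∈ Metric.ball p r, ContDiffAt ℝ ∞ F q) →
      Heat.BddSmooth fun q => χ q * F q := by
    intro F hF
    refine Heat.bddSmooth_of_hasCompactSupport (contDiff_iff_contDiffAt.2 fun q => ?_)
      χ.hasCompactSupport.mul_right
    by_cases hq : q ∈ tsupport χ
    · refine χ.contDiff.contDiffAt.mul (hF q ?_)
      rw [χ.tsupport_eq] at hq
      exact Metric.closedBall_subset_ball (show r / 2 < r by linarith) hq
    · have : (fun q => χ q * F q) =ᶠ[𝓝 q] fun _ => 0 := by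
        filter_upwards [(isClosed_tsupport χ).isOpen_compl.mem_nhds hq] with y hy
        rw [image_eq_zero_of_notMem_tsupport hy, zero_mul]
      exact contDiffAt_const.congr_of_eventuallyEq this
  have hc := key C fun q hq => (hball q hq).1
  obtain ⟨B, hB⟩ := hc.bdd_zero
  -- The constant makes the cut-off coefficient at most `l / 2`. The absorption `-l v` introduced in
  -- this way is undone by the factor `exp (l t)`, and the free term carries the compensating `exp
  -- (-l t)`.
  set l := 2 * |B| + 2 with hl
  have hl0 : 0 < l := by positivity
  have hd := key (fun q => Real.exp (-l * q.1) * D q) fun q hq =>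
    ContDiffAt.mul (by fun_prop) (hball q hq).2
  obtain ⟨v, hv, he⟩ := Heat.exists_solution hl0 hc hd fun q =>
    (hB q).trans (by rw [hl]; linarith [le_abs_self B])
  have hE : ∀ q : Base, SmoothNear (fun q : Base => Real.exp (l * q.1)) q := fun q =>
    SmoothNear.of_contDiff (by fun_prop)
  have hvs : ∀ q, SmoothNear v q := fun q => SmoothNear.of_contDiff hv
  have hl1 : ∀ q : Base, SmoothNear (fun q : Base => l * q.1) q := fun q =>
    SmoothNear.of_contDiff (by fun_prop)
  refine ⟨fun q => Real.exp (l * q.1) * v q, ContDiff.mul (by fun_prop) hv, ?_⟩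
  have h1 : ∀ q : Base, dt (fun q : Base => Real.exp (l * q.1)) q = Real.exp (l * q.1) * l := fun q => by
    rw [dt_exp (hl1 q).differentiableAt, dt_const_mul l (by fun_prop), dt_fst, mul_one]
  have h2 : ∀ q : Base, dx (fun q : Base => Real.exp (l * q.1)) q = 0 := fun q => by
    rw [dx_exp (hl1 q).differentiableAt, dx_const_mul l (by fun_prop), dx_fst]; ring
  have h3 : dx (fun q => Real.exp (l * q.1) * v q) = fun q => Real.exp (l * q.1) * dx v q :=
    funext fun q => by
      rw [dx_mul (hE q).differentiableAt (hvs q).differentiableAt, h2]; ring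
  have hχ : χ =ᶠ[𝓝 p] 1 := χ.eventuallyEq_one
  filter_upwards [hχ] with q hq
  have he := he q
  rw [h3, dx_mul (hE q).differentiableAt (hvs q).dx.differentiableAt, h2,
    dt_mul (hE q).differentiableAt (hvs q).differentiableAt, h1, he, hq]
  have : Real.exp (l * q.1) * Real.exp (-l * q.1) = 1 := by rw [← Real.exp_add]; simp
  simp only [Pi.one_apply]
  linear_combination D q * this

/-! ### Compositions of generators and affine germs -/

namespace Gen

variable {k : ℕ} {θ θ' θ₁ θ₁' : ArbitraryElement k} {p : Base} {G : PB}

theorem gen₁ (hk : 3 ≤ k) {μ : ℝ} (ht : |p.1| < Real.pi / 4) (hx : p.2 ∈ natDom μ) :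
    Gen (potential k μ 1 0) (potential k μ 0 0) p gen₁ := by
  refine ⟨adm_gen₁ hk ht hx, ?_⟩
  rintro P rfl
  exact ⟨_, .single (triple₁ k μ) (Or.inl (Or.inl (Or.inl (Or.inl ⟨μ, rfl⟩)))) P ⟨ht, hx⟩,
    Phi₁_eventuallyEq ⟨ht, hx⟩⟩

theorem gen₂ (hk : 3 ≤ k) {μ : ℝ} (hx : p.2 ∈ natDom μ) :
    Gen (potential k μ (-1) 0) (potential k μ 0 0) p gen₂ := by
  refine ⟨adm_gen₂ hk hx, ?_⟩
  rintro P rfl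
  exact ⟨_, .single (triple₂ k μ) (Or.inl (Or.inl (Or.inl (Or.inr ⟨μ, rfl⟩)))) P hx,
    Eventually.of_forall (Phi₂_eq_map μ)⟩

theorem gen₃ (hk : 3 ≤ k) : Gen (potential k 0 0 1) (potential k 0 0 0) p gen₃ := by
  refine ⟨adm_gen₃ hk p, ?_⟩
  rintro P rfl
  exact ⟨_, .single (triple₃ k) (Or.inl (Or.inl (Or.inr rfl))) P (mem_univ _),
    Eventually.of_forall Phi₃_eq_map⟩

/-- The germ `M` that occurs is the inverse of `E` followed by `G`. The hypothesis on the image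
point allows a further germ to be attached on the right. -/
theorem of_comp_left {E : PB} (hE : Gen θ θ₁ p E) (hG : Adm θ θ' p G)
    (h : ∀ M, Adm θ₁ θ' (E.ψ p) M → (M.ψ (E.ψ p) = G.ψ p) → Gen θ₁ θ' (E.ψ p) M) :
    Gen θ θ' p G := by
  obtain ⟨e, rfl, hp, -⟩ := hE.1.rg.exists_gIso univ_mem
  have e1 : e.G'.ψ (e.G.ψ p) = p := e.left p hp
  refine hE.cancel_left hp hG (h _ ((hE.1.symm hp).comp (by rwa [e1])) ?_)
  rw [PB.comp_ψ, e1]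

theorem of_comp_right {E : PB} (hE : Gen θ' θ₁' (G.ψ p) E) (hG : Adm θ θ' p G)
    (h : Gen θ θ₁' p (G.comp E)) : Gen θ θ' p G := by
  obtain ⟨e, rfl, hp, -⟩ := hE.1.rg.exists_gIso univ_mem
  exact cancel_right hG hp hE h

/-- A germ is generated if every germ between two other equations is, to which there are generated
germs. -/
theorem of_conj {E E' : PB} (hE : Gen θ θ₁ p E) (hE' : Gen θ' θ₁' (G.ψ p) E') (hG : Adm θ θ' p G)
    (h : ∀ M, Adm θ₁ θ₁' (E.ψ p) M → Gen θ₁ θ₁' (E.ψ p) M) : Gen θ θ' p G := by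
  refine hE.of_comp_left hG fun M hM hψ => ?_
  rw [← hψ] at hE'
  exact hE'.of_comp_right hM (h _ (hM.comp hE'.1))

end Gen

/-! ### Germs between equations in normal form -/

section Normal

variable {k : ℕ} {θ θ' : ArbitraryElement k} {p : Base} {G : PB} {C K : ℝ → ℝ}

theorem Nrm.eventually (h : Nrm θ C p) : ∀ᶠ q in 𝓝 p, Nrm θ C q := eventually_eventually_nhds.2 h

theorem Nrm.smooth (h : Nrm θ C p) : SmoothNear (fun q => C q.2) p :=
  (smoothNear_co θ 2 h.self_of_nhds.1).congr (h.mono fun _ hq => hq.2.2.2.1.symm)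

theorem Nrm.hasDerivAt (h : Nrm θ C p) : HasDerivAt C (dx (fun q => C q.2) p) p.2 :=
  hasDerivAt_snd (f := fun q : Base => C q.2) (t := p.1) (x := p.2) h.smooth.differentiableAt

/-- At `q`, the transformation `x̃ = S x + Y` of the space variable, with `S` and `Y` depending on
`t` only, relates the potentials `C` and `K`; half the logarithmic derivative of `S` and the
velocity `Y_t / (2 S)` are `a` and `b`. -/
structure NormalAt (G : PB) (C K : ℝ → ℝ) (S Y a b c : Base → ℝ) (q : Base) : Prop where
  sS : SmoothNear S q
  sY : SmoothNear Y q
  sa : SmoothNear a q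
  sb : SmoothNear b q
  sc : SmoothNear c q
  S_ne : S q ≠ 0
  dxS : dx S q = 0
  dxY : dx Y q = 0
  dxa : dx a q = 0
  dxb : dx b q = 0
  dxc : dx c q = 0
  dtS : dt S q = 2 * a q * S q
  dtY : dt Y q = 2 * b q * S q
  dtT : dt G.T q = S q ^ 2
  dxX : dx G.X q = S q
  X_eq : G.X q = S q * q.2 + Y q
  rel : S q ^ 2 * K (S q * q.2 + Y q) = C q.2 + (a q ^ 2 - dt a q / 2) * q.2 ^ 2
    + (2 * a q * b q - dt b q) * q.2 + c q

/-- Since `X_xx = 0`, one has `X = S x + Y`. The equation for `V_x` becomes `V_x / V = a x + b`, so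
`V_t / V` is `a_t x² / 2 + b_t x` plus a function of `t`, and `V_xx / V = a + (a x + b)²`. Inserting
these into the last determining equation gives the relation between `C` and `K`. -/
theorem Adm.exists_normalAt (h : Adm θ θ' p G) (hn : Nrm θ C p) (hn' : Nrm θ' K (G.ψ p)) :
    ∃ S Y a b c, ∀ᶠ q in 𝓝 p, NormalAt G C K S Y a b c q := by
  set Y : Base → ℝ := fun q => G.X q - dx G.X q * q.2 with hY
  set a : Base → ℝ := fun q => dt (dx G.X) q / (2 * dx G.X q) with ha
  set b : Base → ℝ := fun q => dt Y q / (2 * dx G.X q) with hb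
  set c : Base → ℝ := fun q => a q + b q ^ 2 - (dt G.V q / G.V q - (dt a q / 2 * q.2 ^ 2
    + dt b q * q.2)) with hc
  refine ⟨dx G.X, Y, a, b, c, ?_⟩
  have h1 : ∀ᶠ q in 𝓝 p, G.Rg q ∧ dx (dx G.X) q = 0 := by
    filter_upwards [h.rg.eventually, h.normal_eqs hn hn'] with q h1 h2 using ⟨h1, h2.2.1⟩
  have h2 : ∀ᶠ q in 𝓝 p, G.Rg q ∧ dx (dx G.X) q = 0 ∧ dx (dt (dx G.X)) q = 0 ∧ SmoothNear Y q ∧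
      dx Y q = 0 ∧ dx (dt Y) q = 0 ∧ dt G.X q = dt (dx G.X) q * q.2 + dt Y q := by
    have hYs : ∀ q, G.Rg q → SmoothNear Y q := fun q hq =>
      hq.sX.sub (hq.sX.dx.mul SmoothNear.snd)
    have hYx : ∀ q, G.Rg q → dx (dx G.X) q = 0 → dx Y q = 0 := fun q hq h0 => by
      have hd := hq.sX.dx.mul (SmoothNear.snd (p := q))
      rw [hY, dx_sub hq.sX.differentiableAt hd.differentiableAt, dx_mul hq.sX.dx.differentiableAt
        SmoothNear.snd.differentiableAt, h0, dx_snd]; ring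
    filter_upwards [eventually_eventually_nhds.2 h1] with q hq
    obtain ⟨hr, h0⟩ := hq.self_of_nhds
    have hd := hr.sX.dx.mul (SmoothNear.snd (p := q))
    refine ⟨hr, h0, ?_, hYs q hr, hYx q hr h0, ?_, ?_⟩
    · rw [← dt_dx_comm hr.sX.dx]; exact dt_eq_zero (hq.mono fun _ h => h.2)
    · rw [← dt_dx_comm (hYs q hr)]; exact dt_eq_zero (hq.mono fun q' h => hYx q' h.1 h.2)
    · rw [hY, dt_sub hr.sX.differentiableAt hd.differentiableAt, dt_mul hr.sX.dx.differentiableAt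
        SmoothNear.snd.differentiableAt, dt_snd]; ring
  have h3 : ∀ᶠ q in 𝓝 p, SmoothNear a q ∧ SmoothNear b q ∧ dx a q = 0 ∧ dx b q = 0 ∧
      dx G.V q / G.V q = a q * q.2 + b q := by
    filter_upwards [h2, h.normal_eqs hn hn'] with q ⟨hr, h0, h01, h02, h03, h04, h05⟩ h06
    have hS2 := mul_ne_zero two_ne_zero hr.hX
    have sS2 := (SmoothNear.const 2 (p := q)).mul hr.sX.dx
    have hX := hr.hX
    have hV := hr.hV
    have e : dx (fun q => 2 * dx G.X q) q = 0 := by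
      rw [dx_const_mul _ hr.sX.dx.differentiableAt, h0, mul_zero]
    refine ⟨hr.sX.dx.dt.div sS2 hS2, h02.dt.div sS2 hS2, ?_, ?_, ?_⟩
    · rw [ha, dx_div hr.sX.dx.dt.differentiableAt sS2.differentiableAt hS2, h01, e]; simp
    · rw [hb, dx_div h02.dt.differentiableAt sS2.differentiableAt hS2, h04, e]; simp
    · have e2 := h06.2.2.1
      rw [h05] at e2
      simp only [ha, hb]
      field_simp
      linear_combination e2
  filter_upwards [eventually_eventually_nhds.2 h3, h2, h.normal_eqs hn hn']
    with q hq ⟨hr, h0, h01, h02, h03, h04, h05⟩ ⟨e1, e2, e3, e4⟩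
  obtain ⟨sa, sb, xa, xb, hVx⟩ := hq.self_of_nhds
  have hX := hr.hX
  have hV := hr.hV
  have xa' : dx (dt a) q = 0 := by
    rw [← dt_dx_comm sa]; exact dt_eq_zero (hq.mono fun _ h => h.2.2.1)
  have xb' : dx (dt b) q = 0 := by
    rw [← dt_dx_comm sb]; exact dt_eq_zero (hq.mono fun _ h => h.2.2.2.1)
  have hL : (fun q => dx G.V q / G.V q) =ᶠ[𝓝 q] fun q => a q * q.2 + b q :=
    hq.mono fun _ h => h.2.2.2.2
  have hs : DifferentiableAt ℝ (fun q : Base => q.2) q := SmoothNear.snd.differentiableAt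
  have hVxx := dx_congr hL
  have hVxt := dt_congr hL
  have sas := sa.mul (SmoothNear.snd (p := q))
  rw [dx_div hr.sV.dx.differentiableAt hr.sV.differentiableAt hV,
    dx_add sas.differentiableAt sb.differentiableAt, dx_mul sa.differentiableAt hs, xa, xb,
    dx_snd] at hVxx
  rw [dt_div hr.sV.dx.differentiableAt hr.sV.differentiableAt hV,
    dt_add sas.differentiableAt sb.differentiableAt, dt_mul sa.differentiableAt hs,
    dt_snd] at hVxt
  have s1 := hr.sV.dt.div hr.sV hV
  have s2 := sa.dt.div (SmoothNear.const 2) two_ne_zero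
  have s3 := s2.mul (SmoothNear.snd.pow 2)
  have s4 := sb.dt.mul (SmoothNear.snd (p := q))
  have s5 := s1.sub (s3.add s4)
  have sc : SmoothNear c q := (sa.add (sb.pow 2)).sub s5
  refine ⟨hr.sX.dx, h02, sa, sb, sc, hX, h0, h03, xa, xb, ?_, ?_, ?_, e1, rfl, ?_, ?_⟩
  · rw [hc, dx_sub (sa.add (sb.pow 2)).differentiableAt s5.differentiableAt,
      dx_add sa.differentiableAt (sb.pow 2).differentiableAt, dx_pow sb.differentiableAt, xa, xb,
      dx_sub s1.differentiableAt (s3.add s4).differentiableAt, dx_add s3.differentiableAt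
      s4.differentiableAt, dx_mul s2.differentiableAt (SmoothNear.snd.pow 2).differentiableAt,
      dx_mul sb.dt.differentiableAt hs, dx_div sa.dt.differentiableAt (by fun_prop) two_ne_zero,
      dx_pow hs, xa', xb', dx_snd, dx_div hr.sV.dt.differentiableAt hr.sV.differentiableAt hV,
      ← dt_dx_comm hr.sV]
    simp only [dx_const]
    linear_combination -hVxt
  · simp only [ha]; field_simp
  · simp only [hb]; field_simp
  · simp only [hY]; ring
  · have e5 : dx G.X q * q.2 + Y q = G.X q := by simp only [hY]; ring
    rw [e5, ← e1]
    have e6 : dx (dx G.V) q / G.V q = a q + (a q * q.2 + b q) ^ 2 := by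
      rw [← hVx]
      field_simp at hVxx ⊢
      linear_combination hVxx
    have e7 : dt G.T q * K (G.X q) = -(dt G.V q / G.V q) + dx (dx G.V) q / G.V q + C q.2 := by
      field_simp
      linear_combination e4
    rw [e7, e6]
    simp only [hc]
    ring

end Normal

/-! ### The differential equation classifying the potentials -/

section Normal

variable {k : ℕ} {θ θ' : ArbitraryElement k} {p : Base} {G : PB} {C K : ℝ → ℝ}
  {S Y a b c : Base → ℝ}

theorem affine_of_normalAt (h : ∀ᶠ q in 𝓝 p, NormalAt G C K S Y a b c q)
    (h0 : ∀ᶠ q in 𝓝 p, a q = 0 ∧ b q = 0) : G.Affine p := by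
  filter_upwards [eventually_eventually_nhds.2 h, h0] with q hq ⟨ha, hb⟩
  have hq0 := hq.self_of_nhds
  constructor
  · rw [dt_congr (hq.mono fun q h => h.dtT), dt_pow hq0.sS.differentiableAt, hq0.dtS, ha]; simp
  · rw [dt_congr (hq.mono fun q h => h.X_eq), dt_add (hq0.sS.mul SmoothNear.snd).differentiableAt
      hq0.sY.differentiableAt, dt_mul hq0.sS.differentiableAt SmoothNear.snd.differentiableAt,
      hq0.dtS, hq0.dtY, ha, hb]; simp

/-- The differential consequence of the relation between the potentials which does not involve the
second potential. -/
theorem eventually_ode (h : ∀ᶠ q in 𝓝 p, NormalAt G C K S Y a b c q) (hr : G.Rg p)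
    (hn : Nrm θ C p) (hn' : Nrm θ' K (G.ψ p)) :
    ∃ A₂ A₁ A₀ : Base → ℝ, ((∀ᶠ q in 𝓝 p, a q = 0) → ∀ᶠ q in 𝓝 p, A₂ q = 0) ∧ ∀ᶠ q in 𝓝 p,
      (∀ f ∈ ({a, b, A₂, A₁, A₀} : Set (Base → ℝ)), SmoothNear f q ∧ dx f q = 0) ∧
      HasDerivAt C (dx (fun q => C q.2) q) q.2 ∧
      2 * (a q * q.2 + b q) * dx (fun q => C q.2) q + 4 * a q * C q.2 =
        A₂ q * q.2 ^ 2 + A₁ q * q.2 + A₀ q := by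
  obtain ⟨q₂, hq₂⟩ : ∃ q₂, q₂ = fun q => a q ^ 2 - dt a q / 2 := ⟨_, rfl⟩
  obtain ⟨q₁, hq₁⟩ : ∃ q₁, q₁ = fun q => 2 * a q * b q - dt b q := ⟨_, rfl⟩
  refine ⟨fun q => dt q₂ q - 8 * a q * q₂ q,
    fun q => dt q₁ q - 6 * a q * q₁ q - 4 * b q * q₂ q,
    fun q => dt c q - 4 * a q * c q - 2 * b q * q₁ q, fun ha0 => ?_, ?_⟩
  -- Without this clause the case `a = 0` would leave a quadratic expression for `C'`, and a cubic
  -- potential could not be excluded.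
  · have h20 : ∀ᶠ q in 𝓝 p, q₂ q = 0 := by
      filter_upwards [eventually_eventually_nhds.2 ha0] with q hq
      simp only [hq₂, hq.self_of_nhds, dt_eq_zero hq]; simp
    filter_upwards [ha0, eventually_eventually_nhds.2 h20] with q e1 e2
    rw [e1, dt_eq_zero e2]; simp
  have h2 : ∀ᶠ q in 𝓝 p, SmoothNear q₂ q ∧ SmoothNear q₁ q ∧ dx q₂ q = 0 ∧ dx q₁ q = 0 ∧
      NormalAt G C K S Y a b c q := by
    filter_upwards [eventually_eventually_nhds.2 h] with q hq
    obtain ⟨-, -, sa, sb, sc, -, -, -, xa, xb, -⟩ := hq.self_of_nhds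
    have xa' : dx (dt a) q = 0 := by
      rw [← dt_dx_comm sa]; exact dt_eq_zero (hq.mono fun _ h => h.dxa)
    have xb' : dx (dt b) q = 0 := by
      rw [← dt_dx_comm sb]; exact dt_eq_zero (hq.mono fun _ h => h.dxb)
    have s1 := sa.dt.div (SmoothNear.const 2) two_ne_zero
    have s2 := (SmoothNear.const 2).mul sa
    refine ⟨hq₂ ▸ (sa.pow 2).sub s1, hq₁ ▸ (s2.mul sb).sub sb.dt, ?_, ?_, hq.self_of_nhds⟩
    · rw [hq₂, dx_sub (sa.pow 2).differentiableAt s1.differentiableAt, dx_pow sa.differentiableAt,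
        dx_div sa.dt.differentiableAt (by fun_prop) two_ne_zero, xa, xa']; simp
    · rw [hq₁, dx_sub (s2.mul sb).differentiableAt sb.dt.differentiableAt, dx_mul
        s2.differentiableAt sb.differentiableAt, dx_const_mul _ sa.differentiableAt, xa, xb, xb']
      simp
  filter_upwards [eventually_eventually_nhds.2 h2, hn.eventually,
    hr.continuousAt_ψ.eventually hn'.eventually, hr.eventually] with q hq hC hK hR
  obtain ⟨s₂, s₁, x₂, x₁, hq0⟩ := hq.self_of_nhds
  obtain ⟨sS, sY, sa, sb, sc, hS, xS, xY, xa, xb, xc, tS, tY, -, dX, eX, rel⟩ := hq0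
  have hd : ∀ {f : Base → ℝ}, (∀ᶠ q' in 𝓝 q, dx f q' = 0) → SmoothNear f q → dx (dt f) q = 0 :=
    fun h hf => by rw [← dt_dx_comm hf]; exact dt_eq_zero h
  have x₂' := hd (hq.mono fun _ h => h.2.2.1) s₂
  have x₁' := hd (hq.mono fun _ h => h.2.2.2.1) s₁
  have xc' := hd (hq.mono fun _ h => h.2.2.2.2.dxc) sc
  have cm : ∀ (c : ℝ) {f g : Base → ℝ}, SmoothNear f q → SmoothNear g q → dx f q = 0 → dx g q = 0 →
      SmoothNear (fun q => c * f q * g q) q ∧ dx (fun q => c * f q * g q) q = 0 := by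
    intro c f g hf hg h0 h1
    have s := (SmoothNear.const c).mul hf
    refine ⟨s.mul hg, ?_⟩
    rw [dx_mul s.differentiableAt hg.differentiableAt, dx_const_mul _ hf.differentiableAt, h0, h1]
    simp
  have sbt : ∀ {f g : Base → ℝ}, SmoothNear f q ∧ dx f q = 0 → SmoothNear g q ∧ dx g q = 0 →
      SmoothNear (fun q => f q - g q) q ∧ dx (fun q => f q - g q) q = 0 := by
    intro f g hf hg
    exact ⟨hf.1.sub hg.1, by
      rw [dx_sub hf.1.differentiableAt hg.1.differentiableAt, hf.2, hg.2, sub_zero]⟩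
  refine ⟨?_, hC.hasDerivAt, ?_⟩
  · rintro f (rfl | rfl | rfl | rfl | rfl)
    · exact ⟨sa, xa⟩
    · exact ⟨sb, xb⟩
    · exact sbt ⟨s₂.dt, x₂'⟩ (cm 8 sa s₂ xa x₂)
    · exact sbt (sbt ⟨s₁.dt, x₁'⟩ (cm 6 sa s₁ xa x₁)) (cm 4 sb s₂ xb x₂)
    · exact sbt (sbt ⟨sc.dt, xc'⟩ (cm 4 sa sc xa xc)) (cm 2 sb s₁ xb x₁)
  have hs : DifferentiableAt ℝ (fun q : Base => q.2) q := SmoothNear.snd.differentiableAt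
  have tX : dt G.X q = 2 * S q * (a q * q.2 + b q) := by
    rw [dt_congr (hq.mono fun q h => h.2.2.2.2.X_eq), dt_add (sS.mul SmoothNear.snd).differentiableAt
      sY.differentiableAt, dt_mul sS.differentiableAt hs, tS, tY, dt_snd]; ring
  set k' := dx (fun q => K q.2) (G.ψ q) with hk'
  have hKd : HasDerivAt K k' (G.X q) := hK.hasDerivAt
  have sKX : SmoothNear (fun q => K (G.X q)) q := hR.sc (g := fun q => K q.2) hK.smooth
  have e : (fun q => S q ^ 2 * K (G.X q)) =ᶠ[𝓝 q]
      fun q => C q.2 + q₂ q * q.2 ^ 2 + q₁ q * q.2 + c q := by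
    filter_upwards [hq] with q h
    rw [h.2.2.2.2.X_eq, h.2.2.2.2.rel, hq₂, hq₁]
  have et := dt_congr e
  have ex := dx_congr e
  have f1 := hC.smooth
  have f2 := s₂.mul (SmoothNear.snd.pow 2)
  have f3 := s₁.mul (SmoothNear.snd (p := q))
  rw [dt_mul (sS.pow 2).differentiableAt sKX.differentiableAt, dt_pow sS.differentiableAt,
    dt_comp₁ hKd hR.sX.differentiableAt, dt_add ((f1.add f2).add f3).differentiableAt
    sc.differentiableAt, dt_add (f1.add f2).differentiableAt f3.differentiableAt,
    dt_add f1.differentiableAt f2.differentiableAt, dt_mul s₂.differentiableAt (SmoothNear.snd.pow 2).differentiableAt,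
    dt_mul s₁.differentiableAt hs, dt_pow hs, dt_fun_snd C, dt_snd, tX, tS] at et
  rw [dx_mul (sS.pow 2).differentiableAt sKX.differentiableAt, dx_pow sS.differentiableAt,
    dx_comp₁ hKd hR.sX.differentiableAt, dx_add ((f1.add f2).add f3).differentiableAt
    sc.differentiableAt, dx_add (f1.add f2).differentiableAt f3.differentiableAt,
    dx_add f1.differentiableAt f2.differentiableAt, dx_mul s₂.differentiableAt (SmoothNear.snd.pow 2).differentiableAt,
    dx_mul s₁.differentiableAt hs, dx_pow hs, dx_snd, x₂, x₁, xc, dX, xS] at ex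
  have e0 := e.self_of_nhds
  -- The operator `∂_t - 2(ax + b) ∂_x - 4a` annihilates `S² K(X)`, because `S_t = 2aS` and `X_t =
  -- 2S(ax + b)`; thus both `K` and `K'` disappear.
  linear_combination et - 2 * (a q * q.2 + b q) * ex - 4 * a q * e0

end Normal

/-- Near `x₀`, the function `C` has the form `μ / y² + α y² + β y + γ` with `y = x + z`. -/
def Special (C : ℝ → ℝ) (x₀ : ℝ) : Prop :=
  ∃ μ α β γ z, x₀ + z ∈ natDom μ ∧
    ∀ᶠ x in 𝓝 x₀, C x = μ / (x + z) ^ 2 + α * (x + z) ^ 2 + β * (x + z) + γ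

theorem eqOn_ball_of_hasDerivAt {f g f' : ℝ → ℝ} {x₀ r : ℝ} (hr : 0 < r)
    (hf : ∀ x ∈ Metric.ball x₀ r, HasDerivAt f (f' x) x)
    (hg : ∀ x ∈ Metric.ball x₀ r, HasDerivAt g (f' x) x) :
    ∃ m, ∀ x ∈ Metric.ball x₀ r, f x = g x + m := by
  refine ⟨f x₀ - g x₀, fun x hx => ?_⟩
  have hd : ∀ x ∈ Metric.ball x₀ r, HasDerivAt (fun x => f x - g x) 0 x := fun x hx => by
    have := (hf x hx).sub (hg x hx)
    rwa [sub_self] at this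
  have := Metric.isOpen_ball.is_const_of_deriv_eq_zero (convex_ball x₀ r).isPreconnected
    (fun s hs => (hd s hs).differentiableAt.differentiableWithinAt) (fun s hs => (hd s hs).deriv)
    hx (Metric.mem_ball_self hr)
  linarith

/-- Multiplication by `x + z` turns the left-hand side into the derivative of `(x + z)² C`; the
constant of integration is `μ`. If `x₀ + z = 0`, evaluation at `x₀` gives `μ = 0`. -/
theorem special_of_euler {C C' : ℝ → ℝ} {x₀ r z p₂ p₁ p₀ : ℝ} (hr : 0 < r)
    (h : ∀ x ∈ Metric.ball x₀ r, HasDerivAt C (C' x) x ∧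
      (x + z) * C' x + 2 * C x = p₂ * (x + z) ^ 2 + p₁ * (x + z) + p₀) : Special C x₀ := by
  obtain ⟨μ, hμ⟩ := eqOn_ball_of_hasDerivAt (f := fun x => (x + z) ^ 2 * C x)
    (g := fun x => p₂ / 4 * (x + z) ^ 4 + p₁ / 3 * (x + z) ^ 3 + p₀ / 2 * (x + z) ^ 2)
    (f' := fun x => (x + z) * (p₂ * (x + z) ^ 2 + p₁ * (x + z) + p₀)) (x₀ := x₀) hr
    (fun x hx => by
      refine ((((hasDerivAt_id' x).add_const z).pow 2).mul (h x hx).1).congr_deriv ?_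
      rw [← (h x hx).2]; simp; ring)
    (fun x hx => by
      have hd := (hasDerivAt_id' x).add_const z
      refine ((((hd.pow 4).const_mul (p₂ / 4)).add ((hd.pow 3).const_mul (p₁ / 3))).add
        ((hd.pow 2).const_mul (p₀ / 2))).congr_deriv ?_
      simp; ring)
  refine ⟨μ, p₂ / 4, p₁ / 3, p₀ / 2, z, ?_, ?_⟩
  · intro h0 h1
    have := hμ x₀ (Metric.mem_ball_self hr)
    rw [h1] at this
    exact h0 (by linarith)
  filter_upwards [Metric.ball_mem_nhds x₀ hr] with x hx
  have e := hμ x hx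
  by_cases hz : x + z = 0
  -- Where `x + z = 0` one cannot divide, but the equation itself reads `2 C = p₀`, in agreement
  -- with the value `0` of `μ / 0`.
  · have e2 := (h x hx).2
    rw [hz] at e e2 ⊢
    simp
    linarith
  · apply mul_left_cancel₀ (pow_ne_zero 2 hz)
    rw [e]
    field_simp
    ring

theorem special_of_hasDerivAt_affine {C C' : ℝ → ℝ} {x₀ r p₁ p₀ : ℝ} (hr : 0 < r)
    (h : ∀ x ∈ Metric.ball x₀ r, HasDerivAt C (C' x) x ∧ C' x = p₁ * x + p₀) : Special C x₀ := by
  obtain ⟨m, hm⟩ := eqOn_ball_of_hasDerivAt (f := C) (f' := fun x => p₁ * x + p₀)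
    (g := fun x => p₁ / 2 * x ^ 2 + p₀ * x) (x₀ := x₀) hr
    (fun x hx => by rw [← (h x hx).2]; exact (h x hx).1)
    (fun x hx => by
      have hd := hasDerivAt_id' x
      refine (((hd.pow 2).const_mul (p₁ / 2)).add (hd.const_mul p₀)).congr_deriv ?_
      simp; ring)
  refine ⟨0, p₁ / 2, p₀, m, 0, fun h => absurd rfl h, ?_⟩
  filter_upwards [Metric.ball_mem_nhds x₀ hr] with x hx
  rw [hm x hx]; simp

theorem exists_mem_ball_ne {f : Base → ℝ} {p : Base} {r : ℝ} (hr : 0 < r)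
    (h : ¬ ∀ᶠ q in 𝓝 p, f q = 0) :
    ∃ t ∈ Metric.ball p.1 r, ∃ x ∈ Metric.ball p.2 r, f (t, x) ≠ 0 := by
  by_contra! h0
  exact h (eventually_of_ball hr h0)

/-- For a non-affine germ `a` or `b` is nonzero at times arbitrarily near `p.1`. Fix such a time:
the coefficients do not depend on `x` and `C` does not depend on `t`, so this is an ordinary
differential equation for `C` on a full interval around `p.2`. It is of Euler type if `a ≠ 0`; if
`a` vanishes identically, it says that `C'` is affine. -/
theorem Adm.special {k : ℕ} {θ θ' : ArbitraryElement k} {p : Base} {G : PB} {C K : ℝ → ℝ}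
    (h : Adm θ θ' p G) (hn : Nrm θ C p) (hn' : Nrm θ' K (G.ψ p)) (ha : ¬ G.Affine p) :
    Special C p.2 := by
  obtain ⟨S, Y, a, b, c, hN⟩ := h.exists_normalAt hn hn'
  obtain ⟨A₂, A₁, A₀, hA, hode⟩ := eventually_ode hN h.rg hn hn'
  by_cases ha0 : ∀ᶠ q in 𝓝 p, a q = 0
  · have hb0 : ¬ ∀ᶠ q in 𝓝 p, b q = 0 := fun hb0 => ha (affine_of_normalAt hN (ha0.and hb0))
    obtain ⟨r, hr, H⟩ := exists_ball_iff (hode.and (ha0.and (hA ha0)))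
    obtain ⟨t, ht, x₁, hx₁, hb⟩ := exists_mem_ball_ne hr hb0
    have hc : ∀ f ∈ ({a, b, A₂, A₁, A₀} : Set (Base → ℝ)), ∀ x ∈ Metric.ball p.2 r,
        f (t, x) = f (t, x₁) := fun f hf x hx => eq_of_dx_eq_zero_on (fun t ht x hx =>
        ⟨((H t ht x hx).1.1 f hf).1.differentiableAt, ((H t ht x hx).1.1 f hf).2⟩) ht hx hx₁
    refine special_of_hasDerivAt_affine (C' := fun x => dx (fun q => C q.2) (t, x)) hr
      (p₁ := A₁ (t, x₁) / (2 * b (t, x₁))) (p₀ := A₀ (t, x₁) / (2 * b (t, x₁)))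
      fun x hx => ⟨(H t ht x hx).1.2.1, ?_⟩
    have e := (H t ht x hx).1.2.2
    rw [(H t ht x hx).2.1, (H t ht x hx).2.2, hc b (by simp) x hx, hc A₁ (by simp) x hx,
      hc A₀ (by simp) x hx] at e
    field_simp
    linear_combination e
  · obtain ⟨r, hr, H⟩ := exists_ball_iff hode
    obtain ⟨t, ht, x₁, hx₁, hb⟩ := exists_mem_ball_ne hr ha0
    have hc : ∀ f ∈ ({a, b, A₂, A₁, A₀} : Set (Base → ℝ)), ∀ x ∈ Metric.ball p.2 r,
        f (t, x) = f (t, x₁) := fun f hf x hx => eq_of_dx_eq_zero_on (fun t ht x hx =>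
        ⟨((H t ht x hx).1 f hf).1.differentiableAt, ((H t ht x hx).1 f hf).2⟩) ht hx hx₁
    -- The shift `z = b / a` makes `a x + b = a (x + z)`, and the right-hand side is re-expanded in
    -- powers of `x + z`.
    obtain ⟨z, hz⟩ : ∃ z, b (t, x₁) = z * a (t, x₁) := ⟨b (t, x₁) / a (t, x₁), by field_simp⟩
    refine special_of_euler (C' := fun x => dx (fun q => C q.2) (t, x)) (z := z) hr
      (p₂ := A₂ (t, x₁) / (2 * a (t, x₁)))
      (p₁ := (A₁ (t, x₁) - 2 * A₂ (t, x₁) * z) / (2 * a (t, x₁)))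
      (p₀ := (A₀ (t, x₁) - A₁ (t, x₁) * z + A₂ (t, x₁) * z ^ 2) / (2 * a (t, x₁)))
      fun x hx => ⟨(H t ht x hx).2.1, ?_⟩
    have e := (H t ht x hx).2.2
    rw [hc a (by simp) x hx, hc b (by simp) x hx, hc A₂ (by simp) x hx, hc A₁ (by simp) x hx,
      hc A₀ (by simp) x hx, hz] at e
    field_simp
    linear_combination e

/-! ### Reduction to inverse square potentials -/

/-- Scalings and shifts of the independent variables, together with a multiplication of `u` by an
exponential function of time. -/
noncomputable def PB.scale (r d κ γ : ℝ) : PB :=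
  PB.ofExp (fun q => r ^ 2 * q.1 + d) (fun q => r * q.2 + κ) (fun q => γ * q.1)

theorem PB.scale_derivs (r d κ γ : ℝ) (q : Base) :
    dt (PB.scale r d κ γ).T q = r ^ 2 ∧ dx (PB.scale r d κ γ).T q = 0 ∧
    dt (PB.scale r d κ γ).X q = 0 ∧ dx (PB.scale r d κ γ).X q = r := by
  have h1 := dt_affine d 0 0 (r ^ 2) 0 q
  have h2 := dx_affine d 0 0 (r ^ 2) 0 q
  have h3 := dt_affine κ 0 0 0 r q
  have h4 := dx_affine κ 0 0 0 r q
  simp only [sub_zero, zero_mul, add_zero] at h1 h2 h3 h4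
  exact ⟨(congrArg (fun f => dt f q) (funext fun q => add_comm _ _)).trans h1,
    (congrArg (fun f => dx f q) (funext fun q => add_comm _ _)).trans h2,
    (congrArg (fun f => dt f q) (funext fun q => add_comm _ _)).trans h3,
    (congrArg (fun f => dx f q) (funext fun q => add_comm _ _)).trans h4⟩

theorem PB.affine_scale (r d κ γ : ℝ) (p : Base) : (PB.scale r d κ γ).Affine p := by
  refine Eventually.of_forall fun q => ⟨?_, (PB.scale_derivs r d κ γ q).2.2.1⟩
  rw [dt_congr (g := fun _ => r ^ 2) (Eventually.of_forall fun q => (PB.scale_derivs r d κ γ q).1),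
    dt_const]

theorem adm_scale {k : ℕ} {θ θ' : ArbitraryElement k} {C C' : ℝ → ℝ} {p : Base} {r d κ γ : ℝ}
    (hr : r ≠ 0) (hn : Nrm θ C p) (hn' : Nrm θ' C' ((PB.scale r d κ γ).ψ p))
    (h : ∀ᶠ x in 𝓝 p.2, r ^ 2 * C' (r * x + κ) = C x - γ) : Adm θ θ' p (PB.scale r d κ γ) := by
  refine adm_ofExp (SmoothNear.of_contDiff (by fun_prop)) (SmoothNear.of_contDiff (by fun_prop))
    (SmoothNear.of_contDiff (by fun_prop)) hn hn' ?_
  filter_upwards [continuous_snd.continuousAt.eventually h] with q hq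
  obtain ⟨h1, h2, h3, h4⟩ := PB.scale_derivs r d κ γ q
  simp only [PB.scale, PB.ofExp] at h1 h2 h3 h4
  have h5 := dt_affine 0 0 0 γ 0 q
  have h6 : dx (fun q : Base => γ * q.1) = fun _ => 0 := by
    funext q
    have := dx_affine 0 0 0 γ 0 q
    simpa using this
  simp only [sub_zero, zero_mul, add_zero, zero_add] at h5
  have h7 : dx (fun q : Base => r * q.2 + κ) = fun _ => r := by
    funext q
    exact (PB.scale_derivs r d κ γ q).2.2.2
  rw [h1, h2, h3, h5, h6, h7]
  refine ⟨rfl, rfl, hr, dx_const r, by simp, ?_⟩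
  rw [hq]; simp

section Reduction

variable {k : ℕ} {θ θ' : ArbitraryElement k} {p : Base} {G : PB} {μ α β μ' α' β' : ℝ}

/-- A shift of `x` removes `z`, and an exponential factor in `t` removes the additive constant `γ`.
-/
theorem Special.exists_adm (hk : 3 ≤ k) {C : ℝ → ℝ} (h : Special C p.2) (hn : Nrm θ C p) :
    ∃ μ α β E, Adm θ (potential k μ α β) p E ∧ E.Affine p := by
  obtain ⟨μ, α, β, γ, z, h0, h1⟩ := h
  refine ⟨μ, α, β, _, adm_scale (d := 0) (κ := z) (γ := γ) one_ne_zero hn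
    (nrm_potential hk μ α β ?_) ?_, PB.affine_scale _ _ _ _ _⟩
  · change 1 * p.2 + z ∈ natDom μ
    rwa [one_mul]
  · filter_upwards [h1] with x hx
    rw [hx]; ring

theorem exists_pow_three_eq (β : ℝ) : ∃ r : ℝ, r ^ 3 = β := by
  rcases le_total 0 β with h | h
  · exact ⟨_, Real.rpow_inv_natCast_pow h three_ne_zero⟩
  · refine ⟨-(-β) ^ (((3 : ℕ) : ℝ)⁻¹), ?_⟩
    rw [Odd.neg_pow (by decide), Real.rpow_inv_natCast_pow (by linarith) three_ne_zero, neg_neg]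

/-- Scaling by `r` normalises `α` to `ε`, and completing the square removes `β`. The corresponding
shift `κ` is zero if `μ ≠ 0`, so it does not move the singularity. Then `gen₁` or `gen₂` applies. -/
theorem exists_gen_square (hk : 3 ≤ k) {ε r : ℝ} (hr : r ≠ 0) (hε : ε = 1 ∨ ε = -1)
    (hα : ε * r ^ 4 = α) (hβ : μ ≠ 0 → β = 0) (hp : p.2 ∈ natDom μ) :
    ∃ E, Gen (potential k μ α β) (potential k μ 0 0) p E := by
  have hε2 : ε ^ 2 = 1 := by rcases hε with rfl | rfl <;> norm_num
  obtain ⟨κ, hκ⟩ : ∃ κ, β = 2 * ε * r ^ 3 * κ := by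
    refine ⟨ε * β / (2 * r ^ 3), ?_⟩
    field_simp
    linear_combination -β * hε2
  have hκ0 : μ ≠ 0 → κ = 0 := by
    intro h
    have := hβ h
    rw [hκ] at this
    rcases hε with rfl | rfl <;> simpa [hr] using this
  have hd : ∀ x ∈ natDom μ, r * x + κ ∈ natDom μ := by
    intro x hx h
    rw [hκ0 h, add_zero]
    exact mul_ne_zero hr (hx h)
  -- The time shift sends the point to time `0`, inside the strip on which `Φ₁` is defined; the last
  -- parameter compensates the constant left by completing the square.
  set E := PB.scale r (-(r ^ 2 * p.1)) κ (-(ε * r ^ 2 * κ ^ 2)) with hE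
  have hψ : E.ψ p = (0, r * p.2 + κ) := by
    simp [hE, PB.scale, PB.ofExp, PB.ψ]
  have h1 : Adm (potential k μ α β) (potential k μ ε 0) p E := by
    refine adm_scale hr (nrm_potential hk μ α β hp) (nrm_potential hk μ ε 0 (hd _ hp)) ?_
    filter_upwards [(isOpen_natDom μ).mem_nhds hp] with x hx
    have e : r ^ 2 * (μ / (r * x + κ) ^ 2) = μ / x ^ 2 := by
      by_cases h : μ = 0
      · simp [h]
      · have := hx h
        rw [hκ0 h, add_zero]; field_simp
    rw [hκ, ← hα]
    linear_combination e
  have h2 := Gen.of_affine (potential_mem hk _ _ _) (potential_mem hk _ _ _) h1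
    (PB.affine_scale _ _ _ _ p)
  have h3 : (E.ψ p).2 ∈ natDom μ := hd _ hp
  rcases hε with rfl | rfl
  · exact ⟨_, h2.comp (Gen.gen₁ hk (by rw [hψ]; simpa using Real.pi_pos) h3)⟩
  · exact ⟨_, h2.comp (Gen.gen₂ hk h3)⟩

/-- For `α ≠ 0` the scaling factor is the fourth root of `|α|`. For `α = 0` and `β ≠ 0` the number
`μ` is zero, and scaling by the cube root of `β` leads to the source of `gen₃`. -/
theorem exists_gen_vertex (hk : 3 ≤ k) (hβ : μ ≠ 0 → β = 0) (hp : p.2 ∈ natDom μ) :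
    ∃ E, Gen (potential k μ α β) (potential k μ 0 0) p E := by
  have hs : ∀ s : ℝ, 0 ≤ s → √(√s) ^ 4 = s := fun s hs => by
    rw [show 4 = 2 * 2 by norm_num, pow_mul, Real.sq_sqrt (Real.sqrt_nonneg _), Real.sq_sqrt hs]
  have hn : ∀ s : ℝ, 0 < s → √(√s) ≠ 0 := fun s hs =>
    (Real.sqrt_pos.2 (Real.sqrt_pos.2 hs)).ne'
  rcases lt_trichotomy α 0 with hα | rfl | hα
  · exact exists_gen_square hk (hn (-α) (by linarith)) (Or.inr rfl)
      (by rw [hs (-α) (by linarith)]; ring) hβ hp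
  · by_cases h0 : β = 0
    · subst h0
      exact ⟨_, Gen.of_affine (potential_mem hk _ _ _) (potential_mem hk _ _ _) (adm_refl hp)
        (PB.affine_shift _ _)⟩
    · have hμ : μ = 0 := by_contra fun h => h0 (hβ h)
      subst hμ
      obtain ⟨r, hr⟩ := exists_pow_three_eq β
      have hr0 : r ≠ 0 := by rintro rfl; exact h0 (by rw [← hr]; norm_num)
      have h1 : Adm (potential k 0 0 β) (potential k 0 0 1) p (PB.scale r 0 0 0) := by
        refine adm_scale hr0 (nrm_potential hk 0 0 β hp)
          (nrm_potential hk 0 0 1 fun h => absurd rfl h) (Eventually.of_forall fun x => ?_)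
        rw [← hr]; ring
      exact ⟨_, (Gen.of_affine (potential_mem hk _ _ _) (potential_mem hk _ _ _) h1
        (PB.affine_scale _ _ _ _ p)).comp (Gen.gen₃ hk)⟩
  · exact exists_gen_square hk (hn α hα) (Or.inl rfl) (by rw [hs α hα.le]; ring) hβ hp

/-- The relations between the parameters of two potentials. -/
theorem Adm.potential_rel (hk : 3 ≤ k) (h : Adm (potential k μ α β) (potential k μ' α' β') p G) :
    ∃ S Y a b : Base → ℝ, ∀ᶠ q in 𝓝 p, SmoothNear S q ∧ SmoothNear Y q ∧ SmoothNear a q ∧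
      SmoothNear b q ∧ S q ≠ 0 ∧ dx S q = 0 ∧ dx a q = 0 ∧ dx b q = 0 ∧
      dt S q = 2 * a q * S q ∧ dt Y q = 2 * b q * S q ∧ dx G.X q = S q ∧
      G.X q = S q * q.2 + Y q ∧ α + (a q ^ 2 - dt a q / 2) = S q ^ 4 * α' ∧
      β + (2 * a q * b q - dt b q) = S q ^ 3 * (2 * α' * Y q + β') ∧ μ' = μ ∧ μ * Y q = 0 ∧
      ((∀ᶠ q in 𝓝 p, a q = 0 ∧ b q = 0) → G.Affine p) := by
  have hn := nrm_potential hk μ α β h.mem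
  have hn' := nrm_potential hk μ' α' β' h.mem'
  obtain ⟨S, Y, a, b, c, hN⟩ := h.exists_normalAt hn hn'
  refine ⟨S, Y, a, b, ?_⟩
  filter_upwards [eventually_eventually_nhds.2 hN, h.eventually] with q hq hA
  have H := hq.self_of_nhds
  have hc : ∀ {f : Base → ℝ}, SmoothNear f q → (∀ᶠ q' in 𝓝 q, dx f q' = 0) →
      ∀ᶠ x in 𝓝 q.2, f (q.1, x) = f q := fun hf h0 =>
    (tendsto_line' q).eventually (eventually_eq_of_dx hf h0)
  have hd : ∀ {f : Base → ℝ}, SmoothNear f q → (∀ᶠ q' in 𝓝 q, dx f q' = 0) →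
      ∀ᶠ q' in 𝓝 q, dx (dt f) q' = 0 := fun hf h0 => by
    filter_upwards [hf.eventually, eventually_eventually_nhds.2 h0] with q' h1 h2
    rw [← dt_dx_comm h1]; exact dt_eq_zero h2
  have xa := hq.mono fun _ h => h.dxa
  have xb := hq.mono fun _ h => h.dxb
  obtain ⟨e1, e2, -, e4, e5⟩ := inverse_square_identity (μ := μ) (μ' := μ') (s := S q) (κ := Y q)
    (x₀ := q.2) (q₂ := α + (a q ^ 2 - dt a q / 2) - S q ^ 4 * α')
    (q₁ := β + (2 * a q * b q - dt b q) - S q ^ 3 * (2 * α' * Y q + β'))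
    (q₀ := c q - S q ^ 2 * (α' * Y q ^ 2 + β' * Y q)) H.S_ne (by
      filter_upwards [(tendsto_line' q).eventually (hq.and hA.eventually),
        hc H.sS (hq.mono fun _ h => h.dxS), hc H.sY (hq.mono fun _ h => h.dxY), hc H.sa xa,
        hc H.sb xb, hc H.sc (hq.mono fun _ h => h.dxc), hc H.sa.dt (hd H.sa xa),
        hc H.sb.dt (hd H.sb xb)] with x ⟨h1, h2⟩ f1 f2 f3 f4 f5 f6 f7
      have g1 : x ∈ natDom μ := h2.mem
      have g2 : G.X (q.1, x) ∈ natDom μ' := h2.mem'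
      have g3 := h1.rel
      rw [h1.X_eq] at g2
      rw [f1, f2] at g2 g3
      rw [f3, f4, f5, f6, f7] at g3
      exact ⟨g1, g2, by linear_combination g3⟩)
  exact ⟨H.sS, H.sY, H.sa, H.sb, H.S_ne, H.dxS, H.dxa, H.dxb, H.dtS, H.dtY, H.dxX, H.X_eq,
    sub_eq_zero.1 e1, sub_eq_zero.1 e2, e4, e5, affine_of_normalAt hN⟩

/-- If `μ ≠ 0`, the singularity cannot move, so `Y = 0`, `b = 0` and `S³ β' = β`. Were `β' ≠ 0`,
then `S` would be constant, hence `a = 0`, and the germ would be affine. -/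
theorem Adm.parameters (hk : 3 ≤ k) (h : Adm (potential k μ α β) (potential k μ' α' β') p G)
    (ha : ¬ G.Affine p) : μ' = μ ∧ (μ ≠ 0 → β = 0) ∧ (μ ≠ 0 → β' = 0) := by
  obtain ⟨S, Y, a, b, hN⟩ := h.potential_rel hk
  have key : μ ≠ 0 → β' = 0 ∧ β = 0 := by
    intro hμ
    have hY : ∀ᶠ q in 𝓝 p, Y q = 0 :=
      hN.mono fun q h => (mul_eq_zero.1 h.2.2.2.2.2.2.2.2.2.2.2.2.2.2.2.1).resolve_left hμ
    have hb : ∀ᶠ q in 𝓝 p, b q = 0 := by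
      filter_upwards [hN, eventually_eventually_nhds.2 hY] with q ⟨_, _, _, _, h1, _, _, _, _, h2, _⟩ h3
      rw [dt_eq_zero h3] at h2
      simpa [h1] using h2.symm
    have hβ : ∀ᶠ q in 𝓝 p, S q ^ 3 * β' = β := by
      filter_upwards [hN, hY, eventually_eventually_nhds.2 hb] with q
        ⟨_, _, _, _, _, _, _, _, _, _, _, _, _, h1, _⟩ h2 h3
      rw [h2, h3.self_of_nhds, dt_eq_zero h3] at h1
      linear_combination -h1
    have hβ' : β' = 0 := by
      by_contra h0
      refine ha (hN.self_of_nhds.2.2.2.2.2.2.2.2.2.2.2.2.2.2.2.2 (Eventually.and ?_ hb))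
      filter_upwards [hN, eventually_eventually_nhds.2 hβ] with q
        ⟨h1, _, _, _, h2, _, _, _, h3, _⟩ h4
      have h5 : dt (fun q => S q ^ 3 * β') q = 0 := by
        rw [dt_congr (g := fun _ => β) h4, dt_const]
      rw [dt_mul (h1.pow 3).differentiableAt (by fun_prop), dt_pow h1.differentiableAt, h3,
        dt_const] at h5
      simpa [h0, h2] using h5
    refine ⟨hβ', ?_⟩
    rw [← hβ.self_of_nhds, hβ', mul_zero]
  exact ⟨hN.self_of_nhds.2.2.2.2.2.2.2.2.2.2.2.2.2.2.1, fun h => (key h).2, fun h => (key h).1⟩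

/-- A germ between inverse square potentials is affine if its derivatives at the point are those
of an affine one. -/
theorem Adm.affine_of_derivs (hk : 3 ≤ k) (h : Adm (potential k μ 0 0) (potential k μ' 0 0) p G)
    (h1 : dt (dx G.X) p = 0) (h2 : μ = 0 → dt G.X p = 0) : G.Affine p := by
  obtain ⟨S, Y, a, b, hN⟩ := h.potential_rel hk
  -- With `α = β = 0` on both sides one has `a_t = 2a²` and `b_t = 2ab`, the same linear equation
  -- `f_t = 2af` that `S` satisfies. Hence `f / S` is constant, and `f` vanishes near `p` if it
  -- vanishes at `p`.
  have cst : ∀ f : Base → ℝ, (∀ᶠ q in 𝓝 p, SmoothNear f q ∧ dx f q = 0 ∧ dt f q = 2 * a q * f q) →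
      f p = 0 → ∀ᶠ q in 𝓝 p, f q = 0 := by
    intro f hf h0
    have := eventually_const (f := fun q => f q / S q) (hf.self_of_nhds.1.div hN.self_of_nhds.1
      hN.self_of_nhds.2.2.2.2.1) (by
        filter_upwards [hN, hf] with q ⟨g1, _, _, _, g5, g6, _, _, g9, _⟩ ⟨f1, f2, f3⟩
        rw [dt_div f1.differentiableAt g1.differentiableAt g5, dx_div f1.differentiableAt
          g1.differentiableAt g5, f2, f3, g6, g9]
        constructor
        · field_simp; ring
        · simp)
    filter_upwards [this, hN] with q e1 e2
    rw [h0, zero_div, div_eq_zero_iff] at e1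
    exact e1.resolve_right e2.2.2.2.2.1
  have hX : ∀ᶠ q in 𝓝 p, dx G.X q = S q := by
    filter_upwards [hN] with q ⟨_, _, _, _, _, _, _, _, _, _, h, _⟩ using h
  have hX' : ∀ᶠ q in 𝓝 p, G.X q = S q * q.2 + Y q := by
    filter_upwards [hN] with q ⟨_, _, _, _, _, _, _, _, _, _, _, h, _⟩ using h
  have hf := hN.self_of_nhds
  obtain ⟨g1, g2, g3, g4, g5, g6, g7, g8, g9, g10, g11, g12, g13, g14, g15, g16, g17⟩ := hf
  have ha : a p = 0 := by
    rw [dt_congr hX, g9] at h1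
    simpa [g5] using h1
  refine g17 (Eventually.and (cst a ?_ ha) ?_)
  · filter_upwards [hN] with q ⟨_, _, h1, _, _, _, h2, _, _, _, _, _, h3, _⟩
    exact ⟨h1, h2, by linear_combination (-2) * h3⟩
  by_cases hμ : μ = 0
  · refine cst b ?_ ?_
    · filter_upwards [hN] with q ⟨_, _, _, h1, _, _, _, h2, _, _, _, _, _, h3, _⟩
      exact ⟨h1, h2, by linear_combination -h3⟩
    · have := h2 hμ
      rw [dt_congr hX', dt_add (g1.mul SmoothNear.snd).differentiableAt g2.differentiableAt,
        dt_mul g1.differentiableAt SmoothNear.snd.differentiableAt, g9, g10, ha, dt_snd] at this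
      simpa [g5] using this
  · have hY : ∀ᶠ q in 𝓝 p, Y q = 0 :=
      hN.mono fun q h => (mul_eq_zero.1 h.2.2.2.2.2.2.2.2.2.2.2.2.2.2.2.1).resolve_left hμ
    filter_upwards [hN, eventually_eventually_nhds.2 hY] with q ⟨_, _, _, _, h1, _, _, _, _, h2, _⟩ h3
    rw [dt_eq_zero h3] at h2
    simpa [h1] using h2.symm

end Reduction

/-! ### Germs between inverse square potentials -/

section Vertex

variable {k : ℕ} {θ θ₁ θ' : ArbitraryElement k} {p : Base} {G H : PB} {μ μ' : ℝ}

theorem PB.Rg.dx_comp_X (hG : G.Rg p) (hH : H.Rg (G.ψ p)) :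
    dx (G.comp H).X p = dx H.X (G.ψ p) * dx G.X p := hG.dx_c hH.sX

theorem PB.Rg.dt_comp_X (hG : G.Rg p) (hH : H.Rg (G.ψ p)) :
    dt (G.comp H).X p = dt H.X (G.ψ p) * dt G.T p + dx H.X (G.ψ p) * dt G.X p := hG.dt_c hH.sX

theorem PB.Rg.dtdx_comp_X (hG : G.Rg p) (hH : H.Rg (G.ψ p)) (h0 : dx (dx H.X) (G.ψ p) = 0) :
    dt (dx (G.comp H).X) p = dt (dx H.X) (G.ψ p) * dt G.T p * dx G.X p
      + dx H.X (G.ψ p) * dt (dx G.X) p := by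
  have h1 : dx (G.comp H).X =ᶠ[𝓝 p] fun q => dx H.X (G.ψ q) * dx G.X q := by
    filter_upwards [hG.eventually, hG.continuousAt_ψ.eventually hH.eventually] with q h1 h2
      using h1.dx_comp_X h2
  rw [dt_congr h1, dt_mul (hG.sc hH.sX.dx).differentiableAt hG.sX.dx.differentiableAt,
    hG.dt_c hH.sX.dx, h0, zero_mul, add_zero]

theorem Adm.dxdx_X (hk : 3 ≤ k) {α β α' β' : ℝ}
    (h : Adm (potential k μ α β) (potential k μ' α' β') p G) : dx (dx G.X) p = 0 :=
  (h.normal_eqs (nrm_potential hk _ _ _ h.mem) (nrm_potential hk _ _ _ h.mem')).self_of_nhds.2.1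

/-- A version of `Gen.of_comp_left` that remembers the `x`-components, so that derivatives of `G.X`
can be transferred to `M.X`. -/
theorem Gen.of_comp_left' {E : PB} (hE : Gen θ θ₁ p E) (hG : Adm θ θ' p G)
    (h : ∀ M, Adm θ₁ θ' (E.ψ p) M → (E.comp M).X =ᶠ[𝓝 p] G.X → Gen θ₁ θ' (E.ψ p) M) :
    Gen θ θ' p G := by
  obtain ⟨e, rfl, hp, -⟩ := hE.1.rg.exists_gIso univ_mem
  have e1 : e.G'.ψ (e.G.ψ p) = p := e.left p hp
  refine hE.cancel_left hp hG (h _ ((hE.1.symm hp).comp (by rwa [e1])) ?_)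
  filter_upwards [e.isOpen.mem_nhds hp] with q hq
  change G.X (e.G'.ψ (e.G.ψ q)) = _
  rw [e.left q hq]

theorem Gen.of_comp {E : PB} (hE : Gen θ θ₁ p E) (h : Gen θ θ' p (E.comp G))
    (hG : Adm θ₁ θ' (E.ψ p) G) : Gen θ₁ θ' (E.ψ p) G := by
  obtain ⟨e, rfl, hp, -⟩ := hE.1.rg.exists_gIso univ_mem
  have e1 : e.G'.ψ (e.G.ψ p) = p := e.left p hp
  refine Gen.cancel_left (e := e.symm) (e.maps p hp) (hE.symm hp) hG ?_
  change Gen θ θ' (e.G'.ψ (e.G.ψ p)) (e.G.comp G)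
  rwa [e1]

theorem gen_timeShift (hk : 3 ≤ k) {α β : ℝ} (hp : p.2 ∈ natDom μ) (d : ℝ) :
    Gen (potential k μ α β) (potential k μ α β) p (PB.scale 1 d 0 0) := by
  refine Gen.of_affine (potential_mem hk _ _ _) (potential_mem hk _ _ _) (adm_scale one_ne_zero
    (nrm_potential hk _ _ _ hp) (nrm_potential hk _ _ _ ?_) (Eventually.of_forall fun x => ?_))
    (PB.affine_scale _ _ _ _ _)
  · change 1 * p.2 + 0 ∈ natDom μ
    simpa using hp
  · simp

theorem PB.scale_ψ (d t x : ℝ) : (PB.scale 1 d 0 0).ψ (t, x) = (t + d, x) := by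
  simp [PB.scale, PB.ofExp, PB.ψ]

/-- Conjugation with a shift of time on the other side of a generator. -/
theorem Gen.of_flow {g : PB} {x₀ σ : ℝ} (h0 : Gen θ₁ θ (0, x₀) g) (hσ : Gen θ₁ θ (σ, x₀) g)
    (hs : Gen θ₁ θ₁ (0, x₀) (PB.scale 1 σ 0 0)) (hψ : g.ψ (0, x₀) = (0, x₀))
    (hG : Adm θ θ' (0, x₀) G) (h : ∀ M, Adm θ θ' (g.ψ (σ, x₀)) M →
      (g.comp G).X =ᶠ[𝓝 (0, x₀)] ((PB.scale 1 σ 0 0).comp (g.comp M)).X →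
      Gen θ θ' (g.ψ (σ, x₀)) M) : Gen θ θ' (0, x₀) G := by
  have hG' : Adm θ θ' (g.ψ (0, x₀)) G := by rwa [hψ]
  rw [← hψ]
  have hψs : (PB.scale 1 σ 0 0).ψ (0, x₀) = (σ, x₀) := by rw [PB.scale_ψ, zero_add]
  refine h0.of_comp (hs.of_comp_left' (h0.1.comp hG') fun N hN hNX => ?_) hG'
  rw [hψs] at hN ⊢
  refine hσ.of_comp_left' hN fun M hM hMX => h M hM ?_
  have hc : Tendsto (PB.scale 1 σ 0 0).ψ (𝓝 (0, x₀)) (𝓝 (σ, x₀)) := by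
    have := hs.1.rg.continuousAt_ψ
    rwa [ContinuousAt, hψs] at this
  filter_upwards [hNX, hc.eventually hMX] with q h1 h2
  rw [← h1]
  exact h2.symm

theorem gen₃_derivs (q : Base) : dt gen₃.T q = 1 ∧ dx gen₃.X = (fun _ => 1) ∧
    dt gen₃.X q = 2 * q.1 := by
  refine ⟨dt_fst, funext fun q => ?_, ?_⟩
  · exact dx_eq_of_hasDerivAt (show DifferentiableAt ℝ (fun q : Base => q.2 + q.1 ^ 2) q by fun_prop)
      ((hasDerivAt_id' q.2).add_const (q.1 ^ 2))
  · refine dt_eq_of_hasDerivAt (show DifferentiableAt ℝ (fun q : Base => q.2 + q.1 ^ 2) q by fun_prop)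
      ?_
    refine HasDerivAt.congr_deriv (((hasDerivAt_id' q.1).pow 2).const_add q.2) ?_
    norm_num

theorem gen₁_derivs {q : Base} (hq : |q.1| < Real.pi / 4) :
    dt gen₁.T q = 1 / Real.cos (2 * q.1) ^ 2 ∧ dx gen₁.X q = 1 / Real.cos (2 * q.1) ∧
    dt (dx gen₁.X) q = 2 * Real.sin (2 * q.1) / Real.cos (2 * q.1) ^ 2 := by
  have hev : ∀ᶠ q : Base in 𝓝 q, |q.1| < Real.pi / 4 := by
    have : ContinuousAt (fun q : Base => |q.1|) q := by fun_prop
    exact this.eventually (isOpen_Iio.mem_nhds hq)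
  have h1 : ∀ q : Base, |q.1| < Real.pi / 4 → dx gen₁.X q = 1 / Real.cos (2 * q.1) := fun q hq =>
    dx_eq_of_hasDerivAt (adm_gen₁ (k := 3) le_rfl (μ := 0) hq fun h => absurd rfl h).rg.sX.differentiableAt
      ((hasDerivAt_id' q.2).div_const (Real.cos (2 * q.1)))
  have hr := (adm_gen₁ (k := 3) le_rfl (μ := 0) hq fun h => absurd rfl h)
  have hc := (cos_pos_of_abs_lt hq).ne'
  have dcos : HasDerivAt (fun t => Real.cos (2 * t)) (-Real.sin (2 * q.1) * 2) q.1 := by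
    have := ((hasDerivAt_id' q.1).const_mul (2 : ℝ)).cos; simpa using this
  refine ⟨?_, h1 q hq, ?_⟩
  · have := (hr.normal_eqs (nrm_potential le_rfl _ _ _ hr.mem)
      (nrm_potential le_rfl _ _ _ hr.mem')).self_of_nhds.1
    rw [this, h1 q hq, div_pow, one_pow]
  · refine dt_eq_of_hasDerivAt hr.rg.sX.dx.differentiableAt ?_
    refine HasDerivAt.congr_of_eventuallyEq (f₁ := fun t => dx gen₁.X (t, q.2))
      (f := fun t => 1 / Real.cos (2 * t)) ?_ ((tendsto_line q).eventually (hev.mono h1))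
    refine HasDerivAt.congr_deriv ((hasDerivAt_const q.1 (1 : ℝ)).div dcos hc) ?_
    ring

/-- If `μ ≠ 0` the germ is already affine. If `μ = 0` the only obstruction left is `X_t` at the
point. A Galilean boost, namely a time shift of the potential `x` conjugated by `Φ₃`, removes it. -/
theorem gen_of_dtdx_eq_zero (hk : 3 ≤ k) (hG : Adm (potential k μ 0 0) (potential k μ' 0 0) p G)
    (h0 : dt (dx G.X) p = 0) : Gen (potential k μ 0 0) (potential k μ' 0 0) p G := by
  by_cases hμ : μ = 0
  swap
  · exact Gen.of_affine (potential_mem hk _ _ _) (potential_mem hk _ _ _) hG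
      (hG.affine_of_derivs hk h0 fun h => absurd h hμ)
  subst hμ
  have hd : ∀ x : ℝ, x ∈ natDom 0 := fun x h => absurd rfl h
  obtain ⟨t₀, x₀⟩ := p
  -- The point is moved to time `0`, where `gen₃` fixes it, as `Gen.of_flow` requires.
  have hs := gen_timeShift hk (α := 0) (β := 0) (p := (t₀, x₀)) (hd x₀) (-t₀)
  refine hs.of_comp_left' hG fun M hM hMX => ?_
  obtain ⟨s1, s2, s3, s4⟩ := PB.scale_derivs 1 (-t₀) 0 0 (t₀, x₀)
  have sx : dx (PB.scale 1 (-t₀) 0 0).X = fun _ => 1 :=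
    funext fun q => (PB.scale_derivs 1 (-t₀) 0 0 q).2.2.2
  have hM0 : dt (dx M.X) ((PB.scale 1 (-t₀) 0 0).ψ (t₀, x₀)) = 0 := by
    rw [← dt_congr (dx_congr' hMX), hs.1.rg.dtdx_comp_X hM.rg (hM.dxdx_X hk), s1, s4, sx] at h0
    simpa using h0
  rw [PB.scale_ψ, add_neg_cancel] at hM hM0 ⊢
  -- The chain rule through `gen₃`, whose `X_t` equals `2t`, gives `N_t = M_t - 2σ M_x` for the
  -- `x`-components of the new germ `N` and of `M`; this `σ` makes it zero.
  set σ := dt M.X (0, x₀) / dx M.X (0, x₀) / 2 with hσ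
  have hψ : gen₃.ψ (0, x₀) = (0, x₀) := by simp [gen₃, PB.ofExp, PB.ψ]
  have hψs : (PB.scale 1 σ 0 0).ψ (0, x₀) = (σ, x₀) := by rw [PB.scale_ψ, zero_add]
  have hs := gen_timeShift hk (α := 0) (β := 1) (p := (0, x₀)) (hd x₀) σ
  have g0 := Gen.gen₃ hk (p := (0, x₀))
  have gσ := Gen.gen₃ hk (p := (σ, x₀))
  refine Gen.of_flow g0 gσ hs hψ hM fun N hN hNX => ?_
  refine Gen.of_affine (potential_mem hk _ _ _) (potential_mem hk _ _ _) hN ?_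
  have hx := dx_congr hNX
  have ht := dt_congr hNX
  have htx := dt_congr (dx_congr' hNX)
  have hMr := hM.rg
  have hMd := hM.dxdx_X hk
  rw [← hψ] at hMr hMd
  have hgN : (gen₃.comp N).Rg ((PB.scale 1 σ 0 0).ψ (0, x₀)) := by
    rw [hψs]; exact gσ.1.rg.comp hN.rg
  have hgNd : dx (dx (gen₃.comp N).X) ((PB.scale 1 σ 0 0).ψ (0, x₀)) = 0 := by
    rw [hψs]; exact (gσ.1.comp hN).dxdx_X hk
  obtain ⟨s1, s2, s3, s4⟩ := PB.scale_derivs 1 σ 0 0 (0, x₀)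
  have sx : dx (PB.scale 1 σ 0 0).X = fun _ => 1 :=
    funext fun q => (PB.scale_derivs 1 σ 0 0 q).2.2.2
  obtain ⟨f1, f2, f3⟩ := gen₃_derivs (0, x₀)
  obtain ⟨f1', f2', f3'⟩ := gen₃_derivs (σ, x₀)
  rw [g0.1.rg.dx_comp_X hMr, hs.1.rg.dx_comp_X hgN, hψs, gσ.1.rg.dx_comp_X hN.rg, s4, f2, hψ] at hx
  rw [g0.1.rg.dt_comp_X hMr, hs.1.rg.dt_comp_X hgN, hψs, gσ.1.rg.dt_comp_X hN.rg, s1, s3, f1, f3,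
    f1', f3', hψ] at ht
  rw [g0.1.rg.dtdx_comp_X hMr hMd, hs.1.rg.dtdx_comp_X hgN hgNd, hψs,
    gσ.1.rg.dtdx_comp_X hN.rg (hN.dxdx_X hk), s1, f1, f1', f2, sx, hψ, hM0] at htx
  simp only [dt_const] at htx
  have hMx := hM.rg.hX
  refine hN.affine_of_derivs hk (by linarith) fun _ => ?_
  simp only at ht
  have e : dt M.X (0, x₀) = 2 * σ * dx M.X (0, x₀) := by rw [hσ]; field_simp
  linear_combination (-1) * ht + e + 2 * σ * hx

/-- The quantity `X_tx` at the point is removed by a projective transformation, namely a time shift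
of the potential `μ / x² + x²` conjugated by `Φ₁`; the previous lemma then applies. -/
theorem gen_of_inverse_square (hk : 3 ≤ k)
    (hG : Adm (potential k μ 0 0) (potential k μ' 0 0) p G) :
    Gen (potential k μ 0 0) (potential k μ' 0 0) p G := by
  obtain ⟨t₀, x₀⟩ := p
  have hx₀ : x₀ ∈ natDom μ := hG.mem
  have hs := gen_timeShift hk (α := 0) (β := 0) (p := (t₀, x₀)) hx₀ (-t₀)
  refine hs.of_comp_left' hG fun M hM _ => ?_
  rw [PB.scale_ψ, add_neg_cancel] at hM ⊢
  clear hG hs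
  -- The chain rule through `gen₁` makes the new mixed derivative proportional to `M_tx - 2 tan(2σ)
  -- M_x`. The arctangent solves this and automatically gives `|σ| < π/4`, so `Φ₁` is defined at the
  -- shifted point.
  set σ := Real.arctan (dt (dx M.X) (0, x₀) / dx M.X (0, x₀) / 2) / 2 with hσ
  have hσ4 : |σ| < Real.pi / 4 := by
    have h1 := Real.arctan_lt_pi_div_two (dt (dx M.X) (0, x₀) / dx M.X (0, x₀) / 2)
    have h2 := Real.neg_pi_div_two_lt_arctan (dt (dx M.X) (0, x₀) / dx M.X (0, x₀) / 2)
    rw [abs_lt]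
    constructor <;> linarith
  have h04 : |(0 : ℝ)| < Real.pi / 4 := by simpa using Real.pi_pos
  have hψ : gen₁.ψ (0, x₀) = (0, x₀) := by simp [gen₁, PB.ofExp, PB.ψ]
  have hψs : (PB.scale 1 σ 0 0).ψ (0, x₀) = (σ, x₀) := by rw [PB.scale_ψ, zero_add]
  have hs := gen_timeShift hk (α := 1) (β := 0) (p := (0, x₀)) hx₀ σ
  have g0 := Gen.gen₁ hk (p := (0, x₀)) h04 hx₀
  have gσ := Gen.gen₁ hk (p := (σ, x₀)) hσ4 hx₀
  refine Gen.of_flow g0 gσ hs hψ hM fun N hN hNX => gen_of_dtdx_eq_zero hk hN ?_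
  have hx := dx_congr hNX
  have htx := dt_congr (dx_congr' hNX)
  have hMr := hM.rg
  have hMd := hM.dxdx_X hk
  rw [← hψ] at hMr hMd
  have hgN : (gen₁.comp N).Rg ((PB.scale 1 σ 0 0).ψ (0, x₀)) := by
    rw [hψs]; exact gσ.1.rg.comp hN.rg
  have hgNd : dx (dx (gen₁.comp N).X) ((PB.scale 1 σ 0 0).ψ (0, x₀)) = 0 := by
    rw [hψs]; exact (gσ.1.comp hN).dxdx_X hk
  obtain ⟨s1, s2, s3, s4⟩ := PB.scale_derivs 1 σ 0 0 (0, x₀)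
  have sx : dx (PB.scale 1 σ 0 0).X = fun _ => 1 :=
    funext fun q => (PB.scale_derivs 1 σ 0 0 q).2.2.2
  obtain ⟨f1, f2, f3⟩ := gen₁_derivs (q := (0, x₀)) h04
  obtain ⟨f1', f2', f3'⟩ := gen₁_derivs (q := (σ, x₀)) hσ4
  rw [g0.1.rg.dx_comp_X hMr, hs.1.rg.dx_comp_X hgN, hψs, gσ.1.rg.dx_comp_X hN.rg, s4, f2, f2',
    hψ] at hx
  rw [g0.1.rg.dtdx_comp_X hMr hMd, hs.1.rg.dtdx_comp_X hgN hgNd, hψs,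
    gσ.1.rg.dtdx_comp_X hN.rg (hN.dxdx_X hk), s1, f1, f1', f2, f2', f3, f3', sx, hψ] at htx
  have hc := (cos_pos_of_abs_lt hσ4).ne'
  have hMx := hM.rg.hX
  have htan : Real.sin (2 * σ) / Real.cos (2 * σ) = dt (dx M.X) (0, x₀) / dx M.X (0, x₀) / 2 := by
    rw [← Real.tan_eq_sin_div_cos, hσ, mul_div_cancel₀ _ two_ne_zero, Real.tan_arctan]
  simp only [dt_const, mul_zero, Real.cos_zero, Real.sin_zero, one_pow, div_one, mul_one,
    add_zero] at hx htx
  have e : dt (dx M.X) (0, x₀) = 2 * (Real.sin (2 * σ) / Real.cos (2 * σ)) * dx M.X (0, x₀) := by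
    rw [htan]; field_simp
  rw [e, hx] at htx
  have hne : (1 / Real.cos (2 * σ) ^ 2) * (1 / Real.cos (2 * σ)) ≠ 0 := by positivity
  apply mul_right_cancel₀ hne
  linear_combination -htx

end Vertex

/-! ### Reduction to normal form -/

theorem Stationary.exp {f : Base → ℝ} {q : Base} (hf : Stationary f q) :
    Stationary (fun q => Real.exp (f q)) q := by
  filter_upwards [hf] with q h
  exact ⟨h.1.exp, by rw [dt_exp h.1.differentiableAt, h.2, mul_zero]⟩

theorem Stationary.inv_sqrt {f : Base → ℝ} {q : Base} (hf : Stationary f q) (h0 : 0 < f q) :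
    Stationary (fun q => (√(f q))⁻¹) q := by
  filter_upwards [hf, hf.smooth.continuousAt.eventually (isOpen_Ioi.mem_nhds h0)] with q h h1
  have hd := (Real.hasDerivAt_sqrt (ne_of_gt h1)).inv (Real.sqrt_pos.2 h1).ne'
  refine ⟨(h.1.sqrt (ne_of_gt h1)).inv (Real.sqrt_pos.2 h1).ne', ?_⟩
  have := dt_comp₁ hd h.1.differentiableAt
  rw [h.2, mul_zero] at this
  exact this

theorem exists_primitive_of_stationary {f : Base → ℝ} {p : Base} (hf : Stationary f p) :
    ∃ F, Stationary F p ∧ ∀ᶠ q in 𝓝 p, dx F q = f q := by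
  have h1 := eventually_eq_of_dt hf.smooth (hf.mono fun _ h => h.2)
  obtain ⟨r, hr, H⟩ := exists_ball_iff (hf.and h1)
  set B := Metric.ball p.2 r
  set g : ℝ → ℝ := fun x => f (p.1, x) with hg
  have gs : ContDiffOn ℝ ∞ g B := fun x hx => by
    have := (H p.1 (Metric.mem_ball_self hr) x hx).1.1.contDiffAt
    have h2 : ContDiffAt ℝ ∞ (fun x : ℝ => ((p.1, x) : Base)) x := by fun_prop
    exact (ContDiffAt.comp (g := f) (f := fun x : ℝ => ((p.1, x) : Base)) x this
      h2).contDiffWithinAt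
  have hd : ∀ x ∈ B, HasDerivAt (fun u => ∫ y in p.2..u, g y) (g x) x := by
    intro x hx
    refine intervalIntegral.integral_hasDerivAt_right (ContinuousOn.intervalIntegrable
      (gs.continuousOn.mono ?_)) (gs.continuousOn.stronglyMeasurableAtFilter Metric.isOpen_ball x hx)
      (gs.continuousOn.continuousAt (Metric.isOpen_ball.mem_nhds hx))
    exact (convex_ball p.2 r).ordConnected.uIcc_subset (Metric.mem_ball_self hr) hx
  have Fs : ContDiffOn ℝ ∞ (fun u => ∫ y in p.2..u, g y) B := by
    rw [contDiffOn_infty_iff_deriv_of_isOpen Metric.isOpen_ball]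
    exact ⟨fun x hx => (hd x hx).differentiableAt.differentiableWithinAt,
      gs.congr fun x hx => (hd x hx).deriv⟩
  have hs : ∀ q : Base, q.2 ∈ B → SmoothNear (fun q => ∫ y in p.2..q.2, g y) q := fun q hq =>
    SmoothNear.comp₁ (h := fun u => ∫ y in p.2..u, g y) (by
      filter_upwards [Metric.isOpen_ball.mem_nhds hq] with y hy
      exact Fs.contDiffAt (Metric.isOpen_ball.mem_nhds hy)) SmoothNear.snd
  have hB : ∀ᶠ q : Base in 𝓝 p, q.2 ∈ B :=
    continuous_snd.continuousAt.eventually (Metric.ball_mem_nhds p.2 hr)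
  refine ⟨fun q => ∫ y in p.2..q.2, g y, ?_, ?_⟩
  · filter_upwards [hB] with q hq
    exact ⟨hs q hq, dt_fun_snd (fun u => ∫ y in p.2..u, g y) q⟩
  · filter_upwards [hB, h1] with q hq h2
    rw [h2]
    exact dx_eq_of_hasDerivAt (hs q hq).differentiableAt (hd q.2 hq)

open Classical in
/-- The equation `u_t = u_xx + C(x) u` with `x` in the open set `I`. -/
noncomputable def normalElement (k : ℕ) (C : ℝ → ℝ) (I : Set ℝ) (hI : IsOpen I) (hne : I.Nonempty)
    (hC : ContDiffOn ℝ ∞ C I) : ArbitraryElement k where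
  domain := {q | q.2 ∈ I}
  val := fun q i => if q.2 ∈ I then (if i.val = 0 then 1 else if i.val = 2 then C q.2 else 0) else 0
  isOpen_domain := hI.preimage continuous_snd
  nonempty_domain := hne.elim fun x hx => ⟨(0, x), hx⟩
  smooth := by
    rw [contDiffOn_pi]
    intro i
    have key : ContDiffOn ℝ ∞ (fun q : Base => if i.val = 0 then (1 : ℝ) else
        if i.val = 2 then C q.2 else 0) {q | q.2 ∈ I} := by
      split_ifs
      · exact contDiffOn_const
      · exact hC.comp contDiff_snd.contDiffOn fun q hq => hq
      · exact contDiffOn_const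
    refine key.congr fun q hq => ?_
    have hq' : q.2 ∈ I := hq
    simp only [if_pos hq']
  val_off := by
    intro q hq
    have hq' : q.2 ∉ I := hq
    funext i
    simp only [if_neg hq', Pi.zero_apply]

section

variable {k : ℕ} {C : ℝ → ℝ} {I : Set ℝ} {hI : IsOpen I} {hne : I.Nonempty}
  {hC : ContDiffOn ℝ ∞ C I}

theorem nrm_normalElement (hk : 3 ≤ k) {q : Base} (hq : q.2 ∈ I) :
    Nrm (normalElement k C I hI hne hC) C q := by
  have h0 : 0 < k := by omega
  have h1 : 1 < k := by omega
  have h2 : 2 < k := by omega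
  filter_upwards [continuous_snd.continuousAt.eventually (hI.mem_nhds hq)] with q hq'
  have hq : q.2 ∈ I := hq'
  refine ⟨hq, ?_, ?_, ?_, ?_⟩
  · simp [co, normalElement, hq, h0]
  · simp [co, normalElement, hq, h1]
  · simp [co, normalElement, hq, h2]
  · simp [co, normalElement, hq]

theorem normalElement_mem (hk : 3 ≤ k) : normalElement k C I hI hne hC ∈ (linClass k).S := by
  intro p hp
  have h := nrm_normalElement (hI := hI) (hne := hne) (hC := hC) hk hp
  refine ⟨by rw [h.self_of_nhds.2.1]; exact one_ne_zero, ?_, ?_, ?_⟩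
  · rw [dt_congr (g := fun _ => 1) (h.mono fun _ h => h.2.1), dt_const]
  · rw [dt_congr (g := fun _ => 0) (h.mono fun _ h => h.2.2.1), dt_const]
  · rw [dt_congr (g := fun q => C q.2) (h.mono fun _ h => h.2.2.2.1)]
    exact dt_fun_snd C p

end

/-- The new variable with `X_x = |A|^(-1/2)` normalises `A`, a multiplier `V(x)` removes `B`, and a
shift `W` by a particular solution removes `D`. As `A`, `B`, `C` do not depend on `t`, the first two
steps are time-independent, so the germ is affine. -/
theorem exists_adm_normal {k : ℕ} (hk : 3 ≤ k) {θ : ArbitraryElement k} (hθ : θ ∈ (linClass k).S)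
    {p : Base} (hp : p ∈ θ.domain) : ∃ θ₁ C E, θ₁ ∈ (linClass k).S ∧ Adm θ θ₁ p E ∧ E.Affine p ∧
      Nrm θ₁ C (E.ψ p) := by
  have hst := stationary_co hθ hp
  set A : Base → ℝ := fun q => co (θ.val q) 0 with hA
  set B : Base → ℝ := fun q => co (θ.val q) 1 with hB
  set C : Base → ℝ := fun q => co (θ.val q) 2 with hC
  have sA : Stationary A p := hst 0 (by norm_num)
  have sB : Stationary B p := hst 1 (by norm_num)
  have sC : Stationary C p := hst 2 (by norm_num)
  have hA0 : A p ≠ 0 := (hθ p hp).1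
  -- Negative `A` is handled by time reversal `T = ε t`.
  obtain ⟨ε, hε, hpos⟩ : ∃ ε : ℝ, ε ^ 2 = 1 ∧ 0 < ε * A p := by
    rcases lt_or_gt_of_ne hA0 with h | h
    · exact ⟨-1, by norm_num, by linarith⟩
    · exact ⟨1, by norm_num, by linarith⟩
  have hε0 : ε ≠ 0 := by rintro rfl; norm_num at hε
  have sεA : Stationary (fun q => ε * A q) p := (Stationary.const ε).mul sA
  set f : Base → ℝ := fun q => (√(ε * A q))⁻¹ with hf
  have sf : Stationary f p := sεA.inv_sqrt hpos
  have hf0 : f p ≠ 0 := inv_ne_zero (Real.sqrt_pos.2 hpos).ne'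
  obtain ⟨X, sX, hX⟩ := exists_primitive_of_stationary sf
  -- The logarithm of `V`: its `x`-derivative `-(A X_xx + B X_x) / (2 A X_x)` is what the second
  -- determining equation requires for a zero target coefficient `B`.
  obtain ⟨η, sη, hη⟩ := exists_primitive_of_stationary (((sA.mul sf.dx).add (sB.mul sf)).div
    (((Stationary.const (-2)).mul sA).mul sf) (by simp [hA0, hf0]))
  set V : Base → ℝ := fun q => Real.exp (η q) with hV
  have sV : Stationary V p := sη.exp
  have hV0 : ∀ q, V q ≠ 0 := fun q => (Real.exp_pos _).ne'
  -- The new potential from the third determining equation, still in the old variables; `K` below is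
  -- the same function of the new `x`.
  set M : Base → ℝ := fun q => ε * ((A q * dx (dx V) q + B q * dx V q + C q * V q) / V q) with hM
  have sM : Stationary M p := (Stationary.const ε).mul
    ((((sA.mul sV.dx.dx).add (sB.mul sV.dx)).add (sC.mul sV)).div sV (hV0 p))
  set E : PB := PB.ofExp (fun q => ε * q.1) X η with hE
  have hTd : ∀ q : Base, dt E.T q = ε ∧ dx E.T q = 0 := fun q => by
    have h1 := dt_affine 0 0 0 ε 0 q
    have h2 := dx_affine 0 0 0 ε 0 q
    simp only [sub_zero, zero_mul, add_zero, zero_add] at h1 h2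
    exact ⟨h1, h2⟩
  have hrg : E.Rg p := ⟨(SmoothNear.const ε).mul SmoothNear.fst, sX.smooth, sV.smooth,
    SmoothNear.const 0, Eventually.of_forall fun q => (hTd q).2, by rw [(hTd p).1]; exact hε0,
    hX.self_of_nhds.trans_ne hf0, hV0 p⟩
  have haff : ∀ᶠ q in 𝓝 p, dt (dt E.T) q = 0 ∧ dt E.X q = 0 := by
    filter_upwards [sX] with q h
    refine ⟨?_, h.2⟩
    rw [dt_congr (g := fun _ => ε) (Eventually.of_forall fun q => (hTd q).1), dt_const]
  obtain ⟨e, heG, hpe, -⟩ := hrg.exists_gIso univ_mem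
  have hleft : ∀ q ∈ e.O, e.G'.ψ (E.ψ q) = q := fun q hq => by rw [← heG]; exact e.left q hq
  have hrg' : e.G'.Rg (E.ψ p) := by rw [← heG]; exact e.rg' _ (e.maps p hpe)
  set K : ℝ → ℝ := fun y => M (p.1, e.G'.X ((E.ψ p).1, y)) with hK
  have sK : SmoothNear (fun y : Base => K y.2) (E.ψ p) := by
    have h1 : SmoothNear (fun y : Base => e.G'.X ((E.ψ p).1, y.2)) (E.ψ p) :=
      SmoothNear.comp hrg'.sX (SmoothNear.const _) SmoothNear.snd
    refine SmoothNear.comp (g := M) (a := fun _ => p.1) ?_ (SmoothNear.const _) h1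
    have h2 : e.G'.X ((E.ψ p).1, (E.ψ p).2) = p.2 := congrArg Prod.snd (hleft p hpe)
    rw [h2]
    exact sM.smooth
  have hKM : ∀ᶠ q in 𝓝 p, K (X q) = M q := by
    have hc : Tendsto (fun q : Base => ((p.1, q.2) : Base)) (𝓝 p) (𝓝 p) :=
      (tendsto_line' p).comp (continuous_snd.tendsto p)
    filter_upwards [eventually_eq_of_dt sX.smooth (sX.mono fun _ h => h.2),
      eventually_eq_of_dt sM.smooth (sM.mono fun _ h => h.2),
      hc.eventually (e.isOpen.mem_nhds hpe)] with q h1 h2 h3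
    have h4 : e.G'.X ((E.ψ p).1, X (p.1, q.2)) = q.2 := congrArg Prod.snd (hleft _ h3)
    simp only [hK]
    rw [h1, h4, ← h2]
  obtain ⟨I, hIK, hI, hpI⟩ : ∃ I : Set ℝ, ContDiffOn ℝ ∞ K I ∧ IsOpen I ∧ (E.ψ p).2 ∈ I := by
    have h1 : ∀ᶠ y in 𝓝 (E.ψ p).2, ContDiffAt ℝ ∞ K y := by
      filter_upwards [(tendsto_line' (E.ψ p)).eventually sK] with y hy
      have h2 : ContDiffAt ℝ ∞ (fun y : ℝ => (((E.ψ p).1, y) : Base)) y := by fun_prop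
      exact ContDiffAt.comp (g := fun y : Base => K y.2)
        (f := fun y : ℝ => (((E.ψ p).1, y) : Base)) y hy h2
    obtain ⟨I, h2, h3, h4⟩ := mem_nhds_iff.1 h1
    exact ⟨I, fun y hy => ContDiffAt.contDiffWithinAt (h2 hy), h3, h4⟩
  set θ₁ := normalElement k K I hI ⟨_, hpI⟩ hIK with hθ₁
  have hn : Nrm θ₁ K (E.ψ p) := nrm_normalElement hk hpI
  have sD : SmoothNear (fun y => co (θ.val (e.G'.ψ y)) 3 / (V (e.G'.ψ y) * ε)) (E.ψ p) := by
    refine (hrg'.sc (g := fun q => co (θ.val q) 3) ?_).div ((hrg'.sc (g := V) ?_).mul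
      (SmoothNear.const ε)) (mul_ne_zero (hV0 _) hε0) <;> rw [hleft p hpe]
    · exact smoothNear_co θ 3 hp
    · exact sV.smooth
  -- The free term is `D / (ε V)` in the new variables. By the residual identity, `W = V w(T, X)`
  -- then solves the original inhomogeneous equation, which is the fourth determining equation with
  -- zero target `D`.
  obtain ⟨w, sw, hw⟩ := exists_local_solution sK sD
  refine ⟨θ₁, K, { E with W := E.pull w }, normalElement_mem hk, ?_, haff, hn⟩
  have hψc := hrg.continuousAt_ψ
  filter_upwards [hrg.eventually, eventually_eventually_nhds.2 hX, hη, sV, hKM, haff, sA,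
    hψc.eventually hn, hψc.eventually hw, e.isOpen.mem_nhds hpe, θ.isOpen_domain.mem_nhds hp,
    sεA.smooth.continuousAt.eventually (isOpen_Ioi.mem_nhds hpos), sη] with q hr hXq hηq hVq hKq
    haq hAq hnq hwq hqe hqθ hAp sηq
  have hAp' : 0 < ε * A q := hAp
  have hf2 : f q ^ 2 * (ε * A q) = 1 := by
    simp only [hf]
    rw [inv_pow, Real.sq_sqrt hAp'.le, inv_mul_cancel₀ hAp'.ne']
  have hfq : f q ≠ 0 := inv_ne_zero (Real.sqrt_pos.2 hAp').ne'
  have hAq0 : A q ≠ 0 := right_ne_zero_of_mul hAp'.ne'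
  have hsw : SmoothNear w (E.ψ q) := SmoothNear.of_contDiff sw
  have eX : dx E.X q = f q := hXq.self_of_nhds
  have eXX : dx (dx E.X) q = dx f q := dx_congr hXq
  have eV : dx E.V q = V q * dx η q := dx_exp sηq.1.differentiableAt
  -- The determining equations are first checked for the homogeneous part and `W = 0`; the residual
  -- identity is then applied to `w`.
  set b : ℕ → ℝ := fun i => if i = 3 then 0 else co (θ.val q) i with hb
  have hdet : E.Det q b (co (θ₁.val (E.ψ q))) := by
    refine ⟨?_, ?_, ?_, ?_⟩
    · rw [hnq.2.1, (hTd q).1, eX]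
      change ε * 1 = A q * f q ^ 2
      linear_combination (-ε) * hf2 + A q * f q ^ 2 * hε
    · rw [hnq.2.2.1, eX, eXX, eV, hηq, haq.2]
      change V q * dt E.T q * 0 = V q * (A q * dx f q + B q * f q - 0) + 2 * A q * f q * _
      field_simp
      ring
    · rw [hnq.2.2.2.1, (hTd q).1]
      change V q * ε * K (X q) = -dt V q + A q * dx (dx V) q + B q * dx V q + C q * V q
      rw [hKq, hVq.2]
      simp only [hM]
      have := hV0 q
      field_simp
      linear_combination (A q * dx (dx V) q + B q * dx V q + C q * V q) * hε
    · have h0 : dx (fun _ : Base => (0 : ℝ)) = fun _ => 0 := funext fun q => dx_const 0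
      rw [hnq.2.2.2.2]
      change _ = -dt (fun _ => 0) q + b 0 * dx (dx fun _ => 0) q + b 1 * dx (fun _ => 0) q
        + b 2 * 0 + b 3
      simp [h0, hb]
  have hres := hr.res_pull hdet hsw
  refine ⟨{ hr with sW := hr.s_pull hsw }, hqθ, hnq.1, hdet.h0, hdet.h1, hdet.h2, ?_⟩
  change E.V q * dt E.T q * co (θ₁.val (E.ψ q)) 3 = -dt (E.pull w) q + A q * dx (dx (E.pull w)) q
    + B q * dx (E.pull w) q + C q * E.pull w q + co (θ.val q) 3
  simp only [res] at hres
  rw [hwq, hnq.2.1, hnq.2.2.1, hnq.2.2.2.1, hnq.2.2.2.2, (hTd q).1, hleft q hqe] at hres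
  rw [hnq.2.2.2.2]
  have hVq0 : E.V q = V q := rfl
  rw [hVq0] at hres ⊢
  simp only [hb] at hres
  norm_num at hres
  have := hV0 q
  field_simp at hres
  linear_combination hres

/-! ### Every admissible germ is generated -/

section Main

variable {k : ℕ} {θ θ' : ArbitraryElement k} {p : Base} {G : PB}

/-- For a non-affine germ `μ` agrees on both sides and any nonzero `μ` forces `β = β' = 0`. Both
ends are therefore connected by generated germs to `μ / x²`, and conjugation reduces to that
potential. -/
theorem gen_of_adm_potential (hk : 3 ≤ k) {μ α β μ' α' β' : ℝ}
    (h : Adm (potential k μ α β) (potential k μ' α' β') p G) :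
    Gen (potential k μ α β) (potential k μ' α' β') p G := by
  by_cases ha : G.Affine p
  · exact Gen.of_affine (potential_mem hk _ _ _) (potential_mem hk _ _ _) h ha
  obtain ⟨rfl, h1, h2⟩ := h.parameters hk ha
  obtain ⟨E, hE⟩ := exists_gen_vertex (α := α) hk h1 h.mem
  obtain ⟨E', hE'⟩ := exists_gen_vertex (α := α') hk h2 h.mem'
  exact Gen.of_conj hE hE' h fun M hM => gen_of_inverse_square hk hM

/-- A non-affine germ has a non-affine inverse, so `Adm.special` applies to the target potential as
well as to the source. -/
theorem gen_of_adm_normal (hk : 3 ≤ k) (hθ : θ ∈ (linClass k).S) (hθ' : θ' ∈ (linClass k).S)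
    {C K : ℝ → ℝ} (hn : Nrm θ C p) (hn' : Nrm θ' K (G.ψ p)) (h : Adm θ θ' p G) :
    Gen θ θ' p G := by
  by_cases ha : G.Affine p
  · exact Gen.of_affine hθ hθ' h ha
  have hC := h.special hn hn' ha
  obtain ⟨e, rfl, hp, -⟩ := h.rg.exists_gIso univ_mem
  have hp' : e.G'.ψ (e.G.ψ p) = p := e.left p hp
  have hK : Special K (e.G.ψ p).2 := by
    refine (h.symm hp).special hn' (by rwa [hp']) fun h0 => ha ?_
    have := PB.Affine.symm (e := e.symm) (e.maps p hp) h0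
    rwa [show e.symm.G.ψ (e.G.ψ p) = p from hp'] at this
  obtain ⟨μ, α, β, E, hE, hEa⟩ := hC.exists_adm hk hn
  obtain ⟨μ', α', β', E', hE', hEa'⟩ := hK.exists_adm hk hn'
  exact Gen.of_conj (Gen.of_affine hθ (potential_mem hk _ _ _) hE hEa)
    (Gen.of_affine hθ' (potential_mem hk _ _ _) hE' hEa') h fun M hM => gen_of_adm_potential hk hM

theorem gen_of_adm (hk : 3 ≤ k) (hθ : θ ∈ (linClass k).S) (hθ' : θ' ∈ (linClass k).S)
    (h : Adm θ θ' p G) : Gen θ θ' p G := by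
  obtain ⟨θ₁, C, E, h1, hE, hEa, hn⟩ := exists_adm_normal hk hθ h.mem
  obtain ⟨θ₁', K, E', h1', hE', hEa', hn'⟩ := exists_adm_normal hk hθ' h.mem'
  refine (Gen.of_affine hθ h1 hE hEa).of_comp_left h fun M hM hψ => ?_
  rw [← hψ] at hE' hEa' hn'
  exact (Gen.of_affine hθ' h1' hE' hEa').of_comp_right hM
    (gen_of_adm_normal hk h1 h1' hn hn' (hM.comp hE'))

/-- Only two properties of `U` matter: its elements have affine germs, and every affine germ between
equations of the class is realised by an element of `U`. The first yields self-consistency and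
minimality, the second generation. -/
theorem isMinimalSelfConsistentGenerating_generators (hk : 3 ≤ k) {U : Set (Triple k)}
    (hU : ∀ T ∈ U, T.Φ.source.Nonempty ∧ HasAffineGerms T)
    (hU' : ∀ {θ θ' : ArbitraryElement k}, θ ∈ (linClass k).S → θ' ∈ (linClass k).S →
      ∀ {p : Base} {G : PB}, Adm θ θ' p G → G.Affine p → ∀ {P : Pt}, base P = p →
        ∃ T ∈ U, T.src = θ ∧ T.tgt = θ' ∧ P ∈ T.Φ.source ∧ T.Φ =ᶠ[𝓝 P] G.map) :
    (linClass k).IsMinimalSelfConsistentGenerating U (generators k) := by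
  refine ⟨⟨⟨generators_subset hk, fun T hT P hP => ?_⟩, isSelfConsistent_generators hk hU⟩,
    fun 𝓑 h𝓑 hsub => minimal_generators hk hU hsub h𝓑.1⟩
  obtain ⟨G, h1, h2⟩ := hasGerms_of_mem_groupoid hT P hP
  obtain ⟨F, h3, h4⟩ := (gen_of_adm hk hT.1 hT.2.1 h1).2 P rfl
  obtain ⟨F', h5, h6⟩ := IsLocalComposition.of_pieces hU' h3
  exact ⟨F', h5, (h6.trans h4).trans h2.symm⟩

end Main

theorem mainTheorem12 :
    classE'.IsMinimalSelfConsistentGenerating classE'.actionGroupoid (generators 4) ∧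
    classE'₀.IsMinimalSelfConsistentGenerating classE'₀.actionLinGroupoid (generators 3) := by
  rw [classE'_eq, classE'₀_eq]
  exact ⟨isMinimalSelfConsistentGenerating_generators (by norm_num)
      (fun _ hT => ⟨hT.1.2.2.1.1, hasAffineGerms_of_mem_actionGroupoid hT⟩)
      exists_mem_actionGroupoid,
    isMinimalSelfConsistentGenerating_generators le_rfl
      (fun _ hT => ⟨hT.1.2.2.1.1, hasAffineGerms_of_mem_actionLinGroupoid hT⟩)
      exists_mem_actionLinGroupoid⟩
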